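/- **Setting.** Let $T>0$ and let $\Omega\subset\mathbb R^d$ be open with $C^\infty$ compact boundary (for instance $\Omega$ bounded) and inward unit normal $\nu$. Write $u=(u^1,u^2)\in\mathbb R^{N-N'}\times\mathbb R^{N'}=\mathbb R^N$, and write $M^{\alpha\beta}$ for the corresponding blocks of a matrix $M$. Let $\mathcal O(t,x)\subset\mathbb R^N$, for $(t,x)\in[-T,T]\times\overline\Omega$, and $\mathcal O^*(t,x_0)\supset\mathcal O(t,x_0)$, for $(t,x_0)\in[-T,T]\times\partial\Omega$, be open sets depending continuously on the base point (their graphs are relatively open). Put $\mathcal U_\partial=\{(t,x_0,u): (t,x_0)\in[-T,T]\times\partial\Omega,\ u\in\mathcal O(t,x_0)\}$, $\pi\mathcal U=\bigcup\mathcal O(t,x)$, $\pi\mathcal U^*=\bigcup\mathcal O^*(t,x_0)$. Consider the system $$A_0(u)u_t+\sum_jA_j(u)\partial_ju-\varepsilon\sum_{j,k}\partial_j(B_{jk}(u)\partial_ku)=0,$$ where $A_0^{12}=0$ and $B_{jk}^{11}=B_{jk}^{12}=B_{jk}^{21}=0$, with boundary conditions $\Upsilon_1(u^1)=g_1$, $\Upsilon_2(u^2)=g_2$,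 $\Upsilon_3(u,\partial_Tu^2,\partial_\nu u^2)=K_\nu\partial_\nu u^2+\sum_jK_j(u)V_ju^2=0$, with $K_\nu$ constant and $V_j$ tangential. Let $A_\xi=\sum_j\xi_jA_j$, $B_\xi=\sum_{j,k}\xi_j\xi_kB_{jk}$, $\overline A(u,\xi)=A_0^{-1}A_\xi$, $\overline B(u,\xi)=A_0^{-1}B_\xi$. Assume: * (H1) $A_j,B_{jk}$ are $C^\infty$ and $\det A_0\ne0$ on $\pi\mathcal U\cup\pi\mathcal U^*$. * (H2) For some $c>0$ the eigenvalues of $\overline B^{22}(u,\xi)$ satisfy $\operatorname{Re}\mu\ge c|\xi|^2$ for $u\in\pi\mathcal U\cup\pi\mathcal U^*$, $\xi\in\mathbb R^d$. * (H3) For $u\in\pi\mathcal U\cup\pi\mathcal U^*$ and $\xi\neq0$ the eigenvalues of $\overline A^{11}(u,\xi)$ are real. For $(t,x_0)\in[-T,T]\times\partial\Omega$ and $u\in\mathcal O^*(t,x_0)$, those of $\overline A^{11}(u,\nu(x_0))$ are always all positive, or always all negative; $N^1_+$ of them are positive. * (H4) For $u\in\pi\mathcal U$ and $\xi\ne0$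 the eigenvalues of $\overline A(u,\xi)$ are real. On $\mathcal U_\partial$, $\det\overline A(u,\nu(x_0))\ne0$ and the number $N_+$ of positive eigenvalues of $\overline A(u,\nu(x_0))$ is constant. * (H5) For some $c>0$ the eigenvalues of $i\overline A(u,\xi)+\overline B(u,\xi)$ satisfy $\operatorname{Re}\mu\ge c|\xi|^2/(1+|\xi|^2)$ for $u\in\pi\mathcal U$, $\xi\in\mathbb R^d$. * (H6) $\Upsilon_1,\Upsilon_2,\Upsilon_3$ are smooth with values in $\mathbb R^{N^1_+},\mathbb R^{N'-N''},\mathbb R^{N''}$, $0\le N''\le N'$; $K_\nu$ has rank $N''$, and for $u\in\pi\mathcal U^*$ the Jacobians $\Upsilon_1'(u^1)$, $\Upsilon_2'(u^2)$ have full rank $N^1_+$, $N'-N''$. **Profiles.** A *layer profile* at $(t,x_0)\in[-T,T]\times\partial\Omega$ with boundary data $(g_1,g_2,0)$ and endstate $q$ is a $w\in C^\infty([0,\infty);\mathcal O^*(t,x_0))$ with, for $\nu=\nu(x_0)$, $$A_\nu(w)\partial_zw-\partial_z(B_\nu(w)\partial_zw)=0\ (z\ge0),\quad \bigl(\Upsilon_1(w^1),\Upsilon_2(w^2),K_\nu\partial_zw^2\bigr)\big|_{z=0}=(g_1,g_2,0)(t,x_0),\quad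 \lim_{z\to\infty}w=q .$$ Let $\mathcal S$ (resp. $\mathcal S_0$) be the space of solutions $\dot w$ on $[0,\infty)$ of the linearization of this equation about $w$ for which $(\dot w,\partial_z\dot w^2)$ has a finite limit (resp. tends to $0$) as $z\to\infty$, and let $\Gamma_\nu\dot w=(\Upsilon_1'(w^1)\dot w^1,\Upsilon_2'(w^2)\dot w^2,K_\nu\partial_z\dot w^2)|_{z=0}$. The profile $w$ is *transversal* if $\Gamma_\nu$ is injective on $\mathcal S_0$ and maps $\mathcal S$ onto $\mathbb R^{N_b}$, $N_b=N^1_++N'$. It has *amplitude at most $\varepsilon$ about $p$* if $\|(w,\partial_zw^2)-(p,0)\|_{L^\infty(0,\infty)}\le\varepsilon$. **Proposition.** Let $p:[-T,T]\times\partial\Omega\to\mathbb R^N$ be $C^\infty$ with $(t,x_0,p(t,x_0))\in\mathcal U_\partial$ for all $(t,x_0)$, and suppose that for every $(t,x_0)\in[-T,T]\times\partial\Omega$ the constant layer $w\equiv p(t,x_0)$ is transversal (with $\nu=\nu(x_0)$). Take the boundary data $$(g_1,g_2,0)(t,x_0)=\bigl(\Upsilon_1(p^1(t,x_0)),\Upsilon_2(p^2(t,x_0)),0\bigr).$$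 For $\varepsilon,\delta>0$ let $\mathcal C(t,x_0)$ be the set of $q$ with $|q-p(t,x_0)|<\delta$ that are endstates of layer profiles at $(t,x_0)$ with data $(g_1,g_2,0)$ and amplitude at most $\varepsilon$ about $p(t,x_0)$, and let $\mathcal C=\{(t,x_0,q): (t,x_0)\in[-T,T]\times\partial\Omega,\ q\in\mathcal C(t,x_0)\}$. Then for all sufficiently small $\varepsilon>0$ and all sufficiently small $\delta>0$ (depending on $\varepsilon$): 1. $\mathcal C\subset\mathcal U_\partial$ is a smooth submanifold of $[-T,T]\times\partial\Omega\times\mathbb R^N$, locally $\{F=0\}$ with $F$ smooth, $\mathbb R^{N_+}$-valued and $\partial_uF$ of full rank; so each $\mathcal C(t,x_0)$ is a smooth manifold of dimension $N-N_+$. Moreover $p(t,x_0)\in\mathcal C(t,x_0)$ for all $(t,x_0)$. 2. There is a smooth $W:[0,\infty)\times\mathcal C\to\pi\mathcal U^*$ such that for every $(t,x_0,q)\in\mathcal C$ the function $W(\cdot,t,x_0,q)$ is a transversal layer profile at $(t,x_0)$ with data $(g_1,g_2,0)$, endstate $q$ and amplitude at most $\varepsilon$ about $p(t,x_0)$. 3.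 For every compact $K\subset\mathcal C$ there are $M,\theta>0$ with $|W(z,t,x_0,q)-q|\le Me^{-\theta z}$ for all $z\ge0$ and $(t,x_0,q)\in K$. -/

import Mathlib

open Set Filter Topology Matrix
open scoped ContDiff

noncomputable section

/-- Space variable `x ∈ ℝ^d`. -/
abbrev Space (d : ℕ) := EuclideanSpace ℝ (Fin d)

/-- State space `ℝ^N = ℝ^(N-N') × ℝ^(N')` with `m = N - N'` and `n = N'`. -/
abbrev State (m n : ℕ) := Fin m ⊕ Fin n → ℝ

/-- `N × N` matrices with the block splitting of the state space. -/
abbrev BMat (m n : ℕ) := Matrix (Fin m ⊕ Fin n) (Fin m ⊕ Fin n) ℝ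

/-- The component `u¹` of a state. -/
def comp1 {m n : ℕ} (u : State m n) : Fin m → ℝ := fun i => u (Sum.inl i)

/-- The component `u²` of a state. -/
def comp2 {m n : ℕ} (u : State m n) : Fin n → ℝ := fun i => u (Sum.inr i)

/-- The data of the viscous boundary problem
`A₀(u) ∂ₜu + ∑ⱼ Aⱼ(u) ∂ⱼu - ε ∑ⱼₖ ∂ⱼ(Bⱼₖ(u) ∂ₖu) = 0` on `[-T,T] × Ω`,
`Υ₁(u¹) = g₁`, `Υ₂(u²) = g₂`, `Υ₃(u, ∂_T u², ∂_ν u²) = 0` on `[-T,T] × ∂Ω`,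
together with the sets `O(t,x)`, `O*(t,x₀)` of admissible states. Here `nPos1 = N¹₊` and
`n3 = N''`. The operator `Υ₃` is `Kν ∂_ν u² + ∑ⱼ Kⱼ(u) Vⱼ u²` with `Kν` constant and `r`
tangential fields `Vⱼ`. -/
structure ViscousProblem (d m n nPos1 n3 r : ℕ) where
  T : ℝ
  Ω : Set (Space d)
  /-- inward unit normal (only its values on the boundary matter) -/
  ν : Space d → Space d
  A0 : State m n → BMat m n
  A : Fin d → State m n → BMat m n
  B : Fin d → Fin d → State m n → BMat m n
  /-- `O(t,x)`, for `t ∈ [-T,T]` and `x` in the closure of `Ω` -/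
  O : ℝ → Space d → Set (State m n)
  /-- `O*(t,x₀)`, for `t ∈ [-T,T]` and `x₀ ∈ ∂Ω` -/
  Ostar : ℝ → Space d → Set (State m n)
  Υ1 : (Fin m → ℝ) → (Fin nPos1 → ℝ)
  Υ2 : (Fin n → ℝ) → (Fin (n - n3) → ℝ)
  Kν : Matrix (Fin n3) (Fin n) ℝ
  Ktan : Fin r → State m n → Matrix (Fin n3) (Fin n) ℝ

/-- `nu` is the inward unit normal field of the open set `Ω`, whose boundary is smooth: near each
boundary point `Ω` is `{ρ > 0}` with `ρ` smooth, `∇ρ ≠ 0`, and `nu = ∇ρ / |∇ρ|` on `∂Ω`. -/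
def HasSmoothBoundaryWithInwardNormal {d : ℕ} (Ω : Set (Space d)) (nu : Space d → Space d) : Prop :=
  IsOpen Ω ∧ ∀ x₀ ∈ frontier Ω, ∃ (V : Set (Space d)) (ρ : Space d → ℝ),
    IsOpen V ∧ x₀ ∈ V ∧ ContDiffOn ℝ ∞ ρ V ∧ Ω ∩ V = {x ∈ V | 0 < ρ x} ∧
    (∀ x ∈ V, gradient ρ x ≠ 0) ∧
    ∀ x ∈ V ∩ frontier Ω, nu x = ‖gradient ρ x‖⁻¹ • gradient ρ x

/-- Continuity of an open-set-valued map on `S`: its graph is relatively open over `S`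
(equivalently, a compact subset of `O(t,x)` is contained in `O(t',x')` for `(t',x')` near
`(t,x)`, and the values are open). -/
def OpenSetValuedContinuousOn {d m n : ℕ} (S : Set (ℝ × Space d))
    (O : ℝ → Space d → Set (State m n)) : Prop :=
  ∃ G : Set (ℝ × Space d × State m n), IsOpen G ∧
    ∀ t x, (t, x) ∈ S → O t x = {u | (t, x, u) ∈ G}

/-- Complex eigenvalues of a real square matrix. -/
def eigs {k : Type*} [Fintype k] [DecidableEq k] (M : Matrix k k ℝ) : Set ℂ :=
  spectrum ℂ (M.map (fun a : ℝ => (a : ℂ)))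

/-- Number of positive eigenvalues, counted with algebraic multiplicity. -/
def numPosEigs {k : Type*} [Fintype k] [DecidableEq k] (M : Matrix k k ℝ) : ℕ := by
  classical
  exact (M.charpoly.roots.filter (fun a => 0 < a)).card

/-- The derivative `∂_z` on the closed half-line `[0,∞)`. -/
def dz {F : Type*} [NormedAddCommGroup F] [NormedSpace ℝ F] (f : ℝ → F) (z : ℝ) : F :=
  derivWithin f (Ici 0) z

/-- The directional derivative `M'(u) v` of a matrix-valued function, entry by entry. -/
def dMat {m n : ℕ} (M : State m n → BMat m n) (u v : State m n) : BMat m n :=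
  Matrix.of fun i j => fderiv ℝ (fun y => M y i j) u v

namespace ViscousProblem

variable {d m n nPos1 n3 r : ℕ} (P : ViscousProblem d m n nPos1 n3 r)

/-- `[-T,T] × ∂Ω`. -/
def base : Set (ℝ × Space d) := Icc (-P.T) P.T ×ˢ frontier P.Ω

/-- `πU`, the union of the sets `O(t,x)`. -/
def piU : Set (State m n) :=
  {u | ∃ t ∈ Icc (-P.T) P.T, ∃ x ∈ closure P.Ω, u ∈ P.O t x}

/-- `πU*`, the union of the sets `O*(t,x₀)`. -/
def piUstar : Set (State m n) := {u | ∃ t x₀, (t, x₀) ∈ P.base ∧ u ∈ P.Ostar t x₀}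

/-- `U_∂`, the graph of `O` over `[-T,T] × ∂Ω`. -/
def Ubdry : Set (ℝ × Space d × State m n) :=
  {y | (y.1, y.2.1) ∈ P.base ∧ y.2.2 ∈ P.O y.1 y.2.1}

/-- `∑ⱼ ξⱼ Aⱼ(u)`; this is `A_ν(u)` for `ξ = ν`. -/
def Asym (ξ : Space d) (u : State m n) : BMat m n := ∑ j, ξ j • P.A j u

/-- `∑ⱼₖ ξⱼ ξₖ Bⱼₖ(u)`; this is `B_ν(u)` for `ξ = ν`. -/
def Bsym (ξ : Space d) (u : State m n) : BMat m n := ∑ j, ∑ k, (ξ j * ξ k) • P.B j k u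

/-- `Ā(u,ξ) = A₀(u)⁻¹ ∑ⱼ ξⱼ Aⱼ(u)`. -/
def Abar (u : State m n) (ξ : Space d) : BMat m n := (P.A0 u)⁻¹ * P.Asym ξ u

/-- `B̄(u,ξ) = A₀(u)⁻¹ ∑ⱼₖ ξⱼ ξₖ Bⱼₖ(u)`. -/
def Bbar (u : State m n) (ξ : Space d) : BMat m n := (P.A0 u)⁻¹ * P.Bsym ξ u

/-- `Υ₃(u, τ, η)`, with `τⱼ` in the place of `Vⱼ u²` and `η` in the place of `∂_ν u²`. -/
def Υ3 (u : State m n) (τ : Fin r → Fin n → ℝ) (η : Fin n → ℝ) : Fin n3 → ℝ :=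
  P.Kν *ᵥ η + ∑ j, P.Ktan j u *ᵥ τ j

/-- Geometry of the domain and of the sets of admissible states. -/
structure Geometry : Prop where
  T_pos : 0 < P.T
  boundary : HasSmoothBoundaryWithInwardNormal P.Ω P.ν
  compact_boundary : IsCompact (frontier P.Ω)
  O_cont : OpenSetValuedContinuousOn (Icc (-P.T) P.T ×ˢ closure P.Ω) P.O
  Ostar_cont : OpenSetValuedContinuousOn P.base P.Ostar
  O_subset : ∀ t x₀, (t, x₀) ∈ P.base → P.O t x₀ ⊆ P.Ostar t x₀

/-- The structural hypotheses (H1)-(H6), with the block structure of `A₀` and `Bⱼₖ`.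
`nPos = N₊` is the number of positive eigenvalues of the normal matrix `Ā(u,ν)`. For the
spectra in (H3) and (H4) only reality is asked (no semisimplicity and no constancy of
multiplicities), which is common to the variants of these hypotheses. -/
structure Structural (nPos : ℕ) : Prop where
  block_A0 : ∀ u ∈ P.piU ∪ P.piUstar, (P.A0 u).toBlocks₁₂ = 0
  block_B : ∀ u ∈ P.piU ∪ P.piUstar, ∀ j k,
    (P.B j k u).toBlocks₁₁ = 0 ∧ (P.B j k u).toBlocks₁₂ = 0 ∧ (P.B j k u).toBlocks₂₁ = 0
  H1_A0 : ∀ a b, ContDiffOn ℝ ∞ (fun u => P.A0 u a b) (P.piU ∪ P.piUstar)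
  H1_A : ∀ j a b, ContDiffOn ℝ ∞ (fun u => P.A j u a b) (P.piU ∪ P.piUstar)
  H1_B : ∀ j k a b, ContDiffOn ℝ ∞ (fun u => P.B j k u a b) (P.piU ∪ P.piUstar)
  H1_det : ∀ u ∈ P.piU ∪ P.piUstar, (P.A0 u).det ≠ 0
  H2 : ∃ c > 0, ∀ u ∈ P.piU ∪ P.piUstar, ∀ ξ : Space d,
    ∀ μ ∈ eigs (P.Bbar u ξ).toBlocks₂₂, c * ‖ξ‖ ^ 2 ≤ μ.re
  H3_real : ∀ u ∈ P.piU ∪ P.piUstar, ∀ ξ : Space d, ξ ≠ 0 →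
    ∀ μ ∈ eigs (P.Abar u ξ).toBlocks₁₁, μ.im = 0
  /-- inflow or outflow -/
  H3_sign :
    (∀ t x₀, (t, x₀) ∈ P.base → ∀ u ∈ P.Ostar t x₀,
      ∀ μ ∈ eigs (P.Abar u (P.ν x₀)).toBlocks₁₁, 0 < μ.re) ∨
    (∀ t x₀, (t, x₀) ∈ P.base → ∀ u ∈ P.Ostar t x₀,
      ∀ μ ∈ eigs (P.Abar u (P.ν x₀)).toBlocks₁₁, μ.re < 0)
  H3_count : ∀ t x₀, (t, x₀) ∈ P.base → ∀ u ∈ P.Ostar t x₀,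
    numPosEigs (P.Abar u (P.ν x₀)).toBlocks₁₁ = nPos1
  H4_real : ∀ u ∈ P.piU, ∀ ξ : Space d, ξ ≠ 0 → ∀ μ ∈ eigs (P.Abar u ξ), μ.im = 0
  H4_det : ∀ t x₀, (t, x₀) ∈ P.base → ∀ u ∈ P.O t x₀, (P.Abar u (P.ν x₀)).det ≠ 0
  H4_count : ∀ t x₀, (t, x₀) ∈ P.base → ∀ u ∈ P.O t x₀,
    numPosEigs (P.Abar u (P.ν x₀)) = nPos
  H5 : ∃ c > 0, ∀ u ∈ P.piU, ∀ ξ : Space d,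
    ∀ μ ∈ spectrum ℂ (Complex.I • (P.Abar u ξ).map (fun a : ℝ => (a : ℂ)) +
      (P.Bbar u ξ).map (fun a : ℝ => (a : ℂ))),
    c * (‖ξ‖ ^ 2 / (1 + ‖ξ‖ ^ 2)) ≤ μ.re
  H6_le : n3 ≤ n
  H6_Υ1 : ContDiffOn ℝ ∞ P.Υ1 (comp1 '' P.piUstar)
  H6_Υ2 : ContDiffOn ℝ ∞ P.Υ2 (comp2 '' P.piUstar)
  H6_Ktan : ∀ j a b, ContDiffOn ℝ ∞ (fun u => P.Ktan j u a b) P.piUstar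
  H6_Kν : P.Kν.rank = n3
  H6_rank1 : ∀ u ∈ P.piUstar, Function.Surjective (fderiv ℝ P.Υ1 (comp1 u))
  H6_rank2 : ∀ u ∈ P.piUstar, Function.Surjective (fderiv ℝ P.Υ2 (comp2 u))

/-- `w ∈ C^∞([0,∞))` solves `A_ν(w) ∂_z w - ∂_z (B_ν(w) ∂_z w) = 0` on `z ≥ 0`. -/
def SolvesProfileEq (nu : Space d) (w : ℝ → State m n) : Prop :=
  ContDiffOn ℝ ∞ w (Ici 0) ∧ ∀ z ∈ Ici (0 : ℝ),
    P.Asym nu (w z) *ᵥ dz w z - dz (fun s => P.Bsym nu (w s) *ᵥ dz w s) z = 0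

/-- `w` is a layer profile at `(t,x₀)` with values in `O*(t,x₀)`, boundary data `(γ₁, γ₂, 0)`
and endstate `q`. -/
structure IsLayerProfile (t : ℝ) (x₀ : Space d) (γ1 : Fin nPos1 → ℝ) (γ2 : Fin (n - n3) → ℝ)
    (q : State m n) (w : ℝ → State m n) : Prop where
  eq : P.SolvesProfileEq (P.ν x₀) w
  mem : ∀ z ∈ Ici (0 : ℝ), w z ∈ P.Ostar t x₀
  bc1 : P.Υ1 (comp1 (w 0)) = γ1
  bc2 : P.Υ2 (comp2 (w 0)) = γ2
  bc3 : P.Υ3 (w 0) 0 (comp2 (dz w 0)) = 0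
  lim : Tendsto w atTop (𝓝 q)

/-- `v` solves on `z ≥ 0` the linearization of the profile equation about `w`. -/
def SolvesLinearized (nu : Space d) (w v : ℝ → State m n) : Prop :=
  ContDiffOn ℝ ∞ v (Ici 0) ∧ ∀ z ∈ Ici (0 : ℝ),
    P.Asym nu (w z) *ᵥ dz v z + dMat (P.Asym nu) (w z) (v z) *ᵥ dz w z
      - dz (fun s => P.Bsym nu (w s) *ᵥ dz v s
          + dMat (P.Bsym nu) (w s) (v s) *ᵥ dz w s) z = 0

/-- The space `S`: solutions `(v, ∂_z v²)` of the linearized system with a finite limit. -/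
def LinBounded (nu : Space d) (w v : ℝ → State m n) : Prop :=
  P.SolvesLinearized nu w v ∧
    ∃ L : State m n × (Fin n → ℝ), Tendsto (fun z => (v z, comp2 (dz v z))) atTop (𝓝 L)

/-- The space `S₀`: solutions `(v, ∂_z v²)` of the linearized system that decay to `0`. -/
def LinDecaying (nu : Space d) (w v : ℝ → State m n) : Prop :=
  P.SolvesLinearized nu w v ∧
    Tendsto (fun z => (v z, comp2 (dz v z))) atTop (𝓝 (0 : State m n × (Fin n → ℝ)))

/-- The linearized boundary operator
`Γ_ν(v, ∂_z v²)|_{z=0} = (Υ₁'(w¹) v¹, Υ₂'(w²) v², Kν ∂_z v²)|_{z=0}`. -/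
def Γ (w v : ℝ → State m n) : (Fin nPos1 → ℝ) × (Fin (n - n3) → ℝ) × (Fin n3 → ℝ) :=
  (fderiv ℝ P.Υ1 (comp1 (w 0)) (comp1 (v 0)), fderiv ℝ P.Υ2 (comp2 (w 0)) (comp2 (v 0)),
    P.Kν *ᵥ comp2 (dz v 0))

/-- Transversality of the profile `w`: `Γ_ν` is injective on `S₀` and has full rank
`N_b = N¹₊ + (N' - N'') + N''` on `S`. -/
def Transversal (nu : Space d) (w : ℝ → State m n) : Prop :=
  (∀ v, P.LinDecaying nu w v → P.Γ w v = 0 → ∀ z ∈ Ici (0 : ℝ), v z = 0) ∧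
  (∀ b, ∃ v, P.LinBounded nu w v ∧ P.Γ w v = b)

/-- Amplitude at most `ε` about the state `p`: `‖(w, ∂_z w²) - (p, 0)‖_{L^∞(0,∞)} ≤ ε`. -/
def AmplitudeLE (p : State m n) (ε : ℝ) (w : ℝ → State m n) : Prop :=
  ∀ z ∈ Ici (0 : ℝ), ‖w z - p‖ ≤ ε ∧ ‖comp2 (dz w z)‖ ≤ ε

/-- `C ⊆ [-T,T] × ∂Ω × ℝ^N` is a smooth submanifold whose fibres `C(t,x₀)` are smooth manifolds
of codimension `k` in `ℝ^N`: locally `C = {F = 0}` with `F` smooth with values in `ℝ^k` and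
`∂_u F` of full rank `k`. -/
def IsSmoothFamilyOfCodim (k : ℕ) (C : Set (ℝ × Space d × State m n)) : Prop :=
  ∀ c ∈ C, ∃ (U : Set (ℝ × Space d × State m n)) (F : ℝ × Space d × State m n → Fin k → ℝ),
    IsOpen U ∧ c ∈ U ∧
    ContDiffOn ℝ ∞ F {y ∈ U | (y.1, y.2.1) ∈ P.base} ∧
    C ∩ U = {y ∈ U | (y.1, y.2.1) ∈ P.base ∧ F y = 0} ∧
    ∀ y ∈ C ∩ U, Function.Surjective (fderiv ℝ (fun u => F (y.1, y.2.1, u)) y.2.2)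

/-- `C` is a `𝒞` manifold for the boundary data `(g₁, g₂, 0)`, with associated family of
transversal layer profiles `W : [0,∞) × C → πU*`; `nPos = N₊`, so the fibres `C(t,x₀)` have
dimension `N - N₊`. -/
structure IsCManifoldWithProfiles (nPos : ℕ)
    (g1 : ℝ → Space d → Fin nPos1 → ℝ) (g2 : ℝ → Space d → Fin (n - n3) → ℝ)
    (C : Set (ℝ × Space d × State m n)) (W : ℝ → ℝ × Space d × State m n → State m n) :
    Prop where
  subset : C ⊆ P.Ubdry
  manifold : P.IsSmoothFamilyOfCodim nPos C
  smooth : ContDiffOn ℝ ∞ (fun y : ℝ × ℝ × Space d × State m n => W y.1 y.2) (Ici 0 ×ˢ C)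
  profile : ∀ t x₀ q, (t, x₀, q) ∈ C →
    P.IsLayerProfile t x₀ (g1 t x₀) (g2 t x₀) q (fun z => W z (t, x₀, q))
  transversal : ∀ t x₀ q, (t, x₀, q) ∈ C →
    P.Transversal (P.ν x₀) (fun z => W z (t, x₀, q))
  decay : ∀ K ⊆ C, IsCompact K → ∃ M > 0, ∃ δ > 0, ∀ y ∈ K, ∀ z ∈ Ici (0 : ℝ),
    ‖W z y - y.2.2‖ ≤ M * Real.exp (-δ * z)

/-- The graph of the sets of endstates of small-amplitude layer profiles: over `(t,x₀)`, the
states `q` with `|q - p(t,x₀)| < δ` that are endstates of a layer profile with boundary data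
`(g₁, g₂, 0)` and amplitude at most `ε` about `p(t,x₀)`. -/
def smallEndstates (p : ℝ → Space d → State m n)
    (g1 : ℝ → Space d → Fin nPos1 → ℝ) (g2 : ℝ → Space d → Fin (n - n3) → ℝ) (ε δ : ℝ) :
    Set (ℝ × Space d × State m n) :=
  {y | (y.1, y.2.1) ∈ P.base ∧ ‖y.2.2 - p y.1 y.2.1‖ < δ ∧
    ∃ w, P.IsLayerProfile y.1 y.2.1 (g1 y.1 y.2.1) (g2 y.1 y.2.1) y.2.2 w ∧
      AmplitudeLE (p y.1 y.2.1) ε w}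

end ViscousProblem

end

set_option linter.unusedSectionVars false
set_option linter.unusedVariables false

open scoped BoundedContinuousFunction NNReal

/-- Implicit function theorem: the implicit function is smooth on a whole neighbourhood. -/
theorem exists_implicitFunction_contDiffOn {X Y Z : Type*}
    [NormedAddCommGroup X] [NormedSpace ℝ X] [CompleteSpace X]
    [NormedAddCommGroup Y] [NormedSpace ℝ Y] [CompleteSpace Y]
    [NormedAddCommGroup Z] [NormedSpace ℝ Z] [CompleteSpace Z]
    {f : X × Y → Z} {O : Set (X × Y)} (hO : IsOpen O) (hf : ContDiffOn ℝ ∞ f O)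
    {u : X × Y} (hu : u ∈ O)
    (hinv : (fderiv ℝ f u ∘L ContinuousLinearMap.inr ℝ X Y).IsInvertible) :
    ∃ (φ : X → Y) (U : Set X) (V : Set Y), IsOpen U ∧ IsOpen V ∧ u.1 ∈ U ∧ u.2 ∈ V ∧
      U ×ˢ V ⊆ O ∧ φ u.1 = u.2 ∧ ContDiffOn ℝ ∞ φ U ∧ (∀ x ∈ U, φ x ∈ V) ∧
      ∀ x ∈ U, ∀ y ∈ V, f (x, y) = f u ↔ φ x = y := by
  have hcd : ∀ v ∈ O, ContDiffAt ℝ ∞ f v := fun v hv => hf.contDiffAt (hO.mem_nhds hv)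
  have h0 : (∞ : WithTop ℕ∞) ≠ 0 := by simp
  set φ := (hcd u hu).implicitFunction h0 hinv with hφ
  have hφu : φ u.1 = u.2 := (hcd u hu).implicitFunction_apply_self h0 hinv
  have hφc : ContDiffAt ℝ ∞ φ u.1 := (hcd u hu).contDiffAt_implicitFunction h0 hinv
  have hinvO : ∀ᶠ v in 𝓝 u, v ∈ O ∧ (fderiv ℝ f v ∘L ContinuousLinearMap.inr ℝ X Y).IsInvertible := by
    refine (hO.eventually_mem hu).and ?_
    obtain ⟨e, he⟩ := hinv
    have hc : ContinuousAt (fun v => fderiv ℝ f v ∘L ContinuousLinearMap.inr ℝ X Y) u :=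
      ((hf.continuousOn_fderiv_of_isOpen hO (by simp)).continuousAt (hO.mem_nhds hu)).clm_comp
        continuousAt_const
    have h := e.nhds
    rw [he] at h
    filter_upwards [hc h] with v hv
    exact hv
  have hev := hinvO.and ((hcd u hu).eventually_apply_eq_iff_implicitFunction h0 hinv)
  obtain ⟨N, hN, hNo, huN⟩ := eventually_nhds_iff.1 hev
  obtain ⟨U₀, V, hU₀, hV, huU, huV, hUV⟩ := isOpen_prod_iff.1 hNo u.1 u.2 huN
  obtain ⟨U₁, hU₁, hU₁o, huU₁⟩ := eventually_nhds_iff.1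
    (((hcd u hu).eventually_apply_implicitFunction h0 hinv).and
      (hφc.continuousAt.eventually_mem (hV.mem_nhds (by rw [hφu]; exact huV))))
  refine ⟨φ, U₀ ∩ U₁, V, hU₀.inter hU₁o, hV, ⟨huU, huU₁⟩, huV, ?_, hφu, ?_, fun x hx => (hU₁ x hx.2).2,
    fun x hx y hy => (hN _ (hUV ⟨hx.1, hy⟩)).2⟩
  · rintro ⟨x, y⟩ ⟨hx, hy⟩
    exact (hN _ (hUV ⟨hx.1, hy⟩)).1.1
  · intro x hx
    refine ContDiffAt.contDiffWithinAt ?_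
    have hv : (x, φ x) ∈ U₀ ×ˢ V := ⟨hx.1, (hU₁ x hx.2).2⟩
    obtain ⟨⟨hvO, hvi⟩, -⟩ := hN _ (hUV hv)
    have hψ := (hcd _ hvO).contDiffAt_implicitFunction h0 hvi
    refine hψ.congr_of_eventuallyEq ?_
    have h1 := (hcd _ hvO).eventually_apply_implicitFunction h0 hvi
    have h2 : ∀ᶠ x' in 𝓝 x, (hcd _ hvO).implicitFunction h0 hvi x' ∈ V := by
      refine hψ.continuousAt.eventually_mem (hV.mem_nhds ?_)
      rw [(hcd _ hvO).implicitFunction_apply_self h0 hvi]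
      exact hv.2
    filter_upwards [h1, h2, hU₀.mem_nhds hx.1] with x' e1 e2 e3
    exact ((hN _ (hUV (show (x', _) ∈ U₀ ×ˢ V from ⟨e3, e2⟩))).2.1 (e1.trans (hU₁ x hx.2).1))

section Superposition

variable {X V W : Type*} [TopologicalSpace X] [NormedAddCommGroup V] [NormedSpace ℝ V]
  [ProperSpace V] [NormedAddCommGroup W] [NormedSpace ℝ W]

/-- The superposition operator `u ↦ f ∘ u` on bounded continuous functions. -/
noncomputable def superposition (f : C(V, W)) (u : X →ᵇ V) : X →ᵇ W :=
  BoundedContinuousFunction.ofNormedAddCommGroup (fun x => f (u x)) (by fun_prop)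
    (Classical.choose (((isCompact_closedBall (0 : V) ‖u‖).image f.continuous).isBounded.exists_norm_le))
    (fun x => Classical.choose_spec
      (((isCompact_closedBall (0 : V) ‖u‖).image f.continuous).isBounded.exists_norm_le) _
      ⟨u x, by simpa using u.norm_coe_le_norm x, rfl⟩)

@[simp] theorem superposition_apply (f : C(V, W)) (u : X →ᵇ V) (x : X) :
    superposition f u x = f (u x) := rfl

theorem exists_modulus_on_ball (f : C(V, W)) (R : ℝ) {ε : ℝ} (hε : 0 < ε) :
    ∃ δ > 0, ∀ a ∈ Metric.closedBall (0 : V) R, ∀ b ∈ Metric.closedBall (0 : V) R,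
      dist a b < δ → dist (f a) (f b) < ε := by
  have h := (isCompact_closedBall (0 : V) R).uniformContinuousOn_of_continuous
    f.continuous.continuousOn
  obtain ⟨δ, hδ, h⟩ := Metric.uniformContinuousOn_iff.1 h ε hε
  exact ⟨δ, hδ, h⟩

theorem continuous_superposition (f : C(V, W)) :
    Continuous (superposition f : (X →ᵇ V) → (X →ᵇ W)) := by
  rw [Metric.continuous_iff]
  intro u ε hε
  obtain ⟨δ, hδ, h⟩ := exists_modulus_on_ball f (‖u‖ + 1) (half_pos hε)
  refine ⟨min δ 1, lt_min hδ one_pos, fun v hv => lt_of_le_of_lt ?_ (half_lt_self hε)⟩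
  refine (BoundedContinuousFunction.dist_le (half_pos hε).le).2 fun x => ?_
  have hvx : dist (v x) (u x) < min δ 1 := (BoundedContinuousFunction.dist_coe_le_dist x).trans_lt hv
  have hux := u.norm_coe_le_norm x
  refine (h _ ?_ _ ?_ (hvx.trans_le (min_le_left _ _))).le
  · have := (norm_le_norm_add_norm_sub' (v x) (u x))
    rw [← dist_eq_norm] at this
    simp only [Metric.mem_closedBall, dist_zero_right]
    linarith [hvx.trans_le (min_le_right _ _)]
  · simp only [Metric.mem_closedBall, dist_zero_right]
    linarith

/-- Pointwise application of operator-valued to vector-valued bounded continuous functions. -/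
noncomputable def pointwiseApply (X V W : Type*) [TopologicalSpace X] [NormedAddCommGroup V]
    [NormedSpace ℝ V] [NormedAddCommGroup W] [NormedSpace ℝ W] :
    (X →ᵇ (V →L[ℝ] W)) →L[ℝ] (X →ᵇ V) →L[ℝ] (X →ᵇ W) :=
  LinearMap.mkContinuous₂
    (LinearMap.mk₂ ℝ
      (fun (g : X →ᵇ (V →L[ℝ] W)) (h : X →ᵇ V) =>
        BoundedContinuousFunction.ofNormedAddCommGroup (fun x => g x (h x))
        (by fun_prop) (‖g‖ * ‖h‖) (fun x => (ContinuousLinearMap.le_opNorm _ _).trans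
          (mul_le_mul (g.norm_coe_le_norm x) (h.norm_coe_le_norm x) (norm_nonneg _) (by positivity))))
      (fun _ _ _ => by ext; simp) (fun _ _ _ => by ext; simp)
      (fun _ _ _ => by ext; simp) (fun _ _ _ => by ext; simp)) 1
    (fun g h => by
      rw [one_mul]
      exact (BoundedContinuousFunction.norm_le (by positivity)).2 fun x =>
        (ContinuousLinearMap.le_opNorm _ _).trans
          (mul_le_mul (g.norm_coe_le_norm x) (h.norm_coe_le_norm x) (norm_nonneg _) (by positivity)))

@[simp] theorem pointwiseApply_apply {X V W : Type*} [TopologicalSpace X] [NormedAddCommGroup V]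
    [NormedSpace ℝ V] [NormedAddCommGroup W] [NormedSpace ℝ W]
    (g : X →ᵇ (V →L[ℝ] W)) (h : X →ᵇ V) (x : X) : pointwiseApply X V W g h x = g x (h x) := rfl

theorem norm_pointwiseApply_le {X V W : Type*} [TopologicalSpace X] [NormedAddCommGroup V]
    [NormedSpace ℝ V] [NormedAddCommGroup W] [NormedSpace ℝ W]
    (g : X →ᵇ (V →L[ℝ] W)) (h : X →ᵇ V) : ‖pointwiseApply X V W g h‖ ≤ ‖g‖ * ‖h‖ :=
  (BoundedContinuousFunction.norm_le (by positivity)).2 fun x =>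
    (ContinuousLinearMap.le_opNorm _ _).trans
      (mul_le_mul (g.norm_coe_le_norm x) (h.norm_coe_le_norm x) (norm_nonneg _) (by positivity))

theorem hasFDerivAt_superposition {f : C(V, W)} {f' : C(V, V →L[ℝ] W)}
    (hf : ∀ v, HasFDerivAt f (f' v) v) (u : X →ᵇ V) :
    HasFDerivAt (superposition f : (X →ᵇ V) → (X →ᵇ W))
      (pointwiseApply X V W (superposition f' u)) u := by
  rw [hasFDerivAt_iff_isLittleO, Asymptotics.isLittleO_iff]
  intro c hc
  obtain ⟨δ, hδ, h⟩ := exists_modulus_on_ball f' (‖u‖ + 1) hc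
  filter_upwards [Metric.ball_mem_nhds u (lt_min hδ one_pos)] with v hv
  refine (BoundedContinuousFunction.norm_le (by positivity)).2 fun x => ?_
  have hux := u.norm_coe_le_norm x
  have hvx : dist (v x) (u x) < min δ 1 := (BoundedContinuousFunction.dist_coe_le_dist x).trans_lt hv
  have key := Convex.norm_image_sub_le_of_norm_hasFDerivWithin_le' (f := f) (f' := f') (φ := f' (u x))
    (s := Metric.ball (u x) (min δ 1)) (C := c) (x := u x) (y := v x)
    (fun y _ => (hf y).hasFDerivWithinAt) (fun y hy => ?_) (convex_ball _ _)
    (Metric.mem_ball_self (lt_min hδ one_pos)) hvx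
  · refine key.trans (mul_le_mul_of_nonneg_left ?_ hc.le)
    exact (v - u).norm_coe_le_norm x
  · rw [← dist_eq_norm]
    refine (h _ ?_ _ ?_ (lt_of_lt_of_le hy (min_le_left _ _))).le
    · have := (norm_le_norm_add_norm_sub' y (u x))
      rw [← dist_eq_norm] at this
      have := lt_of_lt_of_le (Metric.mem_ball.1 hy) (min_le_right _ _)
      simp only [Metric.mem_closedBall, dist_zero_right]
      linarith
    · simp only [Metric.mem_closedBall, dist_zero_right]
      linarith

end Superposition

theorem contDiff_superposition {X V W : Type} [TopologicalSpace X] [NormedAddCommGroup V]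
    [NormedSpace ℝ V] [ProperSpace V] [NormedAddCommGroup W] [NormedSpace ℝ W] (f : C(V, W))
    (hf : ContDiff ℝ ∞ f) : ContDiff ℝ ∞ (superposition f : (X →ᵇ V) → (X →ᵇ W)) := by
  rw [contDiff_infty]
  intro n
  replace hf := contDiff_infty.1 hf n
  induction n generalizing W with
  | zero => exact contDiff_zero.2 (continuous_superposition f)
  | succ n ih =>
    push_cast at hf ⊢
    obtain ⟨f', hf', hff'⟩ := contDiff_succ_iff_hasFDerivAt.1 hf
    rw [contDiff_succ_iff_hasFDerivAt]
    refine ⟨fun u => pointwiseApply X V W (superposition ⟨f', hf'.continuous⟩ u),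
      by exact (pointwiseApply X V W).contDiff.comp (ih ⟨f', hf'.continuous⟩ hf'), fun u =>
      hasFDerivAt_superposition (f' := ⟨f', hf'.continuous⟩) hff' u⟩

theorem ContDiffOn.clm_map {X V W : Type*} [NormedAddCommGroup X] [NormedSpace ℝ X]
    [NormedAddCommGroup V] [NormedSpace ℝ V] [NormedAddCommGroup W] [NormedSpace ℝ W]
    {n : WithTop ℕ∞} {f : X → V} {s : Set X} (hf : ContDiffOn ℝ n f s) (L : V →L[ℝ] W) :
    ContDiffOn ℝ n (fun x => L (f x)) s :=
  L.contDiff.comp_contDiffOn hf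

section BoundedFamilies

variable {X V W Y : Type*} [TopologicalSpace X] [NormedAddCommGroup V] [NormedSpace ℝ V]
  [NormedAddCommGroup W] [NormedSpace ℝ W] [NormedAddCommGroup Y] [NormedSpace ℝ Y]

/-- Constant functions, as a continuous linear map. -/
noncomputable def constL (X V : Type*) [TopologicalSpace X] [NormedAddCommGroup V]
    [NormedSpace ℝ V] : V →L[ℝ] (X →ᵇ V) :=
  LinearMap.mkContinuous
    { toFun := fun v => BoundedContinuousFunction.const X v
      map_add' := fun _ _ => by ext; simp
      map_smul' := fun _ _ => by ext; simp } 1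
    (fun v => by rw [one_mul]; exact BoundedContinuousFunction.norm_const_le v)

@[simp] theorem constL_apply (v : V) (x : X) : constL X V v x = v := rfl

/-- Pairs of bounded continuous functions. -/
noncomputable def pairL (X V W : Type*) [TopologicalSpace X] [NormedAddCommGroup V]
    [NormedSpace ℝ V] [NormedAddCommGroup W] [NormedSpace ℝ W] :
    (X →ᵇ V) × (X →ᵇ W) →L[ℝ] (X →ᵇ V × W) :=
  ((ContinuousLinearMap.inl ℝ V W).compLeftContinuousBounded X).comp (ContinuousLinearMap.fst ℝ _ _) +
  ((ContinuousLinearMap.inr ℝ V W).compLeftContinuousBounded X).comp (ContinuousLinearMap.snd ℝ _ _)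

@[simp] theorem pairL_apply (u : (X →ᵇ V) × (X →ᵇ W)) (x : X) :
    pairL X V W u x = (u.1 x, u.2 x) := by
  simp [pairL]

/-- An operator into bounded functions, seen as a bounded function with operator values. -/
noncomputable def flipL (X Y V : Type*) [TopologicalSpace X] [NormedAddCommGroup V]
    [NormedSpace ℝ V] [NormedAddCommGroup Y] [NormedSpace ℝ Y] [FiniteDimensional ℝ Y] :
    (Y →L[ℝ] (X →ᵇ V)) →L[ℝ] (X →ᵇ (Y →L[ℝ] V)) :=
  LinearMap.mkContinuous
    { toFun := fun D => BoundedContinuousFunction.ofNormedAddCommGroup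
        (fun x => (BoundedContinuousFunction.evalCLM ℝ x).comp D)
        (continuous_clm_apply.2 fun y => (D y).continuous) ‖D‖
        (fun x => ContinuousLinearMap.opNorm_le_bound _ (by positivity) fun y =>
          ((D y).norm_coe_le_norm x).trans (D.le_opNorm y))
      map_add' := fun _ _ => by ext; simp
      map_smul' := fun _ _ => by ext; simp } 1
    (fun D => by
      rw [one_mul]
      exact (BoundedContinuousFunction.norm_le (by positivity)).2 fun x =>
        ContinuousLinearMap.opNorm_le_bound _ (by positivity) fun y =>
          ((D y).norm_coe_le_norm x).trans (D.le_opNorm y))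

@[simp] theorem flipL_apply [FiniteDimensional ℝ Y] (D : Y →L[ℝ] (X →ᵇ V)) (x : X) (y : Y) :
    flipL X Y V D x y = D y x := rfl

theorem continuous_extend (u : ℝ≥0 →ᵇ V) : Continuous fun z : ℝ => u z.toNNReal :=
  u.continuous.comp continuous_real_toNNReal

/-- Integration over `[0, z]` of bounded functions on the half-line. -/
noncomputable def integralL (V : Type*) [NormedAddCommGroup V] [NormedSpace ℝ V] (z : ℝ) :
    (ℝ≥0 →ᵇ V) →L[ℝ] V :=
  LinearMap.mkContinuous
    { toFun := fun u => ∫ s in (0 : ℝ)..z, u s.toNNReal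
      map_add' := fun u v => intervalIntegral.integral_add
        ((continuous_extend u).intervalIntegrable _ _) ((continuous_extend v).intervalIntegrable _ _)
      map_smul' := fun c u => intervalIntegral.integral_smul _ _ } |z|
    (fun u => by
      have := intervalIntegral.norm_integral_le_of_norm_le_const (a := 0) (b := z) (C := ‖u‖)
        (f := fun s : ℝ => u s.toNNReal) fun s _ => u.norm_coe_le_norm _
      rw [sub_zero, mul_comm] at this
      exact this)

theorem integralL_apply (z : ℝ) (u : ℝ≥0 →ᵇ V) :
    integralL V z u = ∫ s in (0 : ℝ)..z, u s.toNNReal := rfl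

/-- `g` is the derivative of `u` on the half-line. -/
def HasHalfLineDeriv (u g : ℝ≥0 →ᵇ V) : Prop :=
  ∀ z ∈ Ici (0 : ℝ), HasDerivWithinAt (fun z : ℝ => u z.toNNReal) (g z.toNNReal) (Ici 0) z

theorem hasHalfLineDeriv_iff [CompleteSpace V] {u g : ℝ≥0 →ᵇ V} :
    HasHalfLineDeriv u g ↔ ∀ z : ℝ, 0 ≤ z → u z.toNNReal - u 0 = integralL V z g := by
  constructor
  · intro h z hz
    have := intervalIntegral.integral_eq_sub_of_hasDeriv_right_of_le hz
      (continuous_extend u).continuousOn (f' := fun z : ℝ => g z.toNNReal)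
      (fun x hx => ((h x hx.1.le).mono (Ioi_subset_Ici hx.1.le)))
      ((continuous_extend g).intervalIntegrable _ _)
    rw [integralL_apply, this, Real.toNNReal_zero]
  · intro h z hz
    have h1 : HasDerivAt (fun x => ∫ s in (0 : ℝ)..x, g s.toNNReal) (g z.toNNReal) z :=
      ((continuous_extend g).integral_hasStrictDerivAt 0 z).hasDerivAt
    refine ((h1.hasDerivWithinAt (s := Ici 0)).const_add (u 0)).congr (fun x hx => ?_) ?_
    · rw [← integralL_apply, ← h x hx]; abel
    · rw [← integralL_apply, ← h z hz]; abel

theorem HasHalfLineDeriv.fderiv_family [CompleteSpace V] {U : Set Y} (hU : IsOpen U)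
    {Ξ g : Y → (ℝ≥0 →ᵇ V)} (hg : ∀ y ∈ U, HasHalfLineDeriv (Ξ y) (g y)) {y : Y} (hy : y ∈ U)
    (dΞ : DifferentiableAt ℝ Ξ y) (dg : DifferentiableAt ℝ g y) (h : Y) :
    HasHalfLineDeriv (fderiv ℝ Ξ y h) (fderiv ℝ g y h) := by
  rw [hasHalfLineDeriv_iff]
  intro z hz
  set L : (ℝ≥0 →ᵇ V) →L[ℝ] V := BoundedContinuousFunction.evalCLM ℝ z.toNNReal -
    BoundedContinuousFunction.evalCLM ℝ 0
  have h1 : HasFDerivAt (fun y => L (Ξ y)) (L.comp (fderiv ℝ Ξ y)) y :=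
    L.hasFDerivAt.comp y dΞ.hasFDerivAt
  have h2 : HasFDerivAt (fun y => integralL V z (g y)) ((integralL V z).comp (fderiv ℝ g y)) y :=
    (integralL V z).hasFDerivAt.comp y dg.hasFDerivAt
  have h3 : (fun y => L (Ξ y)) =ᶠ[𝓝 y] fun y => integralL V z (g y) := by
    filter_upwards [hU.mem_nhds hy] with y' hy'
    exact hasHalfLineDeriv_iff.1 (hg y' hy') z hz
  have := (h1.congr_of_eventuallyEq h3.symm).unique h2
  exact DFunLike.congr_fun this h

theorem HasHalfLineDeriv.flip [CompleteSpace V] [FiniteDimensional ℝ Y]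
    {D E : Y →L[ℝ] (ℝ≥0 →ᵇ V)} (h : ∀ y, HasHalfLineDeriv (D y) (E y)) :
    HasHalfLineDeriv (flipL ℝ≥0 Y V D) (flipL ℝ≥0 Y V E) := by
  rw [hasHalfLineDeriv_iff]
  intro z hz
  ext y
  rw [integralL_apply, ContinuousLinearMap.intervalIntegral_apply
    ((continuous_extend _).intervalIntegrable _ _)]
  exact hasHalfLineDeriv_iff.1 (h y) z hz

theorem HasHalfLineDeriv.pair {u g : ℝ≥0 →ᵇ V} {v k : ℝ≥0 →ᵇ W} (hu : HasHalfLineDeriv u g)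
    (hv : HasHalfLineDeriv v k) :
    HasHalfLineDeriv (pairL ℝ≥0 V W (u, v)) (pairL ℝ≥0 V W (g, k)) := fun z hz => by
  simpa using (hu z hz).prodMk (hv z hz)

theorem hasFDerivWithinAt_eval_family [CompleteSpace V] [FiniteDimensional ℝ Y] {U : Set Y}
    (hU : IsOpen U) {Ξ g : Y → (ℝ≥0 →ᵇ V)} (hg : ∀ y ∈ U, HasHalfLineDeriv (Ξ y) (g y))
    {y : Y} (hy : y ∈ U) (dΞ : DifferentiableAt ℝ Ξ y) (dg : DifferentiableAt ℝ g y)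
    {z : ℝ} (hz : 0 ≤ z) :
    HasFDerivWithinAt (fun p : ℝ × Y => Ξ p.2 p.1.toNNReal)
      ((ContinuousLinearMap.fst ℝ ℝ Y).smulRight (g y z.toNNReal) +
        (flipL ℝ≥0 Y V (fderiv ℝ Ξ y) z.toNNReal).comp (ContinuousLinearMap.snd ℝ ℝ Y))
      (Ici 0 ×ˢ U) (z, y) := by
  have hmaps : MapsTo (Prod.fst : ℝ × Y → ℝ) (Ici (0 : ℝ) ×ˢ U) (Ici 0) := fun p hp => hp.1
  have hC : HasFDerivWithinAt (fun p : ℝ × Y => Ξ y p.1.toNNReal)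
      ((ContinuousLinearMap.fst ℝ ℝ Y).smulRight (g y z.toNNReal)) (Ici 0 ×ˢ U) (z, y) := by
    have := ((hg y hy z hz).hasFDerivWithinAt).comp (z, y)
      (hasFDerivWithinAt_fst (𝕜 := ℝ) (s := Ici (0 : ℝ) ×ˢ U)) hmaps
    convert! this using 1
  have hF := HasHalfLineDeriv.flip (fun h => HasHalfLineDeriv.fderiv_family hU hg hy dΞ dg h)
  have hB : HasFDerivWithinAt
      (fun p : ℝ × Y => flipL ℝ≥0 Y V (fderiv ℝ Ξ y) p.1.toNNReal (p.2 - y))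
      ((flipL ℝ≥0 Y V (fderiv ℝ Ξ y) z.toNNReal).comp (ContinuousLinearMap.snd ℝ ℝ Y))
      (Ici 0 ×ˢ U) (z, y) := by
    have h1 := ((hF z hz).hasFDerivWithinAt).comp (z, y)
      (hasFDerivWithinAt_fst (𝕜 := ℝ) (s := Ici (0 : ℝ) ×ˢ U)) hmaps
    have h2 := h1.clm_apply ((hasFDerivWithinAt_snd (𝕜 := ℝ) (s := Ici (0 : ℝ) ×ˢ U)
      (p := (z, y))).sub_const y)
    convert! h2 using 1
    ext <;> simp
  have hA : HasFDerivWithinAt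
      (fun p : ℝ × Y => (Ξ p.2 - Ξ y - fderiv ℝ Ξ y (p.2 - y)) p.1.toNNReal)
      (0 : ℝ × Y →L[ℝ] V) (Ici 0 ×ˢ U) (z, y) := by
    refine HasFDerivAt.hasFDerivWithinAt ?_
    have h0 := dΞ.hasFDerivAt
    rw [hasFDerivAt_iff_isLittleO] at h0 ⊢
    have h1 := h0.comp_tendsto (k := Prod.snd) (l' := 𝓝 (z, y)) continuousAt_snd
    refine (Asymptotics.IsBigO.of_bound 1 (Eventually.of_forall fun p => ?_)).trans_isLittleO
      (h1.trans_isBigO (Asymptotics.IsBigO.of_bound 1 (Eventually.of_forall fun p => ?_)))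
    · simp only [Function.comp_apply, one_mul, _root_.zero_apply, sub_self,
        map_zero, sub_zero, BoundedContinuousFunction.coe_zero, Pi.zero_apply]
      exact BoundedContinuousFunction.norm_coe_le_norm _ _
    · rw [one_mul]
      exact norm_snd_le (p - (z, y))
  have := (hA.add hB).add hC
  rw [zero_add, add_comm (ContinuousLinearMap.comp _ _)] at this
  refine this.congr (fun p _ => ?_) ?_ <;> simp

end BoundedFamilies

theorem contDiffOn_eval_family {Y V : Type} [NormedAddCommGroup V] [NormedSpace ℝ V]
    [FiniteDimensional ℝ V] [NormedAddCommGroup Y] [NormedSpace ℝ Y] [FiniteDimensional ℝ Y]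
    {U : Set Y} (hU : IsOpen U) {G : C(Y × V, V)} (hG : ContDiff ℝ ∞ G) {Ξ : Y → (ℝ≥0 →ᵇ V)}
    (hΞ : ContDiffOn ℝ ∞ Ξ U)
    (hode : ∀ y ∈ U, HasHalfLineDeriv (Ξ y)
      (superposition G (pairL ℝ≥0 Y V (constL ℝ≥0 Y y, Ξ y)))) :
    ContDiffOn ℝ ∞ (fun p : ℝ × Y => Ξ p.2 p.1.toNNReal) (Ici 0 ×ˢ U) := by
  rw [contDiffOn_infty]
  intro n
  induction n generalizing V with
  | zero =>
    refine contDiffOn_zero.2 fun p hp => ?_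
    have hd : DifferentiableAt ℝ Ξ p.2 :=
      (hΞ.contDiffAt (hU.mem_nhds hp.2)).differentiableAt (by simp)
    have hc := hd.continuousAt
    have h2 : ContinuousAt (fun q : (ℝ≥0 →ᵇ V) × ℝ≥0 => q.1 q.2) (Ξ p.2, p.1.toNNReal) :=
      continuous_eval.continuousAt
    exact (ContinuousAt.comp (f := fun p : ℝ × Y => (Ξ p.2, p.1.toNNReal)) h2
      (((ContinuousAt.comp (f := Prod.snd) hc continuousAt_snd)).prodMk
        (continuous_real_toNNReal.continuousAt.comp continuousAt_fst))).continuousWithinAt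
  | succ n ih =>
    have hud : UniqueDiffOn ℝ (Ici (0 : ℝ) ×ˢ U) := (uniqueDiffOn_Ici 0).prod hU.uniqueDiffOn
    push_cast
    rw [contDiffOn_succ_iff_hasFDerivWithinAt_of_uniqueDiffOn hud]
    set g : Y → (ℝ≥0 →ᵇ V) := fun y => superposition G (pairL ℝ≥0 Y V (constL ℝ≥0 Y y, Ξ y))
      with hgdef
    have hΞd : ∀ y ∈ U, DifferentiableAt ℝ Ξ y := fun y hy =>
      (hΞ.contDiffAt (hU.mem_nhds hy)).differentiableAt (by simp)
    have hDG : ContDiff ℝ ∞ (fderiv ℝ G) := hG.fderiv_right (by simp)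
    have hgd : ∀ y ∈ U, HasFDerivAt g ((pointwiseApply ℝ≥0 (Y × V) V (superposition
        ⟨fderiv ℝ G, hDG.continuous⟩ (pairL ℝ≥0 Y V (constL ℝ≥0 Y y, Ξ y)))).comp
        ((pairL ℝ≥0 Y V).comp ((constL ℝ≥0 Y).prod (fderiv ℝ Ξ y)))) y := by
      intro y hy
      exact (hasFDerivAt_superposition (f' := ⟨fderiv ℝ G, hDG.continuous⟩)
        (fun v => ((hG.differentiable (by simp)) v).hasFDerivAt) _).comp y
        ((pairL ℝ≥0 Y V).hasFDerivAt.comp y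
          ((constL ℝ≥0 Y).hasFDerivAt.prodMk (hΞd y hy).hasFDerivAt))
    refine ⟨by simp, _, ?_, fun p hp => hasFDerivWithinAt_eval_family hU hode hp.2 (hΞd _ hp.2)
      (hgd _ hp.2).differentiableAt hp.1⟩
    have hv := ih hG hΞ hode
    let G' : C(Y × V × (Y →L[ℝ] V), V × (Y →L[ℝ] V)) :=
      ⟨fun q => (G (q.1, q.2.1),
        (fderiv ℝ G (q.1, q.2.1)).comp (ContinuousLinearMap.inl ℝ Y V +
          (ContinuousLinearMap.inr ℝ Y V).comp q.2.2)), by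
        have := hG.continuous; have := hDG.continuous; fun_prop⟩
    have hG' : ContDiff ℝ ∞ G' := by
      exact ContDiff.prodMk (hG.comp (by fun_prop)) (ContDiff.clm_comp (hDG.comp (by fun_prop))
        (by fun_prop))
    have hη := ih (V := V × (Y →L[ℝ] V)) hG'
      (Ξ := fun y => pairL ℝ≥0 V (Y →L[ℝ] V) (Ξ y, flipL ℝ≥0 Y V (fderiv ℝ Ξ y)))
      (by
        have h1 := hΞ.fderiv_of_isOpen (m := ∞) hU (by simp)
        have h2 := hΞ.prodMk (h1.clm_map (W := ℝ≥0 →ᵇ (Y →L[ℝ] V)) (flipL ℝ≥0 Y V))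
        exact h2.clm_map (W := ℝ≥0 →ᵇ (V × (Y →L[ℝ] V))) (pairL ℝ≥0 V (Y →L[ℝ] V)))
      (fun y hy => by
        have h1 := (hode y hy).pair (HasHalfLineDeriv.flip
          (fun h => HasHalfLineDeriv.fderiv_family hU hode hy (hΞd y hy) (hgd y hy).differentiableAt h))
        convert! h1 using 1
        ext z
        · simp [G']
        · rw [(hgd y hy).fderiv]
          simp [G', ← map_add])
    have hη' := hη.snd
    have h1 : ContDiffOn ℝ n (fun p : ℝ × Y => g p.2 p.1.toNNReal) (Ici 0 ×ˢ U) :=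
      ((contDiff_infty.1 hG n).comp_contDiffOn (contDiffOn_snd.prodMk hv)).congr
        fun p _ => by simp [hgdef]
    simp only [pairL_apply] at hη'
    refine ContDiffOn.add ?_ (hη'.clm_comp contDiffOn_const)
    exact ContDiffOn.smulRight contDiffOn_const h1

section Dichotomy

variable {Z : Type*} [NormedAddCommGroup Z] [NormedSpace ℝ Z] [CompleteSpace Z]

/-- Exponential dichotomy with rate `κ` of the equation `u' = L u` with flow `S`; the projection
`P` selects the decaying solutions. -/
structure ExpDichotomy {Z : Type*} [NormedAddCommGroup Z] [NormedSpace ℝ Z]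
    (L P : Z →L[ℝ] Z) (S : ℝ → Z →L[ℝ] Z) (C κ : ℝ) : Prop where
  rate_pos : 0 < κ
  C_nonneg : 0 ≤ C
  proj : ∀ x, P (P x) = P x
  flow_zero : ∀ x, S 0 x = x
  flow_add : ∀ s t x, S (s + t) x = S s (S t x)
  flow_deriv : ∀ t, HasDerivAt S (L.comp (S t)) t
  flow_comm : ∀ t x, S t (L x) = L (S t x)
  flow_proj : ∀ t x, S t (P x) = P (S t x)
  stable : ∀ t, 0 ≤ t → ∀ x, ‖S t (P x)‖ ≤ C * Real.exp (-κ * t) * ‖x‖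
  unstable : ∀ t, 0 ≤ t → ∀ x, ‖S (-t) (x - P x)‖ ≤ C * Real.exp (-κ * t) * ‖x‖

namespace ExpDichotomy

variable {L P : Z →L[ℝ] Z} {S : ℝ → Z →L[ℝ] Z} {C κ : ℝ} (h : ExpDichotomy L P S C κ)

include h

theorem continuous_flow : Continuous S :=
  continuous_iff_continuousAt.2 fun t => (h.flow_deriv t).continuousAt

theorem flow_neg (t : ℝ) (x : Z) : S t (S (-t) x) = x := by
  rw [← h.flow_add, add_neg_cancel, h.flow_zero]

theorem hasDerivAt_flow_neg (t : ℝ) : HasDerivAt (fun t => S (-t)) (-(L.comp (S (-t)))) t := by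
  have := HasDerivAt.scomp t (h.flow_deriv (-t)) (hasDerivAt_neg t)
  rw [neg_one_smul] at this
  exact this

/-- Adding a multiple of the identity smaller than the rate keeps the dichotomy. -/
theorem shift {θ : ℝ} (hθ : 0 ≤ θ) (hθκ : θ < κ) :
    ExpDichotomy (L + θ • ContinuousLinearMap.id ℝ Z) P (fun t => Real.exp (θ * t) • S t) C
      (κ - θ) where
  rate_pos := by linarith
  C_nonneg := h.C_nonneg
  proj := h.proj
  flow_zero x := by simp [h.flow_zero]
  flow_add s t x := by
    change Real.exp (θ * (s + t)) • S (s + t) x = Real.exp (θ * s) • S s (Real.exp (θ * t) • S t x)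
    rw [h.flow_add, map_smul, smul_smul, mul_add, Real.exp_add]
  flow_deriv t := by
    have h1 : HasDerivAt (fun t : ℝ => Real.exp (θ * t)) (Real.exp (θ * t) * θ) t := by
      simpa using ((hasDerivAt_id t).const_mul θ).exp
    convert! h1.smul (h.flow_deriv t) using 1
    ext x
    simp [smul_smul, mul_comm]
  flow_comm t x := by simp [h.flow_comm, smul_smul, mul_comm]
  flow_proj t x := by simp [h.flow_proj]
  stable t ht x := by
    rw [_root_.smul_apply, norm_smul, Real.norm_of_nonneg (Real.exp_pos _).le]
    calc _ ≤ Real.exp (θ * t) * (C * Real.exp (-κ * t) * ‖x‖) := by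
          gcongr; exact h.stable t ht x
      _ = C * Real.exp (-(κ - θ) * t) * ‖x‖ := by
          rw [show -(κ - θ) * t = θ * t + -κ * t by ring, Real.exp_add]; ring
  unstable t ht x := by
    rw [_root_.smul_apply, norm_smul, Real.norm_of_nonneg (Real.exp_pos _).le]
    calc _ ≤ 1 * (C * Real.exp (-κ * t) * ‖x‖) := by
          gcongr
          · exact Real.exp_le_one_iff.2 (by nlinarith)
          · exact h.unstable t ht x
      _ ≤ C * Real.exp (-(κ - θ) * t) * ‖x‖ := by
          rw [one_mul]
          have := h.C_nonneg
          gcongr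
          linarith

/-- The decaying solution `S z (P a)` of the homogeneous equation. -/
theorem exists_free : ∃ E : Z →L[ℝ] (ℝ≥0 →ᵇ Z), ∀ a z, E a z = S z (P a) := by
  have hb : ∀ a (z : ℝ≥0), ‖S z (P a)‖ ≤ C * ‖a‖ := fun a z =>
    (h.stable z z.2 a).trans (by
      have : Real.exp (-κ * z) ≤ 1 :=
        Real.exp_le_one_iff.2 (by have := h.rate_pos; have := z.2; nlinarith)
      have := h.C_nonneg
      calc C * Real.exp (-κ * z) * ‖a‖ ≤ C * 1 * ‖a‖ := by gcongr
        _ = C * ‖a‖ := by ring)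
  have hc : Continuous S := h.continuous_flow
  refine ⟨LinearMap.mkContinuous
    { toFun := fun a => BoundedContinuousFunction.ofNormedAddCommGroup
        (fun z : ℝ≥0 => S z (P a)) (by fun_prop) (C * ‖a‖) (hb a)
      map_add' := fun _ _ => by ext; simp
      map_smul' := fun _ _ => by ext; simp } C (fun a =>
      (BoundedContinuousFunction.norm_le (mul_nonneg h.C_nonneg (norm_nonneg a))).2 (hb a)),
    fun a z => rfl⟩

theorem continuous_integrand (u : ℝ≥0 →ᵇ Z) (Q : Z →L[ℝ] Z) :
    Continuous fun s : ℝ => S (-s) (Q (u s.toNNReal)) := by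
  have := h.continuous_flow
  have := continuous_extend u
  fun_prop

theorem norm_unstable_integrand_le (u : ℝ≥0 →ᵇ Z) {s : ℝ} (hs : 0 ≤ s) :
    ‖S (-s) ((ContinuousLinearMap.id ℝ Z - P) (u s.toNNReal))‖ ≤
      C * ‖u‖ * Real.exp (-κ * s) := by
  refine (h.unstable s hs _).trans ?_
  have := h.C_nonneg
  calc _ ≤ C * Real.exp (-κ * s) * ‖u‖ := by gcongr; exact u.norm_coe_le_norm _
    _ = _ := by ring

theorem integrableOn_unstable (u : ℝ≥0 →ᵇ Z) {a : ℝ} (ha : 0 ≤ a) :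
    MeasureTheory.IntegrableOn
      (fun s : ℝ => S (-s) ((ContinuousLinearMap.id ℝ Z - P) (u s.toNNReal))) (Ioi a) := by
  refine MeasureTheory.Integrable.mono'
    ((integrableOn_exp_mul_Ioi (neg_lt_zero.2 h.rate_pos) a).const_mul (C * ‖u‖))
    ((h.continuous_integrand u _).aestronglyMeasurable) ?_
  refine (MeasureTheory.ae_restrict_iff' measurableSet_Ioi).2 (Eventually.of_forall fun s hs => ?_)
  exact h.norm_unstable_integrand_le u (ha.trans (le_of_lt hs))

theorem exists_green : ∃ K : (ℝ≥0 →ᵇ Z) →L[ℝ] (ℝ≥0 →ᵇ Z),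
    (∀ f, HasHalfLineDeriv (K f) (L.compLeftContinuousBounded ℝ≥0 (K f) + f)) ∧
    ∀ f, P (K f 0) = 0 := by
  set Q : Z →L[ℝ] Z := ContinuousLinearMap.id ℝ Z - P with hQ
  have hPQ : ∀ x, P (Q x) = 0 := fun x => by simp [hQ, h.proj]
  have hQP : ∀ x, x = P x + Q x := fun x => by simp [hQ]
  have hSQ : ∀ t x, S t (Q x) = Q (S t x) := fun t x => by simp [hQ, h.flow_proj]
  set c : (ℝ≥0 →ᵇ Z) → Z := fun f => ∫ s in Ioi (0 : ℝ), S (-s) (Q (f s.toNNReal)) with hc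
  set I : (ℝ≥0 →ᵇ Z) → ℝ → Z := fun f z => ∫ s in (0 : ℝ)..z, S (-s) (f s.toNNReal) with hI
  set k : (ℝ≥0 →ᵇ Z) → ℝ → Z := fun f z => S z (I f z - c f) with hk
  have hSc := h.continuous_flow
  have hint : ∀ (f : ℝ≥0 →ᵇ Z) (T : Z →L[ℝ] Z) (a b : ℝ), IntervalIntegrable
      (fun s : ℝ => S (-s) (T (f s.toNNReal))) MeasureTheory.volume a b :=
    fun f T a b => (h.continuous_integrand f T).intervalIntegrable _ _
  have hint' : ∀ (f : ℝ≥0 →ᵇ Z) (a b : ℝ), IntervalIntegrable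
      (fun s : ℝ => S (-s) (f s.toNNReal)) MeasureTheory.volume a b :=
    fun f a b => hint f (ContinuousLinearMap.id ℝ Z) a b
  have hId : ∀ f z, HasDerivAt (I f) (S (-z) (f z.toNNReal)) z := fun f z =>
    ((h.continuous_integrand f (ContinuousLinearMap.id ℝ Z)).integral_hasStrictDerivAt 0 z).hasDerivAt
  have hkd : ∀ f z, HasDerivAt (k f) (L (k f z) + f z.toNNReal) z := fun f z => by
    have := (h.flow_deriv z).clm_apply ((hId f z).sub_const (c f))
    rw [h.flow_neg] at this
    exact this
  have hPc : ∀ f, P (c f) = 0 := fun f => by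
    rw [hc, ← P.integral_comp_comm (h.integrableOn_unstable f le_rfl)]
    simp_rw [← hQ, hSQ, hPQ]
    simp
  have hPk : ∀ f z, 0 ≤ z → ‖P (k f z)‖ ≤ C / κ * ‖f‖ := by
    intro f z hz
    have e1 : P (k f z) = ∫ s in (0 : ℝ)..z, S (z - s) (P (f s.toNNReal)) := by
      simp only [hk]
      rw [← h.flow_proj, map_sub, hPc, sub_zero, hI,
        ← P.intervalIntegral_comp_comm (hint' f 0 z),
        ← (S z).intervalIntegral_comp_comm
          (by simp_rw [← h.flow_proj]; exact hint f P 0 z)]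
      refine intervalIntegral.integral_congr fun s _ => ?_
      simp only [← h.flow_proj]
      rw [← h.flow_add, sub_eq_add_neg]
    rw [e1]
    have hd : ∀ s, HasDerivAt (fun s => C * ‖f‖ / κ * Real.exp (-κ * (z - s)))
        (C * ‖f‖ * Real.exp (-κ * (z - s))) s := fun s => by
      have h1 : HasDerivAt (fun s : ℝ => -κ * (z - s)) κ s := by
        simpa using ((hasDerivAt_id s).const_sub z).const_mul (-κ)
      convert! (h1.exp).const_mul (C * ‖f‖ / κ) using 1
      have := h.rate_pos.ne'
      field_simp
    have hcont : Continuous fun s => C * ‖f‖ * Real.exp (-κ * (z - s)) := by fun_prop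
    have h2 := intervalIntegral.norm_integral_le_of_norm_le (a := 0) (b := z)
      (f := fun s : ℝ => S (z - s) (P (f s.toNNReal)))
      (g := fun s => C * ‖f‖ * Real.exp (-κ * (z - s))) (μ := MeasureTheory.volume) hz
      (Eventually.of_forall fun s hs => by
        refine (h.stable _ (sub_nonneg.2 hs.2) _).trans ?_
        have := h.C_nonneg
        calc _ ≤ C * Real.exp (-κ * (z - s)) * ‖f‖ := by gcongr; exact f.norm_coe_le_norm _
          _ = _ := by ring) (hcont.intervalIntegrable _ _)
    rw [intervalIntegral.integral_eq_sub_of_hasDerivAt (fun s _ => hd s)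
      (hcont.intervalIntegrable _ _)] at h2
    refine h2.trans ?_
    have h3 : 0 ≤ C * ‖f‖ / κ * Real.exp (-κ * (z - 0)) := by
      have := h.C_nonneg; have := h.rate_pos; positivity
    rw [sub_self, mul_zero, Real.exp_zero, mul_one]
    calc _ ≤ C * ‖f‖ / κ := by linarith
      _ = _ := by ring
  have hQk : ∀ f z, 0 ≤ z → ‖Q (k f z)‖ ≤ C / κ * ‖f‖ := by
    intro f z hz
    have e1 : Q (I f z - c f) = -∫ s in Ioi z, S (-s) (Q (f s.toNNReal)) := by
      have e2 : Q (c f) = c f := by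
        have := hQP (c f); rw [hPc, zero_add] at this; exact this.symm
      have e3 := intervalIntegral.integral_Ioi_sub_Ioi (a := 0) (b := z)
        (h.integrableOn_unstable f le_rfl) hz
      rw [map_sub, e2, hI, ← Q.intervalIntegral_comp_comm (hint' f 0 z)]
      simp_rw [← hSQ]
      rw [← hQ] at e3
      rw [← e3, hc]
      abel
    have e2 : Q (k f z) = -∫ s in Ioi z, S (z - s) (Q (f s.toNNReal)) := by
      simp only [hk]
      rw [← hSQ, e1, map_neg, ← (S z).integral_comp_comm (h.integrableOn_unstable f hz)]
      simp_rw [← h.flow_add, sub_eq_add_neg z, hQ]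
    rw [e2, norm_neg]
    have hint3 := ((integrableOn_exp_mul_Ioi (neg_lt_zero.2 h.rate_pos) z).const_mul
      (C * ‖f‖ * Real.exp (κ * z)))
    have h2 := MeasureTheory.norm_integral_le_of_norm_le hint3
      (f := fun s : ℝ => S (z - s) (Q (f s.toNNReal)))
      ((MeasureTheory.ae_restrict_iff' measurableSet_Ioi).2 (Eventually.of_forall fun s hs => by
        have h4 := h.unstable (s - z) (sub_nonneg.2 (le_of_lt hs)) (f s.toNNReal)
        rw [neg_sub] at h4
        refine h4.trans ?_
        have := h.C_nonneg
        calc _ ≤ C * Real.exp (-κ * (s - z)) * ‖f‖ := by gcongr; exact f.norm_coe_le_norm _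
          _ = _ := by
            rw [show -κ * (s - z) = κ * z + -κ * s by ring, Real.exp_add]; ring))
    refine h2.trans (le_of_eq ?_)
    rw [MeasureTheory.integral_const_mul, integral_exp_mul_Ioi (neg_lt_zero.2 h.rate_pos)]
    have := h.rate_pos.ne'
    have e5 : Real.exp (κ * z) * Real.exp (-(κ * z)) = 1 := by
      rw [← Real.exp_add]; simp
    rw [neg_mul]
    field_simp
    linear_combination (C * ‖f‖) * e5
  have hkb : ∀ f (z : ℝ≥0), ‖k f z‖ ≤ 2 * C / κ * ‖f‖ := fun f z => by
    rw [hQP (k f z)]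
    refine (norm_add_le _ _).trans ?_
    have h1 := hPk f z z.2
    have h2 := hQk f z z.2
    calc _ ≤ C / κ * ‖f‖ + C / κ * ‖f‖ := add_le_add h1 h2
      _ = _ := by ring
  have hkc : ∀ f, Continuous (k f) := fun f =>
    continuous_iff_continuousAt.2 fun z => (hkd f z).continuousAt
  have hIa : ∀ f g z, I (f + g) z = I f z + I g z := fun f g z => by
    simp only [hI]
    rw [← intervalIntegral.integral_add (hint' f 0 z) (hint' g 0 z)]
    simp
  have hca : ∀ f g, c (f + g) = c f + c g := fun f g => by
    simp only [hc]
    rw [← MeasureTheory.integral_add (h.integrableOn_unstable f le_rfl)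
      (h.integrableOn_unstable g le_rfl)]
    simp only [← hQ, BoundedContinuousFunction.coe_add, Pi.add_apply, map_add]
  have hIs : ∀ (r : ℝ) f z, I (r • f) z = r • I f z := fun r f z => by
    simp only [hI]
    rw [← intervalIntegral.integral_smul]
    simp
  have hcs : ∀ (r : ℝ) f, c (r • f) = r • c f := fun r f => by
    simp only [hc]
    rw [← MeasureTheory.integral_smul]
    simp
  refine ⟨LinearMap.mkContinuous
    { toFun := fun f => BoundedContinuousFunction.ofNormedAddCommGroup
        (fun z : ℝ≥0 => k f z) ((hkc f).comp NNReal.continuous_coe) (2 * C / κ * ‖f‖) (hkb f)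
      map_add' := fun f g => by
        ext z
        simp only [hk, hIa, hca, BoundedContinuousFunction.coe_ofNormedAddCommGroup,
          BoundedContinuousFunction.coe_add, Pi.add_apply, ← map_add]
        congr 1
        abel
      map_smul' := fun r f => by
        ext z
        simp [hk, hIs, hcs, ← smul_sub] } (2 * C / κ) (fun f =>
      (BoundedContinuousFunction.norm_le (by
        have := h.C_nonneg; have := h.rate_pos; positivity)).2 (hkb f)), fun f z hz => ?_, fun f => ?_⟩
  · have h1 : ∀ x ∈ Ici (0 : ℝ), k f (x.toNNReal : ℝ) = k f x := fun x hx => by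
      rw [Real.coe_toNNReal x hx]
    have h2 := ((hkd f z).hasDerivWithinAt (s := Ici 0)).congr h1 (h1 z hz)
    rw [← h1 z hz] at h2
    exact h2
  · change P (k f ((0 : ℝ≥0) : ℝ)) = 0
    simp [hk, hI, h.flow_zero, hPc]

theorem hasHalfLineDeriv_free {E : Z →L[ℝ] (ℝ≥0 →ᵇ Z)} (hE : ∀ a z, E a z = S z (P a)) (a : Z) :
    HasHalfLineDeriv (E a) (L.compLeftContinuousBounded ℝ≥0 (E a)) := by
  intro z hz
  have h1 : ∀ x ∈ Ici (0 : ℝ), E a x.toNNReal = S x (P a) := fun x hx => by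
    rw [hE, Real.coe_toNNReal x hx]
  have h2 := (((h.flow_deriv z).clm_apply (hasDerivAt_const z (P a))).hasDerivWithinAt
    (s := Ici 0)).congr h1 (h1 z hz)
  simpa [h1 z hz] using h2

/-- A bounded solution of the homogeneous equation without decaying part vanishes. -/
theorem eq_zero_of_bounded {d : ℝ≥0 →ᵇ Z}
    (hd : HasHalfLineDeriv d (L.compLeftContinuousBounded ℝ≥0 d)) (h0 : P (d 0) = 0) : d = 0 := by
  have hconst : ∀ z : ℝ, 0 ≤ z → S (-z) (d z.toNNReal) = d 0 := by
    intro z hz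
    have h1 : ∀ x ∈ Ici (0 : ℝ), HasDerivWithinAt (fun x : ℝ => S (-x) (d x.toNNReal)) 0 (Ici 0) x := by
      intro x hx
      have := ((h.hasDerivAt_flow_neg x).hasDerivWithinAt (s := Ici 0)).clm_apply (hd x hx)
      simpa [h.flow_comm] using this
    have h2 := (convex_Ici (0 : ℝ)).is_const_of_fderivWithin_eq_zero (𝕜 := ℝ)
      (fun x hx => (h1 x hx).differentiableWithinAt) (fun x hx => by
        have := (h1 x hx).hasFDerivWithinAt.fderivWithin (uniqueDiffOn_Ici 0 x hx)
        rw [this]; ext; simp) hz (show (0 : ℝ) ∈ Ici 0 from self_mem_Ici)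
    simpa [h.flow_zero] using h2
  have hd0 : d 0 = 0 := by
    have hle : ∀ z : ℝ, 0 ≤ z → ‖d 0‖ ≤ C * ‖d‖ * Real.exp (-κ * z) := by
      intro z hz
      have e : d 0 = S (-z) (d z.toNNReal - P (d z.toNNReal)) := by
        rw [map_sub, h.flow_proj, hconst z hz, h0, sub_zero]
      rw [e]
      refine (h.unstable z hz _).trans ?_
      have := h.C_nonneg
      calc _ ≤ C * Real.exp (-κ * z) * ‖d‖ := by gcongr; exact d.norm_coe_le_norm _
        _ = _ := by ring
    have hlim : Tendsto (fun z => C * ‖d‖ * Real.exp (-κ * z)) atTop (𝓝 0) := by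
      have : Tendsto (fun z => Real.exp (-κ * z)) atTop (𝓝 0) :=
        Real.tendsto_exp_atBot.comp
          (tendsto_id.const_mul_atTop_of_neg (neg_lt_zero.2 h.rate_pos))
      simpa using this.const_mul (C * ‖d‖)
    have := ge_of_tendsto hlim ((eventually_ge_atTop 0).mono hle)
    exact norm_le_zero_iff.1 this
  ext z
  have := congrArg (S z) (hconst z z.2)
  rw [h.flow_neg, hd0, map_zero, Real.toNNReal_coe] at this
  exact this

/-- Variation of constants for bounded solutions. -/
theorem eq_free_add_green {E K : _} (hE : ∀ a z, (E : Z →L[ℝ] (ℝ≥0 →ᵇ Z)) a z = S z (P a))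
    (hK : ∀ f, HasHalfLineDeriv ((K : (ℝ≥0 →ᵇ Z) →L[ℝ] (ℝ≥0 →ᵇ Z)) f)
      (L.compLeftContinuousBounded ℝ≥0 (K f) + f))
    (hK0 : ∀ f, P (K f 0) = 0) {u f : ℝ≥0 →ᵇ Z} :
    HasHalfLineDeriv u (L.compLeftContinuousBounded ℝ≥0 u + f) ↔ u = E (u 0) + K f := by
  constructor
  · intro hu
    have h1 : u - E (u 0) - K f = 0 := by
      refine h.eq_zero_of_bounded (fun z hz => ?_) ?_
      · have := ((hu z hz).sub (h.hasHalfLineDeriv_free hE (u 0) z hz)).sub (hK f z hz)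
        convert! this using 1
        simp only [map_sub, BoundedContinuousFunction.coe_sub, BoundedContinuousFunction.coe_add,
          Pi.sub_apply, Pi.add_apply]
        abel
      · have : E (u 0) 0 = P (u 0) := by rw [hE, NNReal.coe_zero, h.flow_zero]
        simp [this, h.proj, hK0]
    rw [sub_sub, sub_eq_zero] at h1
    exact h1
  · intro hu z hz
    rw [hu]
    have := (h.hasHalfLineDeriv_free hE (u 0) z hz).add (hK f z hz)
    convert! this using 1
    simp [add_assoc]

theorem proj_free {E : Z →L[ℝ] (ℝ≥0 →ᵇ Z)} (hE : ∀ a z, E a z = S z (P a)) (a : Z) :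
    E a 0 = P a := by
  rw [hE, NNReal.coe_zero, h.flow_zero]

end ExpDichotomy

end Dichotomy

theorem ContDiff.clm_map {X V W : Type*} [NormedAddCommGroup X] [NormedSpace ℝ X]
    [NormedAddCommGroup V] [NormedSpace ℝ V] [NormedAddCommGroup W] [NormedSpace ℝ W]
    {n : WithTop ℕ∞} {f : X → V} (hf : ContDiff ℝ n f) (L : V →L[ℝ] W) :
    ContDiff ℝ n (fun x => L (f x)) :=
  L.contDiff.comp hf

/-- Pointwise application to a fixed function. -/
noncomputable def pointwiseApplyAt {X V : Type*} (W : Type*) [TopologicalSpace X]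
    [NormedAddCommGroup V] [NormedSpace ℝ V] [NormedAddCommGroup W] [NormedSpace ℝ W]
    (u : X →ᵇ V) : (X →ᵇ (V →L[ℝ] W)) →L[ℝ] (X →ᵇ W) :=
  LinearMap.mkContinuous
    { toFun := fun g => pointwiseApply X V W g u
      map_add' := fun _ _ => by ext; simp
      map_smul' := fun _ _ => by ext; simp } ‖u‖
    (fun g => by rw [mul_comm]; exact norm_pointwiseApply_le g u)

@[simp] theorem pointwiseApplyAt_apply {X V W : Type*} [TopologicalSpace X]
    [NormedAddCommGroup V] [NormedSpace ℝ V] [NormedAddCommGroup W] [NormedSpace ℝ W]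
    (u : X →ᵇ V) (g : X →ᵇ (V →L[ℝ] W)) : pointwiseApplyAt W u g = pointwiseApply X V W g u := rfl

theorem HasFDerivAt.pointwiseApply {X V W Y : Type*} [TopologicalSpace X] [NormedAddCommGroup V]
    [NormedSpace ℝ V] [NormedAddCommGroup W] [NormedSpace ℝ W] [NormedAddCommGroup Y]
    [NormedSpace ℝ Y] {g : Y → (X →ᵇ (V →L[ℝ] W))} {g' : Y →L[ℝ] (X →ᵇ (V →L[ℝ] W))}
    {u : Y → (X →ᵇ V)} {u' : Y →L[ℝ] (X →ᵇ V)} {y : Y} (hg : HasFDerivAt g g' y)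
    (hu : HasFDerivAt u u' y) :
    HasFDerivAt (fun y => pointwiseApply X V W (g y) (u y))
      ((pointwiseApply X V W (g y)).comp u' + (pointwiseApplyAt W (u y)).comp g') y := by
  have h1 : HasFDerivAt (fun y => _root_.pointwiseApply X V W (g y))
      ((_root_.pointwiseApply X V W).comp g') y :=
    HasFDerivAt.comp (𝕜 := ℝ) (g := fun v => _root_.pointwiseApply X V W v) (f := g) y
      (ContinuousLinearMap.hasFDerivAt (𝕜 := ℝ) (E := X →ᵇ (V →L[ℝ] W)) (_root_.pointwiseApply X V W)) hg
  refine (h1.clm_apply hu).congr_fderiv ?_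
  ext; rfl

theorem continuousAt_norm_family {X V Y : Type*} [TopologicalSpace X] [NormedAddCommGroup V]
    [TopologicalSpace Y] {f : Y → (X →ᵇ V)} {y : Y} (hf : ContinuousAt f y) :
    ContinuousAt (fun y => ‖f y‖) y := hf.norm

section Weight

variable {V W : Type*} [NormedAddCommGroup V] [NormedSpace ℝ V] [NormedAddCommGroup W]
  [NormedSpace ℝ W]

theorem norm_exp_smul_le (θ : ℝ≥0) (u : ℝ≥0 →ᵇ V) (z : ℝ≥0) :
    ‖Real.exp (-θ * z) • u z‖ ≤ ‖u‖ := by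
  rw [norm_smul, Real.norm_of_nonneg (Real.exp_pos _).le]
  calc _ ≤ 1 * ‖u‖ := by
        gcongr
        · exact Real.exp_le_one_iff.2 (by
            have : (0 : ℝ) ≤ θ * z := by positivity
            linarith)
        · exact u.norm_coe_le_norm z
    _ = ‖u‖ := one_mul _

/-- Multiplication by `e^{-θ z}`. -/
noncomputable def weightL (θ : ℝ≥0) (V : Type*) [NormedAddCommGroup V] [NormedSpace ℝ V] :
    (ℝ≥0 →ᵇ V) →L[ℝ] (ℝ≥0 →ᵇ V) :=
  LinearMap.mkContinuous
    { toFun := fun u => BoundedContinuousFunction.ofNormedAddCommGroup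
        (fun z : ℝ≥0 => Real.exp (-θ * z) • u z) (by fun_prop) ‖u‖ (norm_exp_smul_le θ u)
      map_add' := fun _ _ => by ext; simp
      map_smul' := fun c u => by ext z; simp [smul_comm c] } 1
    (fun u => by
      rw [one_mul]
      exact (BoundedContinuousFunction.norm_le (norm_nonneg u)).2 (norm_exp_smul_le θ u))

@[simp] theorem weightL_apply (θ : ℝ≥0) (u : ℝ≥0 →ᵇ V) (z : ℝ≥0) :
    weightL θ V u z = Real.exp (-θ * z) • u z := rfl

theorem norm_weightL_le (θ : ℝ≥0) (u : ℝ≥0 →ᵇ V) : ‖weightL θ V u‖ ≤ ‖u‖ :=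
  (BoundedContinuousFunction.norm_le (norm_nonneg u)).2 (norm_exp_smul_le θ u)

theorem pointwiseApply_weightL (θ : ℝ≥0) (g : ℝ≥0 →ᵇ (V →L[ℝ] W)) (u : ℝ≥0 →ᵇ V) :
    pointwiseApply ℝ≥0 V W g (weightL θ V u) = weightL θ W (pointwiseApply ℝ≥0 V W g u) := by
  ext z; simp

theorem hasHalfLineDeriv_weightL (θ : ℝ≥0) {u v : ℝ≥0 →ᵇ V} :
    HasHalfLineDeriv (weightL θ V u) (weightL θ V v) ↔
      HasHalfLineDeriv u ((θ : ℝ) • u + v) := by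
  have he : ∀ (c z : ℝ), HasDerivAt (fun z : ℝ => Real.exp (c * z)) (Real.exp (c * z) * c) z :=
    fun c z => by simpa using ((hasDerivAt_id z).const_mul c).exp
  constructor
  · intro h z hz
    have h1 := ((he θ z).hasDerivWithinAt (s := Ici 0)).smul (h z hz)
    have e : ∀ x ∈ Ici (0 : ℝ), u x.toNNReal =
        Real.exp (θ * x) • weightL θ V u x.toNNReal := fun x hx => by
      rw [weightL_apply, smul_smul, ← Real.exp_add, Real.coe_toNNReal x hx]; simp
    have h2 := h1.congr e (e z hz)
    convert! h2 using 1
    simp only [weightL_apply, smul_smul, BoundedContinuousFunction.coe_add, Pi.add_apply,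
      BoundedContinuousFunction.coe_smul, mul_right_comm _ (θ : ℝ), ← Real.exp_add,
      Real.coe_toNNReal z hz]
    simp [add_comm]
  · intro h z hz
    have h1 := ((he (-θ) z).hasDerivWithinAt (s := Ici 0)).smul (h z hz)
    have e : ∀ x ∈ Ici (0 : ℝ), weightL θ V u x.toNNReal =
        Real.exp (-θ * x) • u x.toNNReal := fun x hx => by
      rw [weightL_apply, Real.coe_toNNReal x hx]
    have h2 := h1.congr e (e z hz)
    convert! h2 using 1
    simp only [weightL_apply, BoundedContinuousFunction.coe_add, Pi.add_apply,
      BoundedContinuousFunction.coe_smul, Real.coe_toNNReal z hz, smul_add, smul_smul, mul_neg,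
      neg_smul]
    abel

end Weight

section StableFamily

variable {Λ Z : Type} [NormedAddCommGroup Λ] [NormedSpace ℝ Λ] [FiniteDimensional ℝ Λ]
  [NormedAddCommGroup Z] [NormedSpace ℝ Z] [FiniteDimensional ℝ Z]

/-- The coefficient `M(μ, x)` along the function `x`. -/
noncomputable def coeffAlong {Λ Z W : Type} [NormedAddCommGroup Λ] [NormedSpace ℝ Λ]
    [FiniteDimensional ℝ Λ] [NormedAddCommGroup Z] [NormedSpace ℝ Z] [FiniteDimensional ℝ Z]
    [NormedAddCommGroup W] [NormedSpace ℝ W]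
    (M : C(Λ × Z, W)) (μ : Λ) (x : ℝ≥0 →ᵇ Z) : ℝ≥0 →ᵇ W :=
  superposition M (pairL ℝ≥0 Λ Z (constL ℝ≥0 Λ μ, x))

@[simp] theorem coeffAlong_apply {W : Type} [NormedAddCommGroup W] [NormedSpace ℝ W]
    (M : C(Λ × Z, W)) (μ : Λ) (x : ℝ≥0 →ᵇ Z) (z : ℝ≥0) : coeffAlong M μ x z = M (μ, x z) := by
  simp [coeffAlong]

theorem continuous_coeffAlong {W : Type} [NormedAddCommGroup W] [NormedSpace ℝ W]
    (M : C(Λ × Z, W)) : Continuous (fun p : Λ × (ℝ≥0 →ᵇ Z) => coeffAlong M p.1 p.2) :=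
  (continuous_superposition M).comp ((pairL ℝ≥0 Λ Z).continuous.comp
    (((constL ℝ≥0 Λ).continuous.comp continuous_fst).prodMk continuous_snd))

theorem contDiff_coeffAlong {W : Type} [NormedAddCommGroup W] [NormedSpace ℝ W]
    (M : C(Λ × Z, W)) (hM : ContDiff ℝ ∞ M) :
    ContDiff ℝ ∞ (fun p : Λ × (ℝ≥0 →ᵇ Z) => coeffAlong M p.1 p.2) := by
  refine (contDiff_superposition M hM).comp ?_
  exact (pairL ℝ≥0 Λ Z).contDiff.comp
    (((constL ℝ≥0 Λ).contDiff.comp contDiff_fst).prodMk contDiff_snd)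

/-- The right-hand side of the linearization of `x' = M(μ, x) x`. -/
noncomputable def linRHS (M : C(Λ × Z, Z →L[ℝ] Z))
    (DM : C(Λ × Z, Λ × Z →L[ℝ] Z →L[ℝ] Z)) (μ : Λ) (x : ℝ≥0 →ᵇ Z) (ν : Λ) (v : ℝ≥0 →ᵇ Z) :
    ℝ≥0 →ᵇ Z :=
  pointwiseApply ℝ≥0 Z Z (coeffAlong M μ x) v +
    pointwiseApply ℝ≥0 Z Z (pointwiseApply ℝ≥0 (Λ × Z) (Z →L[ℝ] Z) (coeffAlong DM μ x)
      (pairL ℝ≥0 Λ Z (constL ℝ≥0 Λ ν, v))) x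

set_option maxHeartbeats 800000 in
/-- Stable manifold theorem with parameters for `x' = M(μ, x) x`, in a space of functions
decaying like `e^{-θ z}`. -/
theorem exists_stable_family {M : C(Λ × Z, Z →L[ℝ] Z)} (hM : ContDiff ℝ ∞ M)
    {DM : C(Λ × Z, Λ × Z →L[ℝ] Z →L[ℝ] Z)} (hDM : ∀ v, HasFDerivAt M (DM v) v)
    {μ₀ : Λ} {θ : ℝ≥0} {P : Z →L[ℝ] Z} {S : ℝ → Z →L[ℝ] Z} {C κ : ℝ}
    (h : ExpDichotomy (M (μ₀, 0) + (θ : ℝ) • ContinuousLinearMap.id ℝ Z) P S C κ) :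
    ∃ (U : Set (Λ × Z)) (Φ : Λ × Z → (ℝ≥0 →ᵇ Z)) (η : ℝ), IsOpen U ∧ (μ₀, 0) ∈ U ∧ 0 < η ∧
      ContDiffOn ℝ ∞ Φ U ∧ Φ (μ₀, 0) = 0 ∧
      (∀ y ∈ U, P (Φ y 0) = P y.2 ∧ HasHalfLineDeriv (weightL θ Z (Φ y))
        (pointwiseApply ℝ≥0 Z Z (coeffAlong M y.1 (weightL θ Z (Φ y))) (weightL θ Z (Φ y)))) ∧
      (∀ μ a X, ‖μ - μ₀‖ < η → ‖a‖ < η → ‖X‖ < η → P a = P (X 0) →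
        HasHalfLineDeriv (weightL θ Z X)
          (pointwiseApply ℝ≥0 Z Z (coeffAlong M μ (weightL θ Z X)) (weightL θ Z X)) →
        (μ, a) ∈ U ∧ Φ (μ, a) = X) ∧
      (∀ y ∈ U, ∀ k : Λ × Z, P (fderiv ℝ Φ y k 0) = P k.2 ∧
        HasHalfLineDeriv (weightL θ Z (fderiv ℝ Φ y k))
          (linRHS M DM y.1 (weightL θ Z (Φ y)) k.1 (weightL θ Z (fderiv ℝ Φ y k)))) ∧
      (∀ y ∈ U, ∀ a X, P a = P (X 0) → HasHalfLineDeriv (weightL θ Z X)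
        (linRHS M DM y.1 (weightL θ Z (Φ y)) 0 (weightL θ Z X)) → X = fderiv ℝ Φ y (0, a)) := by
  set A := M (μ₀, 0) with hA
  obtain ⟨E, hE⟩ := h.exists_free
  obtain ⟨K, hK, hK0⟩ := h.exists_green
  obtain ⟨g, hg⟩ : ∃ g : Λ → (ℝ≥0 →ᵇ Z) → (ℝ≥0 →ᵇ (Z →L[ℝ] Z)), ∀ μ X, g μ X =
    coeffAlong M μ (weightL θ Z X) - constL ℝ≥0 (Z →L[ℝ] Z) A := ⟨_, fun _ _ => rfl⟩
  have hweight : ∀ (T : ℝ≥0 →ᵇ (Z →L[ℝ] Z)) (X R : ℝ≥0 →ᵇ Z),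
      HasHalfLineDeriv (weightL θ Z X) (pointwiseApply ℝ≥0 Z Z T (weightL θ Z X) + weightL θ Z R) ↔
      X = E (X 0) + K (pointwiseApply ℝ≥0 Z Z (T - constL ℝ≥0 (Z →L[ℝ] Z) A) X + R) := by
    intro T X R
    rw [← h.eq_free_add_green hE hK hK0, pointwiseApply_weightL, ← map_add,
      hasHalfLineDeriv_weightL]
    have : (θ : ℝ) • X + (pointwiseApply ℝ≥0 Z Z T X + R) =
        (A + (θ : ℝ) • ContinuousLinearMap.id ℝ Z).compLeftContinuousBounded ℝ≥0 X +
        (pointwiseApply ℝ≥0 Z Z (T - constL ℝ≥0 (Z →L[ℝ] Z) A) X + R) := by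
      ext z
      simp only [BoundedContinuousFunction.coe_add, Pi.add_apply,
        BoundedContinuousFunction.coe_smul, pointwiseApply_apply,
        ContinuousLinearMap.compLeftContinuousBounded_apply, BoundedContinuousFunction.coe_sub,
        Pi.sub_apply, constL_apply, _root_.add_apply, _root_.smul_apply, _root_.sub_apply,
        ContinuousLinearMap.id_apply]
      abel
    rw [this]
  have hsolve : ∀ μ X, HasHalfLineDeriv (weightL θ Z X)
        (pointwiseApply ℝ≥0 Z Z (coeffAlong M μ (weightL θ Z X)) (weightL θ Z X)) ↔
      X = E (X 0) + K (pointwiseApply ℝ≥0 Z Z (g μ X) X) := fun μ X => by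
    have := hweight (coeffAlong M μ (weightL θ Z X)) X 0
    rwa [map_zero, add_zero, add_zero, ← hg] at this
  have hgc : ContDiff ℝ ∞ (fun p : Λ × (ℝ≥0 →ᵇ Z) => g p.1 p.2) := by
    simp only [hg]
    exact ((contDiff_coeffAlong M hM).comp
      (contDiff_fst.prodMk ((weightL θ Z).contDiff.comp contDiff_snd))).sub contDiff_const
  have hg0 : g μ₀ 0 = 0 := by ext; simp [hg, hA]
  set f : (Λ × Z) × (ℝ≥0 →ᵇ Z) → (ℝ≥0 →ᵇ Z) := fun p =>
    p.2 - E p.1.2 - K (pointwiseApply ℝ≥0 Z Z (g p.1.1 p.2) p.2) with hf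
  have hfc : ContDiff ℝ ∞ f := by
    have h0 : ContDiff ℝ ∞ (fun p : (Λ × Z) × (ℝ≥0 →ᵇ Z) => (p.1.1, p.2)) :=
      contDiff_fst.fst.prodMk contDiff_snd
    have h1 : ContDiff ℝ ∞ (fun p : (Λ × Z) × (ℝ≥0 →ᵇ Z) => g p.1.1 p.2) :=
      ContDiff.comp (g := fun p : Λ × (ℝ≥0 →ᵇ Z) => g p.1 p.2) hgc h0
    have h2 : ContDiff ℝ ∞ (fun p : (Λ × Z) × (ℝ≥0 →ᵇ Z) => pointwiseApply ℝ≥0 Z Z (g p.1.1 p.2)) :=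
      h1.clm_map (pointwiseApply ℝ≥0 Z Z)
    have h3 := (h2.clm_apply contDiff_snd).clm_map K
    have h4 : ContDiff ℝ ∞ (fun p : (Λ × Z) × (ℝ≥0 →ᵇ Z) => E p.1.2) := contDiff_fst.snd.clm_map E
    exact (contDiff_snd.sub h4).sub h3
  have hf' : fderiv ℝ f ((μ₀, 0), 0) ∘L ContinuousLinearMap.inr ℝ (Λ × Z) (ℝ≥0 →ᵇ Z) =
      ContinuousLinearMap.id ℝ _ := by
    have h1 : HasFDerivAt (fun X => f ((μ₀, 0), X))
        (fderiv ℝ f ((μ₀, 0), 0) ∘L ContinuousLinearMap.inr ℝ (Λ × Z) (ℝ≥0 →ᵇ Z)) 0 :=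
      ((hfc.differentiable (by simp)) _).hasFDerivAt.comp (0 : ℝ≥0 →ᵇ Z)
        (hasFDerivAt_prodMk_right (𝕜 := ℝ) (μ₀, (0 : Z)) (0 : ℝ≥0 →ᵇ Z))
    have h2 : HasFDerivAt (fun X => g μ₀ X) (fderiv ℝ (fun X => g μ₀ X) 0) 0 :=
      (((hgc.comp (contDiff_const.prodMk contDiff_id)).differentiable (by simp)) 0).hasFDerivAt
    have h3 := h2.pointwiseApply (hasFDerivAt_id (𝕜 := ℝ) (0 : ℝ≥0 →ᵇ Z))
    have h4 := ((hasFDerivAt_id (0 : ℝ≥0 →ᵇ Z)).sub_const (E 0)).sub (K.hasFDerivAt.comp 0 h3)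
    refine h1.unique (h4.congr_fderiv ?_)
    ext X z
    simp [hg0]
  obtain ⟨Φ, U, V, hU, hV, hu1, hu2, -, hΦ0, hΦ, hΦV, hiff⟩ :=
    exists_implicitFunction_contDiffOn isOpen_univ hfc.contDiffOn (mem_univ ((μ₀, 0), 0))
      (by rw [hf']; exact ⟨ContinuousLinearEquiv.refl ℝ _, rfl⟩)
  have hfu : f ((μ₀, 0), 0) = 0 := by simp [hf]
  simp only [hfu] at hiff
  have hfix : ∀ y ∈ U, Φ y = E y.2 + K (pointwiseApply ℝ≥0 Z Z (g y.1 (Φ y)) (Φ y)) := by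
    intro y hy
    have := (hiff y hy _ (hΦV y hy)).2 rfl
    rw [hf] at this
    simp only [sub_sub, sub_eq_zero] at this
    exact this
  have hEP : ∀ a, E (P a) = E a := fun a => by ext z; simp [hE, h.proj]
  have hP : ∀ y ∈ U, P (Φ y 0) = P y.2 := by
    intro y hy
    conv_lhs => rw [hfix y hy]
    simp [h.proj_free hE, hK0, h.proj]
  have hsol : ∀ y ∈ U, HasHalfLineDeriv (weightL θ Z (Φ y))
      (pointwiseApply ℝ≥0 Z Z (coeffAlong M y.1 (weightL θ Z (Φ y))) (weightL θ Z (Φ y))) := by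
    intro y hy
    rw [hsolve, ← hEP, hP y hy, hEP]
    exact hfix y hy
  have hDMc : Continuous fun p : Λ × (ℝ≥0 →ᵇ Z) =>
      coeffAlong (W := Λ × Z →L[ℝ] Z →L[ℝ] Z) DM p.1 p.2 :=
    continuous_coeffAlong (W := Λ × Z →L[ℝ] Z →L[ℝ] Z) DM
  have hΦat : ∀ y ∈ U, DifferentiableAt ℝ Φ y := fun y hy =>
    (hΦ.contDiffAt (hU.mem_nhds hy)).differentiableAt (by simp)
  have hm : ∀ᶠ y in 𝓝 (μ₀, (0 : Z)), ‖K‖ * (‖g y.1 (Φ y)‖ +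
      ‖coeffAlong (W := Λ × Z →L[ℝ] Z →L[ℝ] Z) DM y.1 (weightL θ Z (Φ y))‖ * ‖Φ y‖) < 1 := by
    have hc0 : ContinuousAt (fun y : Λ × Z => (y.1, Φ y)) (μ₀, 0) :=
      continuousAt_fst.prodMk (hΦat _ hu1).continuousAt
    have hc1 : ContinuousAt (fun y => g y.1 (Φ y)) (μ₀, 0) :=
      ContinuousAt.comp (f := fun y : Λ × Z => (y.1, Φ y)) hgc.continuous.continuousAt hc0
    have hc2 : ContinuousAt (fun y : Λ × Z => coeffAlong (W := Λ × Z →L[ℝ] Z →L[ℝ] Z) DM y.1 (weightL θ Z (Φ y))) (μ₀, 0) :=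
      ContinuousAt.comp (g := fun p : Λ × (ℝ≥0 →ᵇ Z) =>
        coeffAlong (W := Λ × Z →L[ℝ] Z →L[ℝ] Z) DM p.1 (weightL θ Z p.2))
        (f := fun y : Λ × Z => (y.1, Φ y))
        (hDMc.comp (continuous_fst.prodMk ((weightL θ Z).continuous.comp continuous_snd))).continuousAt
        hc0
    have := continuousAt_const (y := ‖K‖) |>.mul
      ((continuousAt_norm_family hc1).add ((continuousAt_norm_family hc2).mul
        (continuousAt_norm_family (hΦat _ hu1).continuousAt)))
    refine this.eventually_lt continuousAt_const ?_
    have e : Φ (μ₀, 0) = 0 := hΦ0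
    simp [e, hg0]
  obtain ⟨U', hU', hU'o, hu'⟩ := eventually_nhds_iff.1 hm
  have hDlin : ∀ y ∈ U, ∀ k : Λ × Z, HasHalfLineDeriv (weightL θ Z (fderiv ℝ Φ y k))
      (linRHS M DM y.1 (weightL θ Z (Φ y)) k.1 (weightL θ Z (fderiv ℝ Φ y k))) := by
    intro y hy k
    have d1 : HasFDerivAt (fun y => weightL θ Z (Φ y)) ((weightL θ Z).comp (fderiv ℝ Φ y)) y :=
      (weightL θ Z).hasFDerivAt.comp y (hΦat y hy).hasFDerivAt
    have d2 : HasFDerivAt (fun y : Λ × Z => coeffAlong M y.1 (weightL θ Z (Φ y)))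
        ((pointwiseApply ℝ≥0 (Λ × Z) (Z →L[ℝ] Z) (coeffAlong DM y.1 (weightL θ Z (Φ y)))).comp
        ((pairL ℝ≥0 Λ Z).comp (((constL ℝ≥0 Λ).comp (ContinuousLinearMap.fst ℝ Λ Z)).prod
          ((weightL θ Z).comp (fderiv ℝ Φ y))))) y :=
      (hasFDerivAt_superposition (f' := DM) hDM _).comp y ((pairL ℝ≥0 Λ Z).hasFDerivAt.comp y
        (((constL ℝ≥0 Λ).hasFDerivAt.comp y hasFDerivAt_fst).prodMk d1))
    have d3 := d2.pointwiseApply d1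
    have := HasHalfLineDeriv.fderiv_family hU hsol hy d1.differentiableAt d3.differentiableAt k
    rw [d1.fderiv, d3.fderiv] at this
    convert! this using 1
  have hDP : ∀ y ∈ U, ∀ k : Λ × Z, P (fderiv ℝ Φ y k 0) = P k.2 := by
    intro y hy k
    have d0 : HasFDerivAt (fun y => Φ y 0)
        ((BoundedContinuousFunction.evalCLM ℝ (0 : ℝ≥0)).comp (fderiv ℝ Φ y)) y :=
      (BoundedContinuousFunction.evalCLM (β := Z) ℝ (0 : ℝ≥0)).hasFDerivAt.comp y
        (hΦat y hy).hasFDerivAt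
    have d1 : HasFDerivAt (fun y => P (Φ y 0))
        (P.comp ((BoundedContinuousFunction.evalCLM ℝ (0 : ℝ≥0)).comp (fderiv ℝ Φ y))) y :=
      P.hasFDerivAt.comp y d0
    have d2 : HasFDerivAt (fun y : Λ × Z => P y.2) (P.comp (ContinuousLinearMap.snd ℝ Λ Z)) y :=
      P.hasFDerivAt.comp y hasFDerivAt_snd
    have e : (fun y => P (Φ y 0)) =ᶠ[𝓝 y] fun y : Λ × Z => P y.2 := by
      filter_upwards [hU.mem_nhds hy] with y' hy' using hP y' hy'
    exact DFunLike.congr_fun ((d1.congr_of_eventuallyEq e.symm).unique d2) k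
  have hUU : U ∩ U' ∈ 𝓝 (μ₀, (0 : Z)) := (hU.inter hU'o).mem_nhds ⟨hu1, hu'⟩
  obtain ⟨r, hr, hrU⟩ := Metric.mem_nhds_iff.1 hUU
  obtain ⟨s, hs, hsV⟩ := Metric.mem_nhds_iff.1 (hV.mem_nhds hu2)
  refine ⟨U ∩ U', Φ, min r s, hU.inter hU'o, ⟨hu1, hu'⟩, lt_min hr hs, hΦ.mono inter_subset_left,
    hΦ0, fun y hy => ⟨hP y hy.1, hsol y hy.1⟩, ?_, fun y hy k => ⟨hDP y hy.1 k, hDlin y hy.1 k⟩, ?_⟩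
  · intro μ a X hμ ha hX haX hsolX
    have hmem : (μ, a) ∈ U ∩ U' := by
      refine hrU ?_
      rw [Metric.mem_ball, Prod.dist_eq, max_lt_iff, dist_eq_norm, dist_zero_right]
      exact ⟨hμ.trans_le (min_le_left _ _),
        ha.trans_le (min_le_left _ _)⟩
    refine ⟨hmem, (hiff _ hmem.1 X (hsV ?_)).1 ?_⟩
    · rw [Metric.mem_ball, dist_zero_right]
      exact hX.trans_le (min_le_right _ _)
    · rw [hf]
      simp only [sub_sub, sub_eq_zero]
      rw [← hEP a, haX, hEP]
      exact (hsolve μ X).1 hsolX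
  · intro y hy a X haX hX
    set D := X - fderiv ℝ Φ y (0, a) with hD
    set T := coeffAlong (W := Λ × Z →L[ℝ] Z →L[ℝ] Z) DM y.1 (weightL θ Z (Φ y)) with hT
    set J : (ℝ≥0 →ᵇ Z) → (ℝ≥0 →ᵇ Z) := fun v => pointwiseApply ℝ≥0 Z Z
      (pointwiseApply ℝ≥0 (Λ × Z) (Z →L[ℝ] Z) T
        (pairL ℝ≥0 Λ Z (constL ℝ≥0 Λ 0, weightL θ Z v))) (Φ y) with hJ
    have hDsol : HasHalfLineDeriv (weightL θ Z D)
        (pointwiseApply ℝ≥0 Z Z (coeffAlong M y.1 (weightL θ Z (Φ y))) (weightL θ Z D) +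
          weightL θ Z (J D)) := by
      intro z hz
      have := (hX z hz).sub (hDlin y hy.1 (0, a) z hz)
      convert! this using 1
      · ext x; simp [hD]
      · simp only [hD, hJ, linRHS, map_sub, BoundedContinuousFunction.coe_add, Pi.add_apply,
          BoundedContinuousFunction.coe_sub, Pi.sub_apply, pointwiseApply_apply, coeffAlong_apply,
          weightL_apply, pairL_apply, constL_apply, map_smul, ← hT]
        have h0 : ∀ u v : Z, ((0 : Λ), u - v) = (0, u) - (0, v) := by simp
        simp only [h0, map_sub, _root_.sub_apply, smul_sub]
        abel
    rw [hweight, ← hg] at hDsol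
    have hPD : P (D 0) = 0 := by
      rw [hD, BoundedContinuousFunction.coe_sub, Pi.sub_apply, map_sub, hDP y hy.1, haX, sub_self]
    rw [← hEP, hPD, map_zero, zero_add] at hDsol
    have hJn : ‖J D‖ ≤ ‖T‖ * ‖Φ y‖ * ‖D‖ := by
      have e1 : ‖pairL ℝ≥0 Λ Z (constL ℝ≥0 Λ 0, weightL θ Z D)‖ ≤ ‖D‖ := by
        refine (BoundedContinuousFunction.norm_le (norm_nonneg D)).2 fun z => ?_
        rw [pairL_apply, Prod.norm_def]
        refine max_le (by simp) (((weightL θ Z D).norm_coe_le_norm z).trans (norm_weightL_le θ D))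
      calc ‖J D‖ ≤ ‖T‖ * ‖pairL ℝ≥0 Λ Z (constL ℝ≥0 Λ 0, weightL θ Z D)‖ * ‖Φ y‖ :=
            (norm_pointwiseApply_le _ _).trans (by gcongr; exact norm_pointwiseApply_le _ _)
        _ ≤ ‖T‖ * ‖D‖ * ‖Φ y‖ := by gcongr
        _ = _ := by ring
    have hle : ‖D‖ ≤ ‖K‖ * (‖g y.1 (Φ y)‖ + ‖T‖ * ‖Φ y‖) * ‖D‖ := by
      conv_lhs => rw [hDsol]
      refine (K.le_opNorm _).trans ?_
      rw [mul_assoc]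
      gcongr
      refine (norm_add_le _ _).trans ?_
      rw [add_mul]
      exact add_le_add (norm_pointwiseApply_le _ _) hJn
    have hD0 : D = 0 := by
      by_contra hne
      have hpos : 0 < ‖D‖ := norm_pos_iff.2 hne
      have := hU' y hy.2
      nlinarith
    exact sub_eq_zero.1 hD0

end StableFamily

theorem contDiffOn_fderiv_eval_family {Y V : Type} [NormedAddCommGroup V] [NormedSpace ℝ V]
    [FiniteDimensional ℝ V] [NormedAddCommGroup Y] [NormedSpace ℝ Y] [FiniteDimensional ℝ Y]
    {U : Set Y} (hU : IsOpen U) {Ξ g : Y → (ℝ≥0 →ᵇ V)} (hg : ∀ y ∈ U, HasHalfLineDeriv (Ξ y) (g y))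
    (hΞ : ∀ y ∈ U, DifferentiableAt ℝ Ξ y) (hgd : ∀ y ∈ U, DifferentiableAt ℝ g y)
    (hjoint : ContDiffOn ℝ ∞ (fun p : ℝ × Y => Ξ p.2 p.1.toNNReal) (Ici 0 ×ˢ U))
    {y : Y} (hy : y ∈ U) (k : Y) :
    ContDiffOn ℝ ∞ (fun z : ℝ => fderiv ℝ Ξ y k z.toNNReal) (Ici 0) := by
  have hud : UniqueDiffOn ℝ (Ici (0 : ℝ) ×ˢ U) := (uniqueDiffOn_Ici 0).prod hU.uniqueDiffOn
  have h1 := hjoint.fderivWithin hud (m := ∞) (by simp)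
  have h2 : ContDiffOn ℝ ∞ (fun z : ℝ => fderivWithin ℝ
      (fun p : ℝ × Y => Ξ p.2 p.1.toNNReal) (Ici 0 ×ˢ U) (z, y) (0, k)) (Ici 0) :=
    (h1.comp (contDiffOn_id.prodMk contDiffOn_const)
      (fun z hz => ⟨hz, hy⟩)).clm_apply contDiffOn_const
  refine h2.congr fun z hz => ?_
  rw [(hasFDerivWithinAt_eval_family hU hg hy (hΞ y hy) (hgd y hy) hz).fderivWithin
    (hud _ ⟨hz, hy⟩)]
  simp

/-- A function tending to zero whose derivative decays exponentially decays exponentially. -/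
theorem norm_le_of_deriv_exp_decay {V : Type*} [NormedAddCommGroup V] [NormedSpace ℝ V]
    {x x' : ℝ → V} {c θ : ℝ} (hθ : 0 < θ)
    (hx : ∀ z ∈ Ici (0 : ℝ), HasDerivWithinAt x (x' z) (Ici 0) z)
    (hb : ∀ z ∈ Ici (0 : ℝ), ‖x' z‖ ≤ c * Real.exp (-θ * z)) (hlim : Tendsto x atTop (𝓝 0))
    {z : ℝ} (hz : 0 ≤ z) : ‖x z‖ ≤ c / θ * Real.exp (-θ * z) := by
  have he : ∀ t, HasDerivAt (fun t => c / θ * (Real.exp (-θ * z) - Real.exp (-θ * t)))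
      (c * Real.exp (-θ * t)) t := fun t => by
    have h1 : HasDerivAt (fun t : ℝ => Real.exp (-θ * t)) (Real.exp (-θ * t) * -θ) t := by
      simpa using ((hasDerivAt_id t).const_mul (-θ)).exp
    convert! (h1.const_sub (Real.exp (-θ * z))).const_mul (c / θ) using 1
    field_simp
  have key : ∀ y, z ≤ y → ‖x y - x z‖ ≤ c / θ * Real.exp (-θ * z) - c / θ * Real.exp (-θ * y) := by
    intro y hy
    have := image_norm_le_of_norm_deriv_right_le_deriv_boundary (a := z) (b := y)
      (f := fun t => x t - x z) (f' := x')
      (B := fun t => c / θ * (Real.exp (-θ * z) - Real.exp (-θ * t)))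
      (B' := fun t => c * Real.exp (-θ * t))
      (fun t ht => (((hx t (hz.trans ht.1)).continuousWithinAt.mono
        (fun s hs => hz.trans hs.1)).sub continuousWithinAt_const))
      (fun t ht => ((hx t (hz.trans ht.1)).mono (fun s hs =>
        (hz.trans ht.1).trans hs)).sub_const _)
      (by simp) he (fun t ht => hb t (hz.trans ht.1)) (right_mem_Icc.2 hy)
    simpa [mul_sub] using this
  have h1 : Tendsto (fun y => ‖x y - x z‖) atTop (𝓝 ‖0 - x z‖) :=
    (hlim.sub tendsto_const_nhds).norm
  have h2 : Tendsto (fun y => c / θ * Real.exp (-θ * z) - c / θ * Real.exp (-θ * y)) atTop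
      (𝓝 (c / θ * Real.exp (-θ * z) - c / θ * 0)) := by
    refine tendsto_const_nhds.sub (Tendsto.const_mul _ ?_)
    exact Real.tendsto_exp_atBot.comp (tendsto_id.const_mul_atTop_of_neg (neg_lt_zero.2 hθ))
  have := le_of_tendsto_of_tendsto h1 h2 ((eventually_ge_atTop z).mono key)
  simpa using this

/-- Bounded functions on the half-line as elements of the Banach space. -/
theorem exists_boundedContinuous {V : Type*} [NormedAddCommGroup V] {x : ℝ → V} {c : ℝ}
    (hx : ContinuousOn x (Ici 0)) (hb : ∀ z ∈ Ici (0 : ℝ), ‖x z‖ ≤ c) :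
    ∃ u : ℝ≥0 →ᵇ V, (∀ z : ℝ≥0, u z = x z) ∧ ‖u‖ ≤ c := by
  have hc : Continuous fun z : ℝ≥0 => x z :=
    continuousOn_iff_continuous_domRestrict.1 hx |>.comp
      (NNReal.continuous_coe.subtype_mk fun z => z.2)
  have h0 : 0 ≤ c := (norm_nonneg _).trans (hb 0 self_mem_Ici)
  exact ⟨BoundedContinuousFunction.ofNormedAddCommGroup _ hc c fun z => hb z z.2, fun z => rfl,
    (BoundedContinuousFunction.norm_le h0).2 fun z => hb z z.2⟩

theorem HasHalfLineDeriv.of_real {V : Type*} [NormedAddCommGroup V] [NormedSpace ℝ V]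
    {x x' : ℝ → V} {u v : ℝ≥0 →ᵇ V} (hx : ∀ z ∈ Ici (0 : ℝ), HasDerivWithinAt x (x' z) (Ici 0) z)
    (hu : ∀ z : ℝ≥0, u z = x z) (hv : ∀ z : ℝ≥0, v z = x' z) : HasHalfLineDeriv u v := by
  intro z hz
  rw [hv, Real.coe_toNNReal z hz]
  refine (hx z hz).congr (fun y hy => ?_) ?_
  · rw [hu, Real.coe_toNNReal y hy]
  · rw [hu, Real.coe_toNNReal z hz]

section Regularity

variable {F : Type*} [NormedAddCommGroup F] [NormedSpace ℝ F] [FiniteDimensional ℝ F]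

theorem ExpDichotomy.free_proj {L P : F →L[ℝ] F} {S : ℝ → F →L[ℝ] F} {C κ : ℝ}
    (h : ExpDichotomy L P S C κ) {E : F →L[ℝ] (ℝ≥0 →ᵇ F)} (hE : ∀ a z, E a z = S z (P a)) (a : F) :
    E (P a) = E a := by
  ext z; rw [hE, hE, h.proj]

theorem exists_fixed_point_half {V : Type*} [NormedAddCommGroup V] [NormedSpace ℝ V]
    [CompleteSpace V] (T : V →L[ℝ] V) (hT : ‖T‖ ≤ 1 / 2) (b : V) :
    ∃ u, u = b + T u ∧ ‖u‖ ≤ 2 * ‖b‖ := by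
  have hc : ContractingWith (1 / 2 : ℝ≥0) (fun u => b + T u) := by
    refine ⟨by norm_num, LipschitzWith.of_dist_le_mul fun u v => ?_⟩
    rw [dist_eq_norm, dist_eq_norm, add_sub_add_left_eq_sub, ← map_sub]
    refine (T.le_opNorm _).trans ?_
    gcongr
    simpa using hT
  refine ⟨hc.fixedPoint _, hc.fixedPoint_isFixedPt.symm, ?_⟩
  set u := hc.fixedPoint _
  have hu : u = b + T u := hc.fixedPoint_isFixedPt.symm
  have : ‖u‖ ≤ ‖b‖ + 1 / 2 * ‖u‖ := by
    conv_lhs => rw [hu]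
    refine (norm_add_le _ _).trans ?_
    gcongr
    exact (T.le_opNorm u).trans (by gcongr)
  linarith

/-- Bounded solutions of a small perturbation of a hyperbolic equation decay exponentially. -/
theorem ExpDichotomy.exists_decay {L P : F →L[ℝ] F} {S : ℝ → F →L[ℝ] F} {C κ : ℝ}
    (h : ExpDichotomy L P S C κ) {θ : ℝ≥0} (hθ : θ < κ) :
    ∃ γ > 0, ∃ C' > 0, ∀ (g : ℝ≥0 →ᵇ (F →L[ℝ] F)) (f u : ℝ≥0 →ᵇ F), ‖g‖ ≤ γ →
      HasHalfLineDeriv u (L.compLeftContinuousBounded ℝ≥0 u +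
        (pointwiseApply ℝ≥0 F F g u + weightL θ F f)) →
      ∃ v, u = weightL θ F v ∧ ‖v‖ ≤ C' * (‖u 0‖ + ‖f‖) := by
  have h' := h.shift θ.2 hθ
  obtain ⟨E₀, hE₀⟩ := h.exists_free
  obtain ⟨K₀, hK₀, hK₀0⟩ := h.exists_green
  obtain ⟨E, hE⟩ := h'.exists_free
  obtain ⟨K, hK, hK0⟩ := h'.exists_green
  refine ⟨1 / (2 * (‖K₀‖ + ‖K‖ + 1)), by positivity, 2 * (‖E‖ + ‖K‖ + 1), by positivity,
    fun g f u hg hu => ?_⟩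
  have hg' : (‖K₀‖ + ‖K‖ + 1) * ‖g‖ ≤ 1 / 2 := by
    rw [le_div_iff₀ (by positivity)] at hg
    linarith
  have hKg : ‖K‖ * ‖g‖ ≤ 1 / 2 := by nlinarith [norm_nonneg K₀, norm_nonneg g]
  have hK₀g : ‖K₀‖ * ‖g‖ ≤ 1 / 2 := by nlinarith [norm_nonneg K, norm_nonneg g]
  obtain ⟨v, hv, hvb⟩ := exists_fixed_point_half (K.comp (pointwiseApply ℝ≥0 F F g))
    ((ContinuousLinearMap.opNorm_le_bound _ (by positivity) fun w => by
      rw [mul_assoc]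
      exact (K.le_opNorm _).trans (by gcongr; exact norm_pointwiseApply_le g w)).trans hKg)
    (E (u 0) + K f)
  refine ⟨v, ?_, ?_⟩
  · have hv' : v = E (u 0) + K (pointwiseApply ℝ≥0 F F g v + f) := by
      conv_lhs => rw [hv]
      rw [map_add, add_assoc, add_comm (K f)]
      rfl
    have hPv : P (v 0) = P (u 0) := by
      conv_lhs => rw [hv']
      rw [BoundedContinuousFunction.coe_add, Pi.add_apply, map_add, hK0, h'.proj_free hE, h.proj,
        add_zero]
    have hvs : HasHalfLineDeriv v ((L + (θ : ℝ) • ContinuousLinearMap.id ℝ F).compLeftContinuousBounded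
        ℝ≥0 v + (pointwiseApply ℝ≥0 F F g v + f)) := by
      refine (h'.eq_free_add_green hE hK hK0).2 ?_
      rw [← h'.free_proj hE, hPv, h'.free_proj hE]
      exact hv'
    have hws : HasHalfLineDeriv (weightL θ F v)
        (weightL θ F (L.compLeftContinuousBounded ℝ≥0 v + (pointwiseApply ℝ≥0 F F g v + f))) := by
      rw [hasHalfLineDeriv_weightL]
      convert! hvs using 1
      ext z
      simp
      abel
    set d := u - weightL θ F v with hd
    have hds : HasHalfLineDeriv d (L.compLeftContinuousBounded ℝ≥0 d + pointwiseApply ℝ≥0 F F g d) := by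
      intro z hz
      have := (hu z hz).sub (hws z hz)
      convert! this using 1
      simp only [hd, map_sub, map_add, BoundedContinuousFunction.coe_add, Pi.add_apply,
        BoundedContinuousFunction.coe_sub, Pi.sub_apply, pointwiseApply_apply, weightL_apply,
        ContinuousLinearMap.compLeftContinuousBounded_apply, map_smul]
      abel
    rw [h.eq_free_add_green hE₀ hK₀ hK₀0, ← h.free_proj hE₀] at hds
    have hPd : P (d 0) = 0 := by simp [hd, hPv]
    rw [hPd, map_zero, zero_add] at hds
    have : ‖d‖ ≤ 1 / 2 * ‖d‖ := by
      conv_lhs => rw [hds]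
      calc _ ≤ ‖K₀‖ * (‖g‖ * ‖d‖) :=
            (K₀.le_opNorm _).trans (by gcongr; exact norm_pointwiseApply_le g d)
        _ = ‖K₀‖ * ‖g‖ * ‖d‖ := by ring
        _ ≤ _ := by gcongr
    have hd0 : d = 0 := norm_le_zero_iff.1 (by linarith [norm_nonneg d])
    exact sub_eq_zero.1 hd0
  · refine hvb.trans ?_
    have h1 : ‖E (u 0) + K f‖ ≤ ‖E‖ * ‖u 0‖ + ‖K‖ * ‖f‖ :=
      (norm_add_le _ _).trans (add_le_add (E.le_opNorm _) (K.le_opNorm _))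
    nlinarith [norm_nonneg E, norm_nonneg K, norm_nonneg f, norm_nonneg (u 0),
      mul_nonneg (norm_nonneg E) (norm_nonneg f), mul_nonneg (norm_nonneg K) (norm_nonneg (u 0))]

end Regularity

section FirstOrder

variable {E F : Type} [NormedAddCommGroup E] [NormedSpace ℝ E] [FiniteDimensional ℝ E]
  [NormedAddCommGroup F] [NormedSpace ℝ F] [FiniteDimensional ℝ F]

/-- The operator `(x, y) ↦ (H y, G y)` of the first-order profile system. -/
noncomputable def profileOp (H : F →L[ℝ] E) (G : F →L[ℝ] F) : E × F →L[ℝ] E × F :=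
  (H.prod G).comp (ContinuousLinearMap.snd ℝ E F)

@[simp] theorem profileOp_apply (H : F →L[ℝ] E) (G : F →L[ℝ] F) (x : E × F) :
    profileOp H G x = (H x.2, G x.2) := rfl

/-- Dichotomy of the weighted profile system. -/
theorem ExpDichotomy.profile {G P Gi : F →L[ℝ] F} {S : ℝ → F →L[ℝ] F} {C θ : ℝ}
    (h : ExpDichotomy G P S C (2 * θ)) (H : F →L[ℝ] E) (hGi : ∀ x, Gi (G x) = x)
    (hGi' : ∀ x, G (Gi x) = x) :
    ExpDichotomy (profileOp H G + θ • ContinuousLinearMap.id ℝ (E × F))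
      (((H.comp (Gi.comp P)).prod P).comp (ContinuousLinearMap.snd ℝ E F))
      (fun t => Real.exp (θ * t) • ((ContinuousLinearMap.fst ℝ E F +
        (H.comp (Gi.comp (S t - ContinuousLinearMap.id ℝ F))).comp (ContinuousLinearMap.snd ℝ E F)).prod
        ((S t).comp (ContinuousLinearMap.snd ℝ E F))))
      ((1 + ‖H.comp Gi‖) * (1 + C)) θ := by
  have hθ : 0 < θ := by linarith [h.rate_pos]
  have hb : ∀ x, ‖H (Gi x)‖ ≤ ‖H.comp Gi‖ * ‖x‖ := fun x => (H.comp Gi).le_opNorm x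
  have hC := h.C_nonneg
  have hcomm : ∀ t x, S t (Gi x) = Gi (S t x) := fun t x => by
    rw [← hGi (S t (Gi x)), ← h.flow_comm, hGi']
  refine
  { rate_pos := hθ
    C_nonneg := by positivity
    proj := fun x => by simp [h.proj]
    flow_zero := fun x => by simp [h.flow_zero]
    flow_add := fun s t x => ?_
    flow_deriv := fun t => ?_
    flow_comm := fun t x => ?_
    flow_proj := fun t x => ?_
    stable := fun t ht x => ?_
    unstable := fun t ht x => ?_ }
  · change Real.exp (θ * (s + t)) • (x.1 + H (Gi (S (s + t) x.2 - x.2)), S (s + t) x.2) =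
      Real.exp (θ * s) • (Real.exp (θ * t) • (x.1 + H (Gi (S t x.2 - x.2))) +
        H (Gi (S s (Real.exp (θ * t) • S t x.2) - Real.exp (θ * t) • S t x.2)),
        S s (Real.exp (θ * t) • S t x.2))
    rw [h.flow_add, mul_add, Real.exp_add]
    refine Prod.ext ?_ ?_
    · simp only [Prod.smul_mk, map_smul, map_sub, smul_add, smul_sub, smul_smul]
      abel
    · simp only [Prod.smul_mk, map_smul, smul_smul]
  · have h1 : HasDerivAt (fun t : ℝ => Real.exp (θ * t)) (Real.exp (θ * t) * θ) t := by
      simpa using ((hasDerivAt_id t).const_mul θ).exp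
    have h2 : HasDerivAt (fun t => ContinuousLinearMap.inl ℝ E F ∘L (ContinuousLinearMap.fst ℝ E F) +
        (ContinuousLinearMap.inl ℝ E F ∘L H ∘L Gi) ∘L ((S t - ContinuousLinearMap.id ℝ F) ∘L
          ContinuousLinearMap.snd ℝ E F) +
        ContinuousLinearMap.inr ℝ E F ∘L (S t ∘L ContinuousLinearMap.snd ℝ E F))
        ((ContinuousLinearMap.inl ℝ E F ∘L H ∘L Gi) ∘L ((G ∘L S t) ∘L
          ContinuousLinearMap.snd ℝ E F) +
        ContinuousLinearMap.inr ℝ E F ∘L ((G ∘L S t) ∘L ContinuousLinearMap.snd ℝ E F)) t := by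
      have d1 := (((h.flow_deriv t).sub_const (ContinuousLinearMap.id ℝ F)).clm_comp
        (hasDerivAt_const t (ContinuousLinearMap.snd ℝ E F)))
      have d2 := (hasDerivAt_const t (ContinuousLinearMap.inl ℝ E F ∘L H ∘L Gi)).clm_comp d1
      have d3 := (hasDerivAt_const t (ContinuousLinearMap.inr ℝ E F)).clm_comp
        ((h.flow_deriv t).clm_comp (hasDerivAt_const t (ContinuousLinearMap.snd ℝ E F)))
      have d4 := (d2.const_add (ContinuousLinearMap.inl ℝ E F ∘L (ContinuousLinearMap.fst ℝ E F))).add d3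
      convert! d4 using 1
      simp
    have h3 := h1.smul h2
    convert! h3 using 1
    · ext t : 1
      change _ = Real.exp (θ * t) • (_ : E × F →L[ℝ] E × F)
      congr 1
      ext x <;> simp
    · ext x <;> simp [hGi, smul_smul, mul_comm, ← map_sub]
  · refine Prod.ext ?_ ?_
    · simp [h.flow_comm, hGi, smul_smul, mul_comm]
      module
    · simp [h.flow_comm, smul_smul, mul_comm]
  · refine Prod.ext ?_ ?_
    · simp [h.flow_proj]
    · simp [h.flow_proj]
  · rw [_root_.smul_apply, norm_smul, Real.norm_of_nonneg (Real.exp_pos _).le]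
    change Real.exp (θ * t) * ‖(H (Gi (P x.2)) + H (Gi (S t (P x.2) - P x.2)), S t (P x.2))‖ ≤ _
    have e1 : H (Gi (P x.2)) + H (Gi (S t (P x.2) - P x.2)) = H (Gi (S t (P x.2))) := by simp
    have h2 : ‖S t (P x.2)‖ ≤ C * Real.exp (-(2 * θ) * t) * ‖x‖ :=
      (h.stable t ht _).trans (by gcongr; exact norm_snd_le x)
    have h3 : ‖(H (Gi (S t (P x.2))), S t (P x.2))‖ ≤ (1 + ‖H.comp Gi‖) * ‖S t (P x.2)‖ := by
      rw [Prod.norm_def]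
      refine max_le ((hb _).trans ?_) ?_ <;> nlinarith [norm_nonneg (H.comp Gi), norm_nonneg (S t (P x.2))]
    rw [e1]
    calc _ ≤ Real.exp (θ * t) * ((1 + ‖H.comp Gi‖) * (C * Real.exp (-(2 * θ) * t) * ‖x‖)) := by
          gcongr; exact h3.trans (by gcongr)
      _ = (1 + ‖H.comp Gi‖) * C * Real.exp (-θ * t) * ‖x‖ := by
          rw [show -θ * t = θ * t + -(2 * θ) * t by ring, Real.exp_add]; ring
      _ ≤ _ := by gcongr; linarith
  · rw [_root_.smul_apply, norm_smul, Real.norm_of_nonneg (Real.exp_pos _).le]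
    change Real.exp (θ * -t) * ‖((x.1 - H (Gi (P x.2))) + H (Gi (S (-t) (x.2 - P x.2) - (x.2 - P x.2))),
      S (-t) (x.2 - P x.2))‖ ≤ _
    have e1 : (x.1 - H (Gi (P x.2))) + H (Gi (S (-t) (x.2 - P x.2) - (x.2 - P x.2))) =
        x.1 - H (Gi x.2) + H (Gi (S (-t) (x.2 - P x.2))) := by
      simp only [map_sub]; abel
    have h2 : ‖S (-t) (x.2 - P x.2)‖ ≤ C * ‖x‖ := by
      refine (h.unstable t ht _).trans ?_
      have : Real.exp (-(2 * θ) * t) ≤ 1 := Real.exp_le_one_iff.2 (by nlinarith)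
      calc _ ≤ C * 1 * ‖x‖ := by gcongr; exact norm_snd_le x
        _ = _ := by ring
    have h3 : ‖(x.1 - H (Gi x.2) + H (Gi (S (-t) (x.2 - P x.2))), S (-t) (x.2 - P x.2))‖ ≤
        (1 + ‖H.comp Gi‖) * (1 + C) * ‖x‖ := by
      rw [Prod.norm_def]
      refine max_le ?_ ?_
      · calc _ ≤ ‖x.1‖ + ‖H (Gi x.2)‖ + ‖H (Gi (S (-t) (x.2 - P x.2)))‖ :=
              (norm_add_le _ _).trans (by gcongr; exact norm_sub_le _ _)
          _ ≤ ‖x‖ + ‖H.comp Gi‖ * ‖x‖ + ‖H.comp Gi‖ * (C * ‖x‖) := by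
              gcongr
              · exact norm_fst_le x
              · exact (hb _).trans (by gcongr; exact norm_snd_le x)
              · exact (hb _).trans (by gcongr)
          _ ≤ _ := by nlinarith [norm_nonneg x, mul_nonneg hC (norm_nonneg x)]
      · calc _ ≤ C * ‖x‖ := h2
          _ ≤ 1 * (1 + C) * ‖x‖ := by nlinarith [norm_nonneg x]
          _ ≤ _ := by gcongr; linarith [norm_nonneg (H.comp Gi)]
    rw [e1, show θ * -t = -θ * t by ring]
    calc _ ≤ Real.exp (-θ * t) * ((1 + ‖H.comp Gi‖) * (1 + C) * ‖x‖) := by gcongr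
      _ = _ := by ring

end FirstOrder

theorem exists_bound_of_tendsto {V : Type*} [NormedAddCommGroup V] {x : ℝ → V} {l : V}
    (hx : ContinuousOn x (Ici 0)) (hl : Tendsto x atTop (𝓝 l)) :
    ∃ c, ∀ z ∈ Ici (0 : ℝ), ‖x z‖ ≤ c := by
  obtain ⟨N, hN⟩ := eventually_atTop.1 (hl.norm.eventually_le_const (lt_add_one ‖l‖))
  obtain ⟨c, hc⟩ := isCompact_Icc.exists_bound_of_continuousOn
    (hx.mono (Icc_subset_Ici_self : Icc 0 N ⊆ Ici 0))
  refine ⟨max c (‖l‖ + 1), fun z hz => ?_⟩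
  rcases le_total z N with h | h
  · exact (hc z ⟨hz, h⟩).trans (le_max_left _ _)
  · exact (hN z h).trans (le_max_right _ _)

theorem ExpDichotomy.exists_decay_real {F : Type*} [NormedAddCommGroup F] [NormedSpace ℝ F]
    [FiniteDimensional ℝ F] {L P : F →L[ℝ] F} {S : ℝ → F →L[ℝ] F} {C κ : ℝ}
    (h : ExpDichotomy L P S C κ) {θ : ℝ≥0} (hθ : θ < κ) :
    ∃ γ > 0, ∃ C' > 0, ∀ (g : ℝ → F →L[ℝ] F) (f y : ℝ → F) (c : ℝ), ContinuousOn g (Ici 0) →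
      (∀ z ∈ Ici (0 : ℝ), ‖g z‖ ≤ γ) → ContinuousOn f (Ici 0) →
      (∀ z ∈ Ici (0 : ℝ), ‖f z‖ ≤ c * Real.exp (-θ * z)) →
      (∀ z ∈ Ici (0 : ℝ), HasDerivWithinAt y (L (y z) + (g z (y z) + f z)) (Ici 0) z) →
      (∃ b, ∀ z ∈ Ici (0 : ℝ), ‖y z‖ ≤ b) →
      ∀ z ∈ Ici (0 : ℝ), ‖y z‖ ≤ C' * (‖y 0‖ + c) * Real.exp (-θ * z) := by
  obtain ⟨γ, hγ, C', hC', H⟩ := h.exists_decay hθ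
  refine ⟨γ, hγ, C', hC', fun g f y c hgc hg hfc hf hy hb z hz => ?_⟩
  obtain ⟨b, hb⟩ := hb
  obtain ⟨g', hg', hg'n⟩ := exists_boundedContinuous hgc hg
  obtain ⟨f', hf', hf'n⟩ := exists_boundedContinuous (x := fun z => Real.exp (θ * z) • f z)
    (c := c) (ContinuousOn.smul (by fun_prop) hfc) (fun z hz => by
      rw [norm_smul, Real.norm_of_nonneg (Real.exp_pos _).le]
      calc _ ≤ Real.exp (θ * z) * (c * Real.exp (-θ * z)) := by gcongr; exact hf z hz
        _ = c * Real.exp (θ * z + -θ * z) := by rw [Real.exp_add]; ring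
        _ = c := by simp)
  obtain ⟨y', hy', -⟩ := exists_boundedContinuous
    (fun z hz => (hy z hz).continuousWithinAt) hb
  obtain ⟨v, hv, hvb⟩ := H g' f' y' hg'n (HasHalfLineDeriv.of_real hy hy' fun z => by
    simp [hy', hg', hf', smul_smul, ← Real.exp_add])
  have h1 := hy' z.toNNReal
  rw [hv, weightL_apply, Real.coe_toNNReal z hz] at h1
  have h0 : y' 0 = y 0 := by simpa using hy' 0
  rw [← h1, norm_smul, Real.norm_of_nonneg (Real.exp_pos _).le, mul_comm, ← h0]
  refine mul_le_mul_of_nonneg_right ?_ (Real.exp_pos _).le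
  refine (v.norm_coe_le_norm _).trans (hvb.trans ?_)
  gcongr

section ProfileFamily

variable {Λ E F : Type} [NormedAddCommGroup Λ] [NormedSpace ℝ Λ] [FiniteDimensional ℝ Λ]
  [NormedAddCommGroup E] [NormedSpace ℝ E] [FiniteDimensional ℝ E]
  [NormedAddCommGroup F] [NormedSpace ℝ F] [FiniteDimensional ℝ F]

/-- The right-hand side of the system `w' = H(l,w) y`, `y' = G(l,w) y`. -/
def profileField (H : Λ × E → F →L[ℝ] E) (G : Λ × E → F →L[ℝ] F) (l : Λ) (x : E × F) : E × F :=
  (H (l, x.1) x.2, G (l, x.1) x.2)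

/-- A smooth family `X (l, q, a)` of solutions of `w' = H(l,w) y`, `y' = G(l,w) y` with `w → q`,
`y → 0`, parametrized by the limit `q` and by the stable part `a` of `y(0)`, which exhausts the
solutions near the constant solution `(p₀, 0)`. -/
structure IsStableProfileFamily (H : Λ × E → F →L[ℝ] E) (G : Λ × E → F →L[ℝ] F) (P : F →L[ℝ] F)
    (l₀ : Λ) (p₀ : E) (U : Set (Λ × E × F)) (X : Λ × E × F → ℝ → E × F) (η θ : ℝ)
    (m : Λ × E × F → ℝ) : Prop where
  isOpen : IsOpen U
  mem : (l₀, p₀, 0) ∈ U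
  radius_pos : 0 < η
  rate_pos : 0 < θ
  smooth : ContDiffOn ℝ ∞ (fun a : ℝ × (Λ × E × F) => X a.2 a.1) (Ici 0 ×ˢ U)
  ode : ∀ y ∈ U, ∀ z ∈ Ici (0 : ℝ),
    HasDerivWithinAt (X y) (profileField H G y.1 (X y z)) (Ici 0) z
  decay : ∀ y ∈ U, ∀ z ∈ Ici (0 : ℝ), ‖X y z - (y.2.1, 0)‖ ≤ m y * Real.exp (-θ * z)
  continuousOn : ContinuousOn m U
  bound_const : ∀ l q, (l, q, 0) ∈ U → m (l, q, 0) = 0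
  proj : ∀ y ∈ U, P (X y 0).2 = P y.2.2
  const : ∀ l q, (l, q, 0) ∈ U → ∀ z ∈ Ici (0 : ℝ), X (l, q, 0) z = (q, 0)
  unique : ∀ l q a (x : ℝ → E × F), ‖l - l₀‖ < η → ‖a‖ < η →
    (∀ z ∈ Ici (0 : ℝ), ‖x z - (p₀, 0)‖ < η) →
    (∀ z ∈ Ici (0 : ℝ), HasDerivWithinAt x (profileField H G l (x z)) (Ici 0) z) →
    Tendsto (fun z => (x z).1) atTop (𝓝 q) → P a = P (x 0).2 →
    (l, q, a) ∈ U ∧ ∀ z ∈ Ici (0 : ℝ), X (l, q, a) z = x z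
  lin : ∀ y ∈ U, ∀ (q : E) (a : F),
    ContDiffOn ℝ ∞ (fun z => fderiv ℝ (fun y => X y z) y (0, q, a)) (Ici 0) ∧
    (∀ z ∈ Ici (0 : ℝ), HasDerivWithinAt (fun z => fderiv ℝ (fun y => X y z) y (0, q, a))
      (fderiv ℝ (profileField H G y.1) (X y z) (fderiv ℝ (fun y => X y z) y (0, q, a)))
      (Ici 0) z) ∧
    Tendsto (fun z => fderiv ℝ (fun y => X y z) y (0, q, a)) atTop (𝓝 (q, 0)) ∧
    P (fderiv ℝ (fun y => X y 0) y (0, q, a)).2 = P a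
  lin_unique : ∀ y ∈ U, ∀ (v : ℝ → E × F) (a : F),
    (∀ z ∈ Ici (0 : ℝ), HasDerivWithinAt v
      (fderiv ℝ (profileField H G y.1) (X y z) (v z)) (Ici 0) z) →
    Tendsto (fun z => (v z).1) atTop (𝓝 0) → (∃ c, ∀ z ∈ Ici (0 : ℝ), ‖(v z).2‖ ≤ c) →
    P a = P (v 0).2 →
    ∀ z ∈ Ici (0 : ℝ), v z = fderiv ℝ (fun y => X y z) y (0, 0, a)

theorem profileField_hasFDerivAt {H : Λ × E → F →L[ℝ] E} {G : Λ × E → F →L[ℝ] F}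
    (hH : ContDiff ℝ ∞ H) (hG : ContDiff ℝ ∞ G) (l : Λ) (x v : E × F) :
    fderiv ℝ (profileField H G l) x v =
      (H (l, x.1) v.2 + fderiv ℝ H (l, x.1) (0, v.1) x.2,
        G (l, x.1) v.2 + fderiv ℝ G (l, x.1) (0, v.1) x.2) := by
  have hl : HasFDerivAt (fun x : E × F => (l, x.1))
      ((ContinuousLinearMap.inr ℝ Λ E).comp (ContinuousLinearMap.fst ℝ E F)) x := by
    convert! (hasFDerivAt_const l x).prodMk (hasFDerivAt_fst (𝕜 := ℝ) (p := x)) using 1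
  have h1 := ((hH.differentiable (by simp) (l, x.1)).hasFDerivAt.comp x hl).clm_apply
    (hasFDerivAt_snd (𝕜 := ℝ) (p := x))
  have h2 := ((hG.differentiable (by simp) (l, x.1)).hasFDerivAt.comp x hl).clm_apply
    (hasFDerivAt_snd (𝕜 := ℝ) (p := x))
  have h3 : HasFDerivAt (profileField H G l) _ x := h1.prodMk h2
  rw [h3.fderiv]
  simp

theorem contDiff_profileField {H : Λ × E → F →L[ℝ] E} {G : Λ × E → F →L[ℝ] F}
    (hH : ContDiff ℝ ∞ H) (hG : ContDiff ℝ ∞ G) :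
    ContDiff ℝ ∞ (fun p : Λ × (E × F) => profileField H G p.1 p.2) := by
  have h : ContDiff ℝ ∞ (fun p : Λ × (E × F) => (p.1, p.2.1)) :=
    contDiff_fst.prodMk (contDiff_fst.comp contDiff_snd)
  exact ((hH.comp h).clm_apply (contDiff_snd.comp contDiff_snd)).prodMk
    ((hG.comp h).clm_apply (contDiff_snd.comp contDiff_snd))

/-- The coefficient of the profile system centered at the limit `q`. -/
noncomputable def centeredOp (H : Λ × E → F →L[ℝ] E) (G : Λ × E → F →L[ℝ] F)
    (p : (Λ × E) × (E × F)) : E × F →L[ℝ] E × F :=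
  profileOp (H (p.1.1, p.1.2 + p.2.1)) (G (p.1.1, p.1.2 + p.2.1))

theorem centeredOp_apply (H : Λ × E → F →L[ℝ] E) (G : Λ × E → F →L[ℝ] F)
    (l : Λ) (q : E) (x : E × F) :
    centeredOp H G ((l, q), x) x = profileField H G l ((q, 0) + x) := by
  simp [centeredOp, profileField]

theorem contDiff_centeredOp {H : Λ × E → F →L[ℝ] E} {G : Λ × E → F →L[ℝ] F}
    (hH : ContDiff ℝ ∞ H) (hG : ContDiff ℝ ∞ G) : ContDiff ℝ ∞ (centeredOp H G) := by
  have h : ContDiff ℝ ∞ (fun p : (Λ × E) × (E × F) => (p.1.1, p.1.2 + p.2.1)) :=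
    (contDiff_fst.comp contDiff_fst).prodMk
      ((contDiff_snd.comp contDiff_fst).add (contDiff_fst.comp contDiff_snd))
  have h1 : ContDiff ℝ ∞ (fun p : (Λ × E) × (E × F) => (ContinuousLinearMap.inl ℝ E F).comp
      ((H (p.1.1, p.1.2 + p.2.1)).comp (ContinuousLinearMap.snd ℝ E F)) +
      (ContinuousLinearMap.inr ℝ E F).comp
      ((G (p.1.1, p.1.2 + p.2.1)).comp (ContinuousLinearMap.snd ℝ E F))) :=
    (contDiff_const.clm_comp ((hH.comp h).clm_comp contDiff_const)).add
      (contDiff_const.clm_comp ((hG.comp h).clm_comp contDiff_const))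
  convert! h1 using 1
  ext p x <;> simp [centeredOp]

theorem centeredOp_fderiv {H : Λ × E → F →L[ℝ] E} {G : Λ × E → F →L[ℝ] F}
    (hH : ContDiff ℝ ∞ H) (hG : ContDiff ℝ ∞ G) (l : Λ) (q q' : E) (x v : E × F) :
    centeredOp H G ((l, q), x) v + fderiv ℝ (centeredOp H G) ((l, q), x) ((0, q'), v) x =
      fderiv ℝ (profileField H G l) ((q, 0) + x) ((q', 0) + v) := by
  have h0 : HasFDerivAt (fun p : E × (E × F) => ((l, p.1), p.2))
      (((ContinuousLinearMap.inr ℝ Λ E).comp (ContinuousLinearMap.fst ℝ E (E × F))).prod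
        (ContinuousLinearMap.snd ℝ E (E × F))) (q, x) :=
    (HasFDerivAt.congr_fderiv ((hasFDerivAt_const l (q, x)).prodMk
      (hasFDerivAt_fst (𝕜 := ℝ) (p := (q, x)))) (by ext <;> simp)).prodMk
      (hasFDerivAt_snd (𝕜 := ℝ) (p := (q, x)))
  have h1 := (((contDiff_centeredOp hH hG).differentiable (by simp) _).hasFDerivAt.comp (q, x)
    h0).clm_apply (hasFDerivAt_snd (𝕜 := ℝ) (p := (q, x)))
  have h2 : HasFDerivAt (fun p : E × (E × F) => (p.1, (0 : F)) + p.2)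
      ((ContinuousLinearMap.inl ℝ E F).comp (ContinuousLinearMap.fst ℝ E (E × F)) +
        ContinuousLinearMap.snd ℝ E (E × F)) (q, x) :=
    (HasFDerivAt.congr_fderiv ((hasFDerivAt_fst (𝕜 := ℝ) (p := (q, x))).prodMk
      (hasFDerivAt_const (0 : F) (q, x))) (by ext <;> simp)).add
      (hasFDerivAt_snd (𝕜 := ℝ) (p := (q, x)))
  have hf : Differentiable ℝ (profileField H G l) := by
    have := (contDiff_profileField hH hG).comp
      ((contDiff_const (c := l)).prodMk (contDiff_id (E := E × F)))
    exact this.differentiable (by simp)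
  have h3 := (hf ((q, 0) + x)).hasFDerivAt.comp (q, x) h2
  have h4 : (fun p : E × (E × F) => centeredOp H G ((l, p.1), p.2) p.2) =
      profileField H G l ∘ fun p : E × (E × F) => (p.1, (0 : F)) + p.2 := by
    ext1 p; exact centeredOp_apply H G l p.1 p.2
  have h5 := h1.unique (h4 ▸ h3)
  have := congrArg (fun T => T (q', v)) h5
  simpa using this

set_option maxHeartbeats 2000000 in
theorem exists_stableProfileFamily {H : Λ × E → F →L[ℝ] E} {G : Λ × E → F →L[ℝ] F}
    (hH : ContDiff ℝ ∞ H) (hG : ContDiff ℝ ∞ G) {l₀ : Λ} {p₀ : E} {P Gi : F →L[ℝ] F}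
    {S : ℝ → F →L[ℝ] F} {C κ : ℝ} (h : ExpDichotomy (G (l₀, p₀)) P S C κ)
    (hGi : ∀ x, Gi (G (l₀, p₀) x) = x) (hGi' : ∀ x, G (l₀, p₀) (Gi x) = x) :
    ∃ U X η θ m, IsStableProfileFamily H G P l₀ p₀ U X η θ m := by
  obtain ⟨θ, hθκ, hθ⟩ : ∃ θ : ℝ≥0, κ = 2 * θ ∧ 0 < (θ : ℝ) :=
    ⟨(κ / 2).toNNReal, by rw [Real.coe_toNNReal _ (by linarith [h.rate_pos])]; ring, by
      rw [Real.coe_toNNReal _ (by linarith [h.rate_pos])]; linarith [h.rate_pos]⟩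
  subst hθκ
  have hMc := contDiff_centeredOp hH hG
  have hbase : centeredOp H G ((l₀, p₀), 0) = profileOp (H (l₀, p₀)) (G (l₀, p₀)) := by
    simp [centeredOp]
  have hdich := h.profile (H (l₀, p₀)) hGi hGi'
  rw [← hbase] at hdich
  obtain ⟨U, Φ, η, hU, hbU, hη, hΦ, hΦ0, hsol, huni, hder, hlin⟩ :=
    exists_stable_family (M := ⟨_, hMc.continuous⟩)
      (DM := ⟨_, hMc.continuous_fderiv (by simp)⟩) hMc
      (fun v => (hMc.differentiable (by simp) v).hasFDerivAt) hdich
  set PZ := ((((H (l₀, p₀)).comp (Gi.comp P)).prod P).comp (ContinuousLinearMap.snd ℝ E F)) with hPZ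
  have hPZeq : ∀ x y : E × F, PZ x = PZ y ↔ P x.2 = P y.2 := fun x y =>
    ⟨fun e => congrArg Prod.snd e, fun e => by simp [hPZ, e]⟩
  obtain ⟨γ, hγ, C', hC', hdec⟩ := h.exists_decay_real (θ := θ) (by linarith)
  obtain ⟨ρ, hρ, hρGH⟩ : ∃ ρ > 0, ∀ x, ‖x - (l₀, p₀)‖ < ρ →
      ‖G x - G (l₀, p₀)‖ ≤ γ ∧ ‖H x‖ ≤ ‖H (l₀, p₀)‖ + 1 := by
    have h1 : ∀ᶠ x in 𝓝 (l₀, p₀), ‖G x - G (l₀, p₀)‖ < γ ∧ ‖H x‖ < ‖H (l₀, p₀)‖ + 1 := by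
      refine Filter.Eventually.and ?_ ?_
      · have : Tendsto (fun x => ‖G x - G (l₀, p₀)‖) (𝓝 (l₀, p₀)) (𝓝 0) := by
          simpa using (hG.continuous.sub (continuous_const (y := G (l₀, p₀)))).norm.tendsto (l₀, p₀)
        exact this.eventually_lt_const hγ
      · exact (hH.continuous.norm.tendsto (l₀, p₀)).eventually_lt_const (lt_add_one _)
    obtain ⟨ρ, hρ, hh⟩ := Metric.eventually_nhds_iff.1 h1
    exact ⟨ρ, hρ, fun x hx => by
      have := hh (by rwa [dist_eq_norm])
      exact ⟨this.1.le, this.2.le⟩⟩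
  set cH := ‖H (l₀, p₀)‖ + 1 with hcH
  have hcH0 : 0 < cH := by positivity
  let J : Λ × E × F →L[ℝ] (Λ × E) × (E × F) :=
    ((ContinuousLinearMap.fst ℝ Λ (E × F)).prod
      ((ContinuousLinearMap.fst ℝ E F).comp (ContinuousLinearMap.snd ℝ Λ (E × F)))).prod
      ((ContinuousLinearMap.inr ℝ E F).comp
        ((ContinuousLinearMap.snd ℝ E F).comp (ContinuousLinearMap.snd ℝ Λ (E × F))))
  have hJ : ∀ l q a, J (l, q, a) = ((l, q), ((0 : E), a)) := fun l q a => rfl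
  let r := min ρ η
  have hr : 0 < r := lt_min hρ hη
  let U' : Set (Λ × E × F) := {y | J y ∈ U ∧ max ‖y.1 - l₀‖ (‖y.2.1 - p₀‖ + ‖Φ (J y)‖) < r}
  have hJU : IsOpen (J ⁻¹' U) := hU.preimage J.continuous
  have hΦJ : ContDiffOn ℝ ∞ (fun y => Φ (J y)) (J ⁻¹' U) :=
    hΦ.comp J.contDiff.contDiffOn (fun y hy => hy)
  have hU' : IsOpen U' := by
    have hc : ContinuousOn (fun y : Λ × E × F => max ‖y.1 - l₀‖ (‖y.2.1 - p₀‖ + ‖Φ (J y)‖))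
        (J ⁻¹' U) :=
      continuous_max.comp_continuousOn (ContinuousOn.prodMk (by fun_prop)
        (ContinuousOn.add (by fun_prop) hΦJ.continuousOn.norm))
    exact hc.isOpen_inter_preimage hJU (isOpen_Iio (a := r))
  have hUU : U' ⊆ J ⁻¹' U := fun y hy => hy.1
  let Q : Λ × E × F →L[ℝ] (ℝ≥0 →ᵇ E × F) := (constL ℝ≥0 (E × F)).comp
    ((ContinuousLinearMap.inl ℝ E F).comp
      ((ContinuousLinearMap.fst ℝ E F).comp (ContinuousLinearMap.snd ℝ Λ (E × F))))
  have hQ : ∀ y z, Q y z = (y.2.1, 0) := fun y z => rfl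
  obtain ⟨Ψ, hΨ⟩ : ∃ Ψ : Λ × E × F → (ℝ≥0 →ᵇ E × F), ∀ y, Ψ y = Q y + weightL θ (E × F) (Φ (J y)) :=
    ⟨_, fun y => rfl⟩
  have hΨs : ContDiffOn ℝ ∞ Ψ U' := by
    have : ContDiffOn ℝ ∞ (fun y => Q y + weightL θ (E × F) (Φ (J y))) U' :=
      Q.contDiff.contDiffOn.add ((weightL θ (E × F)).contDiff.comp_contDiffOn (hΦJ.mono hUU))
    exact this.congr fun y _ => hΨ y
  obtain ⟨X, hX⟩ : ∃ X : Λ × E × F → ℝ → E × F, ∀ y z, X y z = Ψ y z.toNNReal := ⟨_, fun _ _ => rfl⟩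
  have hXe : ∀ y, ∀ z ∈ Ici (0 : ℝ), X y z =
      (y.2.1, 0) + Real.exp (-θ * z) • Φ (J y) z.toNNReal := fun y z hz => by
    rw [hX, hΨ, BoundedContinuousFunction.coe_add, Pi.add_apply, hQ, weightL_apply,
      Real.coe_toNNReal z hz]
  have hmem : ∀ l q a, (l, q, a) ∈ U' ↔ ((l, q), ((0 : E), a)) ∈ U ∧
    max ‖l - l₀‖ (‖q - p₀‖ + ‖Φ ((l, q), ((0 : E), a))‖) < r := fun _ _ _ => Iff.rfl
  have hXd : ∀ y, ∀ z ∈ Ici (0 : ℝ), ‖X y z - (y.2.1, 0)‖ ≤ ‖Φ (J y)‖ * Real.exp (-θ * z) :=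
    fun y z hz => by
      rw [hXe y z hz, add_sub_cancel_left, norm_smul, Real.norm_of_nonneg (Real.exp_pos _).le,
        mul_comm]
      gcongr
      exact (Φ (J y)).norm_coe_le_norm _
  have hXρ : ∀ y ∈ U', ∀ z ∈ Ici (0 : ℝ), ‖(y.1, (X y z).1) - (l₀, p₀)‖ < ρ := by
    intro y hy z hz
    have h1 := hy.2
    have h2 : ‖X y z - (y.2.1, 0)‖ ≤ ‖Φ (J y)‖ := (hXd y z hz).trans (by
      refine mul_le_of_le_one_right (norm_nonneg _) (Real.exp_le_one_iff.2 ?_)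
      have : (0 : ℝ) ≤ z := hz
      nlinarith)
    have h3 : ‖(X y z).1 - y.2.1‖ ≤ ‖Φ (J y)‖ := (norm_fst_le (X y z - (y.2.1, 0))).trans h2
    have h4 : ‖(X y z).1 - p₀‖ ≤ ‖y.2.1 - p₀‖ + ‖Φ (J y)‖ := by
      rw [show (X y z).1 - p₀ = (y.2.1 - p₀) + ((X y z).1 - y.2.1) by abel]
      exact (norm_add_le _ _).trans (by gcongr)
    rw [max_lt_iff] at h1
    rw [Prod.mk_sub_mk, Prod.norm_mk]
    exact max_lt (h1.1.trans_le (min_le_left _ _)) (h4.trans_lt (h1.2.trans_le (min_le_left _ _)))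
  -- the equation, in the space of bounded functions
  have hfield := contDiff_profileField hH hG
  let R : C((Λ × E × F) × (E × F), E × F) := ⟨fun p => profileField H G p.1.1 p.2,
    hfield.continuous.comp (by fun_prop : Continuous fun p : (Λ × E × F) × (E × F) => (p.1.1, p.2))⟩
  have hR : ContDiff ℝ ∞ R := hfield.comp (ContDiff.prodMk
    (contDiff_fst.comp contDiff_fst) contDiff_snd)
  have hΨode : ∀ y ∈ U', HasHalfLineDeriv (Ψ y)
      (superposition R (pairL ℝ≥0 _ _ (constL ℝ≥0 _ y, Ψ y))) := by
    intro y hy z hz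
    have h1 := (((hsol (J y) hy.1).2 z hz).const_add (y.2.1, (0 : F)))
    convert! h1 using 1
    · ext1 z; rw [hΨ]; rfl
    · rw [superposition_apply, pairL_apply, pointwiseApply_apply]
      rw [coeffAlong_apply]
      refine Eq.trans ?_ (centeredOp_apply H G y.1 y.2.1 _).symm
      change profileField H G y.1 (Ψ y z.toNNReal) = _
      rw [hΨ]; rfl
  have hode : ∀ y ∈ U', ∀ z ∈ Ici (0 : ℝ),
      HasDerivWithinAt (X y) (profileField H G y.1 (X y z)) (Ici 0) z := by
    intro y hy z hz
    have := hΨode y hy z hz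
    rw [superposition_apply, pairL_apply] at this
    rw [show X y = fun z => Ψ y z.toNNReal from funext (hX y)]
    exact this
  have hjoint := contDiffOn_eval_family hU' hR hΨs hΨode
  have hΨd : ∀ y ∈ U', DifferentiableAt ℝ Ψ y := fun y hy =>
    (hΨs.contDiffAt (hU'.mem_nhds hy)).differentiableAt (by simp)
  have hΨf : ∀ y ∈ U', ∀ k, fderiv ℝ Ψ y k = Q k + weightL θ (E × F) (fderiv ℝ Φ (J y) (J k)) := by
    intro y hy k
    have h1 : HasFDerivAt Φ (fderiv ℝ Φ (J y)) (J y) :=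
      ((hΦ.contDiffAt (hU.mem_nhds hy.1)).differentiableAt (by simp)).hasFDerivAt
    have h2 := Q.hasFDerivAt (x := y) |>.add
      ((weightL θ (E × F)).hasFDerivAt.comp y (h1.comp y J.hasFDerivAt))
    have h3 : HasFDerivAt Ψ _ y := h2.congr_of_eventuallyEq (Eventually.of_forall fun y => hΨ y)
    rw [h3.fderiv]; rfl
  have hXf : ∀ y ∈ U', ∀ k z, fderiv ℝ (fun y => X y z) y k = fderiv ℝ Ψ y k z.toNNReal := by
    intro y hy k z
    have h1 := (BoundedContinuousFunction.evalCLM ℝ z.toNNReal).hasFDerivAt.comp y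
      (hΨd y hy).hasFDerivAt
    have h2 : HasFDerivAt (fun y => X y z) _ y :=
      h1.congr_of_eventuallyEq (Eventually.of_forall fun y => hX y z)
    rw [h2.fderiv]; rfl
  have hK0 : 0 ≤ cH * C' / θ := by positivity
  obtain ⟨η', hη'0, hη'⟩ : ∃ η' > 0, (1 + C' + cH * C' / θ) * η' < r := by
    refine ⟨r / (2 * (1 + C' + cH * C' / θ)), by positivity, ?_⟩
    field_simp
    linarith
  have hexpc : Continuous fun z : ℝ => Real.exp (θ * z) := by fun_prop
  have hlift : ∀ (x : ℝ → E × F) (q : E) (b c : ℝ), ContinuousOn x (Ici 0) →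
      (∀ z ∈ Ici (0 : ℝ), ‖(x z).1 - q‖ ≤ b * Real.exp (-θ * z)) →
      (∀ z ∈ Ici (0 : ℝ), ‖(x z).2‖ ≤ c * Real.exp (-θ * z)) →
      ∃ V : ℝ≥0 →ᵇ E × F, (∀ z : ℝ≥0, V z = Real.exp (θ * z) • (x z - (q, 0))) ∧
        ‖V‖ ≤ max b c := by
    intro x q b c hxc hb hc
    refine exists_boundedContinuous (x := fun z => Real.exp (θ * z) • (x z - (q, 0)))
      (hexpc.continuousOn.smul (hxc.sub continuousOn_const)) fun z hz => ?_
    have he : Real.exp (θ * z) * Real.exp (-θ * z) = 1 := by rw [← Real.exp_add]; simp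
    rw [norm_smul, Real.norm_of_nonneg (Real.exp_pos _).le]
    have : ‖x z - (q, 0)‖ ≤ max b c * Real.exp (-θ * z) := by
      rw [Prod.norm_def]
      refine max_le ((hb z hz).trans ?_) (Eq.trans_le (by simp) ((hc z hz).trans ?_)) <;> gcongr
      · exact le_max_left _ _
      · exact le_max_right _ _
    calc _ ≤ Real.exp (θ * z) * (max b c * Real.exp (-θ * z)) := by gcongr
      _ = max b c * (Real.exp (θ * z) * Real.exp (-θ * z)) := by ring
      _ = _ := by rw [he, mul_one]
  have hfst : ∀ {x : ℝ → E × F} {x' : E × F} {z : ℝ}, HasDerivWithinAt x x' (Ici 0) z →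
      HasDerivWithinAt (fun z => (x z).1) x'.1 (Ici 0) z := fun hx =>
    (ContinuousLinearMap.fst ℝ E F).hasFDerivAt.comp_hasDerivWithinAt _ hx
  have hsnd : ∀ {x : ℝ → E × F} {x' : E × F} {z : ℝ}, HasDerivWithinAt x x' (Ici 0) z →
      HasDerivWithinAt (fun z => (x z).2) x'.2 (Ici 0) z := fun hx =>
    (ContinuousLinearMap.snd ℝ E F).hasFDerivAt.comp_hasDerivWithinAt _ hx
  have hweight : ∀ (x : ℝ → E × F) (q : E) (V : ℝ≥0 →ᵇ E × F),
      (∀ z : ℝ≥0, V z = Real.exp (θ * z) • (x z - (q, 0))) →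
      ∀ z : ℝ≥0, weightL θ (E × F) V z = x z - (q, 0) := fun x q V hV z => by
    rw [weightL_apply, hV, smul_smul, ← Real.exp_add]; simp
  have hfinal : ∀ l q a (x : ℝ → E × F), ‖l - l₀‖ < η' → ‖a‖ < η' →
    (∀ z ∈ Ici (0 : ℝ), ‖x z - (p₀, 0)‖ < η') →
    (∀ z ∈ Ici (0 : ℝ), HasDerivWithinAt x (profileField H G l (x z)) (Ici 0) z) →
    Tendsto (fun z => (x z).1) atTop (𝓝 q) → P a = P (x 0).2 →
    (l, q, a) ∈ U' ∧ ∀ z ∈ Ici (0 : ℝ), X (l, q, a) z = x z := by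
    intro l q a x hl ha hx hxo hxl hPa
    have hη'r : η' < r := by nlinarith
    have hxc : ContinuousOn x (Ici 0) := fun z hz => (hxo z hz).continuousWithinAt
    have hx1 : ∀ z ∈ Ici (0 : ℝ), ‖(x z).1 - p₀‖ < η' := fun z hz =>
      (norm_fst_le (x z - (p₀, 0))).trans_lt (hx z hz)
    have hx2 : ∀ z ∈ Ici (0 : ℝ), ‖(x z).2‖ < η' := fun z hz => by
      have := (norm_snd_le (x z - (p₀, 0))).trans_lt (hx z hz)
      simpa using this
    have hxρ : ∀ z ∈ Ici (0 : ℝ), ‖(l, (x z).1) - (l₀, p₀)‖ < ρ := fun z hz => by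
      rw [Prod.mk_sub_mk, Prod.norm_mk]
      exact max_lt (hl.trans (hη'r.trans_le (min_le_left _ _)))
        ((hx1 z hz).trans (hη'r.trans_le (min_le_left _ _)))
    have hwc : ContinuousOn (fun z => (l, (x z).1)) (Ici 0) :=
      continuousOn_const.prodMk (continuous_fst.comp_continuousOn hxc)
    have hd2 : ∀ z ∈ Ici (0 : ℝ), ‖(x z).2‖ ≤ C' * η' * Real.exp (-θ * z) := fun z hz => by
      refine (hdec (fun z => G (l, (x z).1) - G (l₀, p₀)) (fun _ => 0) (fun z => (x z).2) 0
        ((hG.continuous.comp_continuousOn hwc).sub continuousOn_const)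
        (fun z hz => (hρGH _ (hxρ z hz)).1) continuousOn_const (by simp) (fun z hz => ?_)
        ⟨η', fun z hz => (hx2 z hz).le⟩ z hz).trans ?_
      · convert! hsnd (hxo z hz) using 1
        simp [profileField]
      · rw [add_zero]
        gcongr
        exact (hx2 0 self_mem_Ici).le
    have hd1 : ∀ z ∈ Ici (0 : ℝ), ‖(x z).1 - q‖ ≤ cH * C' / θ * η' * Real.exp (-θ * z) :=
        fun z hz => by
      refine (norm_le_of_deriv_exp_decay (x := fun z => (x z).1 - q) (c := cH * (C' * η')) hθ
        (fun z hz => (hfst (hxo z hz)).sub_const q) (fun z hz => ?_) ?_ hz).trans_eq ?_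
      · refine (ContinuousLinearMap.le_opNorm _ _).trans ?_
        rw [mul_assoc cH]
        gcongr
        · exact (hρGH _ (hxρ z hz)).2
        · exact hd2 z hz
      · simpa using hxl.sub_const q
      · ring
    obtain ⟨V, hV, hVn⟩ := hlift x q _ _ hxc hd1 hd2
    have hVn' : ‖V‖ ≤ (C' + cH * C' / θ) * η' := hVn.trans (max_le
      (by nlinarith [mul_pos hC' hη'0]) (by nlinarith [mul_nonneg hK0 hη'0.le]))
    have hVr : ‖V‖ + η' < r := by linarith
    have hqp : ‖q - p₀‖ ≤ η' := le_of_tendsto (hxl.sub_const p₀).norm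
      ((eventually_ge_atTop 0).mono fun z hz => (hx1 z hz).le)
    have hV0 : V 0 = x 0 - (q, 0) := by simpa using hV 0
    have hVw := hweight x q V hV
    obtain ⟨h1, h2⟩ := huni (l, q) (0, a) V
      (by
        rw [Prod.mk_sub_mk, Prod.norm_mk]
        exact max_lt (hl.trans (hη'r.trans_le (min_le_right _ _)))
          (hqp.trans_lt (hη'r.trans_le (min_le_right _ _))))
      (by
        rw [Prod.norm_mk, norm_zero, max_eq_right (norm_nonneg _)]
        exact ha.trans (hη'r.trans_le (min_le_right _ _)))
      ((by linarith : ‖V‖ < r).trans_le (min_le_right _ _))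
      ((hPZeq _ _).2 (by rw [hV0]; simpa using hPa))
      (HasHalfLineDeriv.of_real (fun z hz => (hxo z hz).sub_const (q, 0)) hVw (fun z => by
        rw [pointwiseApply_apply, coeffAlong_apply]
        refine (centeredOp_apply H G l q _).trans ?_
        rw [hVw]; simp))
    refine ⟨⟨h1, ?_⟩, fun z hz => ?_⟩
    · change max ‖l - l₀‖ (‖q - p₀‖ + ‖Φ ((l, q), (0, a))‖) < r
      rw [h2]
      exact max_lt (hl.trans hη'r) (by linarith)
    · have h3 := hVw z.toNNReal
      rw [weightL_apply, Real.coe_toNNReal z hz] at h3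
      rw [hXe _ z hz, hJ, h2, h3]
      simp
  have hconst : ∀ l q, (l, q, 0) ∈ U' → Φ ((l, q), ((0 : E), (0 : F))) = 0 := by
    intro l q hy
    rw [hmem, max_lt_iff] at hy
    refine (huni (l, q) (0, 0) 0 ?_ (by simpa using hη) (by simpa using hη)
      ((hPZeq _ _).2 rfl) ?_).2
    · rw [Prod.norm_def]
      have := norm_nonneg (Φ ((l, q), ((0 : E), (0 : F))))
      exact max_lt (hy.2.1.trans_le (min_le_right _ _))
        ((by linarith [hy.2.2] : ‖q - p₀‖ < r).trans_le (min_le_right _ _))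
    · intro z hz
      rw [map_zero, map_zero]
      exact hasDerivWithinAt_const z (Ici 0) (0 : E × F)
  refine ⟨U', X, η', θ, fun y => ‖Φ (J y)‖,
    { isOpen := hU'
      mem := ?_
      radius_pos := hη'0
      rate_pos := hθ
      smooth := hjoint.congr fun p _ => hX p.2 p.1
      ode := hode
      decay := fun y _ => hXd y
      continuousOn := (hΦJ.mono hUU).continuousOn.norm
      bound_const := ?_
      proj := ?_
      const := ?_
      unique := hfinal
      lin := ?_
      lin_unique := ?_ }⟩
  · rw [hmem]
    refine ⟨hbU, ?_⟩
    change max ‖l₀ - l₀‖ (‖p₀ - p₀‖ + ‖Φ ((l₀, p₀), (0 : E × F))‖) < r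
    simpa [hΦ0] using hr
  · intro l q hy
    change ‖Φ ((l, q), ((0 : E), (0 : F)))‖ = 0
    rw [hconst l q hy, norm_zero]
  · intro y hy
    have h1 : P (Φ (J y) 0).2 = P y.2.2 := ((hPZeq _ _).1 (hsol (J y) hy.1).1)
    rw [hXe y 0 self_mem_Ici]
    simpa using h1
  · intro l q hy z hz
    rw [hXe _ z hz, hJ, hconst l q hy]; simp
  · intro y hy q a
    have hVeq : (fun z => fderiv ℝ (fun y => X y z) y (0, q, a)) =
        fun z : ℝ => fderiv ℝ Ψ y (0, q, a) z.toNNReal := funext fun z => hXf y hy _ z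
    have hR' : ContDiffOn ℝ ∞ (fun y => superposition R (pairL ℝ≥0 _ _ (constL ℝ≥0 _ y, Ψ y))) U' :=
      (contDiff_superposition (X := ℝ≥0) R hR).comp_contDiffOn
        ((pairL ℝ≥0 (Λ × E × F) (E × F)).contDiff.comp_contDiffOn
        ((constL ℝ≥0 (Λ × E × F)).contDiff.contDiffOn.prodMk hΨs))
    have hexp : Tendsto (fun z : ℝ => Real.exp (-θ * z)) atTop (𝓝 0) :=
      Real.tendsto_exp_atBot.comp (tendsto_id.const_mul_atTop_of_neg (neg_lt_zero.2 hθ))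
    have hJk : J (0, q, a) = ((0, q), (0, a)) := rfl
    refine ⟨?_, fun z hz => ?_, ?_, ?_⟩
    · rw [hVeq]
      exact contDiffOn_fderiv_eval_family hU' hΨode hΨd (fun y hy =>
        (hR'.contDiffAt (hU'.mem_nhds hy)).differentiableAt (by simp)) hjoint hy _
    · have h1 := (((hder (J y) hy.1 (J (0, q, a))).2 z hz).const_add (q, (0 : F)))
      rw [hVeq]
      rw [hXf y hy]
      convert! h1 using 1
      · ext1 z; rw [hΨf y hy]; rfl
      · rw [hΨf y hy, hX, hΨ]
        simp only [linRHS, BoundedContinuousFunction.coe_add, Pi.add_apply, pointwiseApply_apply,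
          coeffAlong_apply, pairL_apply, constL_apply, hQ]
        exact (centeredOp_fderiv hH hG y.1 y.2.1 q _ _).symm
    · rw [hVeq]
      have h1 : Tendsto (fun z : ℝ => (q, (0 : F)) + Real.exp (-θ * z) • fderiv ℝ Φ (J y) (J (0, q, a)) z.toNNReal)
          atTop (𝓝 ((q, 0) + 0)) := by
        refine tendsto_const_nhds.add ?_
        refine squeeze_zero_norm (a := fun z => Real.exp (-θ * z) * ‖fderiv ℝ Φ (J y) (J (0, q, a))‖) (fun z => ?_) ?_
        · rw [norm_smul, Real.norm_of_nonneg (Real.exp_pos _).le]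
          gcongr
          exact BoundedContinuousFunction.norm_coe_le_norm _ _
        · simpa using hexp.mul_const _
      rw [add_zero] at h1
      refine h1.congr' ((eventually_ge_atTop 0).mono fun z hz => ?_)
      rw [hΨf y hy]
      change _ = Q (0, q, a) z.toNNReal + weightL θ (E × F) _ z.toNNReal
      rw [hQ, weightL_apply, Real.coe_toNNReal z hz]
    · have h1 : P (fderiv ℝ Φ (J y) (J (0, q, a)) 0).2 = P a :=
        ((hPZeq _ _).1 (hder (J y) hy.1 (J (0, q, a))).1)
      rw [hXf y hy, hΨf y hy]
      simpa [hQ] using h1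
  · intro y hy v a hv hv1 hv2 hva z hz
    have hvc : ContinuousOn v (Ici 0) := fun z hz => (hv z hz).continuousWithinAt
    have hXc : ContinuousOn (X y) (Ici 0) := fun z hz => (hode y hy z hz).continuousWithinAt
    have hwc : ContinuousOn (fun z => (y.1, (X y z).1)) (Ici 0) :=
      continuousOn_const.prodMk (continuous_fst.comp_continuousOn hXc)
    obtain ⟨b₁, hb₁⟩ := exists_bound_of_tendsto (continuous_fst.comp_continuousOn hvc) hv1
    have hDG : Continuous (fderiv ℝ G) := hG.continuous_fderiv (by simp)
    have hDH : Continuous (fderiv ℝ H) := hH.continuous_fderiv (by simp)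
    obtain ⟨DG, hDGb⟩ := (isCompact_closedBall (l₀, p₀) ρ).exists_bound_of_continuousOn
      (f := fderiv ℝ G) hDG.continuousOn
    obtain ⟨DH, hDHb⟩ := (isCompact_closedBall (l₀, p₀) ρ).exists_bound_of_continuousOn
      (f := fderiv ℝ H) hDH.continuousOn
    have hball : ∀ z ∈ Ici (0 : ℝ), (y.1, (X y z).1) ∈ Metric.closedBall (l₀, p₀) ρ :=
      fun z hz => by rw [mem_closedBall_iff_norm]; exact (hXρ y hy z hz).le
    have hX2 : ∀ z ∈ Ici (0 : ℝ), ‖(X y z).2‖ ≤ ‖Φ (J y)‖ * Real.exp (-θ * z) := fun z hz => by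
      have := (norm_snd_le (X y z - (y.2.1, 0))).trans (hXd y z hz)
      simpa using this
    have hterm : ∀ {W : Type} [NormedAddCommGroup W] [NormedSpace ℝ W]
        (T : Λ × E →L[ℝ] F →L[ℝ] W) (D : ℝ) (z : ℝ), ‖T‖ ≤ D → z ∈ Ici (0 : ℝ) →
        ‖T (0, (v z).1) (X y z).2‖ ≤ D * b₁ * ‖Φ (J y)‖ * Real.exp (-θ * z) := by
      intro W _ _ T D z hT hz
      have h0 : ‖((0 : Λ), (v z).1)‖ ≤ b₁ := by
        rw [Prod.norm_mk, norm_zero, max_eq_right (norm_nonneg _)]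
        exact hb₁ z hz
      calc _ ≤ ‖T‖ * ‖((0 : Λ), (v z).1)‖ * ‖(X y z).2‖ := T.le_opNorm₂ _ _
        _ ≤ D * b₁ * (‖Φ (J y)‖ * Real.exp (-θ * z)) := by
          have := (norm_nonneg T).trans hT
          have := (norm_nonneg _).trans h0
          gcongr
          exact hX2 z hz
        _ = _ := by ring
    have hv' : ∀ z ∈ Ici (0 : ℝ), HasDerivWithinAt v
        (H (y.1, (X y z).1) (v z).2 + fderiv ℝ H (y.1, (X y z).1) (0, (v z).1) (X y z).2,
        G (y.1, (X y z).1) (v z).2 + fderiv ℝ G (y.1, (X y z).1) (0, (v z).1) (X y z).2)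
        (Ici 0) z := fun z hz => by
      rw [← profileField_hasFDerivAt hH hG]; exact hv z hz
    have hd2 := hdec (fun z => G (y.1, (X y z).1) - G (l₀, p₀))
      (fun z => fderiv ℝ G (y.1, (X y z).1) (0, (v z).1) (X y z).2) (fun z => (v z).2)
      (DG * b₁ * ‖Φ (J y)‖) ((hG.continuous.comp_continuousOn hwc).sub continuousOn_const)
      (fun z hz => (hρGH _ (hXρ y hy z hz)).1)
      (((hDG.comp_continuousOn hwc).clm_apply (continuousOn_const.prodMk
        (continuous_fst.comp_continuousOn hvc))).clm_apply (continuous_snd.comp_continuousOn hXc))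
      (fun z hz => hterm _ DG z (hDGb _ (hball z hz)) hz) (fun z hz => by
        convert! hsnd (hv' z hz) using 1
        simp; abel) hv2
    have hd1 := fun z (hz : (0 : ℝ) ≤ z) => norm_le_of_deriv_exp_decay
      (x := fun z => (v z).1) (c := cH * (C' * (‖(v 0).2‖ + DG * b₁ * ‖Φ (J y)‖)) +
        DH * b₁ * ‖Φ (J y)‖) hθ
      (fun z hz => hfst (hv' z hz)) (fun z hz => by
        refine (norm_add_le _ _).trans ?_
        rw [add_mul]
        refine add_le_add ?_ (hterm _ DH z (hDHb _ (hball z hz)) hz)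
        refine (ContinuousLinearMap.le_opNorm _ _).trans ?_
        rw [mul_assoc cH]
        gcongr
        · exact (hρGH _ (hXρ y hy z hz)).2
        · exact hd2 z hz) hv1 hz
    obtain ⟨V, hV, -⟩ := hlift v 0 _ _ hvc (fun z hz => by simpa using hd1 z hz) hd2
    have hVw : ∀ z : ℝ≥0, weightL θ (E × F) V z = v z := fun z => by
      rw [hweight v 0 V hV]; simp
    have hV0 : V 0 = v 0 := by
      have := hV 0
      rwa [show ((0 : E), (0 : F)) = 0 from rfl, sub_zero, NNReal.coe_zero, mul_zero, Real.exp_zero,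
        one_smul] at this
    have h1 := hlin (J y) hy.1 (0, a) V ((hPZeq _ _).2 (by rw [hV0]; exact hva))
      (HasHalfLineDeriv.of_real hv hVw fun z => by
        have h3 : ((0 : E), (0 : F)) + v z = v z := zero_add (v z)
        simp only [linRHS, BoundedContinuousFunction.coe_add, Pi.add_apply, pointwiseApply_apply,
          coeffAlong_apply, pairL_apply, constL_apply, hVw]
        refine (centeredOp_fderiv hH hG y.1 y.2.1 0 _ _).trans ?_
        have h2 := hXe y z z.2
        rw [Real.toNNReal_coe] at h2
        rw [weightL_apply, ← h2, h3])
    have hJk : J (0, 0, a) = (0, (0, a)) := rfl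
    rw [hXf y hy, hΨf y hy, hJk, ← h1, BoundedContinuousFunction.coe_add, Pi.add_apply, hQ, hVw,
      Real.coe_toNNReal z hz]
    simp

end ProfileFamily

section Complexification

variable {ι : Type*} [Fintype ι]

/-- The complex-linear extension of a real operator. -/
noncomputable def complexify (T : (ι → ℝ) →ₗ[ℝ] (ι → ℝ)) : (ι → ℂ) →ₗ[ℂ] (ι → ℂ) where
  toFun v := fun i => ⟨T (fun j => (v j).re) i, T (fun j => (v j).im) i⟩
  map_add' u v := by
    ext i
    have h1 : (fun j => ((u + v) j).re) = (fun j => (u j).re) + fun j => (v j).re := rfl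
    have h2 : (fun j => ((u + v) j).im) = (fun j => (u j).im) + fun j => (v j).im := rfl
    rw [h1, h2, map_add, map_add]
    rfl
  map_smul' c v := by
    ext i
    have h1 : (fun j => ((c • v) j).re) = c.re • (fun j => (v j).re) - c.im • fun j => (v j).im := by
      ext j; simp
    have h2 : (fun j => ((c • v) j).im) = c.re • (fun j => (v j).im) + c.im • fun j => (v j).re := by
      ext j; simp
    rw [h1, h2, map_sub, map_add, map_smul, map_smul, map_smul, map_smul]
    apply Complex.ext <;> simp

theorem norm_re_le (v : ι → ℂ) : ‖fun i => (v i).re‖ ≤ ‖v‖ :=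
  (pi_norm_le_iff_of_nonneg (norm_nonneg v)).2 fun i =>
    (Complex.abs_re_le_norm _).trans (norm_le_pi_norm v i)

theorem norm_im_le (v : ι → ℂ) : ‖fun i => (v i).im‖ ≤ ‖v‖ :=
  (pi_norm_le_iff_of_nonneg (norm_nonneg v)).2 fun i =>
    (Complex.abs_im_le_norm _).trans (norm_le_pi_norm v i)

theorem norm_le_re_add_im (v : ι → ℂ) : ‖v‖ ≤ ‖fun i => (v i).re‖ + ‖fun i => (v i).im‖ :=
  (pi_norm_le_iff_of_nonneg (by positivity)).2 fun i =>
    (Complex.norm_le_abs_re_add_abs_im _).trans (add_le_add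
      (norm_le_pi_norm (fun i => (v i).re) i) (norm_le_pi_norm (fun i => (v i).im) i))

theorem complexify_toLin' [DecidableEq ι] (G : Matrix ι ι ℝ) :
    complexify (Matrix.toLin' G) = Matrix.toLin' (G.map (fun a : ℝ => (a : ℂ))) := by
  refine LinearMap.ext fun v => ?_
  ext i
  apply Complex.ext <;> simp [complexify, Matrix.mulVec, dotProduct]

/-- The complex span of a real subspace. -/
def complexSub (V : Submodule ℝ (ι → ℝ)) : Submodule ℂ (ι → ℂ) where
  carrier := {v | (fun i => (v i).re) ∈ V ∧ (fun i => (v i).im) ∈ V}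
  add_mem' := fun hu hv => ⟨V.add_mem hu.1 hv.1, V.add_mem hu.2 hv.2⟩
  zero_mem' := ⟨V.zero_mem, V.zero_mem⟩
  smul_mem' := fun c v hv => by
    have h1 : (fun j => ((c • v) j).re) = c.re • (fun j => (v j).re) - c.im • fun j => (v j).im := by
      ext j; simp
    have h2 : (fun j => ((c • v) j).im) = c.re • (fun j => (v j).im) + c.im • fun j => (v j).re := by
      ext j; simp
    exact ⟨by rw [h1]; exact V.sub_mem (V.smul_mem _ hv.1) (V.smul_mem _ hv.2),
      by rw [h2]; exact V.add_mem (V.smul_mem _ hv.2) (V.smul_mem _ hv.1)⟩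

theorem finrank_complexSub (V : Submodule ℝ (ι → ℝ)) :
    Module.finrank ℂ (complexSub V) = Module.finrank ℝ V := by
  have h := finrank_real_of_complex (complexSub V)
  let e : complexSub V ≃ₗ[ℝ] V × V :=
    { toFun := fun v => (⟨_, v.2.1⟩, ⟨_, v.2.2⟩)
      map_add' := fun u v => rfl
      map_smul' := fun c v => by
        refine Prod.ext (Subtype.ext ?_) (Subtype.ext ?_) <;> ext i <;> simp
      invFun := fun p => ⟨fun i => ⟨p.1.1 i, p.2.1 i⟩, p.1.2, p.2.2⟩
      left_inv := fun v => rfl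
      right_inv := fun p => rfl }
  rw [e.finrank_eq, Module.finrank_prod] at h
  omega

end Complexification

section DecaySubspace

variable {ι : Type*} [Fintype ι]

/-- Initial values of solutions of `x' = L x` that decay at rate `κ`. -/
noncomputable def decaySub (L : (ι → ℝ) →L[ℝ] (ι → ℝ)) (κ : ℝ) : Submodule ℝ (ι → ℝ) where
  carrier := {a | ∃ C, ∀ t : ℝ, 0 ≤ t → ‖NormedSpace.exp (t • L) a‖ ≤ C * Real.exp (-κ * t)}
  add_mem' := by
    rintro a b ⟨C, hC⟩ ⟨D, hD⟩
    refine ⟨C + D, fun t ht => ?_⟩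
    rw [map_add, add_mul]
    exact (norm_add_le _ _).trans (add_le_add (hC t ht) (hD t ht))
  zero_mem' := ⟨0, fun t _ => by simp⟩
  smul_mem' := by
    rintro c a ⟨C, hC⟩
    refine ⟨‖c‖ * C, fun t ht => ?_⟩
    rw [map_smul, norm_smul, mul_assoc]
    gcongr
    exact hC t ht

theorem exp_smul_add (L : (ι → ℝ) →L[ℝ] (ι → ℝ)) (s t : ℝ) (x : ι → ℝ) :
    NormedSpace.exp ((s + t) • L) x = NormedSpace.exp (s • L) (NormedSpace.exp (t • L) x) := by
  let _ : NormedAlgebra ℚ ((ι → ℝ) →L[ℝ] (ι → ℝ)) := NormedAlgebra.restrictScalars ℚ ℝ _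
  rw [add_smul, NormedSpace.exp_add_of_commute (((Commute.refl L).smul_left s).smul_right t)]
  rfl

theorem exp_smul_comm (L : (ι → ℝ) →L[ℝ] (ι → ℝ)) (t : ℝ) (x : ι → ℝ) :
    NormedSpace.exp (t • L) (L x) = L (NormedSpace.exp (t • L) x) := by
  have : Commute (NormedSpace.exp (t • L)) L := ((Commute.refl L).smul_left t).exp_left
  exact congrArg (fun T : (ι → ℝ) →L[ℝ] (ι → ℝ) => T x) this.eq

theorem commute_mem_decaySub {L T : (ι → ℝ) →L[ℝ] (ι → ℝ)} {κ : ℝ}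
    (hT : ∀ t : ℝ, ∀ x, NormedSpace.exp (t • L) (T x) = T (NormedSpace.exp (t • L) x))
    {a : ι → ℝ} (ha : a ∈ decaySub L κ) : T a ∈ decaySub L κ := by
  obtain ⟨C, hC⟩ := ha
  refine ⟨‖T‖ * C, fun t ht => ?_⟩
  rw [hT, mul_assoc]
  exact (T.le_opNorm _).trans (by gcongr; exact hC t ht)

theorem exists_uniform_decaySub (L : (ι → ℝ) →L[ℝ] (ι → ℝ)) (κ : ℝ) :
    ∃ C, 0 ≤ C ∧ ∀ t : ℝ, 0 ≤ t → ∀ a ∈ decaySub L κ,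
      ‖NormedSpace.exp (t • L) a‖ ≤ C * Real.exp (-κ * t) * ‖a‖ := by
  have := banach_steinhaus (E := decaySub L κ) (ι := {t : ℝ // 0 ≤ t})
    (g := fun t => Real.exp (κ * t) • (NormedSpace.exp ((t : ℝ) • L)).comp (decaySub L κ).subtypeL)
    (fun x => by
      obtain ⟨C, hC⟩ := x.2
      refine ⟨C, fun t => ?_⟩
      rw [_root_.smul_apply, norm_smul, Real.norm_of_nonneg (Real.exp_pos _).le]
      calc _ ≤ Real.exp (κ * t) * (C * Real.exp (-κ * t)) := by gcongr; exact hC t t.2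
        _ = C * Real.exp (κ * t + -κ * t) := by rw [Real.exp_add]; ring
        _ = C := by simp)
  obtain ⟨C, hC⟩ := this
  have hC0 : 0 ≤ C := (norm_nonneg _).trans (hC ⟨0, le_rfl⟩)
  refine ⟨C, hC0, fun t ht a ha => ?_⟩
  have h1 := ((ContinuousLinearMap.le_opNorm _ (⟨a, ha⟩ : decaySub L κ)).trans
    (mul_le_mul_of_nonneg_right (hC ⟨t, ht⟩) (norm_nonneg _)))
  rw [_root_.smul_apply, norm_smul, Real.norm_of_nonneg (Real.exp_pos _).le] at h1
  change Real.exp (κ * t) * ‖NormedSpace.exp (t • L) a‖ ≤ C * ‖a‖ at h1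
  calc _ = Real.exp (-κ * t) * (Real.exp (κ * t) * ‖NormedSpace.exp (t • L) a‖) := by
        rw [← mul_assoc, ← Real.exp_add]; simp
    _ ≤ Real.exp (-κ * t) * (C * ‖a‖) := by gcongr
    _ = _ := by ring

theorem disjoint_decaySub (L : (ι → ℝ) →L[ℝ] (ι → ℝ)) {κ : ℝ} (hκ : 0 < κ) :
    Disjoint (decaySub L κ) (decaySub (-L) κ) := by
  rw [Submodule.disjoint_def]
  intro a ha hb
  obtain ⟨C, hC0, hC⟩ := exists_uniform_decaySub L κ
  obtain ⟨D, hD0, hD⟩ := exists_uniform_decaySub (-L) κ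
  have hcomm : ∀ s t : ℝ, ∀ x, NormedSpace.exp (t • -L) (NormedSpace.exp (s • L) x) =
      NormedSpace.exp (s • L) (NormedSpace.exp (t • -L) x) := fun s t x => by
    rw [smul_neg, ← neg_smul, ← exp_smul_add, ← exp_smul_add, add_comm]
  have key : ∀ t : ℝ, 0 ≤ t → ‖a‖ ≤ (D * (C * ‖a‖)) * Real.exp (-κ * t) := fun t ht => by
    have h0 : NormedSpace.exp (t • -L) (NormedSpace.exp (t • L) a) = a := by
      rw [smul_neg, ← neg_smul, ← exp_smul_add]
      simp
    have h1 := hD t ht _ (commute_mem_decaySub (T := NormedSpace.exp (t • L))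
      (fun s x => hcomm t s x) hb)
    have he : Real.exp (-κ * t) ≤ 1 := Real.exp_le_one_iff.2 (by nlinarith)
    rw [h0] at h1
    calc ‖a‖ ≤ _ := h1
      _ ≤ D * Real.exp (-κ * t) * (C * 1 * ‖a‖) := by
        gcongr
        exact (hC t ht a ha).trans (by gcongr)
      _ = _ := by ring
  have hlim : Tendsto (fun t : ℝ => (D * (C * ‖a‖)) * Real.exp (-κ * t)) atTop
      (𝓝 ((D * (C * ‖a‖)) * 0)) := Tendsto.const_mul _
    (Real.tendsto_exp_atBot.comp (tendsto_id.const_mul_atTop_of_neg (neg_lt_zero.2 hκ)))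
  rw [mul_zero] at hlim
  exact norm_le_zero_iff.1 (ge_of_tendsto hlim ((eventually_ge_atTop 0).mono key))

theorem mem_complexSub_decaySub {L : (ι → ℝ) →L[ℝ] (ι → ℝ)} {κ : ℝ} {v : ι → ℂ} :
    v ∈ complexSub (decaySub L κ) ↔ ∃ C, ∀ t : ℝ, 0 ≤ t →
      ‖complexify (NormedSpace.exp (t • L) : (ι → ℝ) →L[ℝ] (ι → ℝ)) v‖ ≤ C * Real.exp (-κ * t) := by
  constructor
  · rintro ⟨⟨C, hC⟩, ⟨D, hD⟩⟩
    refine ⟨C + D, fun t ht => (norm_le_re_add_im _).trans ?_⟩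
    rw [add_mul]
    exact add_le_add (hC t ht) (hD t ht)
  · rintro ⟨C, hC⟩
    exact ⟨⟨C, fun t ht => (norm_re_le _).trans (hC t ht)⟩,
      ⟨C, fun t ht => (norm_im_le _).trans (hC t ht)⟩⟩

theorem hasDerivAt_complexify_exp (L : (ι → ℝ) →L[ℝ] (ι → ℝ)) (v : ι → ℂ) (t : ℝ) :
    HasDerivAt (fun t : ℝ => complexify (NormedSpace.exp (t • L) : (ι → ℝ) →L[ℝ] (ι → ℝ)) v)
      (complexify (NormedSpace.exp (t • L) : (ι → ℝ) →L[ℝ] (ι → ℝ)) (complexify L v)) t := by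
  have h : ∀ x : ι → ℝ, HasDerivAt (fun t : ℝ => NormedSpace.exp (t • L) x)
      (NormedSpace.exp (t • L) (L x)) t := fun x =>
    (hasDerivAt_exp_smul_const L t).clm_apply (hasDerivAt_const t x) |>.congr_deriv (by simp)
  rw [hasDerivAt_pi]
  intro i
  have h1 := hasDerivAt_pi.1 (h fun j => (v j).re) i
  have h2 := hasDerivAt_pi.1 (h fun j => (v j).im) i
  have h3 := h1.ofReal_comp.add (h2.ofReal_comp.mul_const Complex.I)
  convert! h3 using 1
  · ext1 s
    exact (Complex.mk_eq_add_mul_I _ _)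
  · exact (Complex.mk_eq_add_mul_I _ _)

theorem mem_complexSub_of_sub_smul {L : (ι → ℝ) →L[ℝ] (ι → ℝ)} {κ : ℝ} {l : ℂ} (hl : l.re < -κ)
    {v : ι → ℂ} (hv : complexify (L : (ι → ℝ) →ₗ[ℝ] (ι → ℝ)) v - l • v ∈ complexSub (decaySub L κ)) :
    v ∈ complexSub (decaySub L κ) := by
  rw [mem_complexSub_decaySub] at hv ⊢
  obtain ⟨C, hC⟩ := hv
  set S : ℝ → (ι → ℂ) →ₗ[ℂ] (ι → ℂ) := fun t =>
    complexify (NormedSpace.exp (t • L) : (ι → ℝ) →L[ℝ] (ι → ℝ)) with hS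
  set u := complexify (L : (ι → ℝ) →ₗ[ℝ] (ι → ℝ)) v - l • v with hu
  have hC0 : 0 ≤ C := by simpa using (norm_nonneg _).trans (hC 0 le_rfl)
  set b := -l.re - κ with hb
  have hb0 : 0 < b := by linarith
  have hw : ∀ t : ℝ, HasDerivAt (fun t : ℝ => Complex.exp (-l * t) • S t v)
      (Complex.exp (-l * t) • S t u) t := fun t => by
    have h1 : HasDerivAt (fun t : ℝ => Complex.exp (-l * t)) (Complex.exp (-l * t) * -l) t := by
      have : HasDerivAt (fun t : ℝ => -l * (t : ℂ)) (-l) t := by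
        simpa using (Complex.ofRealCLM.hasDerivAt (x := t)).const_mul (-l)
      exact this.cexp
    have h2 := h1.smul (hasDerivAt_complexify_exp L v t)
    convert! h2 using 1
    rw [hu, map_sub, map_smul, smul_sub, smul_smul, sub_eq_add_neg, ← neg_smul, mul_neg]
  have hnorm : ∀ t : ℝ, ‖Complex.exp (-l * t)‖ = Real.exp (-l.re * t) := fun t => by
    rw [Complex.norm_exp]; simp
  have hS0 : S 0 v = v := by
    ext i
    apply Complex.ext <;> simp [hS, complexify]
  have hB : ∀ t : ℝ, HasDerivAt (fun t : ℝ => ‖v‖ + C / b * Real.exp (b * t))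
      (C * Real.exp (b * t)) t := fun t => by
    have h1 : HasDerivAt (fun t : ℝ => Real.exp (b * t)) (Real.exp (b * t) * b) t := by
      simpa using ((hasDerivAt_id t).const_mul b).exp
    convert! (h1.const_mul (C / b)).const_add ‖v‖ using 1
    field_simp
  refine ⟨‖v‖ + C / b, fun t ht => ?_⟩
  have key := image_norm_le_of_norm_deriv_right_le_deriv_boundary (a := 0) (b := t)
    (f := fun t : ℝ => Complex.exp (-l * t) • S t v) (f' := fun t : ℝ => Complex.exp (-l * t) • S t u)
    (B := fun t : ℝ => ‖v‖ + C / b * Real.exp (b * t)) (B' := fun t => C * Real.exp (b * t))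
    (fun t _ => (hw t).continuousAt.continuousWithinAt) (fun t _ => (hw t).hasDerivWithinAt)
    (by
      simp only [Complex.ofReal_zero, mul_zero, Complex.exp_zero, one_smul, Real.exp_zero, mul_one,
        hS0]
      have : 0 ≤ C / b := by positivity
      linarith) hB
    (fun t ht => by
      rw [norm_smul, hnorm]
      calc _ ≤ Real.exp (-l.re * t) * (C * Real.exp (-κ * t)) := by gcongr; exact hC t ht.1
        _ = C * Real.exp (-l.re * t + -κ * t) := by rw [Real.exp_add]; ring
        _ = _ := by rw [hb]; ring_nf) (right_mem_Icc.2 ht)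
  rw [norm_smul, hnorm] at key
  have h1 : ‖S t v‖ = Real.exp (l.re * t) * (Real.exp (-l.re * t) * ‖S t v‖) := by
    rw [← mul_assoc, ← Real.exp_add]; simp
  have h2 : Real.exp (l.re * t) ≤ Real.exp (-κ * t) := Real.exp_le_exp.2 (by nlinarith)
  calc ‖S t v‖ ≤ Real.exp (l.re * t) * (‖v‖ + C / b * Real.exp (b * t)) := by rw [h1]; gcongr
    _ = Real.exp (l.re * t) * ‖v‖ + C / b * Real.exp (l.re * t + b * t) := by
      rw [Real.exp_add]; ring
    _ = Real.exp (l.re * t) * ‖v‖ + C / b * Real.exp (-κ * t) := by rw [hb]; ring_nf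
    _ ≤ Real.exp (-κ * t) * ‖v‖ + C / b * Real.exp (-κ * t) := by gcongr
    _ = _ := by ring

theorem maxGenEigenspace_le_complexSub {L : (ι → ℝ) →L[ℝ] (ι → ℝ)} {κ : ℝ} {l : ℂ}
    (hl : l.re < -κ) :
    Module.End.maxGenEigenspace (complexify (L : (ι → ℝ) →ₗ[ℝ] (ι → ℝ))) l ≤ complexSub (decaySub L κ) := by
  intro v hv
  obtain ⟨k, hk⟩ := (Module.End.mem_maxGenEigenspace _ _ _).1 hv
  clear hv
  induction k generalizing v with
  | zero =>
    have : v = 0 := hk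
    rw [this]; exact Submodule.zero_mem _
  | succ k ih =>
    exact mem_complexSub_of_sub_smul hl (ih (by rw [pow_succ] at hk; exact hk))

end DecaySubspace

section Spectral

variable {ι : Type*} [Fintype ι] [DecidableEq ι]

/-- The complex roots of the characteristic polynomial of a real matrix, with multiplicity. -/
noncomputable def complexRoots (G : Matrix ι ι ℝ) : Multiset ℂ :=
  (G.map (fun a : ℝ => (a : ℂ))).charpoly.roots

open Classical in
/-- The number of complex roots with negative real part. -/
noncomputable def numNegRe (G : Matrix ι ι ℝ) : ℕ := (complexRoots G).countP (fun l => l.re < 0)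

open Classical in
/-- The number of complex roots with positive real part. -/
noncomputable def numPosRe (G : Matrix ι ι ℝ) : ℕ := (complexRoots G).countP (fun l => 0 < l.re)

theorem card_complexRoots (G : Matrix ι ι ℝ) : (complexRoots G).card = Fintype.card ι := by
  rw [complexRoots, IsAlgClosed.card_roots_eq_natDegree, Matrix.charpoly_natDegree_eq_dim]

theorem numNegRe_add_numPosRe {G : Matrix ι ι ℝ} (hG : ∀ l ∈ complexRoots G, l.re ≠ 0) :
    numNegRe G + numPosRe G = Fintype.card ι := by
  rw [← card_complexRoots G, numNegRe, numPosRe,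
    Multiset.card_eq_countP_add_countP (fun l : ℂ => l.re < 0)]
  congr 1
  refine Multiset.countP_congr rfl fun l hl => ?_
  have := hG l hl
  simp only [not_lt, eq_iff_iff]
  exact ⟨fun h => h.le, fun h => lt_of_le_of_ne h this.symm⟩

theorem finrank_biSup_le {K V α : Type*} [DivisionRing K] [AddCommGroup V] [Module K V]
    [FiniteDimensional K V] (s : Finset α) (p : α → Submodule K V) :
    Module.finrank K ↥(⨆ a ∈ s, p a) ≤ ∑ a ∈ s, Module.finrank K (p a) := by
  classical
  induction s using Finset.induction_on with
  | empty => simp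
  | insert a s ha ih =>
    rw [Finset.iSup_insert, Finset.sum_insert ha]
    exact (Submodule.finrank_add_le_finrank_add_finrank _ _).trans (by gcongr)

theorem finrank_spectral_le (f : Module.End ℂ (ι → ℂ)) (q : ℂ → Prop) [DecidablePred q] :
    Module.finrank ℂ ↥(⨆ l ∈ f.charpoly.roots.toFinset.filter q, f.maxGenEigenspace l) ≤
      f.charpoly.roots.countP q := by
  refine (finrank_biSup_le _ _).trans_eq ?_
  rw [Multiset.countP_eq_card_filter, ← Multiset.toFinset_sum_count_eq, Multiset.toFinset_filter]
  refine Finset.sum_congr rfl fun l hl => ?_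
  rw [LinearMap.finrank_maxGenEigenspace_eq, Multiset.count_filter_of_pos (Finset.mem_filter.1 hl).2,
    Polynomial.count_roots]

theorem exists_expDichotomy {G : Matrix ι ι ℝ} (hG : ∀ l ∈ complexRoots G, l.re ≠ 0) :
    ∃ P S C κ, ExpDichotomy (Matrix.toLin' G).toContinuousLinearMap P S C κ ∧
      Module.finrank ℝ P.range = numNegRe G := by
  classical
  set L : (ι → ℝ) →L[ℝ] (ι → ℝ) := (Matrix.toLin' G).toContinuousLinearMap with hL
  set f : Module.End ℂ (ι → ℂ) := Matrix.toLin' (G.map (fun a : ℝ => (a : ℂ))) with hf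
  have hfL : complexify (L : (ι → ℝ) →ₗ[ℝ] (ι → ℝ)) = f := complexify_toLin' G
  have hch : f.charpoly.roots = complexRoots G := by
    rw [hf, complexRoots, Matrix.charpoly_toLin']
  obtain ⟨κ, hκ, hκl⟩ : ∃ κ > 0, ∀ l ∈ f.charpoly.roots.toFinset, κ < |l.re| := by
    have h1 : ∀ᶠ κ : ℝ in 𝓝[>] 0, ∀ l ∈ f.charpoly.roots.toFinset, κ < |l.re| := by
      rw [Filter.eventually_all_finset]
      intro l hl
      rw [hch] at hl
      exact nhdsWithin_le_nhds (eventually_lt_nhds (abs_pos.2 (hG l (Multiset.mem_toFinset.1 hl))))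
    obtain ⟨κ, h2, h3⟩ := (h1.and self_mem_nhdsWithin).exists
    exact ⟨κ, h3, h2⟩
  set Vs := decaySub L κ with hVs
  set Vu := decaySub (-L) κ with hVu
  have hdisj : Disjoint Vs Vu := disjoint_decaySub L hκ
  have hs : (⨆ l ∈ f.charpoly.roots.toFinset.filter (fun l : ℂ => l.re < 0),
      f.maxGenEigenspace l) ≤ complexSub Vs := by
    refine iSup₂_le fun l hl => ?_
    rw [Finset.mem_filter] at hl
    have := hκl l hl.1
    rw [abs_of_neg hl.2] at this
    rw [← hfL]
    exact maxGenEigenspace_le_complexSub (by linarith)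
  have hu : (⨆ l ∈ f.charpoly.roots.toFinset.filter (fun l : ℂ => 0 < l.re),
      f.maxGenEigenspace l) ≤ complexSub Vu := by
    refine iSup₂_le fun l hl => ?_
    rw [Finset.mem_filter] at hl
    have h1 := hκl l hl.1
    rw [abs_of_pos hl.2] at h1
    have h2 : complexify ((-L : (ι → ℝ) →L[ℝ] (ι → ℝ)) : (ι → ℝ) →ₗ[ℝ] (ι → ℝ)) = -f := by
      rw [← hfL]
      refine LinearMap.ext fun v => ?_
      ext i
      apply Complex.ext <;> simp [complexify]
    have h3 : f.maxGenEigenspace l ≤ Module.End.maxGenEigenspace (-f) (-l) := by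
      intro v hv
      rw [Module.End.mem_maxGenEigenspace] at hv ⊢
      obtain ⟨k, hk⟩ := hv
      refine ⟨k, ?_⟩
      have : -f - -l • (1 : Module.End ℂ (ι → ℂ)) = (-1 : ℂ) • (f - l • 1) := by
        refine LinearMap.ext fun x => ?_
        simp
        abel
      rw [this, smul_pow, LinearMap.smul_apply, hk, smul_zero]
    refine h3.trans ?_
    rw [← h2]
    exact maxGenEigenspace_le_complexSub (by simpa using h1)
  have htop : (⊤ : Submodule ℂ (ι → ℂ)) ≤
      (⨆ l ∈ f.charpoly.roots.toFinset.filter (fun l : ℂ => l.re < 0), f.maxGenEigenspace l) ⊔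
      (⨆ l ∈ f.charpoly.roots.toFinset.filter (fun l : ℂ => 0 < l.re), f.maxGenEigenspace l) := by
    rw [← Module.End.iSup_maxGenEigenspace_eq_top f]
    refine iSup_le fun l => ?_
    by_cases hl : l ∈ f.charpoly.roots
    · have hl' := hG l (hch ▸ hl)
      rcases lt_or_gt_of_ne hl' with h | h
      · refine le_sup_of_le_left (le_iSup₂_of_le l ?_ le_rfl)
        simpa [h] using hl
      · refine le_sup_of_le_right (le_iSup₂_of_le l ?_ le_rfl)
        simpa [h] using hl
    · have : f.maxGenEigenspace l = ⊥ := by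
        rw [← Submodule.finrank_eq_zero, LinearMap.finrank_maxGenEigenspace_eq,
          ← Polynomial.count_roots, Multiset.count_eq_zero]
        exact hl
      rw [this]; exact bot_le
  have hle1 := Submodule.finrank_mono hs
  have hle2 := Submodule.finrank_mono hu
  rw [finrank_complexSub] at hle1 hle2
  have hb1 := finrank_spectral_le f (fun l : ℂ => l.re < 0)
  have hb2 := finrank_spectral_le f (fun l : ℂ => 0 < l.re)
  rw [hch] at hb1 hb2
  have hsum := numNegRe_add_numPosRe hG
  have hge := (Submodule.finrank_mono htop).trans (Submodule.finrank_add_le_finrank_add_finrank _ _)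
  rw [finrank_top, Module.finrank_fintype_fun_eq_card] at hge
  have hR := Submodule.finrank_add_finrank_le_of_disjoint hdisj
  rw [Module.finrank_fintype_fun_eq_card] at hR
  rw [numNegRe, numPosRe] at hsum
  rw [hch] at hle1 hle2 hge
  have hdim : Module.finrank ℝ Vs = numNegRe G := by
    rw [numNegRe]; omega
  have hcompl : IsCompl Vs Vu := (Submodule.isCompl_iff_disjoint _ _ (by
    rw [Module.finrank_fintype_fun_eq_card]; omega)).2 hdisj
  obtain ⟨C, hC0, hC⟩ := exists_uniform_decaySub L κ
  obtain ⟨D, hD0, hD⟩ := exists_uniform_decaySub (-L) κ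
  set P : (ι → ℝ) →L[ℝ] (ι → ℝ) := (Vs.projection Vu hcompl).toContinuousLinearMap with hP
  have hPa : ∀ x, P x = Vs.projection Vu hcompl x := fun x => rfl
  have hPm : ∀ x, P x ∈ Vs := fun x => Submodule.projection_apply_mem hcompl x
  have hPs : ∀ x, x - P x ∈ Vu := fun x => Submodule.sub_projection_mem hcompl x
  have hP1 : ∀ x ∈ Vs, P x = x := fun x hx => Submodule.projection_apply_of_mem_left hcompl hx
  have hP0 : ∀ x ∈ Vu, P x = 0 := fun x hx => (Submodule.projection_apply_eq_zero_iff hcompl).2 hx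
  have hcomm : ∀ s t : ℝ, ∀ x, NormedSpace.exp (s • L) (NormedSpace.exp (t • L) x) =
      NormedSpace.exp (t • L) (NormedSpace.exp (s • L) x) := fun s t x => by
    rw [← exp_smul_add, ← exp_smul_add, add_comm]
  have hneg : ∀ t : ℝ, t • -L = (-t) • L := fun t =>
    (smul_neg t L).trans (neg_smul t L).symm
  refine ⟨P, fun t => NormedSpace.exp (t • L), C * ‖P‖ + D * (1 + ‖P‖), κ,
    { rate_pos := hκ
      C_nonneg := by positivity
      proj := fun x => hP1 _ (hPm x)
      flow_zero := fun x => by simp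
      flow_add := fun s t x => exp_smul_add L s t x
      flow_deriv := fun t => hasDerivAt_exp_smul_const' L t
      flow_comm := exp_smul_comm L
      flow_proj := fun t x => ?_
      stable := fun t ht x => ?_
      unstable := fun t ht x => ?_ }, ?_⟩
  · have h1 : NormedSpace.exp (t • L) (P x) ∈ Vs := commute_mem_decaySub (fun s y => hcomm s t y) (hPm x)
    have h2 : NormedSpace.exp (t • L) (x - P x) ∈ Vu :=
      commute_mem_decaySub (fun s y => by rw [hneg]; exact hcomm _ t y) (hPs x)
    have h3 : NormedSpace.exp (t • L) x =
        NormedSpace.exp (t • L) (P x) + NormedSpace.exp (t • L) (x - P x) := by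
      rw [← map_add]; simp
    rw [h3, map_add, hP1 _ h1, hP0 _ h2, add_zero]
  · calc _ ≤ C * Real.exp (-κ * t) * ‖P x‖ := hC t ht _ (hPm x)
      _ ≤ C * Real.exp (-κ * t) * (‖P‖ * ‖x‖) := by gcongr; exact P.le_opNorm x
      _ = C * ‖P‖ * (Real.exp (-κ * t) * ‖x‖) := by ring
      _ ≤ (C * ‖P‖ + D * (1 + ‖P‖)) * (Real.exp (-κ * t) * ‖x‖) := by
        gcongr
        have : 0 ≤ D * (1 + ‖P‖) := by positivity
        linarith
      _ = _ := by ring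
  · have h1 := hD t ht _ (hPs x)
    rw [hneg] at h1
    have h2 : ‖x - P x‖ ≤ (1 + ‖P‖) * ‖x‖ := by
      refine (norm_sub_le _ _).trans ?_
      have := P.le_opNorm x
      linarith
    calc _ ≤ D * Real.exp (-κ * t) * ‖x - P x‖ := h1
      _ ≤ D * Real.exp (-κ * t) * ((1 + ‖P‖) * ‖x‖) := by gcongr
      _ = D * (1 + ‖P‖) * (Real.exp (-κ * t) * ‖x‖) := by ring
      _ ≤ (C * ‖P‖ + D * (1 + ‖P‖)) * (Real.exp (-κ * t) * ‖x‖) := by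
        gcongr
        have : 0 ≤ C * ‖P‖ := by positivity
        linarith
      _ = _ := by ring
  · rw [← hdim]
    have : LinearMap.range (P : (ι → ℝ) →ₗ[ℝ] (ι → ℝ)) = Vs := Submodule.range_projection hcompl
    exact congrArg (fun V : Submodule ℝ (ι → ℝ) => Module.finrank ℝ V) this

end Spectral

section RootCounting

variable {ι : Type*} [Fintype ι] [DecidableEq ι]

theorem charpoly_eq_prod_roots (M : Matrix ι ι ℂ) :
    M.charpoly = (M.charpoly.roots.map fun a => Polynomial.X - Polynomial.C a).prod :=
  (IsAlgClosed.splits M.charpoly).eq_prod_roots_of_monic M.charpoly_monic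

theorem card_roots_charpoly (M : Matrix ι ι ℂ) : M.charpoly.roots.card = Fintype.card ι := by
  rw [IsAlgClosed.card_roots_eq_natDegree, Matrix.charpoly_natDegree_eq_dim]

theorem exists_roots_tuple (M : Matrix ι ι ℂ) :
    ∃ r : Fin (Fintype.card ι) → ℂ, M.charpoly.roots = Finset.univ.val.map r := by
  have hl : M.charpoly.roots.toList.length = Fintype.card ι := by
    rw [Multiset.length_toList, card_roots_charpoly]
  refine ⟨fun i => M.charpoly.roots.toList.get (i.cast hl.symm), ?_⟩
  rw [Fin.univ_val_map]
  conv_lhs => rw [← Multiset.coe_toList M.charpoly.roots]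
  congr 1
  refine List.ext_get (by simp [hl]) fun k h1 h2 => ?_
  simp

theorem norm_root_le {M : Matrix ι ι ℂ} {a : ℂ} (ha : a ∈ M.charpoly.roots) :
    ‖a‖ ≤ ∑ i, ∑ j, ‖M i j‖ := by
  have h0 : (Matrix.scalar ι a - M).det = 0 := by
    rw [← Matrix.eval_charpoly]
    exact (Polynomial.mem_roots'.1 ha).2
  obtain ⟨v, hv, hMv⟩ := Matrix.exists_mulVec_eq_zero_iff.2 h0
  have h1 : a • v = M *ᵥ v := by
    have : Matrix.scalar ι a *ᵥ v - M *ᵥ v = 0 := by rw [← Matrix.sub_mulVec]; exact hMv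
    rw [← sub_eq_zero.1 this]
    ext i
    simp [Matrix.scalar_apply, Matrix.mulVec_diagonal]
  have h2 : ‖a‖ * ‖v‖ ≤ (∑ i, ∑ j, ‖M i j‖) * ‖v‖ := by
    rw [← norm_smul, h1]
    refine (pi_norm_le_iff_of_nonneg (by positivity)).2 fun i => ?_
    calc ‖(M *ᵥ v) i‖ ≤ ∑ j, ‖M i j * v j‖ := norm_sum_le _ _
      _ ≤ ∑ j, ‖M i j‖ * ‖v‖ := Finset.sum_le_sum fun j _ => by
        rw [norm_mul]; gcongr; exact norm_le_pi_norm v j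
      _ = (∑ j, ‖M i j‖) * ‖v‖ := (Finset.sum_mul _ _ _).symm
      _ ≤ _ := mul_le_mul_of_nonneg_right (Finset.single_le_sum (f := fun i => ∑ j, ‖M i j‖)
          (fun _ _ => by positivity) (Finset.mem_univ i)) (norm_nonneg _)
  exact le_of_mul_le_mul_right h2 (norm_pos_iff.2 hv)

/-- The number of eigenvalues in an open set is lower semicontinuous. -/
theorem eventually_countP_roots_le {p : ℂ → Prop} [DecidablePred p] (hO : IsOpen {a | p a})
    (M₀ : Matrix ι ι ℂ) :
    ∀ᶠ M in 𝓝 M₀, M₀.charpoly.roots.countP p ≤ M.charpoly.roots.countP p := by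
  have : FirstCountableTopology (Matrix ι ι ℂ) :=
    inferInstanceAs (FirstCountableTopology (ι → ι → ℂ))
  by_contra hcon
  obtain ⟨M, hM, hbad⟩ := Filter.exists_seq_forall_of_frequently
    (Filter.not_eventually.1 hcon)
  choose r hr using fun k => exists_roots_tuple (M k)
  have hcont : Continuous fun M : Matrix ι ι ℂ => ∑ i, ∑ j, ‖M i j‖ := by
    refine continuous_finsetSum _ fun i _ => continuous_finsetSum _ fun j _ => ?_
    exact (continuous_id.matrix_elem i j).norm
  obtain ⟨c, hc⟩ := ((hcont.tendsto M₀).comp hM).isBoundedUnder_le.eventually_le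
  obtain ⟨K, hK⟩ := eventually_atTop.1 hc
  obtain ⟨r₀, -, φ, hφ, hlim⟩ := tendsto_subseq_of_bounded
    (Metric.isBounded_closedBall (x := (0 : Fin (Fintype.card ι) → ℂ)) (r := max c 0))
    (x := fun k => r (k + K)) (fun k => by
      rw [mem_closedBall_zero_iff]
      refine (pi_norm_le_iff_of_nonneg (le_max_right _ _)).2 fun i => ?_
      refine (norm_root_le (M := M (k + K)) ?_).trans ((hK (k + K) (by omega)).trans (le_max_left _ _))
      rw [hr]
      exact Multiset.mem_map_of_mem _ (Finset.mem_univ i))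
  have hMφ : Tendsto (fun k => M (φ k + K)) atTop (𝓝 M₀) :=
    hM.comp ((tendsto_add_atTop_nat K).comp hφ.tendsto_atTop)
  have hprod : ∀ k, (M k).charpoly = ∏ i, (Polynomial.X - Polynomial.C (r k i)) := fun k => by
    rw [charpoly_eq_prod_roots, hr, Multiset.map_map]; rfl
  have hpr : M₀.charpoly = ∏ i, (Polynomial.X - Polynomial.C (r₀ i)) := by
    refine Polynomial.funext fun x => ?_
    have h1 : Tendsto (fun k => (M (φ k + K)).charpoly.eval x) atTop (𝓝 (M₀.charpoly.eval x)) := by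
      simp only [Matrix.eval_charpoly]
      have : Continuous fun M : Matrix ι ι ℂ => (Matrix.scalar ι x - M).det :=
        (continuous_const.sub continuous_id).matrix_det
      exact (this.tendsto M₀).comp hMφ
    have h2 : Tendsto (fun k => (M (φ k + K)).charpoly.eval x) atTop
        (𝓝 ((∏ i, (Polynomial.X - Polynomial.C (r₀ i))).eval x)) := by
      simp only [hprod, Polynomial.eval_prod, Polynomial.eval_sub, Polynomial.eval_X,
        Polynomial.eval_C]
      exact tendsto_finsetProd _ fun i _ => tendsto_const_nhds.sub ((tendsto_pi_nhds.1 hlim) i)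
    exact tendsto_nhds_unique h1 h2
  have hr₀ : M₀.charpoly.roots = Finset.univ.val.map r₀ := by
    rw [hpr]
    have := Polynomial.roots_multiset_prod_X_sub_C (Finset.univ.val.map r₀)
    rwa [Multiset.map_map] at this
  have hev : ∀ᶠ k in atTop, ∀ i, p (r₀ i) → p (r (φ k + K) i) := by
    refine Filter.eventually_all.2 fun i => ?_
    by_cases hi : p (r₀ i)
    · exact (((tendsto_pi_nhds.1 hlim) i).eventually (hO.mem_nhds hi)).mono fun k hk _ => hk
    · exact Eventually.of_forall fun k h => absurd h hi
  obtain ⟨k, hk⟩ := hev.exists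
  refine hbad (φ k + K) ?_
  rw [hr₀, hr, Multiset.countP_map, Multiset.countP_map]
  refine Multiset.card_le_card ?_
  exact Multiset.monotone_filter_right _ fun i hi => hk i hi

theorem roots_charpoly_inv {M : Matrix ι ι ℂ} (hM : M.det ≠ 0) :
    M⁻¹.charpoly.roots = M.charpoly.roots.map (·⁻¹) := by
  set s := M.charpoly.roots with hs
  have hM' : IsUnit M.det := isUnit_iff_ne_zero.2 hM
  have hprod : M.det = s.prod := Matrix.det_eq_prod_roots_charpoly M
  have hs0 : (0 : ℂ) ∉ s := fun h => hM (by rw [hprod]; exact Multiset.prod_eq_zero h)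
  have hcard : s.card = Fintype.card ι := card_roots_charpoly M
  have key : M⁻¹.charpoly = ((s.map (·⁻¹)).map fun a => Polynomial.X - Polynomial.C a).prod := by
    refine Polynomial.eq_of_infinite_eval_eq _ _ (Set.Infinite.mono (s := {0}ᶜ) ?_
      (Set.finite_singleton (0 : ℂ)).infinite_compl)
    intro x hx
    have hx : x ≠ 0 := hx
    change Polynomial.eval x _ = Polynomial.eval x _
    have h1 : Matrix.scalar ι x - M⁻¹ = (-x) • (M⁻¹ * (Matrix.scalar ι x⁻¹ - M)) := by
      rw [mul_sub, Matrix.nonsing_inv_mul _ hM']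
      ext i j
      simp [Matrix.scalar_apply, Matrix.mul_diagonal, Matrix.diagonal_apply, Matrix.one_apply]
      split_ifs
      · field_simp; ring
      · field_simp; ring
    have h2 : (Matrix.scalar ι x⁻¹ - M).det = (s.map fun a => x⁻¹ - a).prod := by
      rw [← Matrix.eval_charpoly, charpoly_eq_prod_roots, Polynomial.eval_multiset_prod,
        Multiset.map_map]
      simp [← hs]
    have h3 : (M⁻¹).det = (s.map (·⁻¹)).prod := by
      rw [Matrix.det_nonsing_inv, hprod, Ring.inverse_eq_inv', Multiset.prod_map_inv]
      simp
    have h4 : (-x) ^ Fintype.card ι = (s.map fun _ => -x).prod := by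
      rw [Multiset.map_const', Multiset.prod_replicate, hcard]
    rw [Matrix.eval_charpoly, h1, Matrix.det_smul, Matrix.det_mul, h2, h3, h4, mul_comm (Multiset.prod (s.map (·⁻¹))),
      ← Multiset.prod_map_mul, ← Multiset.prod_map_mul, Polynomial.eval_multiset_prod,
      Multiset.map_map, Multiset.map_map]
    refine congrArg Multiset.prod (Multiset.map_congr rfl fun a ha => ?_)
    have ha0 : a ≠ 0 := fun h => hs0 (h ▸ ha)
    simp
    field_simp
    ring
  rw [key, Polynomial.roots_multiset_prod_X_sub_C]

theorem roots_charpoly_smul {M : Matrix ι ι ℂ} {c : ℂ} (hc : c ≠ 0) :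
    (c • M).charpoly.roots = M.charpoly.roots.map (c * ·) := by
  set s := M.charpoly.roots with hs
  have key : (c • M).charpoly = ((s.map (c * ·)).map fun a => Polynomial.X - Polynomial.C a).prod := by
    refine Polynomial.funext fun x => ?_
    have h1 : Matrix.scalar ι x - c • M = c • (Matrix.scalar ι (c⁻¹ * x) - M) := by
      ext i j
      simp [Matrix.scalar_apply, Matrix.diagonal_apply]
      split_ifs <;> field_simp
      ring
    have h2 : (Matrix.scalar ι (c⁻¹ * x) - M).det = (s.map fun a => c⁻¹ * x - a).prod := by
      rw [← Matrix.eval_charpoly, charpoly_eq_prod_roots, Polynomial.eval_multiset_prod,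
        Multiset.map_map]
      simp [← hs]
    have h4 : c ^ Fintype.card ι = (s.map fun _ => c).prod := by
      rw [Multiset.map_const', Multiset.prod_replicate, card_roots_charpoly]
    rw [Matrix.eval_charpoly, h1, Matrix.det_smul, h2, h4, ← Multiset.prod_map_mul,
      Polynomial.eval_multiset_prod, Multiset.map_map, Multiset.map_map]
    refine congrArg Multiset.prod (Multiset.map_congr rfl fun a _ => ?_)
    simp
    field_simp
  rw [key, Polynomial.roots_multiset_prod_X_sub_C]

theorem mem_roots_charpoly {M : Matrix ι ι ℂ} {a : ℂ} :
    a ∈ M.charpoly.roots ↔ (Matrix.scalar ι a - M).det = 0 := by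
  rw [Polynomial.mem_roots M.charpoly_monic.ne_zero, Polynomial.IsRoot, Matrix.eval_charpoly]

end RootCounting

section BlockCounting

variable {m n : ℕ}

theorem roots_charpoly_fromBlocks_zero (A₁ : Matrix (Fin m) (Fin m) ℂ)
    (A₂ : Matrix (Fin m) (Fin n) ℂ) :
    (Matrix.fromBlocks A₁ A₂ 0 0 : Matrix (Fin m ⊕ Fin n) (Fin m ⊕ Fin n) ℂ).charpoly.roots =
      A₁.charpoly.roots + n • {0} := by
  have h : (Matrix.fromBlocks A₁ A₂ 0 0 : Matrix (Fin m ⊕ Fin n) (Fin m ⊕ Fin n) ℂ).charpoly =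
      A₁.charpoly * Polynomial.X ^ n := by
    refine Polynomial.funext fun x => ?_
    have h1 : Matrix.scalar (Fin m ⊕ Fin n) x - Matrix.fromBlocks A₁ A₂ 0 0 =
        Matrix.fromBlocks (Matrix.scalar (Fin m) x - A₁) (-A₂) 0 (Matrix.scalar (Fin n) x) := by
      ext i j
      rcases i with i | i <;> rcases j with j | j <;> simp [Matrix.diagonal_apply]
    rw [Polynomial.eval_mul, Matrix.eval_charpoly, Matrix.eval_charpoly, h1,
      Matrix.det_fromBlocks_zero₂₁]
    simp
  rw [h, Polynomial.roots_mul (mul_ne_zero A₁.charpoly_monic.ne_zero (by simp)),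
    Polynomial.roots_X_pow]

theorem exists_lt_norm_of_roots (s : Multiset ℂ) : ∃ ρ > 0, ∀ a ∈ s, a ≠ 0 → ρ < ‖a‖ := by
  classical
  have h1 : ∀ᶠ ρ : ℝ in 𝓝[>] 0, ∀ a ∈ s.toFinset, a ≠ 0 → ρ < ‖a‖ := by
    rw [Filter.eventually_all_finset]
    intro a _
    by_cases ha : a = 0
    · exact Eventually.of_forall fun _ h => absurd ha h
    · exact nhdsWithin_le_nhds ((eventually_lt_nhds (norm_pos_iff.2 ha)).mono fun _ h _ => h)
  obtain ⟨ρ, h2, h3⟩ := (h1.and self_mem_nhdsWithin).exists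
  exact ⟨ρ, h3, fun a ha => h2 a (Multiset.mem_toFinset.2 ha)⟩

theorem isOpen_halfPlane_norm (e ρ : ℝ) : IsOpen {a : ℂ | 0 < e * a.re ∧ ρ < ‖a‖} :=
  (isOpen_lt continuous_const (continuous_const.mul Complex.continuous_re)).inter
    (isOpen_lt continuous_const continuous_norm)

theorem countP_add_nsmul_zero (s : Multiset ℂ) (k : ℕ) (p q : ℂ → Prop) [DecidablePred p]
    [DecidablePred q] (hp : ¬ p 0) (hpq : ∀ a ∈ s, p a ↔ q a) :
    (s + k • {0}).countP p = s.countP q := by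
  rw [Multiset.countP_add, Multiset.countP_nsmul, show ({0} : Multiset ℂ) = 0 ::ₘ 0 from rfl,
    Multiset.countP_cons_of_neg _ hp, Multiset.countP_zero, mul_zero, add_zero]
  exact Multiset.countP_congr rfl fun a ha => propext (hpq a ha)

/-- Combined count of the large and the small eigenvalues of a singularly perturbed family. -/
theorem countP_roots_add_le {K : Matrix (Fin n) (Fin n) ℂ}
    {A N : ℝ → Matrix (Fin m ⊕ Fin n) (Fin m ⊕ Fin n) ℂ} {A₁ : Matrix (Fin m) (Fin m) ℂ}
    {A₂ : Matrix (Fin m) (Fin n) ℂ} {N₀ : Matrix (Fin m ⊕ Fin n) (Fin m ⊕ Fin n) ℂ}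
    (hN : Tendsto N (𝓝[>] 0) (𝓝 N₀))
    (hA : Tendsto A (𝓝[>] 0) (𝓝 (Matrix.fromBlocks A₁ A₂ 0 0)))
    (hN₀ : N₀.charpoly.roots = K.charpoly.roots + m • {0})
    (hK : (0 : ℂ) ∉ K.charpoly.roots) (hA₁ : (0 : ℂ) ∉ A₁.charpoly.roots)
    (hAN : ∀ᶠ t in 𝓝[>] (0 : ℝ), (A t).charpoly.roots =
      (N t).charpoly.roots.map (fun a => (t : ℂ) * a⁻¹)) (e : ℝ) :
    ∀ᶠ t in 𝓝[>] (0 : ℝ), K.charpoly.roots.countP (fun a => 0 < e * a.re) +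
      A₁.charpoly.roots.countP (fun a => 0 < e * a.re) ≤
      (N t).charpoly.roots.countP (fun a => 0 < e * a.re) := by
  obtain ⟨ρ, hρ, hKρ⟩ := exists_lt_norm_of_roots K.charpoly.roots
  obtain ⟨ρ', hρ', hAρ⟩ := exists_lt_norm_of_roots A₁.charpoly.roots
  have h1 := hN.eventually (eventually_countP_roots_le (isOpen_halfPlane_norm e ρ) N₀)
  have h2 := hA.eventually (eventually_countP_roots_le (isOpen_halfPlane_norm e ρ') _)
  have h3 : ∀ᶠ t : ℝ in 𝓝[>] 0, t < ρ * ρ' :=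
    nhdsWithin_le_nhds (eventually_lt_nhds (mul_pos hρ hρ'))
  filter_upwards [h1, h2, h3, hAN, self_mem_nhdsWithin] with t h1 h2 h3 h4 ht
  have ht : 0 < t := ht
  have e1 := countP_add_nsmul_zero K.charpoly.roots m (fun a => 0 < e * a.re ∧ ρ < ‖a‖)
    (fun a => 0 < e * a.re) (by simp) (fun a ha => and_iff_left (hKρ a ha fun h => hK (h ▸ ha)))
  have e2 := countP_add_nsmul_zero A₁.charpoly.roots n (fun a => 0 < e * a.re ∧ ρ' < ‖a‖)
    (fun a => 0 < e * a.re) (by simp) (fun a ha => and_iff_left (hAρ a ha fun h => hA₁ (h ▸ ha)))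
  rw [hN₀] at h1
  rw [roots_charpoly_fromBlocks_zero, h4, Multiset.countP_map] at h2
  set s := (N t).charpoly.roots with hs
  rw [Multiset.countP_eq_countP_filter_add s (fun a => 0 < e * a.re) (fun a => ρ < ‖a‖)]
  refine add_le_add ((e1.symm.le.trans h1).trans_eq ?_) ((e2.symm.le.trans h2).trans ?_)
  · rw [Multiset.countP_filter]
  · rw [Multiset.countP_filter, Multiset.countP_eq_card_filter]
    refine Multiset.card_le_card (Multiset.monotone_filter_right _ fun a ha => ?_)
    obtain ⟨ha1, ha2⟩ := ha
    have ha0 : a ≠ 0 := by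
      rintro rfl
      simp at ha1
    have hn : 0 < Complex.normSq a := Complex.normSq_pos.2 ha0
    have hre : ((t : ℂ) * a⁻¹).re = t * (a.re / Complex.normSq a) := by simp
    rw [hre] at ha1
    refine ⟨?_, ?_⟩
    · have : e * (t * (a.re / Complex.normSq a)) = (t / Complex.normSq a) * (e * a.re) := by ring
      rw [this] at ha1
      exact (mul_pos_iff_of_pos_left (by positivity)).1 ha1
    · intro h
      rw [norm_mul, norm_inv, Complex.norm_real, Real.norm_of_nonneg ht.le, ← div_eq_mul_inv,
        lt_div_iff₀ (norm_pos_iff.2 ha0)] at ha2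
      nlinarith

theorem countP_pos_add_neg {s : Multiset ℂ} (hs : ∀ a ∈ s, a.re ≠ 0) :
    s.countP (fun a => 0 < 1 * a.re) + s.countP (fun a => 0 < -1 * a.re) = s.card := by
  rw [Multiset.card_eq_countP_add_countP (fun a : ℂ => 0 < 1 * a.re)]
  congr 1
  refine Multiset.countP_congr rfl fun a ha => ?_
  have := hs a ha
  simp only [one_mul, neg_mul, Left.neg_pos_iff, not_lt, eq_iff_iff]
  exact ⟨fun h => h.le, fun h => lt_of_le_of_ne h this⟩

/-- The number of eigenvalues with positive real part is constant along a path of matrices without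
imaginary eigenvalues. -/
theorem countP_roots_eq_of_path {ι : Type*} [Fintype ι] [DecidableEq ι] {N : ℝ → Matrix ι ι ℂ}
    (hN : Continuous N) {S : Set ℝ} (hS : IsPreconnected S)
    (him : ∀ t ∈ S, ∀ a ∈ (N t).charpoly.roots, a.re ≠ 0) {t t' : ℝ} (ht : t ∈ S) (ht' : t' ∈ S) :
    (N t).charpoly.roots.countP (fun a => 0 < 1 * a.re) =
      (N t').charpoly.roots.countP (fun a => 0 < 1 * a.re) := by
  refine hS.constant (f := fun t => (N t).charpoly.roots.countP (fun a => 0 < 1 * a.re))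
    (fun t ht => ?_) ht ht'
  have hO : ∀ e : ℝ, IsOpen {a : ℂ | 0 < e * a.re} := fun e =>
    isOpen_lt continuous_const (continuous_const.mul Complex.continuous_re)
  have h1 := (hN.tendsto t).eventually (eventually_countP_roots_le (hO 1) (N t))
  have h2 := (hN.tendsto t).eventually (eventually_countP_roots_le (hO (-1)) (N t))
  rw [ContinuousWithinAt, nhds_discrete, tendsto_pure]
  filter_upwards [nhdsWithin_le_nhds h1, nhdsWithin_le_nhds h2, self_mem_nhdsWithin] with t' h1 h2 ht'
  have e1 := countP_pos_add_neg (him t ht)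
  have e2 := countP_pos_add_neg (him t' ht')
  rw [card_roots_charpoly] at e1 e2
  have h1' : (N t).charpoly.roots.countP (fun a => 0 < 1 * a.re) ≤
      (N t').charpoly.roots.countP (fun a => 0 < 1 * a.re) := h1
  have h2' : (N t).charpoly.roots.countP (fun a => 0 < -1 * a.re) ≤
      (N t').charpoly.roots.countP (fun a => 0 < -1 * a.re) := h2
  omega

/-- Count of the stable eigenvalues of the pencil of a hyperbolic-parabolic system. -/
theorem count_pencil {A : Matrix (Fin m ⊕ Fin n) (Fin m ⊕ Fin n) ℂ}
    {A₁ : Matrix (Fin m) (Fin m) ℂ} {A₂ : Matrix (Fin m) (Fin n) ℂ} {A₃ : Matrix (Fin n) (Fin m) ℂ}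
    {A₄ b K : Matrix (Fin n) (Fin n) ℂ} (hAb : A = Matrix.fromBlocks A₁ A₂ A₃ A₄)
    (hA : A.det ≠ 0) (hAreal : ∀ a ∈ A.charpoly.roots, a.im = 0)
    (hA₁ : ∀ a ∈ A₁.charpoly.roots, a.re ≠ 0)
    (hb : ∀ s : ℝ, 0 ≤ s → (b + (s : ℂ) • (1 : Matrix (Fin n) (Fin n) ℂ)).det ≠ 0)
    (hpar : ∀ x : ℝ, x ≠ 0 → ∀ s : ℝ, 0 ≤ s → ((Complex.I * x) • A +
      ((x ^ 2 : ℝ) : ℂ) • Matrix.fromBlocks 0 0 0 b + (s : ℂ) • 1).det ≠ 0)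
    (hK : (A⁻¹ * Matrix.fromBlocks 0 0 0 b).charpoly.roots = K.charpoly.roots + m • {0})
    (hK0 : (0 : ℂ) ∉ K.charpoly.roots) :
    (∀ a ∈ K.charpoly.roots, a.re ≠ 0) ∧
    K.charpoly.roots.countP (fun a => 0 < -1 * a.re) +
      A.charpoly.roots.countP (fun a => 0 < 1 * a.re) =
      A₁.charpoly.roots.countP (fun a => 0 < 1 * a.re) + n := by
  have hAu : IsUnit A.det := isUnit_iff_ne_zero.2 hA
  set B : Matrix (Fin m ⊕ Fin n) (Fin m ⊕ Fin n) ℂ := Matrix.fromBlocks 0 0 0 b with hB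
  set β : ℝ → Matrix (Fin n) (Fin n) ℂ := fun t => ((1 - t : ℝ) : ℂ) • b + (t : ℂ) • 1 with hβ
  set R : ℝ → Matrix (Fin m ⊕ Fin n) (Fin m ⊕ Fin n) ℂ :=
    fun t => ((1 - t : ℝ) : ℂ) • B + (t : ℂ) • 1 with hR
  set N : ℝ → Matrix (Fin m ⊕ Fin n) (Fin m ⊕ Fin n) ℂ := fun t => A⁻¹ * R t with hN
  have hRβ : ∀ t, R t = Matrix.fromBlocks ((t : ℂ) • 1) 0 0 (β t) := fun t => by
    rw [hR, hB, hβ]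
    simp only
    rw [← Matrix.fromBlocks_one, Matrix.fromBlocks_smul, Matrix.fromBlocks_smul, Matrix.fromBlocks_add]
    simp
  have hβdet : ∀ t ∈ Icc (0 : ℝ) 1, (β t).det ≠ 0 := fun t ht => by
    rcases ht.2.lt_or_eq with h | h
    · have h1 : (0 : ℝ) < 1 - t := by linarith
      have h2 : β t = ((1 - t : ℝ) : ℂ) • (b + ((t / (1 - t) : ℝ) : ℂ) • 1) := by
        rw [hβ, smul_add, smul_smul, ← Complex.ofReal_mul, mul_div_cancel₀ _ h1.ne']
      rw [h2, Matrix.det_smul]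
      exact mul_ne_zero (pow_ne_zero _ (Complex.ofReal_ne_zero.2 h1.ne'))
        (hb _ (div_nonneg ht.1 h1.le))
    · subst h; simp [hβ]
  have hRc : Continuous R := by
    exact ((Complex.continuous_ofReal.comp (continuous_const.sub continuous_id)).smul
      continuous_const).add (Complex.continuous_ofReal.smul continuous_const)
  have hβc : Continuous β := by
    exact ((Complex.continuous_ofReal.comp (continuous_const.sub continuous_id)).smul
      continuous_const).add (Complex.continuous_ofReal.smul continuous_const)
  have hNc : Continuous N := continuous_const.matrix_mul hRc
  have hNdet : ∀ t ∈ Ioc (0 : ℝ) 1, (N t).det ≠ 0 := fun t ht => by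
    rw [hN, Matrix.det_mul, hRβ, Matrix.det_fromBlocks_zero₂₁, Matrix.det_nonsing_inv,
      Ring.inverse_eq_inv']
    refine mul_ne_zero (inv_ne_zero hA) (mul_ne_zero ?_ (hβdet t ⟨ht.1.le, ht.2⟩))
    rw [Matrix.det_smul]
    simpa using fun h => absurd h ht.1.ne'
  have hN1 : N 1 = A⁻¹ := by simp [hN, hR]
  have him : ∀ t ∈ Icc (0 : ℝ) 1, ∀ a ∈ (N t).charpoly.roots, a ≠ 0 → a.re ≠ 0 := by
    intro t ht a ha ha0 hre
    set y := a.im with hy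
    have hay : a = Complex.I * y := by apply Complex.ext <;> simp [hre, hy]
    have hy0 : y ≠ 0 := fun h => ha0 (by rw [hay, h]; simp)
    rcases ht.2.lt_or_eq with h | h
    · have h1 : (0 : ℝ) < 1 - t := by linarith
      rw [mem_roots_charpoly] at ha
      set r := (1 - t) / y ^ 2 with hr
      have hr0 : 0 < r := by positivity
      refine hpar (-(r * y)) (neg_ne_zero.2 (mul_ne_zero hr0.ne' hy0)) (r * t)
        (mul_nonneg hr0.le ht.1) ?_
      have h2 : (Complex.I * ((-(r * y) : ℝ) : ℂ)) • A + (((-(r * y)) ^ 2 : ℝ) : ℂ) • B +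
          ((r * t : ℝ) : ℂ) • (1 : Matrix (Fin m ⊕ Fin n) (Fin m ⊕ Fin n) ℂ) =
          (-(r : ℂ)) • (A * (Matrix.scalar _ a - N t)) := by
        have h3 : (-(r * y)) ^ 2 = r * (1 - t) := by rw [hr]; field_simp
        have h4 : A * Matrix.scalar (Fin m ⊕ Fin n) a = a • A := by
          ext i j
          simp [Matrix.scalar_apply, Matrix.mul_diagonal, mul_comm]
        rw [mul_sub, hN, Matrix.mul_nonsing_inv_cancel_left _ _ hAu, h3, h4, hR, hay]
        simp only [smul_sub, smul_add, smul_smul]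
        push_cast
        module
      rw [h2, Matrix.det_smul, Matrix.det_mul, ha]
      simp
    · subst h
      rw [hN1, roots_charpoly_inv hA, Multiset.mem_map] at ha
      obtain ⟨c, hc, hca⟩ := ha
      have hc' : c = a⁻¹ := by rw [← hca, inv_inv]
      have := hAreal c hc
      rw [hc', Complex.inv_im] at this
      have hn : Complex.normSq a ≠ 0 := (Complex.normSq_pos.2 ha0).ne'
      have : -a.im = 0 := by simpa [hn] using this
      exact hy0 (by rw [hy]; linarith)
  have hN0 : N 0 = A⁻¹ * B := by simp [hN, hR]
  have hKre : ∀ a ∈ K.charpoly.roots, a.re ≠ 0 := fun a ha => by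
    refine him 0 ⟨le_rfl, zero_le_one⟩ a ?_ fun h => hK0 (h ▸ ha)
    rw [hN0, hK]
    exact Multiset.mem_add.2 (Or.inl ha)
  refine ⟨hKre, ?_⟩
  have hNre : ∀ t ∈ Ioc (0 : ℝ) 1, ∀ a ∈ (N t).charpoly.roots, a.re ≠ 0 := fun t ht a ha => by
    refine him t ⟨ht.1.le, ht.2⟩ a ha ?_
    rintro rfl
    refine hNdet t ht ?_
    rw [Matrix.det_eq_prod_roots_charpoly]
    exact Multiset.prod_eq_zero ha
  set Q : ℝ → Matrix (Fin m ⊕ Fin n) (Fin m ⊕ Fin n) ℂ :=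
    fun t => Matrix.fromBlocks 1 0 0 ((t : ℂ) • (β t)⁻¹) * A with hQ
  have hQN : ∀ t ∈ Ioc (0 : ℝ) 1, Q t = (t : ℂ) • (N t)⁻¹ := fun t ht => by
    have hβu : IsUnit (β t).det := isUnit_iff_ne_zero.2 (hβdet t ⟨ht.1.le, ht.2⟩)
    have ht0 : (t : ℂ) ≠ 0 := Complex.ofReal_ne_zero.2 ht.1.ne'
    have h1 : N t * ((t : ℂ)⁻¹ • Q t) = 1 := by
      have h2 : R t * Matrix.fromBlocks 1 0 0 ((t : ℂ) • (β t)⁻¹) = (t : ℂ) • 1 := by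
        rw [hRβ, Matrix.fromBlocks_multiply, ← Matrix.fromBlocks_one, Matrix.fromBlocks_smul]
        simp [Matrix.mul_nonsing_inv _ hβu]
      rw [Matrix.mul_smul, hN, hQ]
      simp only
      rw [Matrix.mul_assoc, ← Matrix.mul_assoc (R t), h2, Matrix.smul_mul, Matrix.one_mul,
        Matrix.mul_smul, smul_smul, inv_mul_cancel₀ ht0, one_smul, Matrix.nonsing_inv_mul _ hAu]
    rw [Matrix.inv_eq_right_inv h1, smul_smul, mul_inv_cancel₀ ht0, one_smul]
  have hQlim : Tendsto Q (𝓝[>] 0) (𝓝 (Matrix.fromBlocks A₁ A₂ 0 0)) := by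
    have h1 : Tendsto (fun t : ℝ => (t : ℂ) • (β t)⁻¹) (𝓝[>] 0) (𝓝 0) := by
      have h2 : Tendsto (fun t : ℝ => (t : ℂ) • ((β t).det⁻¹ • (β t).adjugate)) (𝓝 0)
          (𝓝 (((0 : ℝ) : ℂ) • ((β 0).det⁻¹ • (β 0).adjugate))) :=
        (Complex.continuous_ofReal.tendsto 0).smul
          (((hβc.matrix_det.tendsto 0).inv₀ (hβdet 0 ⟨le_rfl, zero_le_one⟩)).smul
            (hβc.matrix_adjugate.tendsto 0))
      rw [Complex.ofReal_zero, zero_smul] at h2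
      refine (h2.mono_left nhdsWithin_le_nhds).congr fun t => ?_
      rw [Matrix.inv_def, Ring.inverse_eq_inv']
    have hcont : Continuous fun X : Matrix (Fin n) (Fin n) ℂ =>
        (Matrix.fromBlocks 1 0 0 X : Matrix (Fin m ⊕ Fin n) (Fin m ⊕ Fin n) ℂ) * A :=
      (continuous_const.matrix_fromBlocks continuous_const continuous_const
        continuous_id).matrix_mul continuous_const
    have h3 := (hcont.tendsto 0).comp h1
    convert! h3 using 2
    rw [hAb, Matrix.fromBlocks_multiply]
    simp
  have hA₁0 : (0 : ℂ) ∉ A₁.charpoly.roots := fun h => hA₁ 0 h rfl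
  have hcmp := fun e : ℝ => countP_roots_add_le (K := K) ((hNc.tendsto 0).mono_left nhdsWithin_le_nhds)
    hQlim (by rw [hN0, hK]) hK0 hA₁0 (by
      filter_upwards [Ioc_mem_nhdsGT (zero_lt_one' ℝ)] with t ht
      rw [hQN t ht, roots_charpoly_smul (Complex.ofReal_ne_zero.2 ht.1.ne'),
        roots_charpoly_inv (hNdet t ht), Multiset.map_map]
      rfl) e
  obtain ⟨t, ⟨hp, hn⟩, ht⟩ := (((hcmp 1).and (hcmp (-1))).and
    (Ioc_mem_nhdsGT (zero_lt_one' ℝ))).exists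
  have e1 := countP_pos_add_neg (hNre t ht)
  have e2 := countP_pos_add_neg hKre
  have e3 := countP_pos_add_neg hA₁
  rw [card_roots_charpoly] at e1 e2 e3
  simp only [Fintype.card_sum, Fintype.card_fin] at e1 e2 e3
  have e4 := countP_roots_eq_of_path hNc isPreconnected_Ioc hNre ht (right_mem_Ioc.2 zero_lt_one)
  have hA0 : (0 : ℂ) ∉ A.charpoly.roots := fun h => hA (by
    rw [Matrix.det_eq_prod_roots_charpoly]; exact Multiset.prod_eq_zero h)
  have e5 : (N 1).charpoly.roots.countP (fun a => 0 < 1 * a.re) =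
      A.charpoly.roots.countP (fun a => 0 < 1 * a.re) := by
    rw [hN1, roots_charpoly_inv hA, Multiset.countP_map, ← Multiset.countP_eq_card_filter]
    refine Multiset.countP_congr rfl fun a ha => ?_
    have ha0 : a ≠ 0 := fun h => hA0 (h ▸ ha)
    have hn : 0 < Complex.normSq a := Complex.normSq_pos.2 ha0
    simp [hn]
  omega

end BlockCounting

theorem dz_eq {F : Type*} [NormedAddCommGroup F] [NormedSpace ℝ F] {f : ℝ → F} {f' : F} {z : ℝ}
    (hz : z ∈ Ici (0 : ℝ)) (h : HasDerivWithinAt f f' (Ici 0) z) : dz f z = f' :=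
  h.derivWithin (uniqueDiffOn_Ici 0 z hz)

theorem hasDerivWithinAt_dz {F : Type*} [NormedAddCommGroup F] [NormedSpace ℝ F] {f : ℝ → F}
    (h : ContDiffOn ℝ ∞ f (Ici 0)) {z : ℝ} (hz : z ∈ Ici (0 : ℝ)) :
    HasDerivWithinAt f (dz f z) (Ici 0) z :=
  (h.differentiableOn (by simp) z hz).hasDerivWithinAt

theorem contDiffOn_dz {F : Type*} [NormedAddCommGroup F] [NormedSpace ℝ F] {f : ℝ → F}
    (h : ContDiffOn ℝ ∞ f (Ici 0)) : ContDiffOn ℝ ∞ (dz f) (Ici 0) :=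
  h.derivWithin (uniqueDiffOn_Ici 0) (by simp)

section MulVec

variable {X α β : Type*} [NormedAddCommGroup X] [NormedSpace ℝ X] [Fintype α] [Fintype β]

theorem ContDiffOn.mulVec {k : ℕ∞ω} {A : X → Matrix α β ℝ} {v : X → β → ℝ} {s : Set X}
    (hA : ∀ i j, ContDiffOn ℝ k (fun x => A x i j) s) (hv : ContDiffOn ℝ k v s) :
    ContDiffOn ℝ k (fun x => A x *ᵥ v x) s := by
  rw [contDiffOn_pi]
  intro i
  exact ContDiffOn.sum fun j _ => (hA i j).mul (contDiffOn_pi.1 hv j)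

theorem hasDerivAt_mulVec {A : ℝ → Matrix α β ℝ} {A' : Matrix α β ℝ} {v : ℝ → β → ℝ} {v' : β → ℝ}
    {t : ℝ} (hA : ∀ i j, HasDerivAt (fun t => A t i j) (A' i j) t) (hv : HasDerivAt v v' t) :
    HasDerivAt (fun t => A t *ᵥ v t) (A' *ᵥ v t + A t *ᵥ v') t := by
  rw [hasDerivAt_pi]
  intro i
  have h := HasDerivAt.fun_sum fun j (_ : j ∈ Finset.univ) =>
    (hA i j).mul ((hasDerivAt_pi.1 hv) j)
  convert! h using 1
  simp [Matrix.mulVec, dotProduct, Finset.sum_add_distrib]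

end MulVec

section Components

variable {m n : ℕ}

/-- The projection `u ↦ u¹`. -/
noncomputable def comp1L (m n : ℕ) : State m n →L[ℝ] (Fin m → ℝ) :=
  ContinuousLinearMap.pi fun i => ContinuousLinearMap.proj (Sum.inl i)

/-- The projection `u ↦ u²`. -/
noncomputable def comp2L (m n : ℕ) : State m n →L[ℝ] (Fin n → ℝ) :=
  ContinuousLinearMap.pi fun i => ContinuousLinearMap.proj (Sum.inr i)

theorem comp2L_apply (u : State m n) : comp2L m n u = comp2 u := rfl

theorem comp1_add (u v : State m n) : comp1 (u + v) = comp1 u + comp1 v := rfl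
theorem comp2_add (u v : State m n) : comp2 (u + v) = comp2 u + comp2 v := rfl
theorem comp1_sub (u v : State m n) : comp1 (u - v) = comp1 u - comp1 v := rfl
theorem comp2_sub (u v : State m n) : comp2 (u - v) = comp2 u - comp2 v := rfl

theorem state_ext {u v : State m n} (h1 : comp1 u = comp1 v) (h2 : comp2 u = comp2 v) : u = v := by
  ext i
  rcases i with i | i
  · exact congrFun h1 i
  · exact congrFun h2 i

theorem comp1_mulVec_eq_zero {B : BMat m n} (h11 : B.toBlocks₁₁ = 0) (h12 : B.toBlocks₁₂ = 0)
    (v : State m n) : comp1 (B *ᵥ v) = 0 := by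
  ext i
  have e1 : ∀ j, B (Sum.inl i) (Sum.inl j) = 0 := fun j => congrFun (congrFun h11 i) j
  have e2 : ∀ j, B (Sum.inl i) (Sum.inr j) = 0 := fun j => congrFun (congrFun h12 i) j
  simp [comp1, Matrix.mulVec, dotProduct, Fintype.sum_sum_type, e1, e2]

end Components

section Reduction

variable {m n : ℕ}

/-- The right-hand side of the system `w' = H(w) y`, `y' = G(w) y`. -/
def reducedField (H : State m n → (Fin n → ℝ) →L[ℝ] State m n)
    (G : State m n → (Fin n → ℝ) →L[ℝ] (Fin n → ℝ)) (x : State m n × (Fin n → ℝ)) :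
    State m n × (Fin n → ℝ) := (H x.1 x.2, G x.1 x.2)

/-- On `O`, the profile equation `A(w) w' = (B(w) w')'` is equivalent to the first-order system
with coefficients `H` and `G`. -/
structure IsReduction (A B : State m n → BMat m n) (O : Set (State m n))
    (H : State m n → (Fin n → ℝ) →L[ℝ] State m n)
    (G : State m n → (Fin n → ℝ) →L[ℝ] (Fin n → ℝ)) : Prop where
  isOpen : IsOpen O
  smooth_A : ∀ i j, ContDiffOn ℝ ∞ (fun w => A w i j) O
  smooth_B : ∀ i j, ContDiffOn ℝ ∞ (fun w => B w i j) O
  block_B : ∀ w ∈ O, (B w).toBlocks₁₁ = 0 ∧ (B w).toBlocks₁₂ = 0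
  smooth_H : ContDiff ℝ ∞ H
  smooth_G : ContDiff ℝ ∞ G
  comp1_H : ∀ w ∈ O, ∀ y, comp1 (A w *ᵥ H w y) = 0
  comp2_H : ∀ w ∈ O, ∀ y, comp2 (B w *ᵥ H w y) = y
  G_eq : ∀ w ∈ O, ∀ y, G w y = comp2 (A w *ᵥ H w y)
  inj : ∀ w ∈ O, ∀ v, comp1 (A w *ᵥ v) = 0 → comp2 (B w *ᵥ v) = 0 → v = 0

theorem reducedField_fderiv {H : State m n → (Fin n → ℝ) →L[ℝ] State m n}
    {G : State m n → (Fin n → ℝ) →L[ℝ] (Fin n → ℝ)} (hH : ContDiff ℝ ∞ H) (hG : ContDiff ℝ ∞ G)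
    (x v : State m n × (Fin n → ℝ)) : fderiv ℝ (reducedField H G) x v =
      (H x.1 v.2 + fderiv ℝ H x.1 v.1 x.2, G x.1 v.2 + fderiv ℝ G x.1 v.1 x.2) := by
  have h1 := ((hH.differentiable (by simp) x.1).hasFDerivAt.comp x
    (hasFDerivAt_fst (𝕜 := ℝ) (p := x))).clm_apply (hasFDerivAt_snd (𝕜 := ℝ) (p := x))
  have h2 := ((hG.differentiable (by simp) x.1).hasFDerivAt.comp x
    (hasFDerivAt_fst (𝕜 := ℝ) (p := x))).clm_apply (hasFDerivAt_snd (𝕜 := ℝ) (p := x))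
  have h3 : HasFDerivAt (reducedField H G) _ x := h1.prodMk h2
  rw [h3.fderiv]
  simp

namespace IsReduction

variable {A B : State m n → BMat m n} {O : Set (State m n)}
  {H : State m n → (Fin n → ℝ) →L[ℝ] State m n} {G : State m n → (Fin n → ℝ) →L[ℝ] (Fin n → ℝ)}

theorem comp1_B (h : IsReduction A B O H G) {w : State m n} (hw : w ∈ O) (v : State m n) :
    comp1 (B w *ᵥ v) = 0 := comp1_mulVec_eq_zero (h.block_B w hw).1 (h.block_B w hw).2 v

theorem eq_H (h : IsReduction A B O H G) {w : State m n} (hw : w ∈ O) {v : State m n}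
    (hv : comp1 (A w *ᵥ v) = 0) : v = H w (comp2 (B w *ᵥ v)) := by
  refine sub_eq_zero.1 (h.inj w hw _ ?_ ?_)
  · rw [Matrix.mulVec_sub, comp1_sub, hv, h.comp1_H w hw, sub_zero]
  · rw [Matrix.mulVec_sub, comp2_sub, h.comp2_H w hw, sub_self]

theorem hasDerivAt_line {M : State m n → BMat m n} (hO : IsOpen O)
    (hM : ∀ i j, ContDiffOn ℝ ∞ (fun w => M w i j) O) {w : State m n} (hw : w ∈ O)
    (v : State m n) (i j : Fin m ⊕ Fin n) :
    HasDerivAt (fun t : ℝ => M (w + t • v) i j) (dMat M w v i j) 0 := by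
  have h1 : HasFDerivAt (fun w => M w i j) (fderiv ℝ (fun w => M w i j) w) (w + (0 : ℝ) • v) := by
    rw [zero_smul, add_zero]
    exact (((hM i j).contDiffAt (hO.mem_nhds hw)).differentiableAt (by simp)).hasFDerivAt
  have h2 : HasDerivAt (fun t : ℝ => w + t • v) v 0 := by
    simpa using ((hasDerivAt_id (0 : ℝ)).smul_const v).const_add w
  exact h1.comp_hasDerivAt 0 h2

theorem hasDerivAt_line_clm {V : Type*} [NormedAddCommGroup V] [NormedSpace ℝ V]
    {M : State m n → V} (hM : ContDiff ℝ ∞ M) (w v : State m n) :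
    HasDerivAt (fun t : ℝ => M (w + t • v)) (fderiv ℝ M w v) 0 := by
  have h1 : HasFDerivAt M (fderiv ℝ M w) (w + (0 : ℝ) • v) := by
    rw [zero_smul, add_zero]
    exact (hM.differentiable (by simp) w).hasFDerivAt
  have h2 : HasDerivAt (fun t : ℝ => w + t • v) v 0 := by
    simpa using ((hasDerivAt_id (0 : ℝ)).smul_const v).const_add w
  exact h1.comp_hasDerivAt 0 h2

theorem eventually_line (hO : IsOpen O) {w : State m n} (hw : w ∈ O) (v : State m n) :
    ∀ᶠ t : ℝ in 𝓝 0, w + t • v ∈ O := by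
  have : Continuous fun t : ℝ => w + t • v := by fun_prop
  exact this.continuousAt.eventually (hO.mem_nhds (by simpa using hw))

theorem hasDerivAt_line_mulVec (h : IsReduction A B O H G) {M : State m n → BMat m n}
    (hM : ∀ i j, ContDiffOn ℝ ∞ (fun w => M w i j) O) {w : State m n} (hw : w ∈ O)
    (v : State m n) (y : Fin n → ℝ) :
    HasDerivAt (fun t : ℝ => M (w + t • v) *ᵥ H (w + t • v) y)
      (dMat M w v *ᵥ H w y + M w *ᵥ fderiv ℝ H w v y) 0 := by
  have := hasDerivAt_mulVec (fun i j => hasDerivAt_line h.isOpen hM hw v i j)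
    ((hasDerivAt_line_clm h.smooth_H w v).clm_apply (hasDerivAt_const 0 y))
  simpa using this

theorem comp1_deriv (h : IsReduction A B O H G) {w : State m n} (hw : w ∈ O) (v : State m n)
    (y : Fin n → ℝ) : comp1 (dMat A w v *ᵥ H w y + A w *ᵥ fderiv ℝ H w v y) = 0 := by
  have h1 := (comp1L m n).hasFDerivAt.comp_hasDerivAt 0 (h.hasDerivAt_line_mulVec h.smooth_A hw v y)
  refine h1.unique ((hasDerivAt_const (0 : ℝ) (0 : Fin m → ℝ)).congr_of_eventuallyEq ?_)
  filter_upwards [eventually_line h.isOpen hw v] with t ht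
  exact h.comp1_H _ ht y

theorem comp2_deriv (h : IsReduction A B O H G) {w : State m n} (hw : w ∈ O) (v : State m n)
    (y : Fin n → ℝ) : comp2 (dMat B w v *ᵥ H w y + B w *ᵥ fderiv ℝ H w v y) = 0 := by
  have h1 := (comp2L m n).hasFDerivAt.comp_hasDerivAt 0 (h.hasDerivAt_line_mulVec h.smooth_B hw v y)
  refine h1.unique ((hasDerivAt_const (0 : ℝ) y).congr_of_eventuallyEq ?_)
  filter_upwards [eventually_line h.isOpen hw v] with t ht
  exact h.comp2_H _ ht y

theorem fderiv_G (h : IsReduction A B O H G) {w : State m n} (hw : w ∈ O) (v : State m n)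
    (y : Fin n → ℝ) :
    fderiv ℝ G w v y = comp2 (dMat A w v *ᵥ H w y + A w *ᵥ fderiv ℝ H w v y) := by
  have h1 := (comp2L m n).hasFDerivAt.comp_hasDerivAt 0 (h.hasDerivAt_line_mulVec h.smooth_A hw v y)
  have h2 := (hasDerivAt_line_clm h.smooth_G w v).clm_apply (hasDerivAt_const 0 y)
  refine Eq.trans ?_ ((h1.congr_of_eventuallyEq ?_).unique h2).symm
  · simp
  · filter_upwards [eventually_line h.isOpen hw v] with t ht
    exact h.G_eq _ ht y

theorem comp1_dMat_B (h : IsReduction A B O H G) {w : State m n} (hw : w ∈ O) (v u : State m n) :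
    comp1 (dMat B w v *ᵥ u) = 0 := by
  have key : ∀ i j, (∀ w ∈ O, B w i j = 0) → dMat B w v i j = 0 := fun i j hz => by
    refine (hasDerivAt_line h.isOpen h.smooth_B hw v i j).unique
      ((hasDerivAt_const (0 : ℝ) (0 : ℝ)).congr_of_eventuallyEq ?_)
    filter_upwards [eventually_line h.isOpen hw v] with t ht using hz _ ht
  refine comp1_mulVec_eq_zero ?_ ?_ u
  · ext i j
    exact key _ _ fun w hw => congrFun (congrFun (h.block_B w hw).1 i) j
  · ext i j
    exact key _ _ fun w hw => congrFun (congrFun (h.block_B w hw).2 i) j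

theorem firstOrder_of_profile (h : IsReduction A B O H G) {w : ℝ → State m n}
    (hw : ContDiffOn ℝ ∞ w (Ici 0)) (hO : ∀ z ∈ Ici (0 : ℝ), w z ∈ O)
    (heq : ∀ z ∈ Ici (0 : ℝ), A (w z) *ᵥ dz w z - dz (fun s => B (w s) *ᵥ dz w s) z = 0) :
    ∀ z ∈ Ici (0 : ℝ), dz w z = H (w z) (comp2 (B (w z) *ᵥ dz w z)) ∧
      HasDerivWithinAt (fun z => (w z, comp2 (B (w z) *ᵥ dz w z)))
        (reducedField H G (w z, comp2 (B (w z) *ᵥ dz w z))) (Ici 0) z := by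
  intro z hz
  have hS : ContDiffOn ℝ ∞ (fun s => B (w s) *ᵥ dz w s) (Ici 0) :=
    ContDiffOn.mulVec (fun i j => (h.smooth_B i j).comp hw hO) (contDiffOn_dz hw)
  have hS' := hasDerivWithinAt_dz hS hz
  rw [← sub_eq_zero.1 (heq z hz)] at hS'
  have h1 : comp1 (A (w z) *ᵥ dz w z) = 0 := by
    have e1 := (comp1L m n).hasFDerivAt.comp_hasDerivWithinAt z hS'
    refine (uniqueDiffOn_Ici (0 : ℝ) z hz).eq_deriv _ e1 ?_
    refine (hasDerivWithinAt_const z (Ici 0) (0 : Fin m → ℝ)).congr (fun s hs => ?_) ?_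
    · exact h.comp1_B (hO s hs) _
    · exact h.comp1_B (hO z hz) _
  have h2 := h.eq_H (hO z hz) h1
  refine ⟨h2, HasDerivWithinAt.prodMk ?_ ?_⟩
  · rw [← h2]; exact hasDerivWithinAt_dz hw hz
  · change HasDerivWithinAt _ (G (w z) (comp2 (B (w z) *ᵥ dz w z))) _ _
    rw [h.G_eq _ (hO z hz), ← h2]
    exact (comp2L m n).hasFDerivAt.comp_hasDerivWithinAt z hS'

theorem profile_of_firstOrder (h : IsReduction A B O H G) {x : ℝ → State m n × (Fin n → ℝ)}
    (hO : ∀ z ∈ Ici (0 : ℝ), (x z).1 ∈ O)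
    (hx : ∀ z ∈ Ici (0 : ℝ), HasDerivWithinAt x (reducedField H G (x z)) (Ici 0) z) :
    ∀ z ∈ Ici (0 : ℝ), dz (fun z => (x z).1) z = H (x z).1 (x z).2 ∧
      comp2 (B (x z).1 *ᵥ dz (fun z => (x z).1) z) = (x z).2 ∧
      A (x z).1 *ᵥ dz (fun z => (x z).1) z -
        dz (fun s => B (x s).1 *ᵥ dz (fun z => (x z).1) s) z = 0 := by
  have h1 : ∀ z ∈ Ici (0 : ℝ), dz (fun z => (x z).1) z = H (x z).1 (x z).2 := fun z hz =>
    dz_eq hz ((ContinuousLinearMap.fst ℝ (State m n) (Fin n → ℝ)).hasFDerivAt.comp_hasDerivWithinAt z (hx z hz))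
  intro z hz
  refine ⟨h1 z hz, by rw [h1 z hz, h.comp2_H _ (hO z hz)], ?_⟩
  have h2 : HasDerivWithinAt (fun s => B (x s).1 *ᵥ dz (fun z => (x z).1) s)
      (A (x z).1 *ᵥ H (x z).1 (x z).2) (Ici 0) z := by
    have hy := (ContinuousLinearMap.snd ℝ (State m n) (Fin n → ℝ)).hasFDerivAt.comp_hasDerivWithinAt z (hx z hz)
    rw [hasDerivWithinAt_pi]
    rintro (i | i)
    · have e1 : (A (x z).1 *ᵥ H (x z).1 (x z).2) (Sum.inl i) = 0 :=
        congrFun (h.comp1_H _ (hO z hz) (x z).2) i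
      rw [e1]
      refine (hasDerivWithinAt_const z (Ici 0) (0 : ℝ)).congr (fun s hs => ?_) ?_
      · exact congrFun (h.comp1_B (hO s hs) _) i
      · exact congrFun (h.comp1_B (hO z hz) _) i
    · have e1 : (A (x z).1 *ᵥ H (x z).1 (x z).2) (Sum.inr i) = G (x z).1 (x z).2 i :=
        (congrFun (h.G_eq _ (hO z hz) (x z).2) i).symm
      rw [e1]
      have key : ∀ s ∈ Ici (0 : ℝ),
          (B (x s).1 *ᵥ dz (fun z => (x z).1) s) (Sum.inr i) = (x s).2 i := fun s hs => by
        rw [h1 s hs]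
        exact congrFun (h.comp2_H _ (hO s hs) (x s).2) i
      exact ((hasDerivWithinAt_pi.1 hy) i).congr key (key z hz)
  rw [h1 z hz, dz_eq hz h2, sub_self]

theorem firstOrder_of_linearized (h : IsReduction A B O H G) {x : ℝ → State m n × (Fin n → ℝ)}
    (hO : ∀ z ∈ Ici (0 : ℝ), (x z).1 ∈ O) {w v : ℝ → State m n} (hw : ContDiffOn ℝ ∞ w (Ici 0))
    (hwx : ∀ z ∈ Ici (0 : ℝ), w z = (x z).1)
    (hx : ∀ z ∈ Ici (0 : ℝ), dz w z = H (x z).1 (x z).2)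
    (hv : ContDiffOn ℝ ∞ v (Ici 0))
    (heq : ∀ z ∈ Ici (0 : ℝ), A (w z) *ᵥ dz v z + dMat A (w z) (v z) *ᵥ dz w z
      - dz (fun s => B (w s) *ᵥ dz v s + dMat B (w s) (v s) *ᵥ dz w s) z = 0) :
    ∀ z ∈ Ici (0 : ℝ),
      HasDerivWithinAt (fun z => (v z, comp2 (B (w z) *ᵥ dz v z + dMat B (w z) (v z) *ᵥ dz w z)))
        (fderiv ℝ (reducedField H G) (x z)
          (v z, comp2 (B (w z) *ᵥ dz v z + dMat B (w z) (v z) *ᵥ dz w z))) (Ici 0) z := by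
  intro z hz
  have hwO : ∀ z ∈ Ici (0 : ℝ), w z ∈ O := fun z hz => by rw [hwx z hz]; exact hO z hz
  have hdB : ∀ i j, ContDiffOn ℝ ∞ (fun s => dMat B (w s) (v s) i j) (Ici 0) := fun i j =>
    (((h.smooth_B i j).fderiv_of_isOpen h.isOpen (m := ∞) (by simp)).comp hw hwO).clm_apply hv
  have hS : ContDiffOn ℝ ∞ (fun s => B (w s) *ᵥ dz v s + dMat B (w s) (v s) *ᵥ dz w s) (Ici 0) :=
    (ContDiffOn.mulVec (fun i j => (h.smooth_B i j).comp hw hwO) (contDiffOn_dz hv)).add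
      (ContDiffOn.mulVec hdB (contDiffOn_dz hw))
  have hS' := hasDerivWithinAt_dz hS hz
  rw [← sub_eq_zero.1 (heq z hz)] at hS'
  have hS0 : ∀ s ∈ Ici (0 : ℝ), comp1 (B (w s) *ᵥ dz v s + dMat B (w s) (v s) *ᵥ dz w s) = 0 :=
    fun s hs => by
      rw [comp1_add, h.comp1_B (hwO s hs), h.comp1_dMat_B (hwO s hs), add_zero]
  have h1 : comp1 (A (w z) *ᵥ dz v z + dMat A (w z) (v z) *ᵥ dz w z) = 0 := by
    have e1 := (comp1L m n).hasFDerivAt.comp_hasDerivWithinAt z hS'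
    refine (uniqueDiffOn_Ici (0 : ℝ) z hz).eq_deriv _ e1 ?_
    exact (hasDerivWithinAt_const z (Ici 0) (0 : Fin m → ℝ)).congr hS0 (hS0 z hz)
  have h2 := (comp2L m n).hasFDerivAt.comp_hasDerivWithinAt z hS'
  rw [reducedField_fderiv h.smooth_H h.smooth_G]
  set y3 := comp2 (B (w z) *ᵥ dz v z + dMat B (w z) (v z) *ᵥ dz w z) with hy3
  have hd1 := h.comp1_deriv (hwO z hz) (v z) (x z).2
  have hd2 := h.comp2_deriv (hwO z hz) (v z) (x z).2
  have hdG := h.fderiv_G (hwO z hz) (v z) (x z).2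
  have hdw : dz w z = H (w z) (x z).2 := by rw [hx z hz, hwx z hz]
  have hvz : dz v z = H (w z) y3 + fderiv ℝ H (w z) (v z) (x z).2 := by
    refine sub_eq_zero.1 (h.inj _ (hwO z hz) _ ?_ ?_)
    · rw [Matrix.mulVec_sub, Matrix.mulVec_add, comp1_sub, comp1_add, h.comp1_H _ (hwO z hz), zero_add]
      rw [comp1_add] at hd1 h1
      rw [hdw] at h1
      rw [eq_neg_of_add_eq_zero_left h1, eq_neg_of_add_eq_zero_right hd1, sub_self]
    · rw [Matrix.mulVec_sub, Matrix.mulVec_add, comp2_sub, comp2_add, h.comp2_H _ (hwO z hz)]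
      rw [comp2_add] at hd2
      rw [hy3, comp2_add, hdw, eq_neg_of_add_eq_zero_right hd2]
      abel
  rw [← hwx z hz]
  refine HasDerivWithinAt.prodMk ?_ ?_
  · rw [← hvz]; exact hasDerivWithinAt_dz hv hz
  · convert! h2 using 1
    rw [h.G_eq _ (hwO z hz), hdG, comp2L_apply, hvz, hdw, Matrix.mulVec_add]
    simp only [comp2_add]
    abel

theorem linearized_of_firstOrder (h : IsReduction A B O H G) {x : ℝ → State m n × (Fin n → ℝ)}
    (hO : ∀ z ∈ Ici (0 : ℝ), (x z).1 ∈ O) {w : ℝ → State m n}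
    (hwx : ∀ z ∈ Ici (0 : ℝ), w z = (x z).1)
    (hx : ∀ z ∈ Ici (0 : ℝ), dz w z = H (x z).1 (x z).2) {v : ℝ → State m n × (Fin n → ℝ)}
    (hv : ∀ z ∈ Ici (0 : ℝ), HasDerivWithinAt v (fderiv ℝ (reducedField H G) (x z) (v z))
      (Ici 0) z) :
    ∀ z ∈ Ici (0 : ℝ), dz (fun z => (v z).1) z =
        H (x z).1 (v z).2 + fderiv ℝ H (x z).1 (v z).1 (x z).2 ∧
      A (w z) *ᵥ dz (fun z => (v z).1) z + dMat A (w z) (v z).1 *ᵥ dz w z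
      - dz (fun s => B (w s) *ᵥ dz (fun z => (v z).1) s + dMat B (w s) (v s).1 *ᵥ dz w s) z = 0 := by
  have hv' : ∀ z ∈ Ici (0 : ℝ), HasDerivWithinAt v
      (H (x z).1 (v z).2 + fderiv ℝ H (x z).1 (v z).1 (x z).2,
        G (x z).1 (v z).2 + fderiv ℝ G (x z).1 (v z).1 (x z).2) (Ici 0) z := fun z hz => by
    rw [← reducedField_fderiv h.smooth_H h.smooth_G]; exact hv z hz
  have h1 : ∀ z ∈ Ici (0 : ℝ), dz (fun z => (v z).1) z =
      H (x z).1 (v z).2 + fderiv ℝ H (x z).1 (v z).1 (x z).2 := fun z hz =>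
    dz_eq hz ((ContinuousLinearMap.fst ℝ (State m n) (Fin n → ℝ)).hasFDerivAt.comp_hasDerivWithinAt z (hv' z hz))
  intro z hz
  refine ⟨h1 z hz, ?_⟩
  have hS1 : ∀ s ∈ Ici (0 : ℝ), comp1 (B (w s) *ᵥ dz (fun z => (v z).1) s +
      dMat B (w s) (v s).1 *ᵥ dz w s) = 0 := fun s hs => by
    have hs' := hO s hs
    rw [hwx s hs, comp1_add, h.comp1_B hs', h.comp1_dMat_B hs', add_zero]
  have hS2 : ∀ s ∈ Ici (0 : ℝ), comp2 (B (w s) *ᵥ dz (fun z => (v z).1) s +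
      dMat B (w s) (v s).1 *ᵥ dz w s) = (v s).2 := fun s hs => by
    have hs' := hO s hs
    have hd2 := h.comp2_deriv hs' (v s).1 (x s).2
    rw [comp2_add] at hd2
    rw [hwx s hs, comp2_add, h1 s hs, hx s hs, Matrix.mulVec_add, comp2_add, h.comp2_H _ hs',
      eq_neg_of_add_eq_zero_left hd2]
    abel
  have hA1 : comp1 (A (w z) *ᵥ dz (fun z => (v z).1) z + dMat A (w z) (v z).1 *ᵥ dz w z) = 0 := by
    have hd1 := h.comp1_deriv (hO z hz) (v z).1 (x z).2
    rw [comp1_add] at hd1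
    rw [hwx z hz, comp1_add, h1 z hz, hx z hz, Matrix.mulVec_add, comp1_add,
      h.comp1_H _ (hO z hz), zero_add, eq_neg_of_add_eq_zero_left hd1]
    abel
  have hA2 : comp2 (A (w z) *ᵥ dz (fun z => (v z).1) z + dMat A (w z) (v z).1 *ᵥ dz w z) =
      G (x z).1 (v z).2 + fderiv ℝ G (x z).1 (v z).1 (x z).2 := by
    rw [hwx z hz, h1 z hz, hx z hz, h.G_eq _ (hO z hz), h.fderiv_G (hO z hz), Matrix.mulVec_add]
    simp only [comp2_add]
    abel
  have h2 : HasDerivWithinAt (fun s => B (w s) *ᵥ dz (fun z => (v z).1) s +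
      dMat B (w s) (v s).1 *ᵥ dz w s)
      (A (w z) *ᵥ dz (fun z => (v z).1) z + dMat A (w z) (v z).1 *ᵥ dz w z) (Ici 0) z := by
    have hy := (ContinuousLinearMap.snd ℝ (State m n) (Fin n → ℝ)).hasFDerivAt.comp_hasDerivWithinAt z (hv' z hz)
    rw [hasDerivWithinAt_pi]
    rintro (i | i)
    · rw [show (A (w z) *ᵥ dz (fun z => (v z).1) z + dMat A (w z) (v z).1 *ᵥ dz w z) (Sum.inl i) = 0
        from congrFun hA1 i]
      exact (hasDerivWithinAt_const z (Ici 0) (0 : ℝ)).congr (fun s hs => congrFun (hS1 s hs) i)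
        (congrFun (hS1 z hz) i)
    · rw [show (A (w z) *ᵥ dz (fun z => (v z).1) z + dMat A (w z) (v z).1 *ᵥ dz w z) (Sum.inr i) = _
        from congrFun hA2 i]
      exact ((hasDerivWithinAt_pi.1 hy) i).congr (fun s hs => congrFun (hS2 s hs) i)
        (congrFun (hS2 z hz) i)
  rw [dz_eq hz h2, sub_self]

end IsReduction

end Reduction

section Extension

variable {X V : Type*} [NormedAddCommGroup X] [NormedSpace ℝ X] [FiniteDimensional ℝ X]
  [NormedAddCommGroup V] [NormedSpace ℝ V]

/-- A locally defined smooth function agrees near a point with a globally smooth one. -/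
theorem exists_contDiff_eventuallyEq {D : Set X} (hD : IsOpen D) {x : X} (hx : x ∈ D) {f : X → V}
    (hf : ContDiffOn ℝ ∞ f D) : ∃ g : X → V, ContDiff ℝ ∞ g ∧ ∀ᶠ y in 𝓝 x, g y = f y := by
  obtain ⟨r, hr, hrD⟩ := Metric.nhds_basis_closedBall.mem_iff.1 (hD.mem_nhds hx)
  let χ : ContDiffBump x := ⟨r / 2, r, by positivity, by linarith⟩
  refine ⟨fun y => χ y • f y, ?_, ?_⟩
  · rw [contDiff_iff_contDiffAt]
    intro y
    by_cases hy : y ∈ D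
    · exact χ.contDiff.contDiffAt.smul (hf.contDiffAt (hD.mem_nhds hy))
    · have h1 : ∀ᶠ y in 𝓝 y, χ y • f y = 0 := by
        have : (Metric.closedBall x r)ᶜ ∈ 𝓝 y :=
          Metric.isClosed_closedBall.isOpen_compl.mem_nhds fun h => hy (hrD h)
        filter_upwards [this] with z hz
        have : r ≤ dist z x := by
          rw [mem_compl_iff, Metric.mem_closedBall, not_le] at hz
          exact hz.le
        rw [χ.zero_of_le_dist this, zero_smul]
      exact contDiffAt_const.congr_of_eventuallyEq h1
  · filter_upwards [χ.eventuallyEq_one] with y hy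
    rw [hy]; simp

theorem contDiffOn_matrix_det {ι : Type*} [Fintype ι] [DecidableEq ι] {D : Set X}
    {M : X → Matrix ι ι ℝ} (hM : ∀ i j, ContDiffOn ℝ ∞ (fun x => M x i j) D) :
    ContDiffOn ℝ ∞ (fun x => (M x).det) D := by
  simp only [Matrix.det_apply']
  exact ContDiffOn.sum fun σ _ => contDiffOn_const.mul (contDiffOn_prod fun i _ => hM _ _)

theorem contDiffOn_matrix_inv {ι : Type*} [Fintype ι] [DecidableEq ι] {D : Set X}
    {M : X → Matrix ι ι ℝ} (hM : ∀ i j, ContDiffOn ℝ ∞ (fun x => M x i j) D)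
    (hdet : ∀ x ∈ D, (M x).det ≠ 0) (i j : ι) : ContDiffOn ℝ ∞ (fun x => (M x)⁻¹ i j) D := by
  have h1 : ∀ x, (M x)⁻¹ i j = ((M x).det)⁻¹ * ((M x).updateRow j (Pi.single i 1)).det := fun x => by
    rw [Matrix.inv_def, Ring.inverse_eq_inv', Matrix.smul_apply, Matrix.adjugate_apply, smul_eq_mul]
  simp only [h1]
  refine ((contDiffOn_matrix_det hM).inv hdet).mul (contDiffOn_matrix_det fun a b => ?_)
  by_cases ha : a = j
  · subst ha; simp only [Matrix.updateRow_self]; exact contDiffOn_const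
  · simp only [Matrix.updateRow_ne ha]; exact hM a b

/-- Multiplication by a matrix, as a continuous linear map. -/
noncomputable def matCLM {α β : Type*} [Fintype α] [Fintype β] [DecidableEq α] (M : Matrix α β ℝ) :
    (β → ℝ) →L[ℝ] (α → ℝ) :=
  ∑ i, ∑ j, M i j • (ContinuousLinearMap.proj (R := ℝ) (φ := fun _ : β => ℝ) j).smulRight
    (Pi.single i (1 : ℝ) : α → ℝ)

@[simp] theorem matCLM_apply {α β : Type*} [Fintype α] [Fintype β] [DecidableEq α]
    (M : Matrix α β ℝ) (v : β → ℝ) : matCLM M v = M *ᵥ v := by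
  ext i
  simp [matCLM, Matrix.mulVec, dotProduct, Pi.single_apply]

theorem contDiffOn_matCLM {α β : Type*} [Fintype α] [Fintype β] [DecidableEq α] {D : Set X}
    {M : X → Matrix α β ℝ} (hM : ∀ i j, ContDiffOn ℝ ∞ (fun x => M x i j) D) :
    ContDiffOn ℝ ∞ (fun x => matCLM (M x)) D :=
  ContDiffOn.sum fun i _ => ContDiffOn.sum fun j _ => (hM i j).smul contDiffOn_const

end Extension

section Blocks

variable {m n : ℕ}

/-- The matrix `v ↦ ((A v)¹, (B v)²)`. -/
def mixedMat (A B : BMat m n) : BMat m n :=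
  Matrix.fromBlocks A.toBlocks₁₁ A.toBlocks₁₂ 0 B.toBlocks₂₂

theorem comp1_mixedMat (A B : BMat m n) (v : State m n) :
    comp1 (mixedMat A B *ᵥ v) = comp1 (A *ᵥ v) := by
  ext i
  simp [comp1, mixedMat, Matrix.mulVec, dotProduct, Fintype.sum_sum_type, Matrix.toBlocks₁₁,
    Matrix.toBlocks₁₂]

theorem comp2_mixedMat (A : BMat m n) {B : BMat m n} (hB : B.toBlocks₂₁ = 0) (v : State m n) :
    comp2 (mixedMat A B *ᵥ v) = comp2 (B *ᵥ v) := by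
  ext i
  have e1 : ∀ j, B (Sum.inr i) (Sum.inl j) = 0 := fun j => congrFun (congrFun hB i) j
  simp [comp2, mixedMat, Matrix.mulVec, dotProduct, Fintype.sum_sum_type, Matrix.toBlocks₂₂, e1]

theorem det_mixedMat (A B : BMat m n) :
    (mixedMat A B).det = A.toBlocks₁₁.det * B.toBlocks₂₂.det := by
  rw [mixedMat, Matrix.det_fromBlocks_zero₂₁]

/-- The matrix of `y ↦ M⁻¹ (0, y)`. -/
noncomputable def liftMat (A B : BMat m n) : Matrix (Fin m ⊕ Fin n) (Fin n) ℝ :=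
  (mixedMat A B)⁻¹.submatrix id Sum.inr

theorem mulVec_submatrix_inr (M : BMat m n) (y : Fin n → ℝ) :
    M.submatrix id Sum.inr *ᵥ y = M *ᵥ (Sum.elim (0 : Fin m → ℝ) y : State m n) := by
  ext i
  simp [Matrix.mulVec, dotProduct, Fintype.sum_sum_type]

theorem mixedMat_liftMat {A B : BMat m n} (h : (mixedMat A B).det ≠ 0) (y : Fin n → ℝ) :
    mixedMat A B *ᵥ (liftMat A B *ᵥ y) = (Sum.elim (0 : Fin m → ℝ) y : State m n) := by
  rw [liftMat, mulVec_submatrix_inr, Matrix.mulVec_mulVec,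
    Matrix.mul_nonsing_inv _ (isUnit_iff_ne_zero.2 h), Matrix.one_mulVec]

/-- The reduced coefficient matrix. -/
noncomputable def redMat (A B : BMat m n) : Matrix (Fin n) (Fin n) ℝ :=
  (A * liftMat A B).submatrix Sum.inr id

theorem redMat_mulVec (A B : BMat m n) (y : Fin n → ℝ) :
    redMat A B *ᵥ y = comp2 (A *ᵥ (liftMat A B *ᵥ y)) := by
  rw [Matrix.mulVec_mulVec]
  rfl

theorem eq_fromBlocks_of_block {B : BMat m n} (h : B.toBlocks₁₁ = 0 ∧ B.toBlocks₁₂ = 0 ∧ B.toBlocks₂₁ = 0) :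
    B = Matrix.fromBlocks 0 0 0 B.toBlocks₂₂ := by
  conv_lhs => rw [← Matrix.fromBlocks_toBlocks B, h.1, h.2.1, h.2.2]

theorem mul_redMat {A B : BMat m n} (hA : A.det ≠ 0)
    (hB : B.toBlocks₁₁ = 0 ∧ B.toBlocks₁₂ = 0 ∧ B.toBlocks₂₁ = 0)
    (h : (mixedMat A B).det ≠ 0) : (B * A⁻¹).toBlocks₂₂ * redMat A B = 1 := by
  have hu : IsUnit A.det := isUnit_iff_ne_zero.2 hA
  refine Matrix.toLin'.injective (LinearMap.ext fun y => ?_)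
  have h1 := mixedMat_liftMat h y
  have hc1 : comp1 (A *ᵥ (liftMat A B *ᵥ y)) = 0 := by rw [← comp1_mixedMat A B, h1]; rfl
  have hc2 : comp2 (B *ᵥ (liftMat A B *ᵥ y)) = y := by rw [← comp2_mixedMat A hB.2.2, h1]; rfl
  have h2 : A *ᵥ (liftMat A B *ᵥ y) = (Sum.elim (0 : Fin m → ℝ) (redMat A B *ᵥ y) : State m n) :=
    state_ext hc1 (redMat_mulVec A B y).symm
  have h3 : (B * A⁻¹).toBlocks₂₂ *ᵥ (redMat A B *ᵥ y) =
      comp2 ((B * A⁻¹) *ᵥ (Sum.elim (0 : Fin m → ℝ) (redMat A B *ᵥ y) : State m n)) := by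
    rw [← mulVec_submatrix_inr]
    rfl
  rw [Matrix.toLin'_apply, Matrix.toLin'_one, ← Matrix.mulVec_mulVec, h3, ← h2, ← Matrix.mulVec_mulVec,
    Matrix.mulVec_mulVec (liftMat A B *ᵥ y), Matrix.nonsing_inv_mul _ hu, Matrix.one_mulVec, hc2]
  rfl

theorem charpoly_inv_mul {A B : BMat m n}
    (hB : B.toBlocks₁₁ = 0 ∧ B.toBlocks₁₂ = 0 ∧ B.toBlocks₂₁ = 0) :
    (A⁻¹ * B).charpoly = Polynomial.X ^ m * (B * A⁻¹).toBlocks₂₂.charpoly := by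
  let E : Matrix (Fin m ⊕ Fin n) (Fin n) ℝ := Matrix.fromRows 0 1
  let F : Matrix (Fin n) (Fin m ⊕ Fin n) ℝ := Matrix.fromCols 0 1
  have h1 : A⁻¹ * B = (A⁻¹ * E) * (B.toBlocks₂₂ * F) := by
    have : B = E * (B.toBlocks₂₂ * F) := by
      conv_lhs => rw [eq_fromBlocks_of_block hB]
      ext i j
      rcases i with i | i <;> rcases j with j | j <;> simp [E, F]
    rw [Matrix.mul_assoc, ← this]
  have h2 : (B.toBlocks₂₂ * F) * (A⁻¹ * E) = (B * A⁻¹).toBlocks₂₂ := by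
    have : B * A⁻¹ = Matrix.fromBlocks 0 0 0 B.toBlocks₂₂ * A⁻¹ := by
      rw [← eq_fromBlocks_of_block hB]
    rw [this]
    have hF : F * (A⁻¹ * E) = A⁻¹.toBlocks₂₂ := by
      ext i j
      simp [E, F, Matrix.mul_apply, Fintype.sum_sum_type, Matrix.toBlocks₂₂, Matrix.one_apply]
    rw [Matrix.mul_assoc, hF]
    conv_rhs => rw [← Matrix.fromBlocks_toBlocks A⁻¹, Matrix.fromBlocks_multiply]
    simp
  rw [h1, Matrix.charpoly_mul_comm_of_le _ _ (by simp), h2]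
  simp

end Blocks

section Spectra

variable {ι : Type*} [Fintype ι] [DecidableEq ι]

theorem mem_spectrum_iff_mem_roots {M : Matrix ι ι ℂ} {a : ℂ} :
    a ∈ spectrum ℂ M ↔ a ∈ M.charpoly.roots := by
  rw [mem_roots_charpoly, spectrum.mem_iff, Matrix.isUnit_iff_isUnit_det, isUnit_iff_ne_zero, not_not]
  rfl

theorem mem_eigs_iff {M : Matrix ι ι ℝ} {a : ℂ} : a ∈ eigs M ↔ a ∈ complexRoots M :=
  mem_spectrum_iff_mem_roots

theorem complexRoots_eq_map {M : Matrix ι ι ℝ} (h : ∀ a ∈ complexRoots M, a.im = 0) :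
    complexRoots M = M.charpoly.roots.map (fun a : ℝ => (a : ℂ)) := by
  have h1 : (M.map (fun a : ℝ => (a : ℂ))).charpoly = M.charpoly.map Complex.ofRealHom :=
    Matrix.charpoly_map M Complex.ofRealHom
  have h2 : (M.charpoly.map Complex.ofRealHom).Splits := IsAlgClosed.splits _
  have h3 : M.charpoly.Splits := by
    refine Polynomial.Splits.of_splits_map_of_injective Complex.ofRealHom.injective h2 ?_
    intro a ha
    rw [← h1] at ha
    exact ⟨a.re, Complex.ext rfl (h a ha).symm⟩
  rw [complexRoots, h1, h3.roots_map]
  rfl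

theorem numPosEigs_eq_countP {M : Matrix ι ι ℝ} (h : ∀ a ∈ complexRoots M, a.im = 0) :
    numPosEigs M = (complexRoots M).countP (fun a => 0 < a.re) := by
  rw [complexRoots_eq_map h, Multiset.countP_map, numPosEigs]
  simp only [Complex.ofReal_re]

theorem det_ne_zero_of_zero_notMem {M : Matrix ι ι ℂ} (h : (0 : ℂ) ∉ M.charpoly.roots) :
    M.det ≠ 0 := by
  rw [mem_roots_charpoly] at h
  intro h0
  apply h
  rw [map_zero, zero_sub, Matrix.det_neg, h0, mul_zero]

theorem det_map_ofReal (M : Matrix ι ι ℝ) : (M.map (fun a : ℝ => (a : ℂ))).det = (M.det : ℂ) :=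
  (RingHom.map_det Complex.ofRealHom M).symm

theorem map_ofReal_mul (M N : Matrix ι ι ℝ) : (M * N).map (fun a : ℝ => (a : ℂ)) =
    M.map (fun a : ℝ => (a : ℂ)) * N.map (fun a : ℝ => (a : ℂ)) :=
  Matrix.map_mul (f := Complex.ofRealHom)

theorem map_ofReal_one : (1 : Matrix ι ι ℝ).map (fun a : ℝ => (a : ℂ)) = 1 :=
  Matrix.map_one _ Complex.ofReal_zero Complex.ofReal_one

theorem map_ofReal_inv {M : Matrix ι ι ℝ} (h : M.det ≠ 0) :
    (M⁻¹).map (fun a : ℝ => (a : ℂ)) = (M.map (fun a : ℝ => (a : ℂ)))⁻¹ := by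
  refine (Matrix.inv_eq_right_inv ?_).symm
  rw [← map_ofReal_mul, Matrix.mul_nonsing_inv _ (isUnit_iff_ne_zero.2 h), map_ofReal_one]

end Spectra

section ReducedCount

variable {m n : ℕ}

theorem numNegRe_redMat {A0 A B : BMat m n} (h0 : A0.toBlocks₁₂ = 0) (hdet : A0.det ≠ 0)
    (hB : B.toBlocks₁₁ = 0 ∧ B.toBlocks₁₂ = 0 ∧ B.toBlocks₂₁ = 0) (hA : (A0⁻¹ * A).det ≠ 0)
    (hAreal : ∀ a ∈ eigs (A0⁻¹ * A), a.im = 0)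
    (hA₁real : ∀ a ∈ eigs (A0⁻¹ * A).toBlocks₁₁, a.im = 0)
    (hA₁ : ∀ a ∈ eigs (A0⁻¹ * A).toBlocks₁₁, a.re ≠ 0)
    (hb : ∀ a ∈ eigs (A0⁻¹ * B).toBlocks₂₂, 0 < a.re)
    (hpar : ∀ x : ℝ, x ≠ 0 → ∀ a ∈ spectrum ℂ (Complex.I • (x • (A0⁻¹ * A)).map (fun a : ℝ => (a : ℂ)) +
      (x ^ 2 • (A0⁻¹ * B)).map (fun a : ℝ => (a : ℂ))), 0 < a.re) :
    (mixedMat A B).det ≠ 0 ∧ A.det ≠ 0 ∧ (∀ l ∈ complexRoots (redMat A B), l.re ≠ 0) ∧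
      numNegRe (redMat A B) + numPosEigs (A0⁻¹ * A) = numPosEigs (A0⁻¹ * A).toBlocks₁₁ + n := by
  classical
  have hu : IsUnit A0.det := isUnit_iff_ne_zero.2 hdet
  set Ab := A0⁻¹ * A with hAb
  set Bb := A0⁻¹ * B with hBb
  have hAeq : A = A0 * Ab := by rw [hAb, Matrix.mul_nonsing_inv_cancel_left _ _ hu]
  have hBeq : B = A0 * Bb := by rw [hBb, Matrix.mul_nonsing_inv_cancel_left _ _ hu]
  have hA0f : A0 = Matrix.fromBlocks A0.toBlocks₁₁ 0 A0.toBlocks₂₁ A0.toBlocks₂₂ := by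
    conv_lhs => rw [← Matrix.fromBlocks_toBlocks A0, h0]
  have hd0 : A0.det = A0.toBlocks₁₁.det * A0.toBlocks₂₂.det := by
    conv_lhs => rw [hA0f, Matrix.det_fromBlocks_zero₁₂]
  have hd11 : A0.toBlocks₁₁.det ≠ 0 := fun h => hdet (by rw [hd0, h, zero_mul])
  have hd22 : A0.toBlocks₂₂.det ≠ 0 := fun h => hdet (by rw [hd0, h, mul_zero])
  have hA11 : A.toBlocks₁₁ = A0.toBlocks₁₁ * Ab.toBlocks₁₁ := by
    conv_lhs => rw [hAeq, hA0f, ← Matrix.fromBlocks_toBlocks Ab, Matrix.fromBlocks_multiply]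
    simp
  have hBbf : Bb = Matrix.fromBlocks 0 0 0 Bb.toBlocks₂₂ := by
    have h1 : A0 * Bb = Matrix.fromBlocks 0 0 0 B.toBlocks₂₂ := by
      rw [← hBeq]; exact eq_fromBlocks_of_block hB
    have h2 : A0 * Matrix.fromBlocks 0 0 0 (A0.toBlocks₂₂⁻¹ * B.toBlocks₂₂) =
        Matrix.fromBlocks 0 0 0 B.toBlocks₂₂ := by
      conv_lhs => rw [hA0f, Matrix.fromBlocks_multiply]
      simp [Matrix.mul_nonsing_inv_cancel_left _ _ (isUnit_iff_ne_zero.2 hd22)]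
    have h3 : Bb = Matrix.fromBlocks 0 0 0 (A0.toBlocks₂₂⁻¹ * B.toBlocks₂₂) := by
      have := congrArg (A0⁻¹ * ·) (h1.trans h2.symm)
      simpa [Matrix.nonsing_inv_mul_cancel_left _ _ hu] using this
    conv_lhs => rw [h3]
    conv_rhs => rw [h3]
    simp
  have hB22 : B.toBlocks₂₂ = A0.toBlocks₂₂ * Bb.toBlocks₂₂ := by
    conv_lhs => rw [hBeq, hA0f, hBbf, Matrix.fromBlocks_multiply]
    simp
  simp only [mem_eigs_iff] at hAreal hA₁ hb hA₁real
  have hdb : Bb.toBlocks₂₂.det ≠ 0 := by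
    have := det_ne_zero_of_zero_notMem (M := Bb.toBlocks₂₂.map (fun a : ℝ => (a : ℂ)))
      fun h => lt_irrefl _ (hb 0 h)
    rw [det_map_ofReal] at this
    exact_mod_cast this
  have hdA1 : Ab.toBlocks₁₁.det ≠ 0 := by
    have := det_ne_zero_of_zero_notMem (M := Ab.toBlocks₁₁.map (fun a : ℝ => (a : ℂ)))
      fun h => hA₁ 0 h rfl
    rw [det_map_ofReal] at this
    exact_mod_cast this
  have hmix : (mixedMat A B).det ≠ 0 := by
    rw [det_mixedMat, hA11, hB22, Matrix.det_mul, Matrix.det_mul]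
    exact mul_ne_zero (mul_ne_zero hd11 hdA1) (mul_ne_zero hd22 hdb)
  have hAdet : A.det ≠ 0 := by rw [hAeq, Matrix.det_mul]; exact mul_ne_zero hdet hA
  have hKred := mul_redMat hAdet hB hmix
  set K := (B * A⁻¹).toBlocks₂₂ with hK
  have hKdet : K.det ≠ 0 := fun h => by
    have := congrArg Matrix.det hKred
    rw [Matrix.det_mul, h, zero_mul, Matrix.det_one] at this
    exact zero_ne_one this
  have hred : redMat A B = K⁻¹ := (Matrix.inv_eq_right_inv hKred).symm
  have hroots : complexRoots (redMat A B) = (complexRoots K).map (·⁻¹) := by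
    rw [complexRoots, hred, map_ofReal_inv hKdet, roots_charpoly_inv]
    · rfl
    · rw [det_map_ofReal]; exact_mod_cast hKdet
  have hinv : Ab⁻¹ * Bb = A⁻¹ * B := by
    conv_rhs => rw [hAeq, hBeq, Matrix.mul_inv_rev, Matrix.mul_assoc,
      Matrix.nonsing_inv_mul_cancel_left _ _ hu]
  have hBbm : Bb.map (fun a : ℝ => (a : ℂ)) =
      Matrix.fromBlocks 0 0 0 (Bb.toBlocks₂₂.map (fun a : ℝ => (a : ℂ))) := by
    conv_lhs => rw [hBbf, Matrix.fromBlocks_map]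
    simp
  have key := count_pencil (A := Ab.map (fun a : ℝ => (a : ℂ)))
    (A₁ := Ab.toBlocks₁₁.map (fun a : ℝ => (a : ℂ))) (A₂ := Ab.toBlocks₁₂.map (fun a : ℝ => (a : ℂ)))
    (A₃ := Ab.toBlocks₂₁.map (fun a : ℝ => (a : ℂ))) (A₄ := Ab.toBlocks₂₂.map (fun a : ℝ => (a : ℂ)))
    (b := Bb.toBlocks₂₂.map (fun a : ℝ => (a : ℂ))) (K := K.map (fun a : ℝ => (a : ℂ)))
    (by rw [← Matrix.fromBlocks_map, Matrix.fromBlocks_toBlocks])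
    (by rw [det_map_ofReal]; exact_mod_cast hA) hAreal hA₁
    (fun s hs h => by
      have h2 : ((-s : ℝ) : ℂ) ∈ complexRoots Bb.toBlocks₂₂ := by
        refine mem_roots_charpoly.2 ?_
        have : Matrix.scalar (Fin n) ((-s : ℝ) : ℂ) - Bb.toBlocks₂₂.map (fun a : ℝ => (a : ℂ)) =
            -(Bb.toBlocks₂₂.map (fun a : ℝ => (a : ℂ)) + (s : ℂ) • 1) := by
          ext i j
          by_cases hij : i = j <;> simp [hij] <;> ring
        rw [this, Matrix.det_neg, h, mul_zero]
      have := hb _ h2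
      rw [Complex.ofReal_re] at this
      linarith)
    (fun x hx s hs h => by
      have h2 : ((-s : ℝ) : ℂ) ∈ spectrum ℂ (Complex.I • (x • Ab).map (fun a : ℝ => (a : ℂ)) +
          (x ^ 2 • Bb).map (fun a : ℝ => (a : ℂ))) := by
        rw [mem_spectrum_iff_mem_roots, mem_roots_charpoly]
        rw [← hBbm] at h
        have : Matrix.scalar (Fin m ⊕ Fin n) ((-s : ℝ) : ℂ) -
            (Complex.I • (x • Ab).map (fun a : ℝ => (a : ℂ)) +
              (x ^ 2 • Bb).map (fun a : ℝ => (a : ℂ))) =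
            -((Complex.I * x) • Ab.map (fun a : ℝ => (a : ℂ)) +
              ((x ^ 2 : ℝ) : ℂ) • Bb.map (fun a : ℝ => (a : ℂ)) + (s : ℂ) • 1) := by
          ext i j
          by_cases hij : i = j <;> simp [hij] <;> ring
        rw [this, Matrix.det_neg, h, mul_zero]
      have := hpar x hx _ h2
      rw [Complex.ofReal_re] at this
      linarith)
    (by
      rw [← hBbm, ← map_ofReal_inv hA, ← map_ofReal_mul, hinv]
      have e : ∀ {k : Type} [Fintype k] [DecidableEq k] (M : Matrix k k ℝ),
        (M.map (fun a : ℝ => (a : ℂ))).charpoly = M.charpoly.map Complex.ofRealHom :=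
        fun M => Matrix.charpoly_map M Complex.ofRealHom
      rw [e, charpoly_inv_mul hB, e, Polynomial.map_mul, Polynomial.map_pow, Polynomial.map_X,
        Polynomial.roots_mul, Polynomial.roots_pow, Polynomial.roots_X, add_comm]
      exact mul_ne_zero (pow_ne_zero _ Polynomial.X_ne_zero)
        ((Matrix.charpoly_monic K).map _).ne_zero)
    (by
      rw [mem_roots_charpoly, map_zero, zero_sub, Matrix.det_neg, det_map_ofReal]
      exact mul_ne_zero (pow_ne_zero _ (by norm_num)) (by exact_mod_cast hKdet))
  obtain ⟨k1, k2⟩ := key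
  have hs : ∀ a : ℂ, a⁻¹.re = a.re / Complex.normSq a := fun a => Complex.inv_re a
  have hKne : ∀ a ∈ complexRoots K, a ≠ 0 := fun a ha h0 => k1 a ha (by rw [h0]; rfl)
  refine ⟨hmix, hAdet, ?_, ?_⟩
  · rw [hroots]
    intro l hl
    obtain ⟨a, ha, rfl⟩ := Multiset.mem_map.1 hl
    rw [hs]
    exact div_ne_zero (k1 a ha) (Complex.normSq_pos.2 (hKne a ha)).ne'
  · have e1 : numNegRe (redMat A B) = (complexRoots K).countP (fun a => 0 < -1 * a.re) := by
      rw [numNegRe, hroots, Multiset.countP_map, ← Multiset.countP_eq_card_filter]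
      refine Multiset.countP_congr rfl fun a ha => ?_
      rw [hs, div_lt_iff₀ (Complex.normSq_pos.2 (hKne a ha)), zero_mul]
      simp
    rw [e1, numPosEigs_eq_countP hAreal, numPosEigs_eq_countP hA₁real]
    simp only [one_mul] at k2
    simp only [complexRoots] at k2 ⊢
    convert k2

end ReducedCount

namespace ViscousProblem

variable {d m n nPos1 n3 r : ℕ} {P : ViscousProblem d m n nPos1 n3 r} {nPos : ℕ}

theorem Geometry.isOpen_Ostar (hgeo : P.Geometry) {t : ℝ} {x₀ : Space d} (h : (t, x₀) ∈ P.base) :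
    IsOpen (P.Ostar t x₀) := by
  obtain ⟨G, hG, hGO⟩ := hgeo.Ostar_cont
  rw [hGO t x₀ h]
  exact hG.preimage (by fun_prop : Continuous fun u : State m n => (t, x₀, u))

theorem Geometry.isOpen_piUstar (hgeo : P.Geometry) : IsOpen P.piUstar := by
  have : P.piUstar = ⋃ y ∈ P.base, P.Ostar y.1 y.2 := by
    ext u
    simp [piUstar]
  rw [this]
  exact isOpen_biUnion fun y hy => hgeo.isOpen_Ostar hy

theorem Geometry.mem_piUstar (hgeo : P.Geometry) {t : ℝ} {x₀ : Space d} (h : (t, x₀) ∈ P.base)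
    {u : State m n} (hu : u ∈ P.O t x₀) : u ∈ P.piUstar :=
  ⟨t, x₀, h, hgeo.O_subset t x₀ h hu⟩

theorem mem_piU {t : ℝ} {x₀ : Space d} (h : (t, x₀) ∈ P.base) {u : State m n}
    (hu : u ∈ P.O t x₀) : u ∈ P.piU :=
  ⟨t, h.1, x₀, frontier_subset_closure h.2, hu⟩

theorem Geometry.norm_normal (hgeo : P.Geometry) {x₀ : Space d} (h : x₀ ∈ frontier P.Ω) :
    ‖P.ν x₀‖ = 1 := by
  obtain ⟨V, ρ, -, hx, -, -, hne, hν⟩ := hgeo.boundary.2 x₀ h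
  rw [hν x₀ ⟨hx, h⟩, norm_smul, norm_inv, norm_norm, inv_mul_cancel₀ (norm_ne_zero_iff.2 (hne x₀ hx))]

theorem Structural.block_Bsym (hstr : P.Structural nPos) {u : State m n} (hu : u ∈ P.piUstar)
    (l : Space d) : (P.Bsym l u).toBlocks₁₁ = 0 ∧ (P.Bsym l u).toBlocks₁₂ = 0 ∧
      (P.Bsym l u).toBlocks₂₁ = 0 := by
  have h := hstr.block_B u (Or.inr hu)
  have e11 : ∀ j k a b, P.B j k u (Sum.inl a) (Sum.inl b) = 0 := fun j k a b =>
    congrFun (congrFun (h j k).1 a) b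
  have e12 : ∀ j k a b, P.B j k u (Sum.inl a) (Sum.inr b) = 0 := fun j k a b =>
    congrFun (congrFun (h j k).2.1 a) b
  have e21 : ∀ j k a b, P.B j k u (Sum.inr a) (Sum.inl b) = 0 := fun j k a b =>
    congrFun (congrFun (h j k).2.2 a) b
  refine ⟨?_, ?_, ?_⟩ <;> ext a b <;>
    simp [Bsym, Matrix.toBlocks₁₁, Matrix.toBlocks₁₂, Matrix.toBlocks₂₁, Matrix.sum_apply, e11, e12,
      e21]

theorem Structural.contDiffOn_Asym (hstr : P.Structural nPos) (i j : Fin m ⊕ Fin n) :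
    ContDiffOn ℝ ∞ (fun y : Space d × State m n => P.Asym y.1 y.2 i j) (univ ×ˢ P.piUstar) := by
  simp only [Asym, Matrix.sum_apply, Matrix.smul_apply, smul_eq_mul]
  refine ContDiffOn.sum fun k _ => ContDiffOn.mul (by fun_prop) ?_
  exact ((hstr.H1_A k i j).mono subset_union_right).comp contDiffOn_snd fun y hy => hy.2

theorem Structural.contDiffOn_Bsym (hstr : P.Structural nPos) (i j : Fin m ⊕ Fin n) :
    ContDiffOn ℝ ∞ (fun y : Space d × State m n => P.Bsym y.1 y.2 i j) (univ ×ˢ P.piUstar) := by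
  simp only [Bsym, Matrix.sum_apply, Matrix.smul_apply, smul_eq_mul]
  refine ContDiffOn.sum fun k _ => ContDiffOn.sum fun k' _ => ContDiffOn.mul (by fun_prop) ?_
  exact ((hstr.H1_B k k' i j).mono subset_union_right).comp contDiffOn_snd fun y hy => hy.2

theorem Abar_smul (u : State m n) (x : ℝ) (l : Space d) : P.Abar u (x • l) = x • P.Abar u l := by
  have : P.Asym (x • l) u = x • P.Asym l u := by
    simp [Asym, Finset.smul_sum, smul_smul]
  rw [Abar, this, Matrix.mul_smul]; rfl

theorem Bbar_smul (u : State m n) (x : ℝ) (l : Space d) : P.Bbar u (x • l) = x ^ 2 • P.Bbar u l := by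
  have : P.Bsym (x • l) u = x ^ 2 • P.Bsym l u := by
    simp only [Bsym, Finset.smul_sum, smul_smul, PiLp.smul_apply, smul_eq_mul]
    refine Finset.sum_congr rfl fun j _ => Finset.sum_congr rfl fun k _ => ?_
    congr 1
    ring
  rw [Bbar, this, Matrix.mul_smul]; rfl

theorem Structural.numNegRe_redMat (hgeo : P.Geometry) (hstr : P.Structural nPos) {t : ℝ}
    {x₀ : Space d} (hb : (t, x₀) ∈ P.base) {u : State m n} (hu : u ∈ P.O t x₀) :
    (mixedMat (P.Asym (P.ν x₀) u) (P.Bsym (P.ν x₀) u)).det ≠ 0 ∧ (P.Asym (P.ν x₀) u).det ≠ 0 ∧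
      (∀ l ∈ complexRoots (redMat (P.Asym (P.ν x₀) u) (P.Bsym (P.ν x₀) u)), l.re ≠ 0) ∧
      numNegRe (redMat (P.Asym (P.ν x₀) u) (P.Bsym (P.ν x₀) u)) + nPos = nPos1 + n := by
  have hus := hgeo.mem_piUstar hb hu
  have hn := hgeo.norm_normal hb.2
  have hn0 : P.ν x₀ ≠ 0 := by rw [← norm_ne_zero_iff, hn]; exact one_ne_zero
  have hmem : u ∈ P.piU ∪ P.piUstar := Or.inr hus
  have hO := hgeo.O_subset t x₀ hb hu
  have h4 : numPosEigs ((P.A0 u)⁻¹ * P.Asym (P.ν x₀) u) = nPos := hstr.H4_count t x₀ hb u hu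
  have h3 : numPosEigs ((P.A0 u)⁻¹ * P.Asym (P.ν x₀) u).toBlocks₁₁ = nPos1 :=
    hstr.H3_count t x₀ hb u hO
  have key := _root_.numNegRe_redMat (A0 := P.A0 u) (hstr.block_A0 u hmem) (hstr.H1_det u hmem)
    (hstr.block_Bsym hus _) (hstr.H4_det t x₀ hb u hu) (hstr.H4_real u (mem_piU hb hu) _ hn0)
    (hstr.H3_real u hmem _ hn0) (by
      rcases hstr.H3_sign with h | h
      · exact fun a ha => (h t x₀ hb u hO a ha).ne'
      · exact fun a ha => (h t x₀ hb u hO a ha).ne) (by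
      obtain ⟨c, hc, h2⟩ := hstr.H2
      intro a ha
      have := h2 u hmem (P.ν x₀) a ha
      rw [hn] at this
      linarith) (by
      obtain ⟨c, hc, h5⟩ := hstr.H5
      intro x hx a ha
      have := h5 u (mem_piU hb hu) (x • P.ν x₀) a (by rwa [Abar_smul, Bbar_smul])
      rw [norm_smul, hn, mul_one, Real.norm_eq_abs, sq_abs] at this
      refine lt_of_lt_of_le ?_ this
      positivity)
  rw [h4, h3] at key
  exact key

set_option maxHeartbeats 2000000 in
theorem exists_reduction (hgeo : P.Geometry) (hstr : P.Structural nPos) {t : ℝ}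
    {x₀ : Space d} (hb : (t, x₀) ∈ P.base) {p₀ : State m n} (hp : p₀ ∈ P.O t x₀) :
    ∃ (H : Space d × State m n → ((Fin n → ℝ) →L[ℝ] State m n))
      (G : Space d × State m n → ((Fin n → ℝ) →L[ℝ] (Fin n → ℝ)))
      (Pr : (Fin n → ℝ) →L[ℝ] (Fin n → ℝ)) (S : ℝ → (Fin n → ℝ) →L[ℝ] (Fin n → ℝ)) (C κ : ℝ)
      (Gi : (Fin n → ℝ) →L[ℝ] (Fin n → ℝ)) (ρ : ℝ),
      ContDiff ℝ ∞ H ∧ ContDiff ℝ ∞ G ∧ ExpDichotomy (G (P.ν x₀, p₀)) Pr S C κ ∧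
      (∀ y, Gi (G (P.ν x₀, p₀) y) = y) ∧ (∀ y, G (P.ν x₀, p₀) (Gi y) = y) ∧
      Module.finrank ℝ Pr.range + nPos = nPos1 + n ∧ 0 < ρ ∧ Metric.ball p₀ ρ ⊆ P.piUstar ∧
      ∀ l ∈ Metric.ball (P.ν x₀) ρ, IsReduction (P.Asym l) (P.Bsym l) (Metric.ball p₀ ρ)
        (fun w => H (l, w)) (fun w => G (l, w)) := by
  obtain ⟨hmix, hA, hhyp, hcount⟩ := hstr.numNegRe_redMat hgeo hb hp
  have hO := hgeo.isOpen_piUstar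
  have hU : IsOpen ((univ : Set (Space d)) ×ˢ P.piUstar) := isOpen_univ.prod hO
  let Mx : Space d × State m n → BMat m n := fun y => mixedMat (P.Asym y.1 y.2) (P.Bsym y.1 y.2)
  have hMx : ∀ i j, ContDiffOn ℝ ∞ (fun y => Mx y i j) (univ ×ˢ P.piUstar) := by
    rintro (i | i) (j | j)
    · exact hstr.contDiffOn_Asym (Sum.inl i) (Sum.inl j)
    · exact hstr.contDiffOn_Asym (Sum.inl i) (Sum.inr j)
    · exact contDiffOn_const
    · exact hstr.contDiffOn_Bsym (Sum.inr i) (Sum.inr j)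
  let D : Set (Space d × State m n) :=
    ((univ : Set (Space d)) ×ˢ P.piUstar) ∩ (fun y => (Mx y).det) ⁻¹' {0}ᶜ
  have hD : IsOpen D := (contDiffOn_matrix_det hMx).continuousOn.isOpen_inter_preimage hU
    isOpen_compl_singleton
  have hpD : (P.ν x₀, p₀) ∈ D := ⟨⟨mem_univ _, hgeo.mem_piUstar hb hp⟩, hmix⟩
  have hinv := contDiffOn_matrix_inv (fun i j => (hMx i j).mono (inter_subset_left : D ⊆ _))
    (fun y hy => hy.2)
  have hlift : ∀ i j, ContDiffOn ℝ ∞ (fun y : Space d × State m n =>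
      liftMat (P.Asym y.1 y.2) (P.Bsym y.1 y.2) i j) D := fun i j => hinv i (Sum.inr j)
  have hred : ∀ i j, ContDiffOn ℝ ∞ (fun y : Space d × State m n =>
      redMat (P.Asym y.1 y.2) (P.Bsym y.1 y.2) i j) D := fun i j => by
    simp only [redMat, Matrix.submatrix_apply, Matrix.mul_apply]
    exact ContDiffOn.sum fun k _ => ((hstr.contDiffOn_Asym _ _).mono inter_subset_left).mul
      (hlift k j)
  obtain ⟨H, hH, hHe⟩ := exists_contDiff_eventuallyEq hD hpD (contDiffOn_matCLM hlift)
  obtain ⟨G, hG, hGe⟩ := exists_contDiff_eventuallyEq hD hpD (contDiffOn_matCLM hred)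
  obtain ⟨Pr, S, C, κ, hdich, hrank⟩ := exists_expDichotomy hhyp
  set R := redMat (P.Asym (P.ν x₀) p₀) (P.Bsym (P.ν x₀) p₀) with hR
  have hG0 : G (P.ν x₀, p₀) = matCLM R := hGe.self_of_nhds
  have hG0' : matCLM R = (Matrix.toLin' R).toContinuousLinearMap := by
    ext y i
    simp
  have hRdet : IsUnit R.det := by
    have h1 := mul_redMat hA (hstr.block_Bsym (hgeo.mem_piUstar hb hp) _) hmix
    have := congrArg Matrix.det h1
    rw [Matrix.det_mul, Matrix.det_one] at this
    exact IsUnit.of_mul_eq_one_right _ this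
  obtain ⟨ρ, hρ, hball⟩ := Metric.eventually_nhds_iff_ball.1
    ((hHe.and hGe).and (hD.mem_nhds hpD : ∀ᶠ y in 𝓝 (P.ν x₀, p₀), y ∈ D))
  have hball' : ∀ l ∈ Metric.ball (P.ν x₀) ρ, ∀ w ∈ Metric.ball p₀ ρ,
      (l, w) ∈ Metric.ball (P.ν x₀, p₀) ρ := fun l hl w hw => by
    rw [← ball_prod_same]; exact ⟨hl, hw⟩
  refine ⟨H, G, Pr, S, C, κ, matCLM R⁻¹, ρ, hH, hG, ?_, ?_, ?_, ?_, hρ, ?_, ?_⟩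
  · rw [hG0, hG0']; exact hdich
  · intro y; rw [hG0, matCLM_apply, matCLM_apply, Matrix.mulVec_mulVec, Matrix.nonsing_inv_mul _ hRdet,
      Matrix.one_mulVec]
  · intro y; rw [hG0, matCLM_apply, matCLM_apply, Matrix.mulVec_mulVec, Matrix.mul_nonsing_inv _ hRdet,
      Matrix.one_mulVec]
  · rw [hrank]; exact hcount
  · intro w hw
    exact (hball _ (hball' _ (Metric.mem_ball_self hρ) w hw)).2.1.2
  · intro l hl
    have hb' := fun w hw => hball _ (hball' l hl w hw)
    have hsub : Metric.ball p₀ ρ ⊆ P.piUstar := fun w hw => (hb' w hw).2.1.2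
    have hmaps : MapsTo (fun w : State m n => (l, w)) (Metric.ball p₀ ρ) (univ ×ˢ P.piUstar) :=
      fun w hw => ⟨mem_univ _, hsub hw⟩
    have hl' : ContDiff ℝ ∞ fun w : State m n => (l, w) := contDiff_const.prodMk contDiff_id
    have hsA : ∀ i j, ContDiffOn ℝ ∞ (fun w => P.Asym l w i j) (Metric.ball p₀ ρ) := fun i j =>
      ContDiffOn.comp (g := fun y : Space d × State m n => P.Asym y.1 y.2 i j)
        (hstr.contDiffOn_Asym i j) hl'.contDiffOn hmaps
    have hsB : ∀ i j, ContDiffOn ℝ ∞ (fun w => P.Bsym l w i j) (Metric.ball p₀ ρ) := fun i j =>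
      ContDiffOn.comp (g := fun y : Space d × State m n => P.Bsym y.1 y.2 i j)
        (hstr.contDiffOn_Bsym i j) hl'.contDiffOn hmaps
    refine ⟨Metric.isOpen_ball, hsA, hsB,
      fun w hw => ⟨(hstr.block_Bsym (hsub hw) l).1, (hstr.block_Bsym (hsub hw) l).2.1⟩,
      hH.comp hl', hG.comp hl', ?_, ?_, ?_, ?_⟩
    · intro w hw y
      rw [(hb' w hw).1.1, matCLM_apply, ← comp1_mixedMat _ (P.Bsym l w), mixedMat_liftMat (hb' w hw).2.2]
      rfl
    · intro w hw y
      rw [(hb' w hw).1.1, matCLM_apply, ← comp2_mixedMat (P.Asym l w) (hstr.block_Bsym (hsub hw) l).2.2,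
        mixedMat_liftMat (hb' w hw).2.2]
      rfl
    · intro w hw y
      rw [(hb' w hw).1.1, (hb' w hw).1.2, matCLM_apply, matCLM_apply, redMat_mulVec]
    · intro w hw v h1 h2
      have h3 : mixedMat (P.Asym l w) (P.Bsym l w) *ᵥ v = 0 := by
        refine state_ext ?_ ?_
        · rw [comp1_mixedMat, h1]; rfl
        · rw [comp2_mixedMat _ (hstr.block_Bsym (hsub hw) l).2.2, h2]; rfl
      exact Matrix.eq_zero_of_mulVec_eq_zero (hb' w hw).2.2 h3

end ViscousProblem

theorem dz_congr {F : Type*} [NormedAddCommGroup F] [NormedSpace ℝ F] {f g : ℝ → F}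
    (h : EqOn f g (Ici 0)) {z : ℝ} (hz : z ∈ Ici (0 : ℝ)) : dz f z = dz g z :=
  derivWithin_congr h (h hz)

theorem tendsto_of_norm_sub_le_exp {E : Type*} [NormedAddCommGroup E] {w : ℝ → E} {q : E}
    {M θ : ℝ} (hθ : 0 < θ) (h : ∀ z ∈ Ici (0 : ℝ), ‖w z - q‖ ≤ M * Real.exp (-θ * z)) :
    Tendsto w atTop (𝓝 q) := by
  rw [tendsto_iff_norm_sub_tendsto_zero]
  have h1 : Tendsto (fun z : ℝ => M * Real.exp (-θ * z)) atTop (𝓝 0) := by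
    have : Tendsto (fun z : ℝ => Real.exp (-θ * z)) atTop (𝓝 0) := Real.tendsto_exp_atBot.comp
      (tendsto_id.const_mul_atTop_of_neg (neg_lt_zero.2 hθ))
    simpa using this.const_mul M
  refine squeeze_zero' (Eventually.of_forall fun z => norm_nonneg _) ?_ h1
  filter_upwards [eventually_ge_atTop 0] with z hz using h z hz

theorem tendsto_clm_apply {α X Y : Type*} [NormedAddCommGroup X] [NormedSpace ℝ X]
    [NormedAddCommGroup Y] [NormedSpace ℝ Y] {f : α → X →L[ℝ] Y} {g : α → X} {l : Filter α}
    {L : X →L[ℝ] Y} {x : X} (hf : Tendsto f l (𝓝 L)) (hg : Tendsto g l (𝓝 x)) :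
    Tendsto (fun a => f a (g a)) l (𝓝 (L x)) :=
  ((isBoundedBilinearMap_apply (𝕜 := ℝ) (E := X) (F := Y)).continuous.tendsto (L, x)).comp
    (hf.prodMk_nhds hg)

namespace ViscousProblem

variable {d m n nPos1 n3 r : ℕ} {P : ViscousProblem d m n nPos1 n3 r} {nPos : ℕ}

theorem Γ_congr {w w' v v' : ℝ → State m n} (hw : EqOn w w' (Ici 0)) (hv : EqOn v v' (Ici 0)) :
    P.Γ w v = P.Γ w' v' := by
  simp only [Γ, hw self_mem_Ici, hv self_mem_Ici, dz_congr hv self_mem_Ici]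

/-- The boundary operator, on the initial state and first-order unknown. -/
def boundaryOp (P : ViscousProblem d m n nPos1 n3 r)
    (H : Space d × State m n → ((Fin n → ℝ) →L[ℝ] State m n))
    (x : Space d × State m n × (Fin n → ℝ)) :
    (Fin nPos1 → ℝ) × (Fin (n - n3) → ℝ) × (Fin n3 → ℝ) :=
  (P.Υ1 (comp1 x.2.1), P.Υ2 (comp2 x.2.1), P.Kν *ᵥ comp2 (H (x.1, x.2.1) x.2.2))

theorem isOpenMap_comp1 : IsOpenMap (comp1 : State m n → Fin m → ℝ) :=
  (comp1L m n).isOpenMap fun v => ⟨Sum.elim v 0, rfl⟩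

theorem isOpenMap_comp2 : IsOpenMap (comp2 : State m n → Fin n → ℝ) :=
  (comp2L m n).isOpenMap fun v => ⟨Sum.elim 0 v, rfl⟩

theorem contDiffOn_boundaryOp (hstr : P.Structural nPos)
    {H : Space d × State m n → ((Fin n → ℝ) →L[ℝ] State m n)} (hH : ContDiff ℝ ∞ H) :
    ContDiffOn ℝ ∞ (P.boundaryOp H) {x | x.2.1 ∈ P.piUstar} := by
  have h1 : ContDiffOn ℝ ∞ (fun x : Space d × State m n × (Fin n → ℝ) => P.Υ1 (comp1 x.2.1))
      {x | x.2.1 ∈ P.piUstar} :=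
    hstr.H6_Υ1.comp ((comp1L m n).contDiff.comp (contDiff_fst.comp contDiff_snd)).contDiffOn
      fun x hx => mem_image_of_mem _ hx
  have h2 : ContDiffOn ℝ ∞ (fun x : Space d × State m n × (Fin n → ℝ) => P.Υ2 (comp2 x.2.1))
      {x | x.2.1 ∈ P.piUstar} :=
    hstr.H6_Υ2.comp ((comp2L m n).contDiff.comp (contDiff_fst.comp contDiff_snd)).contDiffOn
      fun x hx => mem_image_of_mem _ hx
  have h3 : ContDiff ℝ ∞ (fun x : Space d × State m n × (Fin n → ℝ) =>
      matCLM P.Kν (comp2L m n (H (x.1, x.2.1) x.2.2))) :=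
    (matCLM P.Kν).contDiff.comp ((comp2L m n).contDiff.comp
      ((hH.comp (contDiff_fst.prodMk (contDiff_fst.comp contDiff_snd))).clm_apply
        (contDiff_snd.comp contDiff_snd)))
  have h3' : ContDiffOn ℝ ∞ (fun x : Space d × State m n × (Fin n → ℝ) =>
      P.Kν *ᵥ comp2 (H (x.1, x.2.1) x.2.2)) {x | x.2.1 ∈ P.piUstar} :=
    h3.contDiffOn.congr fun x _ => (matCLM_apply _ _).symm
  exact h1.prodMk (h2.prodMk h3')

theorem fderiv_boundaryOp (hgeo : P.Geometry) (hstr : P.Structural nPos)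
    {H : Space d × State m n → ((Fin n → ℝ) →L[ℝ] State m n)} (hH : ContDiff ℝ ∞ H)
    {l : Space d} {x : State m n × (Fin n → ℝ)} (hx : x.1 ∈ P.piUstar)
    (v : State m n × (Fin n → ℝ)) : fderiv ℝ (P.boundaryOp H) (l, x) (0, v) =
      (fderiv ℝ P.Υ1 (comp1 x.1) (comp1 v.1), fderiv ℝ P.Υ2 (comp2 x.1) (comp2 v.1),
        P.Kν *ᵥ comp2 (H (l, x.1) v.2 + fderiv ℝ (fun w => H (l, w)) x.1 v.1 x.2)) := by
  have hO1 := isOpenMap_comp1 _ hgeo.isOpen_piUstar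
  have hO2 := isOpenMap_comp2 _ hgeo.isOpen_piUstar
  have d1 := ((hstr.H6_Υ1.contDiffAt (hO1.mem_nhds (mem_image_of_mem _ hx))).differentiableAt
    (by simp)).hasFDerivAt
  have d2 := ((hstr.H6_Υ2.contDiffAt (hO2.mem_nhds (mem_image_of_mem _ hx))).differentiableAt
    (by simp)).hasFDerivAt
  have d3 : HasFDerivAt (fun w => H (l, w)) (fderiv ℝ (fun w => H (l, w)) x.1) x.1 :=
    ((hH.comp (contDiff_const.prodMk contDiff_id)).differentiable (by simp) x.1).hasFDerivAt
  have hd : DifferentiableAt ℝ (P.boundaryOp H) (l, x) :=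
    ((contDiffOn_boundaryOp hstr hH).contDiffAt ((hgeo.isOpen_piUstar.preimage
      (by fun_prop : Continuous fun x : Space d × State m n × (Fin n → ℝ) => x.2.1)).mem_nhds hx)
      ).differentiableAt (by simp)
  have e1 : HasFDerivAt (fun x => P.boundaryOp H (l, x)) _ x :=
    hd.hasFDerivAt.comp x (hasFDerivAt_prodMk_right l x)
  have f1 := (ContinuousLinearMap.fst ℝ (State m n) (Fin n → ℝ)).hasFDerivAt (x := x)
  have f2 := (ContinuousLinearMap.snd ℝ (State m n) (Fin n → ℝ)).hasFDerivAt (x := x)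
  have g1 := d1.comp x ((comp1L m n).hasFDerivAt.comp x f1)
  have g2 := d2.comp x ((comp2L m n).hasFDerivAt.comp x f1)
  have g3 := (matCLM P.Kν).hasFDerivAt.comp x
    ((comp2L m n).hasFDerivAt.comp x ((d3.comp x f1).clm_apply f2))
  have e2 : HasFDerivAt (fun x => P.boundaryOp H (l, x)) _ x :=
    (g1.prodMk (g2.prodMk g3)).congr_of_eventuallyEq (Eventually.of_forall fun x => by
      simp only [boundaryOp, Function.comp_apply, matCLM_apply]; rfl)
  have := DFunLike.congr_fun (e1.unique e2) v
  refine Eq.trans (by rfl) (this.trans ?_)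
  simp only [ContinuousLinearMap.prod_apply, ContinuousLinearMap.comp_apply, matCLM_apply,
    _root_.add_apply, ContinuousLinearMap.flip_apply, ContinuousLinearMap.coe_fst',
    ContinuousLinearMap.coe_snd']
  rfl

section Transversality

variable {H : Space d × State m n → ((Fin n → ℝ) →L[ℝ] State m n)}
  {G : Space d × State m n → ((Fin n → ℝ) →L[ℝ] (Fin n → ℝ))}
  {Pr : (Fin n → ℝ) →L[ℝ] (Fin n → ℝ)} {l₀ l : Space d} {p₀ q : State m n} {a : Fin n → ℝ}
  {O : Set (State m n)} {U : Set (Space d × State m n × (Fin n → ℝ))}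
  {X : Space d × State m n × (Fin n → ℝ) → ℝ → State m n × (Fin n → ℝ)} {η θ : ℝ}
  {M : Space d × State m n × (Fin n → ℝ) → ℝ}

theorem contDiffOn_family (fam : IsStableProfileFamily H G Pr l₀ p₀ U X η θ M)
    {y : Space d × State m n × (Fin n → ℝ)} (hy : y ∈ U) : ContDiffOn ℝ ∞ (X y) (Ici 0) :=
  ContDiffOn.comp (g := fun a : ℝ × (Space d × State m n × (Fin n → ℝ)) => X a.2 a.1) fam.smooth
    (contDiff_id.prodMk contDiff_const).contDiffOn fun z hz => ⟨hz, hy⟩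

theorem contDiffOn_family_zero (fam : IsStableProfileFamily H G Pr l₀ p₀ U X η θ M) :
    ContDiffOn ℝ ∞ (fun y => X y 0) U :=
  ContDiffOn.comp (g := fun a : ℝ × (Space d × State m n × (Fin n → ℝ)) => X a.2 a.1) fam.smooth
    (contDiff_const.prodMk contDiff_id).contDiffOn fun y hy => ⟨self_mem_Ici, hy⟩

theorem tendsto_family (fam : IsStableProfileFamily H G Pr l₀ p₀ U X η θ M)
    (hy : (l, q, a) ∈ U) : Tendsto (X (l, q, a)) atTop (𝓝 (q, 0)) :=
  tendsto_of_norm_sub_le_exp fam.rate_pos (fam.decay _ hy)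

/-- Boundary values of the profile family. -/
def bdryMap (P : ViscousProblem d m n nPos1 n3 r)
    (H : Space d × State m n → ((Fin n → ℝ) →L[ℝ] State m n))
    (X : Space d × State m n × (Fin n → ℝ) → ℝ → State m n × (Fin n → ℝ))
    (y : Space d × State m n × (Fin n → ℝ)) :
    (Fin nPos1 → ℝ) × (Fin (n - n3) → ℝ) × (Fin n3 → ℝ) :=
  P.boundaryOp H (y.1, X y 0)

theorem contDiffOn_bdryMap (hstr : P.Structural nPos)
    (hH : ContDiff ℝ ∞ H) (fam : IsStableProfileFamily H G Pr l₀ p₀ U X η θ M) :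
    ContDiffOn ℝ ∞ (P.bdryMap H X) {y ∈ U | (X y 0).1 ∈ P.piUstar} :=
  ContDiffOn.comp (contDiffOn_boundaryOp hstr hH)
    (contDiffOn_fst.prodMk ((contDiffOn_family_zero fam).mono fun y hy => hy.1)) fun y hy => hy.2

theorem fderiv_bdryMap (hgeo : P.Geometry) (hstr : P.Structural nPos) (hH : ContDiff ℝ ∞ H)
    (fam : IsStableProfileFamily H G Pr l₀ p₀ U X η θ M) {y : Space d × State m n × (Fin n → ℝ)}
    (hy : y ∈ U) (hyU : (X y 0).1 ∈ P.piUstar) (q' : State m n) (a' : Fin n → ℝ) :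
    fderiv ℝ (P.bdryMap H X) y (0, q', a') =
      fderiv ℝ (P.boundaryOp H) (y.1, X y 0) (0, fderiv ℝ (fun y => X y 0) y (0, q', a')) := by
  have hd : DifferentiableAt ℝ (P.boundaryOp H) (y.1, X y 0) :=
    ((contDiffOn_boundaryOp hstr hH).contDiffAt ((hgeo.isOpen_piUstar.preimage
      (by fun_prop : Continuous fun x : Space d × State m n × (Fin n → ℝ) => x.2.1)).mem_nhds hyU)
      ).differentiableAt (by simp)
  have hX : DifferentiableAt ℝ (fun y => X y 0) y :=
    ((contDiffOn_family_zero fam).contDiffAt (fam.isOpen.mem_nhds hy)).differentiableAt (by simp)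
  have h1 : HasFDerivAt (P.bdryMap H X) _ y :=
    hd.hasFDerivAt.comp y (hasFDerivAt_fst.prodMk hX.hasFDerivAt)
  rw [h1.fderiv]
  rfl

variable (hgeo : P.Geometry) (hstr : P.Structural nPos) (hH : ContDiff ℝ ∞ H)
  (fam : IsStableProfileFamily H G Pr l₀ p₀ U X η θ M) (hOU : O ⊆ P.piUstar)
  (hred : IsReduction (P.Asym l) (P.Bsym l) O (fun w => H (l, w)) (fun w => G (l, w)))
  (hy : (l, q, a) ∈ U) (hO : ∀ z ∈ Ici (0 : ℝ), (X (l, q, a) z).1 ∈ O)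

include fam hred hy hO

theorem dz_family {z : ℝ} (hz : z ∈ Ici (0 : ℝ)) : dz (fun z => (X (l, q, a) z).1) z =
    H (l, (X (l, q, a) z).1) (X (l, q, a) z).2 :=
  (hred.profile_of_firstOrder hO (fam.ode _ hy) z hz).1

theorem solvesProfileEq_family : P.SolvesProfileEq l (fun z => (X (l, q, a) z).1) :=
  ⟨contDiff_fst.comp_contDiffOn (contDiffOn_family fam hy), fun z hz =>
    (hred.profile_of_firstOrder hO (fam.ode _ hy) z hz).2.2⟩

include hgeo hstr hH hOU in
theorem linearized_family {w : ℝ → State m n}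
    (hw : EqOn w (fun z => (X (l, q, a) z).1) (Ici 0)) (q' : State m n) (a' : Fin n → ℝ) :
    P.SolvesLinearized l w (fun z => (fderiv ℝ (fun y => X y z) (l, q, a) (0, q', a')).1) ∧
    Tendsto (fun z => ((fderiv ℝ (fun y => X y z) (l, q, a) (0, q', a')).1,
      comp2 (dz (fun z => (fderiv ℝ (fun y => X y z) (l, q, a) (0, q', a')).1) z))) atTop
      (𝓝 (q', 0)) ∧
    P.Γ w (fun z => (fderiv ℝ (fun y => X y z) (l, q, a) (0, q', a')).1) =
      fderiv ℝ (P.bdryMap H X) (l, q, a) (0, q', a') := by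
  obtain ⟨h1, h2, h3, h4⟩ := fam.lin _ hy q' a'
  have hdw : ∀ z ∈ Ici (0 : ℝ), dz w z = H (l, (X (l, q, a) z).1) (X (l, q, a) z).2 := fun z hz => by
    rw [dz_congr hw hz, dz_family fam hred hy hO hz]
  have key := hred.linearized_of_firstOrder hO hw hdw h2
  refine ⟨⟨contDiff_fst.comp_contDiffOn h1, fun z hz => (key z hz).2⟩, ?_, ?_⟩
  · have hX := tendsto_family fam hy
    have c1 : Tendsto (fun z => (X (l, q, a) z).1) atTop (𝓝 q) :=
      (continuous_fst.tendsto (q, (0 : Fin n → ℝ))).comp hX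
    have c2 : Tendsto (fun z => (X (l, q, a) z).2) atTop (𝓝 0) :=
      (continuous_snd.tendsto (q, (0 : Fin n → ℝ))).comp hX
    have c3 := (continuous_fst.tendsto (q', (0 : Fin n → ℝ))).comp h3
    have c4 := (continuous_snd.tendsto (q', (0 : Fin n → ℝ))).comp h3
    refine c3.prodMk_nhds ?_
    have hHl : ContDiff ℝ ∞ fun w => H (l, w) := hred.smooth_H
    have c5 := (tendsto_clm_apply ((hHl.continuous.tendsto q).comp c1) c4).add
      (tendsto_clm_apply (tendsto_clm_apply
        (((hHl.continuous_fderiv (by simp)).tendsto q).comp c1) c3) c2)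
    have c6 := ((comp2L m n).continuous.tendsto _).comp c5
    rw [map_zero, map_zero, add_zero, map_zero] at c6
    refine c6.congr' ?_
    filter_upwards [eventually_ge_atTop 0] with z hz
    rw [(key z hz).1]
    rfl
  · rw [fderiv_bdryMap hgeo hstr hH fam hy (hOU (hO 0 self_mem_Ici)),
      fderiv_boundaryOp hgeo hstr hH (hOU (hO 0 self_mem_Ici)), Γ, hw self_mem_Ici,
      (key 0 self_mem_Ici).1]

include hstr hOU in
theorem eq_family_of_linearized (hPr : ∀ x, Pr (Pr x) = Pr x) (hqO : q ∈ O) {w : ℝ → State m n}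
    (hw : EqOn w (fun z => (X (l, q, a) z).1) (Ici 0)) {v : ℝ → State m n}
    (hv : P.SolvesLinearized l w v) {L : State m n × (Fin n → ℝ)}
    (hL : Tendsto (fun z => (v z, comp2 (dz v z))) atTop (𝓝 L)) :
    ∃ a', Pr a' = a' ∧ EqOn v
      (fun z => (fderiv ℝ (fun y => X y z) (l, q, a) (0, L.1, a')).1) (Ici 0) := by
  have hdw : ∀ z ∈ Ici (0 : ℝ), dz w z = H (l, (X (l, q, a) z).1) (X (l, q, a) z).2 := fun z hz => by
    rw [dz_congr hw hz, dz_family fam hred hy hO hz]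
  have hws : ContDiffOn ℝ ∞ w (Ici 0) :=
    (contDiff_fst.comp_contDiffOn (contDiffOn_family fam hy)).congr hw
  have key := hred.firstOrder_of_linearized hO hws hw hdw hv.1 hv.2
  set V3 : ℝ → Fin n → ℝ := fun z =>
    comp2 (P.Bsym l (w z) *ᵥ dz v z + dMat (P.Bsym l) (w z) (v z) *ᵥ dz w z) with hV3
  obtain ⟨-, h2, h3, h4⟩ := fam.lin _ hy L.1 0
  -- the limit of the first-order unknown
  have hX := tendsto_family fam hy
  have c1 : Tendsto w atTop (𝓝 q) := ((continuous_fst.tendsto (q, (0 : Fin n → ℝ))).comp hX).congr' (by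
    filter_upwards [eventually_ge_atTop 0] with z hz using (hw hz).symm)
  have c2 : Tendsto (fun z => (X (l, q, a) z).2) atTop (𝓝 0) :=
    (continuous_snd.tendsto (q, (0 : Fin n → ℝ))).comp hX
  have hHl : ContDiff ℝ ∞ fun w => H (l, w) := hred.smooth_H
  have c3 : Tendsto (fun z => dz w z) atTop (𝓝 0) := by
    have := tendsto_clm_apply ((hHl.continuous.tendsto q).comp c1) c2
    rw [map_zero] at this
    refine this.congr' ?_
    filter_upwards [eventually_ge_atTop 0] with z hz
    rw [hdw z hz, show (X (l, q, a) z).1 = w z from (hw hz).symm]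
    rfl
  have cv := (continuous_fst.tendsto L).comp hL
  have cv2 := (continuous_snd.tendsto L).comp hL
  have hlim : ∃ L3, Tendsto V3 atTop (𝓝 L3) := by
    refine ⟨(P.Bsym l q).toBlocks₂₂ *ᵥ L.2 + 0, ?_⟩
    have cB : ∀ i j, Tendsto (fun z => P.Bsym l (w z) i j) atTop (𝓝 (P.Bsym l q i j)) := fun i j =>
      (((hred.smooth_B i j).continuousOn.continuousAt (hred.isOpen.mem_nhds hqO)).tendsto).comp c1
    have cdB : ∀ i j, Tendsto (fun z => dMat (P.Bsym l) (w z) (v z) i j) atTop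
        (𝓝 (dMat (P.Bsym l) q L.1 i j)) := fun i j => by
      have := (((hred.smooth_B i j).continuousOn_fderiv_of_isOpen hred.isOpen (by simp)).continuousAt
        (hred.isOpen.mem_nhds hqO)).tendsto.comp c1
      exact tendsto_clm_apply this cv
    rw [tendsto_pi_nhds]
    intro i
    have h1 : Tendsto (fun z => ∑ j, P.Bsym l (w z) (Sum.inr i) (Sum.inr j) * comp2 (dz v z) j +
        ∑ j, dMat (P.Bsym l) (w z) (v z) (Sum.inr i) j * dz w z j) atTop
        (𝓝 (∑ j, P.Bsym l q (Sum.inr i) (Sum.inr j) * L.2 j +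
          ∑ j, dMat (P.Bsym l) q L.1 (Sum.inr i) j * (0 : State m n) j)) :=
      (tendsto_finsetSum _ fun j _ => (cB _ _).mul ((tendsto_pi_nhds.1 cv2) j)).add
        (tendsto_finsetSum _ fun j _ => (cdB _ _).mul ((tendsto_pi_nhds.1 c3) j))
    simp only [Pi.zero_apply, mul_zero, Finset.sum_const_zero, add_zero] at h1
    rw [add_zero]
    refine h1.congr' ?_
    filter_upwards [eventually_ge_atTop 0] with z hz
    have hz' : w z ∈ P.piUstar := by rw [hw hz]; exact hOU (hO z hz)
    have e21 : ∀ j, P.Bsym l (w z) (Sum.inr i) (Sum.inl j) = 0 := fun j =>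
      congrFun (congrFun (hstr.block_Bsym hz' l).2.2 i) j
    rw [hV3]
    simp only [comp2_add, Pi.add_apply]
    simp [comp2, Matrix.mulVec, dotProduct, Fintype.sum_sum_type, e21]
  obtain ⟨L3, hL3⟩ := hlim
  have hdiff := fam.lin_unique _ hy
    (fun z => (v z, V3 z) - fderiv ℝ (fun y => X y z) (l, q, a) (0, L.1, 0)) (Pr (V3 0)) ?_ ?_ ?_ ?_
  · refine ⟨Pr (V3 0), hPr _, fun z hz => ?_⟩
    have h5 := sub_eq_iff_eq_add.1 (hdiff z hz)
    rw [← map_add] at h5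
    have h6 := congrArg Prod.fst h5
    simpa using h6
  · intro z hz
    rw [map_sub]
    exact (key z hz).sub (h2 z hz)
  · have := cv.sub ((continuous_fst.tendsto (L.1, (0 : Fin n → ℝ))).comp h3)
    simpa using this
  · have hc := hL3.sub ((continuous_snd.tendsto (L.1, (0 : Fin n → ℝ))).comp h3)
    have hcont : ContinuousOn (fun z => V3 z - (fderiv ℝ (fun y => X y z) (l, q, a) (0, L.1, 0)).2)
        (Ici 0) := fun z hz =>
      (continuous_snd.tendsto _).comp ((key z hz).sub (h2 z hz)).continuousWithinAt
    exact exists_bound_of_tendsto hcont hc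
  · change Pr (Pr (V3 0)) = Pr (V3 0 - (fderiv ℝ (fun y => X y 0) (l, q, a) (0, L.1, 0)).2)
    rw [map_sub, h4, hPr, map_zero, sub_zero]

include hgeo hstr hH hOU in
theorem transversal_iff (hPr : ∀ x, Pr (Pr x) = Pr x) (hqO : q ∈ O) {w : ℝ → State m n}
    (hw : EqOn w (fun z => (X (l, q, a) z).1) (Ici 0)) : P.Transversal l w ↔
    (∀ a', Pr a' = a' → fderiv ℝ (P.bdryMap H X) (l, q, a) (0, 0, a') = 0 → a' = 0) ∧
    ∀ b, ∃ q' a', Pr a' = a' ∧ fderiv ℝ (P.bdryMap H X) (l, q, a) (0, q', a') = b := by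
  have hlin := linearized_family hgeo hstr hH fam hOU hred hy hO hw
  have hsol := fun {v : ℝ → State m n} (hv : P.SolvesLinearized l w v) {L : State m n × (Fin n → ℝ)} =>
    eq_family_of_linearized hstr fam hOU hred hy hO hPr hqO hw hv (L := L)
  constructor
  · rintro ⟨hinj, hsurj⟩
    refine ⟨fun a' ha' h0 => ?_, fun b => ?_⟩
    · obtain ⟨h1, h2, h3⟩ := hlin 0 a'
      have hv := hinj _ ⟨h1, h2⟩ (h3.trans h0)
      obtain ⟨-, h5, h6, h7⟩ := fam.lin _ hy 0 a'
      have hd : (fderiv ℝ (fun y => X y 0) (l, q, a) (0, 0, a')).2 = 0 := by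
        have hdw : ∀ z ∈ Ici (0 : ℝ), dz w z = H (l, (X (l, q, a) z).1) (X (l, q, a) z).2 :=
          fun z hz => by rw [dz_congr hw hz, dz_family fam hred hy hO hz]
        have k1 := (hred.linearized_of_firstOrder hO hw hdw h5 0 self_mem_Ici).1
        have k2 : dz (fun z => (fderiv ℝ (fun y => X y z) (l, q, a) (0, 0, a')).1) 0 = 0 := by
          rw [dz_congr (g := fun _ => 0) hv self_mem_Ici]
          exact dz_eq self_mem_Ici (hasDerivWithinAt_const 0 (Ici 0) (0 : State m n))
        rw [k2, hv 0 self_mem_Ici, map_zero] at k1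
        have k3 : H (l, (X (l, q, a) 0).1) (fderiv ℝ (fun y => X y 0) (l, q, a) (0, 0, a')).2 = 0 := by
          simpa using k1.symm
        have k4 := hred.comp2_H _ (hO 0 self_mem_Ici)
          (fderiv ℝ (fun y => X y 0) (l, q, a) (0, 0, a')).2
        rw [k3, Matrix.mulVec_zero] at k4
        exact k4.symm
      rw [hd, map_zero, ha'] at h7
      exact h7.symm
    · obtain ⟨v, ⟨hv, L, hL⟩, hb⟩ := hsurj b
      obtain ⟨a', ha', hva⟩ := hsol hv hL
      refine ⟨L.1, a', ha', ?_⟩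
      rw [← (hlin L.1 a').2.2, ← hb]
      exact Γ_congr (fun _ _ => rfl) hva.symm
  · rintro ⟨hinj, hsurj⟩
    refine ⟨fun v hv h0 z hz => ?_, fun b => ?_⟩
    · obtain ⟨a', ha', hva⟩ := hsol hv.1 hv.2
      have h1 : a' = 0 := hinj a' ha' (by
        rw [← (hlin 0 a').2.2, ← h0]
        exact Γ_congr (fun _ _ => rfl) hva.symm)
      rw [hva hz, h1]
      change (fderiv ℝ (fun y => X y z) (l, q, a) (0, 0, 0)).1 = 0
      rw [show ((0 : Space d), (0 : State m n), (0 : Fin n → ℝ)) = 0 from rfl, map_zero]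
      rfl
    · obtain ⟨q', a', -, hb⟩ := hsurj b
      obtain ⟨h1, h2, h3⟩ := hlin q' a'
      exact ⟨_, ⟨h1, _, h2⟩, h3.trans hb⟩

end Transversality

end ViscousProblem

section LyapunovSchmidt

variable {X V Y : Type} [NormedAddCommGroup X] [NormedSpace ℝ X] [FiniteDimensional ℝ X]
  [NormedAddCommGroup V] [NormedSpace ℝ V] [FiniteDimensional ℝ V]
  [NormedAddCommGroup Y] [NormedSpace ℝ Y] [FiniteDimensional ℝ Y]

theorem isOpen_setOf_surjective : IsOpen {f : X →L[ℝ] Y | Function.Surjective f} := by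
  rw [isOpen_iff_mem_nhds]
  intro f hf
  obtain ⟨R, hR⟩ := LinearMap.exists_rightInverse_of_surjective (f : X →ₗ[ℝ] Y)
    (LinearMap.range_eq_top.2 hf)
  let R' : Y →L[ℝ] X := LinearMap.toContinuousLinearMap R
  have hc : Continuous fun g : X →L[ℝ] Y => g.comp R' := by fun_prop
  have h1 : f.comp R' = 1 := by
    ext y
    exact LinearMap.congr_fun hR y
  have h2 : {g : Y →L[ℝ] Y | IsUnit g} ∈ 𝓝 (f.comp R') := by
    rw [h1]; exact Units.isOpen.mem_nhds isUnit_one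
  filter_upwards [hc.continuousAt.preimage_mem_nhds h2] with g hg y
  obtain ⟨u, hu⟩ := (hg : IsUnit (g.comp R'))
  have hu' : (u : Y →L[ℝ] Y) = g.comp R' := hu
  refine ⟨R' ((↑u⁻¹ : Y →L[ℝ] Y) y), ?_⟩
  have : (g.comp R') ((↑u⁻¹ : Y →L[ℝ] Y) y) = (u * u⁻¹ : Y →L[ℝ] Y) y := by
    rw [← hu']; rfl
  rw [Units.mul_inv] at this
  exact this

theorem exists_leftInverse_and_cokernel {D : V →L[ℝ] Y} (hD : Function.Injective D) {k : ℕ}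
    (hk : Module.finrank ℝ Y = Module.finrank ℝ V + k) :
    ∃ (π : Y →L[ℝ] V) (κ : Y →L[ℝ] (Fin k → ℝ)), (∀ v, π (D v) = v) ∧ Function.Surjective κ ∧
      (∀ v, κ (D v) = 0) ∧ ∀ y, π y = 0 → κ y = 0 → y = 0 := by
  obtain ⟨π, hπ⟩ := LinearMap.exists_leftInverse_of_injective (D : V →ₗ[ℝ] Y)
    (LinearMap.ker_eq_bot.2 hD)
  let R := LinearMap.range (D : V →ₗ[ℝ] Y)
  have hR : Module.finrank ℝ R = Module.finrank ℝ V := LinearMap.finrank_range_of_inj hD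
  have hq : Module.finrank ℝ (Y ⧸ R) = Module.finrank ℝ (Fin k → ℝ) := by
    have := R.finrank_quotient_add_finrank
    rw [Module.finrank_fin_fun]
    omega
  let e := LinearEquiv.ofFinrankEq (Y ⧸ R) (Fin k → ℝ) hq
  let κ : Y →ₗ[ℝ] (Fin k → ℝ) := e.toLinearMap ∘ₗ R.mkQ
  have hκ : ∀ y, κ y = 0 ↔ y ∈ R := fun y => by
    change e (R.mkQ y) = 0 ↔ _
    rw [LinearEquiv.map_eq_zero_iff, Submodule.mkQ_apply, Submodule.Quotient.mk_eq_zero]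
  have hπ' : ∀ v, π (D v) = v := fun v => LinearMap.congr_fun hπ v
  refine ⟨LinearMap.toContinuousLinearMap π, LinearMap.toContinuousLinearMap κ, hπ',
    e.surjective.comp R.mkQ_surjective, fun v => (hκ _).2 ⟨v, rfl⟩, fun y h1 h2 => ?_⟩
  obtain ⟨v, rfl⟩ := (hκ y).1 h2
  have h1' : π (D v) = 0 := h1
  rw [hπ'] at h1'
  change D v = 0
  rw [h1', map_zero]

/-- Lyapunov–Schmidt reduction of the equation `g (x, a) = 0`. -/
theorem exists_reducedEquation {O : Set (X × V)} (hO : IsOpen O) {g : X × V → Y}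
    (hg : ContDiffOn ℝ ∞ g O) {u : X × V} (hu : u ∈ O) (hgu : g u = 0)
    (hD : Function.Injective ((fderiv ℝ g u).comp (ContinuousLinearMap.inr ℝ X V))) {k : ℕ}
    (hk : Module.finrank ℝ Y = Module.finrank ℝ V + k) :
    ∃ (φ : X → V) (F : X → Fin k → ℝ) (κ : Y →L[ℝ] (Fin k → ℝ)) (U : Set X) (W : Set V),
      IsOpen U ∧ IsOpen W ∧ u.1 ∈ U ∧ u.2 ∈ W ∧ U ×ˢ W ⊆ O ∧ ContDiffOn ℝ ∞ φ U ∧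
      ContDiffOn ℝ ∞ F U ∧ (∀ x ∈ U, φ x ∈ W) ∧
      (∀ x ∈ U, ∀ a ∈ W, g (x, a) = 0 ↔ φ x = a ∧ F x = 0) ∧
      Function.Surjective κ ∧ (∀ a, κ (fderiv ℝ g u (0, a)) = 0) ∧
      ∀ x, fderiv ℝ F u.1 x = κ (fderiv ℝ g u (x, 0)) := by
  obtain ⟨π, κ, hπ, hκs, hκD, hπκ⟩ := exists_leftInverse_and_cokernel hD hk
  have hgd : DifferentiableAt ℝ g u := (hg.contDiffAt (hO.mem_nhds hu)).differentiableAt (by simp)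
  have hf : ContDiffOn ℝ ∞ (fun x => π (g x)) O := π.contDiff.comp_contDiffOn hg
  have hfd : HasFDerivAt (fun x => π (g x)) (π.comp (fderiv ℝ g u)) u :=
    π.hasFDerivAt.comp u hgd.hasFDerivAt
  have hinv : (fderiv ℝ (fun x => π (g x)) u ∘L ContinuousLinearMap.inr ℝ X V).IsInvertible := by
    rw [hfd.fderiv]
    refine ⟨ContinuousLinearEquiv.refl ℝ V, ?_⟩
    ext a
    exact (hπ a).symm
  obtain ⟨φ, U, W, hU, hW, huU, huW, hUW, hφu, hφ, hmaps, hiff⟩ :=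
    exists_implicitFunction_contDiffOn hO hf hu hinv
  have hgφ : ContDiffOn ℝ ∞ (fun x => g (x, φ x)) U :=
    hg.comp (contDiffOn_id.prodMk hφ) fun x hx => hUW ⟨hx, hmaps x hx⟩
  refine ⟨φ, fun x => κ (g (x, φ x)), κ, U, W, hU, hW, huU, huW, hUW, hφ,
    κ.contDiff.comp_contDiffOn hgφ, hmaps, fun x hx a ha => ?_, hκs, hκD, fun x => ?_⟩
  · have h1 := hiff x hx
    simp only [hgu, map_zero] at h1
    constructor
    · intro h
      have h2 : φ x = a := (h1 a ha).1 (by rw [h, map_zero])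
      exact ⟨h2, by simp only [h2, h, map_zero]⟩
    · rintro ⟨rfl, h⟩
      exact hπκ _ ((h1 _ ha).2 rfl) h
  · have hφd : HasFDerivAt φ (fderiv ℝ φ u.1) u.1 :=
      ((hφ.contDiffAt (hU.mem_nhds huU)).differentiableAt (by simp)).hasFDerivAt
    have hgd' : HasFDerivAt g (fderiv ℝ g u) (u.1, φ u.1) := by
      rw [hφu]; exact hgd.hasFDerivAt
    have h1 : HasFDerivAt (fun x => κ (g (x, φ x))) _ u.1 :=
      κ.hasFDerivAt.comp u.1 (hgd'.comp u.1 ((hasFDerivAt_id u.1).prodMk hφd))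
    rw [h1.fderiv]
    change κ (fderiv ℝ g u (x, fderiv ℝ φ u.1 x)) = _
    have h2 : ((x, fderiv ℝ φ u.1 x) : X × V) = (x, 0) + (0, fderiv ℝ φ u.1 x) := by simp
    have h3 : κ (fderiv ℝ g u (0, fderiv ℝ φ u.1 x)) = 0 := hκD _
    rw [h2, map_add, map_add, h3, add_zero]

end LyapunovSchmidt

namespace ViscousProblem

variable {d m n nPos1 n3 r : ℕ} {P : ViscousProblem d m n nPos1 n3 r} {nPos : ℕ}

/-- A smooth family `W (l, p, q)` of transversal profiles with frozen normal `l` and endstate `q`,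
satisfying the boundary conditions of the constant state `p` where `F (l, p, q) = 0`, and containing
all such profiles of amplitude at most `e` about `p`. -/
structure IsLocalLayerFamily (P : ViscousProblem d m n nPos1 n3 r) (nPos : ℕ)
    (N : Set (Space d × State m n × State m n)) (F : Space d × State m n × State m n → Fin nPos → ℝ)
    (W : Space d × State m n × State m n → ℝ → State m n) (θ : ℝ)
    (M : Space d × State m n × State m n → ℝ) (e : ℝ) : Prop where
  isOpen : IsOpen N
  smooth_F : ContDiffOn ℝ ∞ F N
  surjective : ∀ l p q, (l, p, q) ∈ N → Function.Surjective (fderiv ℝ (fun q => F (l, p, q)) q)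
  smooth : ContDiffOn ℝ ∞ (fun a : ℝ × (Space d × State m n × State m n) => W a.2 a.1) (Ici 0 ×ˢ N)
  rate_pos : 0 < θ
  decay : ∀ x ∈ N, ∀ z ∈ Ici (0 : ℝ), ‖W x z - x.2.2‖ ≤ M x * Real.exp (-θ * z)
  dz_le : ∀ x ∈ N, ∀ z ∈ Ici (0 : ℝ), ‖comp2 (dz (W x) z)‖ ≤ M x
  continuousOn : ContinuousOn M N
  bound_diag : ∀ l p, (l, p, p) ∈ N → M (l, p, p) = 0
  profile : ∀ l p q, (l, p, q) ∈ N → F (l, p, q) = 0 → P.SolvesProfileEq l (W (l, p, q)) ∧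
    P.Υ1 (comp1 (W (l, p, q) 0)) = P.Υ1 (comp1 p) ∧ P.Υ2 (comp2 (W (l, p, q) 0)) = P.Υ2 (comp2 p) ∧
    P.Kν *ᵥ comp2 (dz (W (l, p, q)) 0) = 0
  transversal : ∀ l p q, (l, p, q) ∈ N → ∀ w, EqOn w (W (l, p, q)) (Ici 0) → P.Transversal l w
  amplitude_pos : 0 < e
  unique : ∀ l p q, (l, p, q) ∈ N → ∀ w, P.SolvesProfileEq l w →
    P.Υ1 (comp1 (w 0)) = P.Υ1 (comp1 p) → P.Υ2 (comp2 (w 0)) = P.Υ2 (comp2 p) →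
    P.Kν *ᵥ comp2 (dz w 0) = 0 → Tendsto w atTop (𝓝 q) → AmplitudeLE p e w →
    F (l, p, q) = 0 ∧ EqOn w (W (l, p, q)) (Ici 0)

theorem exists_bound_Bsym (hgeo : P.Geometry) (hstr : P.Structural nPos) (l₀ : Space d)
    {p₀ : State m n} (hp : p₀ ∈ P.piUstar) : ∃ ρ > 0, ∃ C ≥ 0, ∀ l ∈ Metric.ball l₀ ρ,
      ∀ w ∈ Metric.ball p₀ ρ, ∀ v, ‖comp2 (P.Bsym l w *ᵥ v)‖ ≤ C * ‖comp2 v‖ := by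
  have hU : IsOpen ((univ : Set (Space d)) ×ˢ P.piUstar) := isOpen_univ.prod hgeo.isOpen_piUstar
  have h1 : ContDiffOn ℝ ∞ (fun y : Space d × State m n => matCLM (P.Bsym y.1 y.2).toBlocks₂₂)
      (univ ×ˢ P.piUstar) := contDiffOn_matCLM fun i j => hstr.contDiffOn_Bsym (Sum.inr i) (Sum.inr j)
  have hmem : univ ×ˢ P.piUstar ∈ 𝓝 (l₀, p₀) := hU.mem_nhds ⟨mem_univ l₀, hp⟩
  have h2 := (h1.continuousOn.continuousAt hmem).norm.eventually_lt_const (lt_add_one _)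
  obtain ⟨ρ, hρ, hb⟩ := Metric.eventually_nhds_iff_ball.1
    (h2.and (hmem : ∀ᶠ y in 𝓝 (l₀, p₀), y ∈ univ ×ˢ P.piUstar))
  refine ⟨ρ, hρ, ‖matCLM (P.Bsym l₀ p₀).toBlocks₂₂‖ + 1, by positivity, fun l hl w hw v => ?_⟩
  obtain ⟨h3, -, h4⟩ := hb (l, w) (by rw [← ball_prod_same]; exact ⟨hl, hw⟩)
  have h5 : comp2 (P.Bsym l w *ᵥ v) = matCLM (P.Bsym l w).toBlocks₂₂ (comp2 v) := by
    rw [matCLM_apply]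
    ext i
    have e21 : ∀ j, P.Bsym l w (Sum.inr i) (Sum.inl j) = 0 := fun j =>
      congrFun (congrFun (hstr.block_Bsym h4 l).2.2 i) j
    simp [comp2, Matrix.mulVec, dotProduct, Fintype.sum_sum_type, e21, Matrix.toBlocks₂₂]
  rw [h5]
  exact ContinuousLinearMap.le_of_opNorm_le _ h3.le _

theorem norm_comp2_le (u : State m n) : ‖comp2 u‖ ≤ ‖u‖ :=
  (pi_norm_le_iff_of_nonneg (norm_nonneg u)).2 fun i => norm_le_pi_norm u (Sum.inr i)

set_option maxHeartbeats 4000000 in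
theorem exists_localLayerFamily (hgeo : P.Geometry) (hstr : P.Structural nPos) {t : ℝ}
    {x₀ : Space d} (hb : (t, x₀) ∈ P.base) {p₀ : State m n} (hp : p₀ ∈ P.O t x₀)
    (htr : P.Transversal (P.ν x₀) (fun _ => p₀)) :
    ∃ N F W θ M e, (P.ν x₀, p₀, p₀) ∈ N ∧ P.IsLocalLayerFamily nPos N F W θ M e := by
  obtain ⟨H, G, Pr, S, C, κ', Gi, ρ, hH, hG, hdich, hGi, hGi', hrank, hρ, hball, hred⟩ :=
    exists_reduction hgeo hstr hb hp
  obtain ⟨U, X, η, θ, μ, fam⟩ := exists_stableProfileFamily hH hG hdich hGi hGi'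
  have hps := hgeo.mem_piUstar hb hp
  set l₀ := P.ν x₀ with hl₀
  have hμ : ∀ y ∈ U, 0 ≤ μ y := fun y hy => by
    have := (norm_nonneg _).trans (fam.decay y hy 0 self_mem_Ici)
    simpa using this
  have hdecay : ∀ y ∈ U, ∀ z ∈ Ici (0 : ℝ), ‖X y z - (y.2.1, 0)‖ ≤ μ y := fun y hy z hz =>
    (fam.decay y hy z hz).trans (by
      refine mul_le_of_le_one_right (hμ y hy) (Real.exp_le_one_iff.2 ?_)
      have h1 : (0 : ℝ) ≤ z := hz
      have h2 := fam.rate_pos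
      nlinarith)
  have hXb : (l₀, p₀, (0 : Fin n → ℝ)) ∈ U := fam.mem
  -- parameters for which the profile stays in the ball
  let U1 : Set (Space d × State m n × (Fin n → ℝ)) :=
    {y | y ∈ U ∧ max ‖y.1 - l₀‖ (‖y.2.1 - p₀‖ + μ y) < ρ}
  have hU1o : IsOpen U1 := by
    have hc : ContinuousOn (fun y : Space d × State m n × (Fin n → ℝ) =>
        max ‖y.1 - l₀‖ (‖y.2.1 - p₀‖ + μ y)) U :=
      continuous_max.comp_continuousOn (ContinuousOn.prodMk (by fun_prop)
        (ContinuousOn.add (by fun_prop) fam.continuousOn))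
    exact hc.isOpen_inter_preimage fam.isOpen (isOpen_Iio (a := ρ))
  have hU1X : ∀ y ∈ U1, ∀ z ∈ Ici (0 : ℝ), (X y z).1 ∈ Metric.ball p₀ ρ := fun y hy z hz => by
    rw [mem_ball_iff_norm]
    have h1 := (max_lt_iff.1 hy.2).2
    have h2 : ‖(X y z).1 - y.2.1‖ ≤ μ y :=
      (norm_fst_le (X y z - (y.2.1, 0))).trans (hdecay y hy.1 z hz)
    rw [show (X y z).1 - p₀ = (y.2.1 - p₀) + ((X y z).1 - y.2.1) by abel]
    exact (norm_add_le _ _).trans_lt (by linarith)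
  have hU1l : ∀ l q a, (l, q, a) ∈ U1 → l ∈ Metric.ball l₀ ρ := fun l q a hy => by
    rw [mem_ball_iff_norm]; exact (max_lt_iff.1 hy.2).1
  have hU1q : ∀ l q a, (l, q, a) ∈ U1 → q ∈ Metric.ball p₀ ρ := fun l q a hy => by
    rw [mem_ball_iff_norm]
    have h1 : ‖q - p₀‖ + μ (l, q, a) < ρ := (max_lt_iff.1 hy.2).2
    have := hμ _ hy.1
    linarith
  have hbU1 : (l₀, p₀, (0 : Fin n → ℝ)) ∈ U1 := ⟨hXb, by
    change max ‖l₀ - l₀‖ (‖p₀ - p₀‖ + μ (l₀, p₀, 0)) < ρ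
    rw [fam.bound_const _ _ hXb]; simpa using hρ⟩
  have htriff : ∀ (l : Space d) (q : State m n) (a : Fin n → ℝ), (l, q, a) ∈ U1 →
      ∀ w : ℝ → State m n, EqOn w (fun z => (X (l, q, a) z).1) (Ici 0) → (P.Transversal l w ↔
      (∀ a', Pr a' = a' → fderiv ℝ (P.bdryMap H X) (l, q, a) (0, 0, a') = 0 → a' = 0) ∧
      ∀ b, ∃ q' a', Pr a' = a' ∧ fderiv ℝ (P.bdryMap H X) (l, q, a) (0, q', a') = b) := by
    intro l q a hy w hw
    have hr := hred l (hU1l l q a hy)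
    exact transversal_iff hgeo hstr hH fam hball hr hy.1 (hU1X _ hy) hdich.proj (hU1q l q a hy) hw
  obtain ⟨hT1, hT2⟩ := (htriff l₀ p₀ 0 hbU1 (fun _ => p₀) (fun z hz => by
    simp only [fam.const _ _ hXb z hz])).1 htr
  -- smoothness of the boundary map
  obtain ⟨β, hβ⟩ : ∃ β, β = P.bdryMap H X := ⟨_, rfl⟩
  rw [← hβ] at hT1 hT2
  have hβs : ContDiffOn ℝ ∞ β U1 := by
    rw [hβ]
    exact (contDiffOn_bdryMap hstr hH fam).mono fun y hy => ⟨hy.1, hball (hU1X y hy 0 self_mem_Ici)⟩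
  have hβc := hβs.continuousOn_fderiv_of_isOpen hU1o (by simp)
  let Vs : Submodule ℝ (Fin n → ℝ) := LinearMap.range (Pr : (Fin n → ℝ) →ₗ[ℝ] (Fin n → ℝ))
  have hVs : ∀ a ∈ Vs, Pr a = a := by
    rintro a ⟨b, rfl⟩
    exact hdich.proj b
  let incV : Vs →L[ℝ] Space d × State m n × (Fin n → ℝ) :=
    (ContinuousLinearMap.inr ℝ (Space d) (State m n × (Fin n → ℝ))).comp
      ((ContinuousLinearMap.inr ℝ (State m n) (Fin n → ℝ)).comp Vs.subtypeL)
  let incE : State m n × Vs →L[ℝ] Space d × State m n × (Fin n → ℝ) :=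
    (ContinuousLinearMap.inr ℝ (Space d) (State m n × (Fin n → ℝ))).comp
      ((ContinuousLinearMap.fst ℝ (State m n) Vs).prod
        (Vs.subtypeL.comp (ContinuousLinearMap.snd ℝ (State m n) Vs)))
  let U2 : Set (Space d × State m n × (Fin n → ℝ)) := U1 ∩ {y |
    Function.Injective ((fderiv ℝ β y).comp incV) ∧ Function.Surjective ((fderiv ℝ β y).comp incE)}
  have hU2o : IsOpen U2 := by
    have h1 := (hβc.clm_comp (continuousOn_const (c := incV))).isOpen_inter_preimage hU1o
      (ContinuousLinearMap.isOpen_injective (𝕜 := ℝ))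
    have h2 := (hβc.clm_comp (continuousOn_const (c := incE))).isOpen_inter_preimage hU1o
      isOpen_setOf_surjective
    have : U2 = (U1 ∩ (fun y => (fderiv ℝ β y).comp incV) ⁻¹'
        {f | Function.Injective f}) ∩ (U1 ∩ (fun y => (fderiv ℝ β y).comp incE) ⁻¹'
        {f | Function.Surjective f}) := by
      ext y
      exact ⟨fun h => ⟨⟨h.1, h.2.1⟩, ⟨h.1, h.2.2⟩⟩, fun h => ⟨h.1.1, h.1.2, h.2.2⟩⟩
    rw [this]
    exact h1.inter h2
  have hbU2 : (l₀, p₀, (0 : Fin n → ℝ)) ∈ U2 := by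
    refine ⟨hbU1, ?_, fun b => ?_⟩
    · refine (injective_iff_map_eq_zero _).2 fun a ha => Subtype.ext (hT1 a (hVs a a.2) ha)
    · obtain ⟨q', a', ha', hqa⟩ := hT2 b
      exact ⟨(q', ⟨a', a', ha'⟩), hqa⟩
  have htrans : ∀ l q a, (l, q, a) ∈ U2 → ∀ w, EqOn w (fun z => (X (l, q, a) z).1) (Ici 0) →
      P.Transversal l w := fun l q a hy w hw => by
    refine (htriff l q a hy.1 w hw).2 ⟨fun a' ha' h0 => ?_, fun b => ?_⟩
    · rw [← hβ] at h0
      have := hy.2.1 (a₁ := (⟨a', a', ha'⟩ : Vs)) (a₂ := 0) (by rw [map_zero]; exact h0)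
      exact congrArg Subtype.val this
    · rw [← hβ]
      obtain ⟨⟨q', a'⟩, h⟩ := hy.2.2 b
      exact ⟨q', a', hVs a' a'.2, h⟩
  -- the reduced equation
  let j : (Space d × State m n × State m n) × Vs →L[ℝ] Space d × State m n × (Fin n → ℝ) :=
    ((ContinuousLinearMap.fst ℝ (Space d) (State m n × State m n)).comp
      (ContinuousLinearMap.fst ℝ _ Vs)).prod
    ((((ContinuousLinearMap.snd ℝ (State m n) (State m n)).comp
      (ContinuousLinearMap.snd ℝ (Space d) (State m n × State m n))).comp
      (ContinuousLinearMap.fst ℝ _ Vs)).prod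
      (Vs.subtypeL.comp (ContinuousLinearMap.snd ℝ (Space d × State m n × State m n) Vs)))
  let k : (Space d × State m n × State m n) × Vs →L[ℝ] Space d × State m n × (Fin n → ℝ) :=
    ((ContinuousLinearMap.fst ℝ (Space d) (State m n × State m n)).comp
      (ContinuousLinearMap.fst ℝ _ Vs)).prod
    ((((ContinuousLinearMap.fst ℝ (State m n) (State m n)).comp
      (ContinuousLinearMap.snd ℝ (Space d) (State m n × State m n))).comp
      (ContinuousLinearMap.fst ℝ _ Vs)).prod 0)
  obtain ⟨g, hg⟩ : ∃ g : (Space d × State m n × State m n) × Vs →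
      (Fin nPos1 → ℝ) × (Fin (n - n3) → ℝ) × (Fin n3 → ℝ),
      g = fun x => β (j x) - P.boundaryOp H (k x) := ⟨_, rfl⟩
  let O' : Set ((Space d × State m n × State m n) × Vs) := j ⁻¹' U2 ∩ {x | x.1.2.1 ∈ P.piUstar}
  have hO'o : IsOpen O' := (hU2o.preimage j.continuous).inter (hgeo.isOpen_piUstar.preimage
    (by fun_prop : Continuous fun x : (Space d × State m n × State m n) × Vs => x.1.2.1))
  have hgs : ContDiffOn ℝ ∞ g O' := by
    rw [hg]
    exact (hβs.comp j.contDiff.contDiffOn fun x hx => hx.1.1).sub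
      ((contDiffOn_boundaryOp hstr hH).comp k.contDiff.contDiffOn fun x hx => hx.2)
  let u : (Space d × State m n × State m n) × Vs := ((l₀, p₀, p₀), 0)
  have hu : u ∈ O' := ⟨hbU2, hps⟩
  have hg0 : ∀ l p, (l, p, (0 : Fin n → ℝ)) ∈ U → g ((l, p, p), 0) = 0 := fun l p hlp => by
    rw [hg]
    change β (l, p, 0) - P.boundaryOp H (l, p, 0) = 0
    rw [hβ, bdryMap, fam.const l p hlp 0 self_mem_Ici, sub_self]
  have hgd : ∀ q' a', fderiv ℝ g u ((0, 0, q'), a') = fderiv ℝ β (l₀, p₀, 0) (0, q', a') := by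
    intro q' a'
    have hβd : HasFDerivAt β (fderiv ℝ β (l₀, p₀, 0)) (j u) :=
      ((hβs.contDiffAt (hU1o.mem_nhds hbU1)).differentiableAt (by simp)).hasFDerivAt
    have hbd : HasFDerivAt (P.boundaryOp H) (fderiv ℝ (P.boundaryOp H) (k u)) (k u) :=
      (((contDiffOn_boundaryOp hstr hH).contDiffAt ((hgeo.isOpen_piUstar.preimage
      (by fun_prop : Continuous fun x : Space d × State m n × (Fin n → ℝ) => x.2.1)).mem_nhds hps)
      ).differentiableAt (by simp)).hasFDerivAt
    have h1 := (hβd.comp u j.hasFDerivAt).sub (hbd.comp u k.hasFDerivAt)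
    have h2 : HasFDerivAt g _ u := h1.congr_of_eventuallyEq (Eventually.of_forall fun x => by
      rw [hg]; rfl)
    rw [h2.fderiv]
    change fderiv ℝ β (l₀, p₀, 0) (0, q', a') - fderiv ℝ (P.boundaryOp H) (k u) 0 = _
    rw [map_zero, sub_zero]
  have hinj : Function.Injective ((fderiv ℝ g u).comp
      (ContinuousLinearMap.inr ℝ (Space d × State m n × State m n) Vs)) := by
    refine (injective_iff_map_eq_zero _).2 fun a ha => Subtype.ext (hT1 a (hVs a a.2) ?_)
    exact (hgd 0 a).symm.trans ha
  have hdim : Module.finrank ℝ ((Fin nPos1 → ℝ) × (Fin (n - n3) → ℝ) × (Fin n3 → ℝ)) =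
      Module.finrank ℝ Vs + nPos := by
    have h1 : Module.finrank ℝ Vs + nPos = nPos1 + n := hrank
    have h2 := hstr.H6_le
    rw [h1, Module.finrank_prod, Module.finrank_prod, Module.finrank_fin_fun, Module.finrank_fin_fun,
      Module.finrank_fin_fun]
    omega
  obtain ⟨φ, F, κ, Ux, Wa, hUx, hWa, huUx, huWa, hsub, hφ, hF, hφW, hiff, hκs, hκ, hFd⟩ :=
    exists_reducedEquation hO'o hgs hu (hg0 l₀ p₀ hXb) hinj hdim
  have hFc := hF.continuousOn_fderiv_of_isOpen hUx (by simp)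
  let incQ : State m n →L[ℝ] Space d × State m n × State m n :=
    (ContinuousLinearMap.inr ℝ (Space d) (State m n × State m n)).comp
      (ContinuousLinearMap.inr ℝ (State m n) (State m n))
  have hUs := (hFc.clm_comp (continuousOn_const (c := incQ))).isOpen_inter_preimage hUx
    isOpen_setOf_surjective
  -- constants for the uniqueness of small profiles
  obtain ⟨ρB, hρB, Cb, hCb, hB⟩ := exists_bound_Bsym hgeo hstr l₀ hps
  obtain ⟨rV, hrV, hrVW⟩ := Metric.isOpen_iff.1 hWa _ huWa
  obtain ⟨r1, hr1, hr1B, hr1η, hr1ρ⟩ : ∃ r1 > 0, r1 ≤ ρB ∧ r1 ≤ η ∧ r1 ≤ ρ :=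
    ⟨min ρB (min η ρ), lt_min hρB (lt_min fam.radius_pos hρ), min_le_left _ _,
      (min_le_right _ _).trans (min_le_left _ _), (min_le_right _ _).trans (min_le_right _ _)⟩
  obtain ⟨e, he, he1, he2, he3⟩ : ∃ e > 0, e < r1 / 2 ∧ Cb * e < η ∧ ‖Pr‖ * (Cb * e) < min η rV := by
    have h1 : ∀ᶠ e : ℝ in 𝓝 0, e < r1 / 2 ∧ Cb * e < η ∧ ‖Pr‖ * (Cb * e) < min η rV := by
      refine (eventually_lt_nhds (by positivity)).and (Filter.Eventually.and ?_ ?_)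
      · exact (by fun_prop : Continuous fun e : ℝ => Cb * e).tendsto 0 |>.eventually_lt_const
          (by simpa using fam.radius_pos)
      · exact (by fun_prop : Continuous fun e : ℝ => ‖Pr‖ * (Cb * e)).tendsto 0 |>.eventually_lt_const
          (by simpa using ⟨fam.radius_pos, hrV⟩)
    obtain ⟨e, h2, h3⟩ := ((h1.filter_mono nhdsWithin_le_nhds).and
      (self_mem_nhdsWithin (s := Ioi (0 : ℝ)))).exists
    exact ⟨e, h3, h2⟩
  obtain ⟨Ch, hCh⟩ := (isCompact_closedBall (l₀, p₀) ρ).exists_bound_of_continuousOn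
    hH.continuous.continuousOn
  have hCh' : ∀ l ∈ Metric.ball l₀ ρ, ∀ w ∈ Metric.ball p₀ ρ, ‖H (l, w)‖ ≤ Ch := fun l hl w hw =>
    hCh _ (Metric.ball_subset_closedBall (by rw [← ball_prod_same]; exact ⟨hl, hw⟩))
  let Q : Set (Space d × State m n × State m n) :=
    {x | x.1 ∈ Metric.ball l₀ r1 ∧ x.2.1 ∈ Metric.ball p₀ (r1 / 2)}
  have hQ : IsOpen Q := (Metric.isOpen_ball.preimage continuous_fst).inter
    (Metric.isOpen_ball.preimage (continuous_fst.comp continuous_snd))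
  let N : Set (Space d × State m n × State m n) :=
    (Ux ∩ (fun x => (fderiv ℝ F x).comp incQ) ⁻¹' {f | Function.Surjective f}) ∩ Q
  have hNU : ∀ x ∈ N, x ∈ Ux := fun x hx => hx.1.1
  have hNU2 : ∀ x ∈ N, (x.1, x.2.2, (φ x : Fin n → ℝ)) ∈ U2 := fun x hx =>
    (hsub ⟨hNU x hx, hφW x (hNU x hx)⟩ : (x, φ x) ∈ O').1
  have hbc : ∀ l p q, (l, p, q) ∈ N → ∀ a ∈ Wa, ∀ (w : ℝ → State m n),
      EqOn w (fun z => (X (l, q, a) z).1) (Ici 0) →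
      (g ((l, p, q), a) = 0 ↔ P.Υ1 (comp1 (w 0)) = P.Υ1 (comp1 p) ∧
        P.Υ2 (comp2 (w 0)) = P.Υ2 (comp2 p) ∧ P.Kν *ᵥ comp2 (dz w 0) = 0) := by
    intro l p q hx a ha w hw
    have hy : (l, q, (a : Fin n → ℝ)) ∈ U2 := (hsub ⟨hNU _ hx, ha⟩ : ((l, p, q), a) ∈ O').1
    have h1 := dz_family fam (hred l (hU1l _ _ _ hy.1)) hy.1.1 (hU1X _ hy.1) self_mem_Ici
    rw [dz_congr hw self_mem_Ici, h1, hw self_mem_Ici, hg]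
    change β (l, q, a) - P.boundaryOp H (l, p, 0) = 0 ↔ _
    rw [sub_eq_zero, hβ]
    change (_, _, _) = (_, _, P.Kν *ᵥ comp2 (H (l, p) 0)) ↔ _
    rw [map_zero]
    change (_, _, _) = (_, _, P.Kν *ᵥ (0 : Fin n → ℝ)) ↔ _
    rw [Matrix.mulVec_zero, Prod.mk.injEq, Prod.mk.injEq]
  have hμc : ContinuousOn (fun x => max 1 Ch * μ (x.1, x.2.2, (φ x : Fin n → ℝ))) N := by
    refine continuousOn_const.mul (fam.continuousOn.comp ?_ fun x hx => (hNU2 x hx).1.1)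
    exact continuousOn_fst.prodMk ((continuousOn_snd.comp continuousOn_snd fun x _ => mem_univ _).prodMk
      (continuous_subtype_val.comp_continuousOn (hφ.continuousOn.mono hNU)))
  refine ⟨N, F, fun x z => (X (x.1, x.2.2, (φ x : Fin n → ℝ)) z).1, θ,
    fun x => max 1 Ch * μ (x.1, x.2.2, (φ x : Fin n → ℝ)), e, ?_,
    { isOpen := hUs.inter hQ
      smooth_F := hF.mono hNU
      surjective := ?_
      smooth := ?_
      rate_pos := fam.rate_pos
      decay := ?_
      dz_le := ?_
      continuousOn := hμc
      bound_diag := ?_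
      profile := ?_
      transversal := ?_
      amplitude_pos := he
      unique := ?_ }⟩
  · refine ⟨⟨huUx, fun b => ?_⟩, Metric.mem_ball_self hr1, Metric.mem_ball_self (by positivity)⟩
    obtain ⟨y, rfl⟩ := hκs b
    obtain ⟨q', a', ha', rfl⟩ := hT2 y
    refine ⟨q', ?_⟩
    change fderiv ℝ F u.1 (0, 0, q') = _
    have h1 : ((0 : Space d), q', a') = (0, q', ((0 : Vs) : Fin n → ℝ)) + (0, 0, a') := by simp
    rw [hFd, hgd, h1, map_add, map_add, ← hgd 0 ⟨a', a', ha'⟩]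
    have h2 : κ (fderiv ℝ g u ((0, 0, 0), ⟨a', a', ha'⟩)) = 0 := hκ _
    rw [h2, add_zero]
  · intro l p q hx
    have h1 : HasFDerivAt F (fderiv ℝ F (l, p, q)) (l, p, q) :=
      ((hF.contDiffAt (hUx.mem_nhds (hNU _ hx))).differentiableAt (by simp)).hasFDerivAt
    have h2 : HasFDerivAt (fun q => ((l, p, q) : Space d × State m n × State m n)) incQ q :=
      (hasFDerivAt_prodMk_right l (p, q)).comp q (hasFDerivAt_prodMk_right p q)
    have h3 : HasFDerivAt (fun q => F (l, p, q)) _ q := h1.comp q h2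
    rw [h3.fderiv]
    exact hx.1.2
  · refine contDiff_fst.comp_contDiffOn (ContDiffOn.comp
      (g := fun a : ℝ × (Space d × State m n × (Fin n → ℝ)) => X a.2 a.1) fam.smooth
      (f := fun a : ℝ × (Space d × State m n × State m n) =>
        (a.1, a.2.1, a.2.2.2, (φ a.2 : Fin n → ℝ))) ?_
      fun a ha => ⟨ha.1, (hNU2 _ ha.2).1.1⟩)
    have h1 : ContDiffOn ℝ ∞ (fun a : ℝ × (Space d × State m n × State m n) => φ a.2)
        (Ici 0 ×ˢ N) := hφ.comp contDiff_snd.contDiffOn fun a ha => hNU _ ha.2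
    have h2 : ContDiff ℝ ∞ (fun a : ℝ × (Space d × State m n × State m n) => a.2.2.2) := by fun_prop
    have h3 : ContDiff ℝ ∞ (fun a : ℝ × (Space d × State m n × State m n) => a.2.1) := by fun_prop
    exact contDiff_fst.contDiffOn.prodMk (h3.contDiffOn.prodMk (h2.contDiffOn.prodMk
      (Vs.subtypeL.contDiff.comp_contDiffOn h1)))
  · intro x hx z hz
    have hy := (hNU2 x hx).1.1
    refine ((norm_fst_le (X (x.1, x.2.2, (φ x : Fin n → ℝ)) z - (x.2.2, 0))).trans
      (fam.decay _ hy z hz)).trans ?_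
    gcongr
    exact le_mul_of_one_le_left (hμ _ hy) (le_max_left _ _)
  · intro x hx z hz
    have hy := (hNU2 x hx).1
    have h1 := dz_family fam (hred x.1 (hU1l _ _ _ hy)) hy.1 (hU1X _ hy) hz
    change ‖comp2 (dz (fun z => (X (x.1, x.2.2, (φ x : Fin n → ℝ)) z).1) z)‖ ≤ _
    rw [h1]
    refine (norm_comp2_le _).trans ((ContinuousLinearMap.le_opNorm _ _).trans ?_)
    have h2 := hCh' _ (hU1l _ _ _ hy) _ (hU1X _ hy z hz)
    have h3 : ‖(X (x.1, x.2.2, (φ x : Fin n → ℝ)) z).2‖ ≤ μ (x.1, x.2.2, (φ x : Fin n → ℝ)) := by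
      have := (norm_snd_le (X (x.1, x.2.2, (φ x : Fin n → ℝ)) z - (x.2.2, 0))).trans
        (hdecay _ hy.1 z hz)
      simpa using this
    exact mul_le_mul (h2.trans (le_max_right _ _)) h3 (norm_nonneg _)
      (zero_le_one.trans (le_max_left _ _))
  · intro l p hx
    have h0 : ((l, p, p), (0 : Vs)) ∈ O' := hsub ⟨hNU _ hx, huWa⟩
    have h1 : (l, p, (0 : Fin n → ℝ)) ∈ U := h0.1.1.1
    have h2 : φ (l, p, p) = 0 := ((hiff _ (hNU _ hx) 0 huWa).1 (hg0 l p h1)).1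
    change max 1 Ch * μ (l, p, (φ (l, p, p) : Fin n → ℝ)) = 0
    rw [h2]
    change max 1 Ch * μ (l, p, 0) = 0
    rw [fam.bound_const l p h1, mul_zero]
  · intro l p q hx hF0
    have hy := (hNU2 _ hx).1
    refine ⟨solvesProfileEq_family fam (hred l (hU1l _ _ _ hy)) hy.1 (hU1X _ hy), ?_⟩
    exact (hbc l p q hx _ (hφW _ (hNU _ hx)) _ fun z hz => rfl).1
      ((hiff _ (hNU _ hx) _ (hφW _ (hNU _ hx))).2 ⟨rfl, hF0⟩)
  · intro l p q hx w hw
    exact htrans l q _ (hNU2 _ hx) w hw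
  · intro l p q hx w hw b1 b2 b3 hlim hamp
    have hlr : l ∈ Metric.ball l₀ r1 := hx.2.1
    have hpr : ‖p - p₀‖ < r1 / 2 := mem_ball_iff_norm.1 hx.2.2
    have hw1 : ∀ z ∈ Ici (0 : ℝ), ‖w z - p₀‖ < r1 := fun z hz => by
      rw [show w z - p₀ = (w z - p) + (p - p₀) by abel]
      refine (norm_add_le _ _).trans_lt ?_
      linarith [(hamp z hz).1]
    have hwρ : ∀ z ∈ Ici (0 : ℝ), w z ∈ Metric.ball p₀ ρ := fun z hz =>
      mem_ball_iff_norm.2 ((hw1 z hz).trans_le hr1ρ)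
    have hw3 : ∀ z ∈ Ici (0 : ℝ), ‖comp2 (P.Bsym l (w z) *ᵥ dz w z)‖ ≤ Cb * e := fun z hz =>
      (hB l (Metric.ball_subset_ball hr1B hlr) (w z)
        (mem_ball_iff_norm.2 ((hw1 z hz).trans_le hr1B)) _).trans (by gcongr; exact (hamp z hz).2)
    have hrl := hred l (Metric.ball_subset_ball hr1ρ hlr)
    have hfo := hrl.firstOrder_of_profile hw.1 hwρ hw.2
    let a : Vs := ⟨Pr (comp2 (P.Bsym l (w 0) *ᵥ dz w 0)), _, rfl⟩
    have han : ‖a‖ < min η rV := by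
      refine lt_of_le_of_lt ?_ he3
      refine (Pr.le_opNorm _).trans ?_
      gcongr
      exact hw3 0 self_mem_Ici
    have haW : a ∈ Wa := hrVW (by
      rw [mem_ball_iff_norm]
      change ‖a - 0‖ < rV
      rw [sub_zero]
      exact han.trans_le (min_le_right _ _))
    obtain ⟨hyU, hXw⟩ := fam.unique l q (a : Fin n → ℝ)
      (fun z => (w z, comp2 (P.Bsym l (w z) *ᵥ dz w z)))
      ((mem_ball_iff_norm.1 hlr).trans_le hr1η) (han.trans_le (min_le_left _ _))
      (fun z hz => by
        rw [Prod.mk_sub_mk, sub_zero, Prod.norm_mk]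
        exact max_lt ((hw1 z hz).trans_le hr1η) ((hw3 z hz).trans_lt he2))
      (fun z hz => (hfo z hz).2) hlim (hdich.proj _)
    have hweq : EqOn w (fun z => (X (l, q, a) z).1) (Ici 0) := fun z hz => by
      simp only [hXw z hz]
    have h1 := (hiff _ (hNU _ hx) a haW).1 ((hbc l p q hx a haW w hweq).2 ⟨b1, b2, b3⟩)
    refine ⟨h1.2, ?_⟩
    intro z hz
    change w z = (X (l, q, (φ (l, p, q) : Fin n → ℝ)) z).1
    rw [h1.1]
    exact hweq hz

end ViscousProblem

/-- A local property of points and positive radii that is inherited by smaller radii holds with a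
uniform radius on a compact set. -/
theorem IsCompact.exists_uniform_radius {X : Type*} [TopologicalSpace X] {K : Set X}
    (hK : IsCompact K) {p : X → ℝ → Prop}
    (hmono : ∀ x a b, 0 < a → a ≤ b → p x b → p x a)
    (hloc : ∀ x ∈ K, ∃ a > 0, ∀ᶠ y in 𝓝[K] x, p y a) : ∃ a > 0, ∀ x ∈ K, p x a := by
  refine hK.induction_on (p := fun S => ∃ a > 0, ∀ x ∈ S, p x a) ⟨1, one_pos, fun x hx => hx.elim⟩
    ?_ ?_ ?_
  · rintro S T hST ⟨a, ha, h⟩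
    exact ⟨a, ha, fun x hx => h x (hST hx)⟩
  · rintro S T ⟨a, ha, h⟩ ⟨b, hb, h'⟩
    refine ⟨min a b, lt_min ha hb, fun x hx => hx.elim (fun hx => ?_) fun hx => ?_⟩
    · exact hmono x _ a (lt_min ha hb) (min_le_left _ _) (h x hx)
    · exact hmono x _ b (lt_min ha hb) (min_le_right _ _) (h' x hx)
  · intro x hx
    obtain ⟨a, ha, h⟩ := hloc x hx
    exact ⟨_, h, a, ha, fun y hy => hy⟩

theorem exists_tube {X A E : Type*} [TopologicalSpace A] [NormedAddCommGroup E] {l : Filter X}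
    {f : X → A} {p : X → E} {a : A} {b : E} (hf : Tendsto f l (𝓝 a)) (hp : Tendsto p l (𝓝 b))
    {Z : Set (A × E)} (hZ : Z ∈ 𝓝 (a, b)) :
    ∃ δ > 0, ∀ᶠ y in l, ∀ q, ‖q - p y‖ < δ → (f y, q) ∈ Z := by
  obtain ⟨u, hu, v, hv, huv⟩ := mem_nhds_prod_iff.1 hZ
  obtain ⟨r, hr, hrv⟩ := Metric.mem_nhds_iff.1 hv
  refine ⟨r / 2, by positivity, ?_⟩
  filter_upwards [hf hu, hp (Metric.ball_mem_nhds b (half_pos hr))] with y h1 h2 q hq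
  refine huv ⟨h1, hrv ?_⟩
  rw [mem_ball_iff_norm]
  rw [mem_preimage, mem_ball_iff_norm] at h2
  rw [show q - b = (q - p y) + (p y - b) by abel]
  exact (norm_add_le _ _).trans_lt (by linarith)

namespace ViscousProblem

variable {d m n nPos1 n3 r : ℕ} {P : ViscousProblem d m n nPos1 n3 r} {nPos : ℕ}

theorem Geometry.isCompact_base (hgeo : P.Geometry) : IsCompact P.base :=
  isCompact_Icc.prod hgeo.compact_boundary

theorem Geometry.contDiffOn_normal (hgeo : P.Geometry) : ContDiffOn ℝ ∞ P.ν (frontier P.Ω) := by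
  intro x hx
  obtain ⟨V, ρ, hV, hxV, hρ, -, hne, hν⟩ := hgeo.boundary.2 x hx
  have h1 : ContDiffOn ℝ ∞ (gradient ρ) V :=
    (InnerProductSpace.toDual ℝ (Space d)).symm.contDiff.comp_contDiffOn
      (hρ.fderiv_of_isOpen hV (m := ∞) (by simp))
  have h2 : ContDiffOn ℝ ∞ (fun x => ‖gradient ρ x‖⁻¹ • gradient ρ x) V :=
    ((h1.norm ℝ hne).inv fun y hy => norm_ne_zero_iff.2 (hne y hy)).smul h1
  have h3 : ContDiffWithinAt ℝ ∞ P.ν (V ∩ frontier P.Ω) x :=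
    ((h2 x hxV).mono inter_subset_left).congr hν (hν x ⟨hxV, hx⟩)
  rw [inter_comm] at h3
  exact (contDiffWithinAt_inter (hV.mem_nhds hxV)).1 h3

theorem Υ3_zero (u : State m n) (η : Fin n → ℝ) : P.Υ3 u 0 η = P.Kν *ᵥ η := by
  simp [Υ3]

theorem AmplitudeLE.mono {p : State m n} {ε ε' : ℝ} {w : ℝ → State m n}
    (h : AmplitudeLE p ε w) (hε : ε ≤ ε') : AmplitudeLE p ε' w :=
  fun z hz => ⟨(h z hz).1.trans hε, (h z hz).2.trans hε⟩

theorem IsLocalLayerFamily.mono {N N' : Set (Space d × State m n × State m n)}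
    {F : Space d × State m n × State m n → Fin nPos → ℝ}
    {W : Space d × State m n × State m n → ℝ → State m n} {θ : ℝ}
    {M : Space d × State m n × State m n → ℝ} {e : ℝ}
    (h : P.IsLocalLayerFamily nPos N F W θ M e) (hN' : IsOpen N') (hsub : N' ⊆ N) :
    P.IsLocalLayerFamily nPos N' F W θ M e where
  isOpen := hN'
  smooth_F := h.smooth_F.mono hsub
  surjective l p q hx := h.surjective l p q (hsub hx)
  smooth := h.smooth.mono (prod_mono_right hsub)
  rate_pos := h.rate_pos
  decay x hx := h.decay x (hsub hx)
  dz_le x hx := h.dz_le x (hsub hx)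
  continuousOn := h.continuousOn.mono hsub
  bound_diag l p hx := h.bound_diag l p (hsub hx)
  profile l p q hx := h.profile l p q (hsub hx)
  transversal l p q hx := h.transversal l p q (hsub hx)
  amplitude_pos := h.amplitude_pos
  unique l p q hx := h.unique l p q (hsub hx)

theorem IsLocalLayerFamily.amplitudeLE {N : Set (Space d × State m n × State m n)}
    {F : Space d × State m n × State m n → Fin nPos → ℝ}
    {W : Space d × State m n × State m n → ℝ → State m n} {θ : ℝ}
    {M : Space d × State m n × State m n → ℝ} {e : ℝ}
    (h : P.IsLocalLayerFamily nPos N F W θ M e) {x : Space d × State m n × State m n} (hx : x ∈ N)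
    {ε : ℝ} (hε : M x + ‖x.2.2 - x.2.1‖ ≤ ε) : AmplitudeLE x.2.1 ε (W x) := by
  intro z hz
  have h1 := h.decay x hx z hz
  have hM : 0 ≤ M x := (norm_nonneg _).trans (h.dz_le x hx z hz)
  have h2 : M x * Real.exp (-θ * z) ≤ M x := by
    refine mul_le_of_le_one_right hM (Real.exp_le_one_iff.2 ?_)
    have h3 : (0 : ℝ) ≤ z := hz
    have h4 := h.rate_pos
    nlinarith
  refine ⟨?_, ((h.dz_le x hx z hz).trans (le_add_of_nonneg_right (norm_nonneg _))).trans hε⟩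
  rw [show W x z - x.2.1 = (W x z - x.2.2) + (x.2.2 - x.2.1) by abel]
  exact (norm_add_le _ _).trans (by linarith)

section Assembly

variable {p : ℝ → Space d → State m n}

theorem exists_uniform_amplitude (hgeo : P.Geometry) (hstr : P.Structural nPos)
    (hp : ContDiffOn ℝ ∞ (fun y : ℝ × Space d => p y.1 y.2) P.base)
    (hp_mem : ∀ t x₀, (t, x₀) ∈ P.base → (t, x₀, p t x₀) ∈ P.Ubdry)
    (htrans : ∀ t x₀, (t, x₀) ∈ P.base → P.Transversal (P.ν x₀) (fun _ => p t x₀)) :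
    ∃ ε₀ > 0, ∀ y ∈ P.base, Metric.closedBall (p y.1 y.2) ε₀ ⊆ P.Ostar y.1 y.2 ∧
      ∃ N F W θ M e, ε₀ ≤ e ∧ (P.ν y.2, p y.1 y.2, p y.1 y.2) ∈ N ∧
        P.IsLocalLayerFamily nPos N F W θ M e := by
  refine hgeo.isCompact_base.exists_uniform_radius
    (p := fun y ε₀ => Metric.closedBall (p y.1 y.2) ε₀ ⊆ P.Ostar y.1 y.2 ∧
      ∃ N F W θ M e, ε₀ ≤ e ∧ (P.ν y.2, p y.1 y.2, p y.1 y.2) ∈ N ∧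
        P.IsLocalLayerFamily nPos N F W θ M e) ?_ ?_
  · rintro x a b - hab ⟨h1, N, F, W, θ, M, e, h2, h3⟩
    exact ⟨(Metric.closedBall_subset_closedBall hab).trans h1, N, F, W, θ, M, e, hab.trans h2, h3⟩
  · rintro ⟨t, x⟩ hy
    have hpO := (hp_mem t x hy).2
    obtain ⟨N, F, W, θ, M, e, hmem, hfam⟩ := exists_localLayerFamily hgeo hstr hy hpO (htrans t x hy)
    have hpc : Tendsto (fun y : ℝ × Space d => p y.1 y.2) (𝓝[P.base] (t, x)) (𝓝 (p t x)) :=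
      hp.continuousOn (t, x) hy
    have hνc : Tendsto (fun y : ℝ × Space d => P.ν y.2) (𝓝[P.base] (t, x)) (𝓝 (P.ν x)) :=
      (hgeo.contDiffOn_normal.continuousOn.comp continuousOn_snd fun y hy => hy.2) (t, x) hy
    obtain ⟨G, hG, hGO⟩ := hgeo.Ostar_cont
    have hZ : {a : (ℝ × Space d) × State m n | (a.1.1, a.1.2, a.2) ∈ G} ∈ 𝓝 ((t, x), p t x) := by
      refine (hG.preimage (by fun_prop : Continuous fun a : (ℝ × Space d) × State m n =>
        (a.1.1, a.1.2, a.2))).mem_nhds ?_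
      have := hgeo.O_subset t x hy hpO
      rwa [hGO t x hy] at this
    obtain ⟨δ, hδ, htube⟩ := exists_tube (f := fun y : ℝ × Space d => y)
      (tendsto_id.mono_left nhdsWithin_le_nhds) hpc hZ
    refine ⟨min e (δ / 2), lt_min hfam.amplitude_pos (by positivity), ?_⟩
    filter_upwards [htube, hνc.prodMk_nhds (hpc.prodMk_nhds hpc) (hfam.isOpen.mem_nhds hmem),
      self_mem_nhdsWithin] with y h1 h2 h3
    refine ⟨fun u hu => ?_, N, F, W, θ, M, e, min_le_left _ _, h2, hfam⟩
    rw [hGO y.1 y.2 h3]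
    refine h1 u ?_
    rw [mem_closedBall_iff_norm] at hu
    linarith [min_le_right e (δ / 2)]

theorem exists_uniform_neighborhood (hgeo : P.Geometry)
    (hp : ContDiffOn ℝ ∞ (fun y : ℝ × Space d => p y.1 y.2) P.base)
    (hp_mem : ∀ t x₀, (t, x₀) ∈ P.base → (t, x₀, p t x₀) ∈ P.Ubdry) {ε : ℝ} (hε : 0 < ε)
    (hloc : ∀ y ∈ P.base, ∃ N F W θ M e, ε ≤ e ∧ (P.ν y.2, p y.1 y.2, p y.1 y.2) ∈ N ∧
        P.IsLocalLayerFamily nPos N F W θ M e) :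
    ∃ δ₀ > 0, ∀ y ∈ P.base, ∀ q, ‖q - p y.1 y.2‖ < δ₀ → q ∈ P.O y.1 y.2 ∧
      ∃ N F W θ M e, ε ≤ e ∧ (P.ν y.2, p y.1 y.2, q) ∈ N ∧
        P.IsLocalLayerFamily nPos N F W θ M e ∧ ∀ x ∈ N, AmplitudeLE x.2.1 ε (W x) := by
  refine hgeo.isCompact_base.exists_uniform_radius
    (p := fun y δ₀ => ∀ q, ‖q - p y.1 y.2‖ < δ₀ → q ∈ P.O y.1 y.2 ∧
      ∃ N F W θ M e, ε ≤ e ∧ (P.ν y.2, p y.1 y.2, q) ∈ N ∧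
        P.IsLocalLayerFamily nPos N F W θ M e ∧ ∀ x ∈ N, AmplitudeLE x.2.1 ε (W x)) ?_ ?_
  · exact fun x a b _ hab h q hq => h q (hq.trans_le hab)
  · rintro ⟨t, x⟩ hy
    have hpO := (hp_mem t x hy).2
    obtain ⟨N, F, W, θ, M, e, hεe, hmem, hfam⟩ := hloc (t, x) hy
    have hpc : Tendsto (fun y : ℝ × Space d => p y.1 y.2) (𝓝[P.base] (t, x)) (𝓝 (p t x)) :=
      hp.continuousOn (t, x) hy
    have hνc : Tendsto (fun y : ℝ × Space d => P.ν y.2) (𝓝[P.base] (t, x)) (𝓝 (P.ν x)) :=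
      (hgeo.contDiffOn_normal.continuousOn.comp continuousOn_snd fun y hy => hy.2) (t, x) hy
    let N' : Set (Space d × State m n × State m n) :=
      N ∩ (fun x => M x + ‖x.2.2 - x.2.1‖) ⁻¹' Iio ε
    have hN' : IsOpen N' := (hfam.continuousOn.add (by fun_prop :
      Continuous fun x : Space d × State m n × State m n => ‖x.2.2 - x.2.1‖).continuousOn
      ).isOpen_inter_preimage hfam.isOpen isOpen_Iio
    have hmem' : (P.ν x, p t x, p t x) ∈ N' := ⟨hmem, by
      change M (P.ν x, p t x, p t x) + ‖p t x - p t x‖ < ε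
      rw [hfam.bound_diag _ _ hmem]
      simpa using hε⟩
    obtain ⟨G, hG, hGO⟩ := hgeo.O_cont
    have hcl : ∀ s y, (s, y) ∈ P.base → (s, y) ∈ Icc (-P.T) P.T ×ˢ closure P.Ω := fun s y h =>
      ⟨h.1, frontier_subset_closure h.2⟩
    have hZ : {a : (ℝ × Space d) × State m n | (a.1.1, a.1.2, a.2) ∈ G} ∈ 𝓝 ((t, x), p t x) := by
      refine (hG.preimage (by fun_prop : Continuous fun a : (ℝ × Space d) × State m n =>
        (a.1.1, a.1.2, a.2))).mem_nhds ?_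
      have h := hpO
      change p t x ∈ P.O t x at h
      rwa [hGO t x (hcl t x hy)] at h
    have hZ' : {a : (Space d × State m n) × State m n | (a.1.1, a.1.2, a.2) ∈ N'} ∈
        𝓝 ((P.ν x, p t x), p t x) :=
      (hN'.preimage (by fun_prop : Continuous fun a : (Space d × State m n) × State m n =>
        (a.1.1, a.1.2, a.2))).mem_nhds hmem'
    obtain ⟨δ, hδ, htube⟩ := exists_tube (f := fun y : ℝ × Space d => y)
      (tendsto_id.mono_left nhdsWithin_le_nhds) hpc hZ
    obtain ⟨δ', hδ', htube'⟩ := exists_tube (hνc.prodMk_nhds hpc) hpc hZ'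
    refine ⟨min δ δ', lt_min hδ hδ', ?_⟩
    filter_upwards [htube, htube', self_mem_nhdsWithin] with y h1 h2 h3 q hq
    refine ⟨?_, N', F, W, θ, M, e, hεe, h2 q (hq.trans_le (min_le_right _ _)),
      hfam.mono hN' inter_subset_left, fun x hx => hfam.amplitudeLE hx.1 (le_of_lt hx.2)⟩
    rw [hGO y.1 y.2 (hcl _ _ h3)]
    exact h1 q (hq.trans_le (min_le_left _ _))

theorem isLayerProfile_const {t : ℝ} {x₀ : Space d} {q : State m n} (hq : q ∈ P.Ostar t x₀) :
    P.IsLayerProfile t x₀ (P.Υ1 (comp1 q)) (P.Υ2 (comp2 q)) q (fun _ => q) := by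
  have h0 : ∀ z ∈ Ici (0 : ℝ), dz (fun _ => q) z = 0 := fun z hz =>
    dz_eq hz (hasDerivWithinAt_const z (Ici 0) q)
  refine ⟨⟨contDiffOn_const, fun z hz => ?_⟩, fun _ _ => hq, rfl, rfl, ?_, tendsto_const_nhds⟩
  · have h1 : dz (fun s => P.Bsym (P.ν x₀) q *ᵥ dz (fun _ => q) s) z = 0 := by
      rw [dz_congr (g := fun _ => 0) (fun s hs => by simp only [h0 s hs, Matrix.mulVec_zero]) hz]
      exact dz_eq hz (hasDerivWithinAt_const z (Ici 0) (0 : State m n))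
    rw [h0 z hz, h1, Matrix.mulVec_zero, sub_zero]
  · rw [Υ3_zero, h0 0 self_mem_Ici]
    exact Matrix.mulVec_zero _

theorem amplitudeLE_const (q : State m n) {ε : ℝ} (hε : 0 ≤ ε) : AmplitudeLE q ε (fun _ => q) := by
  intro z hz
  rw [dz_eq hz (hasDerivWithinAt_const z (Ici 0) q), sub_self, norm_zero]
  exact ⟨hε, by simpa using (norm_comp2_le (0 : State m n)).trans (by simpa using hε)⟩

end Assembly

end ViscousProblem

open ViscousProblem in
theorem mainTheorem9 {d m n nPos1 n3 r : ℕ} (nPos : ℕ) (P : ViscousProblem d m n nPos1 n3 r)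
    (hgeo : P.Geometry) (hstr : P.Structural nPos)
    (p : ℝ → Space d → State m n)
    (hp_smooth : ContDiffOn ℝ ∞ (fun y : ℝ × Space d => p y.1 y.2) P.base)
    (hp_mem : ∀ t x₀, (t, x₀) ∈ P.base → (t, x₀, p t x₀) ∈ P.Ubdry)
    (htrans : ∀ t x₀, (t, x₀) ∈ P.base → P.Transversal (P.ν x₀) (fun _ => p t x₀))
    (g1 : ℝ → Space d → Fin nPos1 → ℝ) (g2 : ℝ → Space d → Fin (n - n3) → ℝ)
    (hg1 : ∀ t x₀, (t, x₀) ∈ P.base → g1 t x₀ = P.Υ1 (comp1 (p t x₀)))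
    (hg2 : ∀ t x₀, (t, x₀) ∈ P.base → g2 t x₀ = P.Υ2 (comp2 (p t x₀))) :
    ∃ ε₀ > 0, ∀ ε ∈ Ioc 0 ε₀, ∃ δ₀ > 0, ∀ δ ∈ Ioc 0 δ₀,
      ∃ W : ℝ → ℝ × Space d × State m n → State m n,
        P.IsCManifoldWithProfiles nPos g1 g2 (P.smallEndstates p g1 g2 ε δ) W ∧
        (∀ t x₀, (t, x₀) ∈ P.base → (t, x₀, p t x₀) ∈ P.smallEndstates p g1 g2 ε δ) ∧
        (∀ t x₀ q, (t, x₀, q) ∈ P.smallEndstates p g1 g2 ε δ →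
          ViscousProblem.AmplitudeLE (p t x₀) ε (fun z => W z (t, x₀, q))) := by
  obtain ⟨ε₀, hε₀, huni⟩ := exists_uniform_amplitude hgeo hstr hp_smooth hp_mem htrans
  refine ⟨ε₀, hε₀, fun ε hε => ?_⟩
  obtain ⟨δ₀, hδ₀, hnear⟩ := exists_uniform_neighborhood (nPos := nPos) hgeo hp_smooth hp_mem hε.1
    fun y hy => by
      obtain ⟨-, N, F, W, θ, M, e, h1, h2⟩ := huni y hy
      exact ⟨N, F, W, θ, M, e, hε.2.trans h1, h2⟩
  refine ⟨δ₀, hδ₀, fun δ hδ => ?_⟩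
  set C := P.smallEndstates p g1 g2 ε δ with hC
  classical
  have hex : ∀ y ∈ C, ∃ w, P.IsLayerProfile y.1 y.2.1 (g1 y.1 y.2.1) (g2 y.1 y.2.1) y.2.2 w ∧
      AmplitudeLE (p y.1 y.2.1) ε w := fun y hy => hy.2.2
  let W : ℝ → ℝ × Space d × State m n → State m n := fun z y =>
    if h : y ∈ C then (hex y h).choose z else 0
  have hW : ∀ y ∈ C, P.IsLayerProfile y.1 y.2.1 (g1 y.1 y.2.1) (g2 y.1 y.2.1) y.2.2 (fun z => W z y) ∧
      AmplitudeLE (p y.1 y.2.1) ε (fun z => W z y) := fun y hy => by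
    have h1 : (fun z => W z y) = (hex y hy).choose := funext fun z => dif_pos hy
    rw [h1]
    exact (hex y hy).choose_spec
  let Bs : Set (ℝ × Space d × State m n) := {y | (y.1, y.2.1) ∈ P.base}
  have hCB : C ⊆ Bs := fun y hy => hy.1
  obtain ⟨Θ, hΘ⟩ : ∃ Θ : ℝ × Space d × State m n → Space d × State m n × State m n,
      ∀ y, Θ y = (P.ν y.2.1, p y.1 y.2.1, y.2.2) := ⟨_, fun _ => rfl⟩
  have hΘs : ContDiffOn ℝ ∞ Θ Bs := by
    have h1 : ContDiffOn ℝ ∞ (fun y : ℝ × Space d × State m n => P.ν y.2.1) Bs :=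
      hgeo.contDiffOn_normal.comp (contDiff_fst.comp contDiff_snd).contDiffOn fun y hy => hy.2
    have h2 : ContDiffOn ℝ ∞ (fun y : ℝ × Space d × State m n => p y.1 y.2.1) Bs :=
      ContDiffOn.comp (g := fun y : ℝ × Space d => p y.1 y.2) hp_smooth
        (contDiff_fst.prodMk (contDiff_fst.comp contDiff_snd)).contDiffOn fun y hy => hy
    exact (h1.prodMk (h2.prodMk (contDiff_snd.comp contDiff_snd).contDiffOn)).congr fun y _ => hΘ y
  -- local description of `C`
  have hloc : ∀ c ∈ C, ∃ N F W' θ M e, Θ c ∈ N ∧ P.IsLocalLayerFamily nPos N F W' θ M e ∧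
      (∀ y ∈ Bs, Θ y ∈ N → ‖y.2.2 - p y.1 y.2.1‖ < δ → (y ∈ C ↔ F (Θ y) = 0)) ∧
      ∀ y ∈ C, Θ y ∈ N → EqOn (fun z => W z y) (W' (Θ y)) (Ici 0) := by
    intro c hc
    obtain ⟨-, N, F, W', θ, M, e, hεe, hcN, hfam, hamp⟩ :=
      hnear (c.1, c.2.1) hc.1 c.2.2 (hc.2.1.trans_le hδ.2)
    have hun : ∀ y ∈ C, Θ y ∈ N → F (Θ y) = 0 ∧ EqOn (fun z => W z y) (W' (Θ y)) (Ici 0) := by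
      intro y hy hyN
      obtain ⟨h1, h2⟩ := hW y hy
      rw [hΘ] at hyN ⊢
      refine hfam.unique _ _ _ hyN _ h1.eq ?_ ?_ ?_ h1.lim (h2.mono hεe)
      · rw [← hg1 _ _ hy.1]; exact h1.bc1
      · rw [← hg2 _ _ hy.1]; exact h1.bc2
      · rw [← Υ3_zero]; exact h1.bc3
    refine ⟨N, F, W', θ, M, e, by rw [hΘ]; exact hcN, hfam, fun y hyB hyN hyδ =>
      ⟨fun hy => (hun y hy hyN).1, fun h0 => ⟨hyB, hyδ, W' (Θ y), ?_, ?_⟩⟩, fun y hy hyN => (hun y hy hyN).2⟩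
    · have ha := hamp _ hyN
      have hd := hfam.decay _ hyN
      rw [hΘ] at hyN h0 ha hd ⊢
      obtain ⟨k1, k2, k3, k4⟩ := hfam.profile _ _ _ hyN h0
      refine ⟨k1, fun z hz => ?_, by rw [k2, hg1 _ _ hyB], by rw [k3, hg2 _ _ hyB],
        by rw [Υ3_zero]; exact k4, tendsto_of_norm_sub_le_exp hfam.rate_pos hd⟩
      refine (huni (y.1, y.2.1) hyB).1 ?_
      rw [mem_closedBall_iff_norm]
      exact (ha z hz).1.trans hε.2
    · have ha := hamp _ hyN
      rw [hΘ] at ha ⊢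
      exact ha
  have hrel : ∀ N : Set (Space d × State m n × State m n), IsOpen N →
      ∃ U, IsOpen U ∧ ∀ y ∈ Bs, y ∈ U ↔ Θ y ∈ N := by
    intro N hN
    obtain ⟨U, hU, hUN⟩ := continuousOn_iff'.1 hΘs.continuousOn N hN
    refine ⟨U, hU, fun y hy => ?_⟩
    have := Set.ext_iff.1 hUN y
    simpa [hy] using this.symm
  refine ⟨W, ⟨?_, ?_, ?_, ?_, ?_, ?_⟩, ?_, ?_⟩
  · intro y hy
    exact ⟨hy.1, (hnear (y.1, y.2.1) hy.1 y.2.2 (hy.2.1.trans_le hδ.2)).1⟩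
  · intro c hc
    obtain ⟨N, F, W', θ, M, e, hcN, hfam, hiff, -⟩ := hloc c hc
    have hN' : IsOpen (N ∩ {x | ‖x.2.2 - x.2.1‖ < δ}) := hfam.isOpen.inter
      (isOpen_lt (by fun_prop) continuous_const)
    obtain ⟨U, hU, hUN⟩ := hrel _ hN'
    have hUδ : ∀ y ∈ Bs, y ∈ U ↔ Θ y ∈ N ∧ ‖y.2.2 - p y.1 y.2.1‖ < δ := fun y hy => by
      rw [hUN y hy, mem_inter_iff]
      refine and_congr_right fun _ => ?_
      rw [hΘ]
      rfl
    refine ⟨U, fun y => F (Θ y), hU, (hUδ c (hCB hc)).2 ⟨hcN, hc.2.1⟩, ?_, ?_, ?_⟩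
    · exact hfam.smooth_F.comp (hΘs.mono fun y hy => hy.2) fun y hy => ((hUδ y hy.2).1 hy.1).1
    · ext y
      constructor
      · rintro ⟨hy, hyU⟩
        have h1 := (hUδ y (hCB hy)).1 hyU
        exact ⟨hyU, hCB hy, (hiff y (hCB hy) h1.1 h1.2).1 hy⟩
      · rintro ⟨hyU, hyB, h0⟩
        have h1 := (hUδ y hyB).1 hyU
        exact ⟨(hiff y hyB h1.1 h1.2).2 h0, hyU⟩
    · rintro y ⟨hy, hyU⟩
      have h1 := ((hUδ y (hCB hy)).1 hyU).1
      rw [hΘ] at h1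
      have h2 := hfam.surjective _ _ _ h1
      simp only [hΘ]
      exact h2
  · rintro ⟨z, c⟩ ⟨hz, hc⟩
    obtain ⟨N, F, W', θ, M, e, hcN, hfam, -, heq⟩ := hloc c hc
    obtain ⟨U, hU, hUN⟩ := hrel N hfam.isOpen
    have h1 : ContDiffOn ℝ ∞ (fun y : ℝ × ℝ × Space d × State m n => W y.1 y.2)
        (Ici 0 ×ˢ (C ∩ U)) := by
      have h2 : ContDiffOn ℝ ∞ (fun y : ℝ × ℝ × Space d × State m n => Θ y.2) (Ici 0 ×ˢ (C ∩ U)) :=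
        hΘs.comp contDiff_snd.contDiffOn fun y hy => hCB hy.2.1
      refine (ContDiffOn.comp (g := fun a : ℝ × (Space d × State m n × State m n) => W' a.2 a.1)
        hfam.smooth (contDiff_fst.contDiffOn.prodMk h2) fun y hy => ⟨hy.1, ?_⟩).congr ?_
      · exact (hUN _ (hCB hy.2.1)).1 hy.2.2
      · intro y hy
        exact heq y.2 hy.2.1 ((hUN _ (hCB hy.2.1)).1 hy.2.2) hy.1
    refine (h1 (z, c) ⟨hz, hc, (hUN c (hCB hc)).2 hcN⟩).mono_of_mem_nhdsWithin ?_
    have h3 : (Ici 0 ×ˢ (C ∩ U) : Set (ℝ × ℝ × Space d × State m n)) = (Ici 0 ×ˢ C) ∩ Prod.snd ⁻¹' U := by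
      ext y
      simp only [mem_prod, mem_inter_iff, mem_preimage, and_assoc]
    rw [h3]
    exact inter_mem self_mem_nhdsWithin (mem_nhdsWithin_of_mem_nhds
      ((hU.preimage continuous_snd).mem_nhds ((hUN c (hCB hc)).2 hcN)))
  · intro t x q hy
    exact (hW _ hy).1
  · intro t x q hy
    obtain ⟨N, F, W', θ, M, e, hcN, hfam, -, heq⟩ := hloc _ hy
    have h1 := heq _ hy hcN
    rw [hΘ] at hcN h1
    exact hfam.transversal _ _ _ hcN _ h1
  · intro K hKC hK
    refine hK.induction_on (p := fun S => ∃ M > 0, ∃ θ > 0, ∀ y ∈ S, ∀ z ∈ Ici (0 : ℝ),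
      ‖W z y - y.2.2‖ ≤ M * Real.exp (-θ * z)) ⟨1, one_pos, 1, one_pos, fun y hy => hy.elim⟩ ?_ ?_ ?_
    · rintro S T hST ⟨M, hM, θ, hθ, h⟩
      exact ⟨M, hM, θ, hθ, fun y hy => h y (hST hy)⟩
    · rintro S T ⟨M, hM, θ, hθ, h⟩ ⟨M', hM', θ', hθ', h'⟩
      refine ⟨max M M', lt_max_of_lt_left hM, min θ θ', lt_min hθ hθ', fun y hy z hz => ?_⟩
      have hz' : (0 : ℝ) ≤ z := hz
      rcases hy with hy | hy
      · refine (h y hy z hz).trans ?_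
        gcongr
        · exact le_max_left _ _
        · exact min_le_left _ _
      · refine (h' y hy z hz).trans ?_
        gcongr
        · exact le_max_right _ _
        · exact min_le_right _ _
    · intro c hcK
      have hc := hKC hcK
      obtain ⟨N, F, W', θ, M, e, hcN, hfam, -, heq⟩ := hloc c hc
      have hΘc : Tendsto Θ (𝓝[K] c) (𝓝 (Θ c)) :=
        (hΘs.continuousOn c (hCB hc)).mono (hKC.trans hCB)
      have hMc := (hfam.continuousOn.continuousAt (hfam.isOpen.mem_nhds hcN)).tendsto.comp hΘc
      have hM0 : 0 ≤ M (Θ c) := (norm_nonneg _).trans (hfam.dz_le _ hcN 0 self_mem_Ici)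
      refine ⟨_, (hΘc.eventually (hfam.isOpen.eventually_mem hcN)).and
        ((hMc.eventually_lt_const (lt_add_one _)).and self_mem_nhdsWithin), M (Θ c) + 1,
        by linarith, θ, hfam.rate_pos, ?_⟩
      rintro y ⟨h1, h2, h3⟩ z hz
      have h4 := hfam.decay _ h1 z hz
      have h5 : W z y = W' (Θ y) z := heq y (hKC h3) h1 hz
      rw [h5]
      rw [show (Θ y).2.2 = y.2.2 by rw [hΘ]] at h4
      refine h4.trans ?_
      gcongr
      exact le_of_lt h2
  · intro t x hy
    have hO := hgeo.O_subset t x hy (hp_mem t x hy).2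
    refine ⟨hy, by simpa using hδ.1, fun _ => p t x, ?_, amplitudeLE_const _ hε.1.le⟩
    rw [hg1 t x hy, hg2 t x hy]
    exact isLayerProfile_const hO
  · intro t x q hy
    exact (hW _ hy).2
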